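/- **Setting.** Let $G$ be the group of all bijections $g$ of $\mathbb Z$ with $g(0)=0$ that move only finitely many points, let $K=\{g\in G: g(-i)=-g(i)\}$, let $K_n$ be the group of all $g\in K$ that fix all $i$ with $|i|\le n$, and let $G(n)$ be the group of all $g\in G$ that fix all $i$ with $|i|>n$. For a unitary representation $\pi$ of $G$ in a complex Hilbert space $H(\pi)$ let $H(\pi)_n$ be the space of $K_n$-invariant vectors. Then $\pi$ is called admissible (for the pair $(G,K)$) if $\bigcup_n H(\pi)_n$ is dense in $H(\pi)$; its depth $d(\pi)$ is the least $n$ with $H(\pi)_n\ne 0$, and its root is $R(\pi)=H(\pi)_{d(\pi)}$. In an admissible representation, the operators $A_i=\lim_{n\to\infty}\pi((i,n))$, $i\ne 0$, exist in the weak operator topology. Let $\pi$ be irreducible and admissible, of depth $d$. The Thoma measure $\mu$ of $\pi$ is the spectral measure, a probability measure on $[-1,1]$, of $A_{d+1}$ and a unit vector $\zeta\in R(\pi)$: $(A_{d+1}^k\zeta,\zeta)=\int t^k\,d\mu$ for all $k\ge 0$; it does not depend on $\zeta$. A Young distribution is a function $\Lambda$ from $[-1,1]$ to the set of Young diagrams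 with $\Lambda(x)=\emptyset$ for all but finitely many $x$ (put $\Lambda(x)=\emptyset$ for $|x|>1$); $\operatorname{supp}\Lambda=\{x:\Lambda(x)\ne\emptyset\}$. The Young distribution of $\pi$ is the $\Lambda$ with $\sum_x|\Lambda(x)|=2d$ such that $R(\pi)$, with the action of $G(d)\cong S(2d)$ and of the operators $A_i$, $0<|i|\le d$, is isomorphic to the module $V_\Lambda$ over $S(2d)\ltimes\mathbb Z_+^{2d}$ that is induced from the outer tensor product over $x\in\operatorname{supp}\Lambda$ of the irreducible $S(|\Lambda(x)|)$-modules of the diagrams $\Lambda(x)$, on which the generators of $\mathbb Z_+^{|\Lambda(x)|}$ act by the number $x$. **Mixtures.** Let $p_1,p_2>0$, $p_1+p_2=1$. Let $X$ be the set of all $f:\mathbb Z\setminus\{0\}\to\{1,2\}$ with $f(i)=f(-i)$ for all but finitely many $i$, with the action $(g f)(i)=f(g^{-1}i)$ of $G$, and let $\omega$ be the $G$-invariant measure on $X$ with $$\omega\{f: f(i)=f_i\ (0<|i|\le n),\ f(i)=f(-i)\ (|i|>n)\}=\prod_{0<|i|\le n}p_{f_i}^{1/2}.$$ Let $Y\subset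 X$ be the set of all $f$ such that $|f^{-1}(1)\cap\{-N,\dots,N\}|$ is even for all large $N$, and that $f^{-1}(1)$, $f^{-1}(2)$ are infinite. For $f\in Y$ let $\eta_j^f:f^{-1}(j)\to\mathbb Z\setminus\{0\}$, $j=1,2$, be the unique increasing bijection with $\eta_j^f(-a)=-\eta_j^f(a)$ for all but finitely many $a$, and let $c(g,f)\in G\times G$ have the components $\eta_j^{gf}\circ g\circ(\eta_j^f)^{-1}$ (extended by $0\mapsto 0$). For admissible representations $\pi_1,\pi_2$ of depths $d_1,d_2$, let $G$ act in $H=L^2(Y,\omega;H(\pi_1)\otimes H(\pi_2))$ (Hilbert space tensor product) by $$[gF](f)=(\pi_1\otimes\pi_2)\bigl(c(g,g^{-1}f)\bigr)F(g^{-1}f).$$ For $d=d_1+d_2$ let $Y_{d_1,d_2}$ be the set of all $f\in Y$ with $|f^{-1}(j)\cap\{-d,\dots,d\}|=2d_j$, $j=1,2$, and $f(i)=f(-i)$ for $|i|>d$. Let $H_{d_1,d_2}\subset H$ be the space of all $F$ that vanish outside $Y_{d_1,d_2}$, depend on $f\in Y_{d_1,d_2}$ only through the set $f^{-1}(1)\cap\{-d,\dots,d\}$,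 and have values in $H(\pi_1)_{d_1}\otimes H(\pi_2)_{d_2}$. The mixture of $\pi_1$ and $\pi_2$ with the weights $p_1,p_2$ is the representation $\pi$ of $G$ in the closed cyclic span of $H_{d_1,d_2}$. **Theorem.** Let $\pi_1$ and $\pi_2$ be irreducible admissible representations of $(G,K)$ with Thoma measures $\mu_i$ and Young distributions $\Lambda_i$, $i=1,2$, and let $\pi$ be their mixture with the weights $p_1,p_2>0$, $p_1+p_2=1$. Then $\pi$ is admissible. It is an orthogonal direct sum of finitely many irreducible admissible representations with the Thoma measure $$\mu(x)=p_1\,\mu_1(x/p_1)+p_2\,\mu_2(x/p_2),$$ that is, $\mu(B)=p_1\mu_1(p_1^{-1}B)+p_2\mu_2(p_2^{-1}B)$ for all Borel sets $B$. It is irreducible if and only if $$\operatorname{supp}\Lambda_1(\cdot/p_1)\cap\operatorname{supp}\Lambda_2(\cdot/p_2)=\emptyset,$$ and in this case it has the Young distribution $\Lambda(x)=\Lambda_1(x/p_1)\cup\Lambda_2(x/p_2)$. -/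

import Mathlib

open MeasureTheory Filter Topology
open scoped TensorProduct ENNReal

noncomputable section

namespace Olshanski

/-! ### The pair `(G, K)` -/

/-- The group of finite bijections `g` of `ℤ` with `g 0 = 0`. -/
def GE : Subgroup (Equiv.Perm ℤ) where
  carrier := {g | {i | g i ≠ i}.Finite ∧ g 0 = 0}
  one_mem' := by simp
  mul_mem' := by
    rintro a b ⟨ha, ha0⟩ ⟨hb, hb0⟩
    refine ⟨(ha.union hb).subset ?_, by simp [ha0, hb0]⟩
    intro i hi
    by_contra h
    simp only [Set.mem_union, Set.mem_ofPred_eq, not_or, not_not] at h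
    simp [h.1, h.2] at hi
  inv_mem' := by
    rintro a ⟨ha, ha0⟩
    refine ⟨ha.subset ?_, by rw [Equiv.Perm.inv_eq_iff_eq, ha0]⟩
    intro i hi h
    exact hi (by rw [Equiv.Perm.inv_eq_iff_eq, h])

/-- The subgroup `K` of all `g` in `G` with `g (-i) = -g i`. -/
def KE : Subgroup GE where
  carrier := {g | ∀ i, g.1 (-i) = -g.1 i}
  one_mem' := by simp
  mul_mem' := by
    intro a b ha hb i
    simp only [Set.mem_ofPred_eq] at ha hb
    simp [ha, hb]
  inv_mem' := by
    intro a ha i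
    simp only [Set.mem_ofPred_eq] at ha
    simp only [InvMemClass.coe_inv, Equiv.Perm.inv_eq_iff_eq, ha]
    simp

/-- The subgroup `K_n` of all `g` in `K` that fix every `i` with `|i| ≤ n`. -/
def KEn (n : ℕ) : Subgroup GE where
  carrier := {g | g ∈ KE ∧ ∀ i : ℤ, |i| ≤ n → g.1 i = i}
  one_mem' := ⟨one_mem _, by simp⟩
  mul_mem' := by
    rintro a b ⟨ha, ha'⟩ ⟨hb, hb'⟩
    exact ⟨mul_mem ha hb, fun i hi => by simp [ha' i hi, hb' i hi]⟩
  inv_mem' := by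
    rintro a ⟨ha, ha'⟩
    exact ⟨inv_mem ha, fun i hi => by
      simp only [InvMemClass.coe_inv, Equiv.Perm.inv_eq_iff_eq, ha' i hi]⟩

/-- The nonzero integers. -/
abbrev NZ := {i : ℤ // i ≠ 0}

instance : Neg NZ := ⟨fun i => ⟨-i.1, neg_ne_zero.mpr i.2⟩⟩

@[simp] lemma NZ.coe_neg (i : NZ) : ((-i : NZ) : ℤ) = -(i : ℤ) := rfl

lemma NZ.neg_neg (i : NZ) : - -i = i := Subtype.ext (by simp)

instance : MulAction GE NZ where
  smul g i := ⟨g.1 i, fun h => i.2 (g.1.injective (h.trans g.2.2.symm))⟩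
  one_smul _ := rfl
  mul_smul _ _ _ := rfl

@[simp] lemma coe_smul (g : GE) (i : NZ) : ((g • i : NZ) : ℤ) = g.1 i := rfl

lemma finite_ne (g : GE) : {i : NZ | g • i ≠ i}.Finite := by
  have := g.2.1.preimage (f := (Subtype.val : NZ → ℤ)) Subtype.val_injective.injOn
  refine this.subset fun i hi => ?_
  simpa [Subtype.ext_iff] using hi

/-- The element of `G` given by a finite bijection of the nonzero integers. -/
def ofNZ (σ : Equiv.Perm NZ) (h : {i | σ i ≠ i}.Finite) : GE :=
  ⟨Equiv.Perm.ofSubtype σ, by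
    refine ⟨(h.image Subtype.val).subset ?_, Equiv.Perm.ofSubtype_apply_of_not_mem _ (by simp)⟩
    intro i hi
    by_cases h0 : i = 0
    · exact absurd (Equiv.Perm.ofSubtype_apply_of_not_mem σ (by simp [h0])) hi
    · refine ⟨⟨i, h0⟩, ?_, rfl⟩
      intro h'
      apply hi
      rw [Equiv.Perm.ofSubtype_apply_of_mem σ h0, h']⟩

/-- The nonzero integers `i` with `|i| ≤ n`. -/
def box (n : ℕ) : Finset NZ := (Finset.Icc (-(n : ℤ)) n).subtype (· ≠ 0)

@[simp] lemma mem_box {n : ℕ} {i : NZ} : i ∈ box n ↔ |(i : ℤ)| ≤ n := by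
  simp [box, abs_le]

/-! ### The space `X` -/

/-- The functions `f : ℤ \ {0} → {1, 2}` with `f i = f (-i)` for almost all `i`; the two values
`1`, `2` are written `0`, `1` here. -/
abbrev X := {f : NZ → Fin 2 // {i | f i ≠ f (-i)}.Finite}

instance : MulAction GE X where
  smul g f := ⟨fun i => f.1 (g⁻¹ • i), by
    have h1 := finite_ne g⁻¹
    have h2 := h1.image (fun i => -i)
    refine ((f.2.union h1).union h2).subset ?_
    intro i hi
    by_contra h
    simp only [Set.mem_union, not_or, Set.mem_ofPred_eq, not_not, Set.mem_image, not_exists,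
      not_and] at h hi
    obtain ⟨⟨ha, hb⟩, hc⟩ := h
    have : g⁻¹ • (-i) = -i := by
      by_contra h'
      exact hc (-i) h' (NZ.neg_neg i)
    rw [hb, this] at hi
    exact hi ha⟩
  one_smul f := by
    apply Subtype.ext; funext i
    change f.1 ((1 : GE)⁻¹ • i) = _
    simp
  mul_smul g h f := by
    apply Subtype.ext; funext i
    change f.1 ((g * h)⁻¹ • i) = f.1 (h⁻¹ • (g⁻¹ • i))
    rw [mul_inv_rev, mul_smul]

@[simp] lemma smul_apply (g : GE) (f : X) (i : NZ) : (g • f).1 i = f.1 (g⁻¹ • i) := rfl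

/-- The number of points of `f⁻¹(j)` among the `i` with `|i| ≤ n`. -/
def cnt (f : X) (j : Fin 2) (n : ℕ) : ℕ := ((box n).filter fun i => f.1 i = j).card

/-- The set `Y` of all `f` such that `f⁻¹(1) ∩ {-n, …, n}` has an even number of elements for large
`n`, and that both `f⁻¹(1)` and `f⁻¹(2)` are infinite. -/
def Y : Set X := {f | (∀ᶠ n : ℕ in atTop, Even (cnt f 0 n)) ∧ ∀ j, {i | f.1 i = j}.Infinite}

/-- `f⁻¹(j)`. -/
abbrev fiber (f : X) (j : Fin 2) := {a : NZ // f.1 a = j}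

/-- `f ∈ X_n`. -/
def SymOut (n : ℕ) (f : X) : Prop := ∀ i : NZ, (n : ℤ) < |(i : ℤ)| → f.1 i = f.1 (-i)

/-- `g ∈ G(n)`. -/
def InG (n : ℕ) (g : GE) : Prop := ∀ i : NZ, (n : ℤ) < |(i : ℤ)| → g • i = i

lemma exists_bound {s : Set NZ} (hs : s.Finite) :
    ∃ n : ℕ, ∀ m : ℕ, n ≤ m → ∀ i : NZ, (m : ℤ) < |(i : ℤ)| → i ∉ s := by
  obtain ⟨n, hn⟩ := (hs.image (fun i : NZ => (i : ℤ).natAbs)).bddAbove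
  refine ⟨n, fun m hm i hi h => ?_⟩
  have := hn ⟨i, h, rfl⟩
  simp only at this
  rw [Int.abs_eq_natAbs] at hi
  omega

lemma exists_symOut (f : X) : ∃ n : ℕ, ∀ m : ℕ, n ≤ m → SymOut m f := by
  obtain ⟨n, hn⟩ := exists_bound f.2
  exact ⟨n, fun m hm i hi => by simpa using hn m hm i hi⟩

lemma exists_inG (g : GE) : ∃ n : ℕ, ∀ m : ℕ, n ≤ m → InG m g := by
  obtain ⟨n, hn⟩ := exists_bound (finite_ne g)
  exact ⟨n, fun m hm i hi => by simpa using hn m hm i hi⟩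

lemma InG.inv {n : ℕ} {g : GE} (h : InG n g) : InG n g⁻¹ := fun i hi => by
  rw [inv_smul_eq_iff, h i hi]

lemma InG.abs_le {n : ℕ} {g : GE} (h : InG n g) {i : NZ} (hi : |(i : ℤ)| ≤ n) :
    |((g • i : NZ) : ℤ)| ≤ n := by
  by_contra h'
  push Not at h'
  have h2 := h.inv _ h'
  rw [inv_smul_smul] at h2
  rw [← h2] at h'
  omega

lemma InG.symOut {n : ℕ} {g : GE} (h : InG n g) {f : X} (hf : SymOut n f) :
    SymOut n (g • f) := fun i hi => by
  rw [smul_apply, smul_apply, h.inv i hi, h.inv (-i) (by simpa using hi), hf i hi]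

lemma InG.cnt_eq {n : ℕ} {g : GE} (h : InG n g) (f : X) (j : Fin 2) :
    cnt (g • f) j n = cnt f j n := by
  unfold cnt
  refine Finset.card_nbij' (fun i => g⁻¹ • i) (fun i => g • i) ?_ ?_ ?_ ?_
  · intro i hi
    simp only [Finset.coe_filter, mem_box, Set.mem_ofPred_eq, smul_apply] at hi ⊢
    exact ⟨h.inv.abs_le hi.1, hi.2⟩
  · intro i hi
    simp only [Finset.coe_filter, mem_box, Set.mem_ofPred_eq, smul_apply] at hi ⊢
    exact ⟨h.abs_le hi.1, by simpa using hi.2⟩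
  · intro i _; simp
  · intro i _; simp

lemma smul_mem_Y (g : GE) {f : X} (hf : f ∈ Y) : g • f ∈ Y := by
  obtain ⟨n, hn⟩ := exists_inG g
  refine ⟨?_, fun j => ?_⟩
  · filter_upwards [hf.1, eventually_ge_atTop n] with m hm hnm
    rwa [(hn m hnm).cnt_eq]
  · have := (hf.2 j).image (f := fun i => g • i) (MulAction.injective g).injOn
    refine this.mono ?_
    rintro _ ⟨i, hi, rfl⟩
    simpa using hi

lemma smul_mem_Y_iff (g : GE) {f : X} : g • f ∈ Y ↔ f ∈ Y :=
  ⟨fun h => by simpa using smul_mem_Y g⁻¹ h, smul_mem_Y g⟩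

/-! ### The bijections `η_j` and the cocycle -/

/-- The order isomorphism `ℤ \ {0} ≃ ℤ` sending `i < 0` to `i` and `i > 0` to `i - 1`. -/
def lin : NZ ≃o ℤ where
  toFun i := if 0 < (i : ℤ) then i - 1 else i
  invFun k := if h : 0 ≤ k then ⟨k + 1, by omega⟩ else ⟨k, by omega⟩
  left_inv i := by
    have := i.2
    apply Subtype.ext
    by_cases h : 0 < (i : ℤ)
    · simp [h, show (1 : ℤ) ≤ i by omega]
    · simp [h, show ¬ (0 : ℤ) ≤ i by omega]
  right_inv k := by
    by_cases h : 0 ≤ k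
    · simp [h, show 0 < k + 1 by omega]
    · simp [h, show ¬ 0 < k by omega]
  map_rel_iff' := by
    intro a b
    have ha := a.2
    have hb := b.2
    rw [← Subtype.coe_le_coe]
    simp only [Equiv.coe_fn_mk]
    split_ifs <;> omega

lemma lin_apply (i : NZ) : lin i = if 0 < (i : ℤ) then (i : ℤ) - 1 else i := rfl

lemma lin_neg (i : NZ) : lin (-i) = -lin i - 1 := by
  have := i.2
  simp only [lin_apply, NZ.coe_neg]
  split_ifs <;> omega

/-- `η` is an increasing bijection `f⁻¹(j) → ℤ \ {0}` with `η (-a) = -η a` for almost all `a`. -/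
def IsEta (f : X) (j : Fin 2) (η : fiber f j ≃o NZ) : Prop :=
  {a : fiber f j | ¬ ∃ h : f.1 (-a.1) = j, η ⟨-a.1, h⟩ = -η a}.Finite

lemma exists_large {f : X} {j : Fin 2} (hf : {i | f.1 i = j}.Infinite) (n : ℕ)
    {t : Set (fiber f j)} (ht : t.Finite) :
    ∃ b : fiber f j, (n : ℤ) < (b.1 : ℤ) ∧ b ∉ t ∧ f.1 (-b.1) = j := by
  obtain ⟨n₀, hn₀⟩ := exists_symOut f
  have h2 : ((box (max n n₀) : Set NZ) ∪ (Subtype.val '' t) ∪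
      ((fun a : NZ => -a) '' (Subtype.val '' t))).Finite :=
    ((Finset.finite_toSet _).union (ht.image _)).union ((ht.image _).image _)
  obtain ⟨x, hx, hx'⟩ := hf.exists_notMem_finite h2
  simp only [Set.mem_union, not_or, Finset.mem_coe, mem_box, not_le] at hx'
  obtain ⟨⟨h1, h3⟩, h4⟩ := hx'
  have hs := hn₀ (max n n₀) (le_max_right _ _) x h1
  have hn : (n : ℤ) ≤ (max n n₀ : ℕ) := by exact_mod_cast le_max_left _ _
  have hx0 : f.1 x = j := hx
  rcases lt_or_gt_of_ne x.2 with h | h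
  · rw [abs_of_neg h] at h1
    refine ⟨⟨-x, hs ▸ hx0⟩, by simp; omega, ?_, by rw [NZ.neg_neg]; exact hx0⟩
    intro h'
    exact h4 ⟨-x, ⟨_, h', rfl⟩, NZ.neg_neg x⟩
  · rw [abs_of_pos h] at h1
    exact ⟨⟨x, hx0⟩, by simp; omega, fun h' => h3 ⟨_, h', rfl⟩, hs ▸ hx0⟩

lemma card_Icc_fiber {f : X} {j : Fin 2} (e : fiber f j ≃o ℤ) {a b : fiber f j} (hab : a ≤ b) :
    (((Finset.Icc a.1 b.1).filter fun i => f.1 i = j).card : ℤ) = e b - e a + 1 := by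
  have : ((Finset.Icc a.1 b.1).filter fun i => f.1 i = j).card = (Finset.Icc (e a) (e b)).card := by
    refine Finset.card_bij' (fun i hi => e ⟨i, (Finset.mem_filter.1 hi).2⟩)
      (fun k _ => (e.symm k).1) ?_ ?_ ?_ ?_
    · intro i hi
      have := Finset.mem_filter.1 hi
      rw [Finset.mem_Icc] at this
      rw [Finset.mem_Icc, e.le_iff_le, e.le_iff_le]
      exact this.1
    · intro k hk
      rw [Finset.mem_Icc] at hk
      rw [Finset.mem_filter, Finset.mem_Icc]
      refine ⟨⟨?_, ?_⟩, (e.symm k).2⟩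
      · exact (e.le_symm_apply.2 hk.1 : a ≤ e.symm k)
      · exact (e.symm_apply_le.2 hk.2 : e.symm k ≤ b)
    · intro i hi; simp
    · intro k hk; simp
  rw [this, Int.card_Icc, Int.toNat_of_nonneg]
  · ring
  · have := e.monotone hab; omega

lemma cnt_add {f : X} (j : Fin 2) {n m : ℕ} (hf : SymOut n f) (hnm : n ≤ m) :
    cnt f j m = cnt f j n +
      2 * ((box m).filter fun i : NZ => (n : ℤ) < (i : ℤ) ∧ f.1 i = j).card := by
  have h1 : ((box m).filter fun i : NZ => (n : ℤ) < (i : ℤ) ∧ f.1 i = j).card =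
      ((box m).filter fun i : NZ => (i : ℤ) < -n ∧ f.1 i = j).card := by
    refine Finset.card_nbij' (fun i : NZ => -i) (fun i : NZ => -i) ?_ ?_ ?_ ?_
    · intro i hi
      simp only [Finset.coe_filter, mem_box, Set.mem_ofPred_eq, NZ.coe_neg, abs_neg] at hi ⊢
      refine ⟨hi.1, by omega, ?_⟩
      rw [← hf i (lt_of_lt_of_le hi.2.1 (le_abs_self _))]; exact hi.2.2
    · intro i hi
      simp only [Finset.coe_filter, mem_box, Set.mem_ofPred_eq, NZ.coe_neg, abs_neg] at hi ⊢
      refine ⟨hi.1, by omega, ?_⟩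
      rw [← hf i (by rw [abs_of_neg (by omega)]; omega)]; exact hi.2.2
    · intro i _; exact NZ.neg_neg i
    · intro i _; exact NZ.neg_neg i
  have h2 : ((box m).filter fun i => f.1 i = j) =
      (((box n).filter fun i => f.1 i = j) ∪
        ((box m).filter fun i : NZ => (n : ℤ) < (i : ℤ) ∧ f.1 i = j)) ∪
        ((box m).filter fun i : NZ => (i : ℤ) < -n ∧ f.1 i = j) := by
    ext i
    simp only [Finset.mem_filter, Finset.mem_union, mem_box, abs_le]
    constructor
    · rintro ⟨⟨h, h'⟩, hj⟩
      simp only [hj, and_true]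
      omega
    · rintro ((h | h) | h)
      · exact ⟨by omega, h.2⟩
      · exact ⟨by omega, h.2.2⟩
      · exact ⟨by omega, h.2.2⟩
  have h3 : Disjoint ((box n).filter fun i => f.1 i = j)
      ((box m).filter fun i : NZ => (n : ℤ) < (i : ℤ) ∧ f.1 i = j) := by
    rw [Finset.disjoint_left]
    intro i hi hi'
    simp only [Finset.mem_filter, mem_box, abs_le] at hi hi'
    omega
  have h4 : Disjoint (((box n).filter fun i => f.1 i = j) ∪
        ((box m).filter fun i : NZ => (n : ℤ) < (i : ℤ) ∧ f.1 i = j))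
      ((box m).filter fun i : NZ => (i : ℤ) < -n ∧ f.1 i = j) := by
    rw [Finset.disjoint_left]
    intro i hi hi'
    simp only [Finset.mem_filter, Finset.mem_union, mem_box, abs_le] at hi hi'
    omega
  unfold cnt
  rw [h2, Finset.card_union_of_disjoint h4, Finset.card_union_of_disjoint h3, ← h1]
  ring

lemma cnt_eq_card_Icc {f : X} {j : Fin 2} {b : NZ} {m : ℕ} (hb : (b : ℤ) = m) :
    cnt f j m = ((Finset.Icc (-b) b).filter fun i => f.1 i = j).card := by
  unfold cnt
  congr 1
  ext i
  simp only [Finset.mem_filter, mem_box, Finset.mem_Icc, ← Subtype.coe_le_coe, NZ.coe_neg, hb,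
    abs_le]

/-- The value of `η` in terms of numbers of points of `f⁻¹(j)`. -/
lemma IsEta.formula {f : X} {j : Fin 2} (hinf : {i | f.1 i = j}.Infinite) {η : fiber f j ≃o NZ}
    (hη : IsEta f j η) {n : ℕ} (hf : SymOut n f) (a : fiber f j) (ha : |(a.1 : ℤ)| ≤ n) :
    2 * lin (η a) = cnt f j n - 2 * (((box n).filter fun i => a.1 ≤ i ∧ f.1 i = j).card : ℤ) := by
  obtain ⟨b, hnb, hbt, -⟩ := exists_large hinf n hη
  simp only [Set.mem_ofPred_eq, not_not] at hbt
  obtain ⟨hb', hηb⟩ := hbt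
  obtain ⟨m, hm⟩ : ∃ m : ℕ, (b.1 : ℤ) = m := ⟨(b.1 : ℤ).toNat, by omega⟩
  have hnm : n ≤ m := by omega
  rw [abs_le] at ha
  have h1 := card_Icc_fiber (η.trans lin) (a := ⟨-b.1, hb'⟩) (b := b)
    (by rw [← Subtype.coe_le_coe, ← Subtype.coe_le_coe]; simp only [NZ.coe_neg]; omega)
  have h2 := card_Icc_fiber (η.trans lin) (a := a) (b := b)
    (by rw [← Subtype.coe_le_coe, ← Subtype.coe_le_coe]; omega)
  simp only [OrderIso.trans_apply] at h1 h2
  rw [hηb, lin_neg, ← cnt_eq_card_Icc hm, cnt_add j hf hnm] at h1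
  have h3 : ((Finset.Icc a.1 b.1).filter fun i => f.1 i = j) =
      ((box n).filter fun i => a.1 ≤ i ∧ f.1 i = j) ∪
        ((box m).filter fun i : NZ => (n : ℤ) < (i : ℤ) ∧ f.1 i = j) := by
    ext i
    simp only [Finset.mem_filter, Finset.mem_union, mem_box, abs_le, Finset.mem_Icc,
      ← Subtype.coe_le_coe]
    by_cases hj : f.1 i = j
    · simp only [hj, and_true]; omega
    · simp [hj]
  have h4 : Disjoint ((box n).filter fun i => a.1 ≤ i ∧ f.1 i = j)
        ((box m).filter fun i : NZ => (n : ℤ) < (i : ℤ) ∧ f.1 i = j) := by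
    rw [Finset.disjoint_left]
    intro i hi hi'
    simp only [Finset.mem_filter, mem_box, abs_le] at hi hi'
    omega
  rw [h3, Finset.card_union_of_disjoint h4] at h2
  push_cast at h1 h2
  linarith

lemma card_box (n : ℕ) : (box n).card = 2 * n := by
  induction n with
  | zero =>
    rw [Finset.card_eq_zero, Finset.eq_empty_iff_forall_notMem]
    intro i hi
    rw [mem_box] at hi
    exact i.2 (abs_eq_zero.1 (le_antisymm (by simpa using hi) (abs_nonneg _)))
  | succ k ih =>
    have : box (k + 1) = insert ⟨k + 1, by omega⟩ (insert ⟨-(k + 1), by omega⟩ (box k)) := by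
      ext i
      simp only [mem_box, Finset.mem_insert, abs_le, Subtype.ext_iff]
      push_cast
      omega
    rw [this, Finset.card_insert_of_notMem, Finset.card_insert_of_notMem, ih]
    · ring
    · simp only [mem_box, abs_le]; omega
    · simp only [mem_box, abs_le, Finset.mem_insert, Subtype.ext_iff]; omega

lemma even_cnt {f : X} {n : ℕ} (h : Even (cnt f 0 n)) (j : Fin 2) : Even (cnt f j n) := by
  have h1 : cnt f 0 n + cnt f 1 n = 2 * n := by
    rw [← card_box]
    unfold cnt
    rw [← Finset.card_union_of_disjoint]
    · congr 1
      ext i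
      simp only [Finset.mem_union, Finset.mem_filter]
      rcases Fin.exists_fin_two.1 ⟨f.1 i, rfl⟩ with h | h <;> simp [h]
    · rw [Finset.disjoint_filter]
      intro i _ h; simp [h]
  fin_cases j
  · exact h
  · exact (Nat.even_add.1 (h1 ▸ even_two_mul n)).1 h

theorem existsUnique_eta {f : X} (hf : f ∈ Y) (j : Fin 2) :
    ∃! η : fiber f j ≃o NZ, IsEta f j η := by
  refine existsUnique_of_exists_of_unique ?_ ?_
  · obtain ⟨n₀, hn₀⟩ := exists_symOut f
    obtain ⟨n, hn, he⟩ := ((eventually_ge_atTop n₀).and hf.1).exists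
    have hs := hn₀ n hn
    have he := even_cnt he j
    have hinf := hf.2 j
    have : Nonempty (fiber f j) := ⟨(exists_large hinf 0 Set.finite_empty).choose⟩
    have : NoMaxOrder (fiber f j) := ⟨fun a => by
      obtain ⟨b, hb, -⟩ := exists_large hinf (a.1 : ℤ).natAbs Set.finite_empty
      exact ⟨b, by rw [← Subtype.coe_lt_coe, ← Subtype.coe_lt_coe]; omega⟩⟩
    have : NoMinOrder (fiber f j) := ⟨fun a => by
      obtain ⟨b, hb, -, hb'⟩ := exists_large hinf (a.1 : ℤ).natAbs Set.finite_empty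
      exact ⟨⟨-b.1, hb'⟩, by
        rw [← Subtype.coe_lt_coe, ← Subtype.coe_lt_coe, NZ.coe_neg]; omega⟩⟩
    let _ : SuccOrder (fiber f j) := LinearLocallyFiniteOrder.succOrder _
    let _ : PredOrder (fiber f j) := LinearLocallyFiniteOrder.predOrder _
    let e : fiber f j ≃o ℤ := orderIsoIntOfLinearSuccPredArch
    have hneg : ∀ b : fiber f j, (n : ℤ) < (b.1 : ℤ) → f.1 (-b.1) = j := fun b hb =>
      (hs b.1 (lt_of_lt_of_le hb (le_abs_self _))) ▸ b.2
    have key1 : ∀ (b : fiber f j) (hb : (n : ℤ) < (b.1 : ℤ)),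
        Even (e b - e ⟨-b.1, hneg b hb⟩ + 1) := by
      intro b hb
      obtain ⟨m, hm⟩ : ∃ m : ℕ, (b.1 : ℤ) = m := ⟨(b.1 : ℤ).toNat, by omega⟩
      rw [← card_Icc_fiber e (a := ⟨-b.1, hneg b hb⟩) (b := b)
        (by rw [← Subtype.coe_le_coe, ← Subtype.coe_le_coe]; simp only [NZ.coe_neg]; omega),
        ← cnt_eq_card_Icc hm, cnt_add j hs (by omega)]
      push_cast
      exact ((Int.even_coe_nat _).2 he).add (even_two_mul _)
    have key2 : ∀ (b c : fiber f j) (hb : (n : ℤ) < (b.1 : ℤ)) (hc : (n : ℤ) < (c.1 : ℤ)),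
        b ≤ c → e b + e ⟨-b.1, hneg b hb⟩ = e c + e ⟨-c.1, hneg c hc⟩ := by
      intro b c hb hc hbc
      have hbc' : (b.1 : ℤ) ≤ c.1 := hbc
      have h1 := card_Icc_fiber e hbc
      have h2 := card_Icc_fiber e (a := ⟨-c.1, hneg c hc⟩) (b := ⟨-b.1, hneg b hb⟩)
        (by rw [← Subtype.coe_le_coe, ← Subtype.coe_le_coe]; simp only [NZ.coe_neg]; omega)
      have h3 : ((Finset.Icc b.1 c.1).filter fun i => f.1 i = j).card =
          ((Finset.Icc (-c.1) (-b.1)).filter fun i => f.1 i = j).card := by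
        refine Finset.card_nbij' (fun i => -i) (fun i => -i) ?_ ?_ ?_ ?_
        · intro i hi
          simp only [Finset.coe_filter, Finset.mem_Icc, Set.mem_ofPred_eq, NZ.coe_neg,
            ← Subtype.coe_le_coe] at hi ⊢
          refine ⟨by omega, ?_⟩
          rw [← hs i (lt_of_lt_of_le (by omega) (le_abs_self _))]; exact hi.2
        · intro i hi
          simp only [Finset.coe_filter, Finset.mem_Icc, Set.mem_ofPred_eq, NZ.coe_neg,
            ← Subtype.coe_le_coe] at hi ⊢
          refine ⟨by omega, ?_⟩
          rw [← hs i (by rw [abs_of_neg (by omega)]; omega)]; exact hi.2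
        · intro i _; exact NZ.neg_neg i
        · intro i _; exact NZ.neg_neg i
      rw [h3] at h1
      simp only at h2
      linarith
    obtain ⟨b₀, hb₀, -⟩ := exists_large hinf n Set.finite_empty
    obtain ⟨k, hk⟩ : ∃ k : ℤ, e b₀ + e ⟨-b₀.1, hneg b₀ hb₀⟩ = 2 * k - 1 := by
      obtain ⟨r, hr⟩ := key1 b₀ hb₀
      exact ⟨r + e ⟨-b₀.1, hneg b₀ hb₀⟩, by linarith⟩
    have key3 : ∀ (b : fiber f j) (hb : (n : ℤ) < (b.1 : ℤ)),
        e b + e ⟨-b.1, hneg b hb⟩ = 2 * k - 1 := by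
      intro b hb
      rcases le_total b₀ b with h | h
      · rw [← key2 b₀ b hb₀ hb h, hk]
      · rw [key2 b b₀ hb hb₀ h, hk]
    let sh : ℤ ≃o ℤ := OrderIso.addRight (-k)
    refine ⟨(e.trans sh).trans lin.symm, ?_⟩
    refine ((Finset.finite_toSet (box n)).preimage
      (f := (Subtype.val : fiber f j → NZ)) Subtype.val_injective.injOn).subset ?_
    intro a ha
    by_contra hna
    simp only [Set.mem_preimage, Finset.mem_coe, mem_box, not_le] at hna
    apply ha
    have hn' : f.1 (-a.1) = j := (hs a.1 hna) ▸ a.2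
    refine ⟨hn', ?_⟩
    apply lin.injective
    rw [lin_neg]
    simp only [OrderIso.trans_apply, OrderIso.apply_symm_apply]
    change e _ + -k = -(e _ + -k) - 1
    have : e a + e ⟨-a.1, hn'⟩ = 2 * k - 1 := by
      rcases lt_or_gt_of_ne a.1.2 with h | h
      · rw [abs_of_neg h] at hna
        have h5 := key3 ⟨-a.1, hn'⟩ (by simpa using hna)
        have h6 : (⟨- -a.1, hneg ⟨-a.1, hn'⟩ (by simpa using hna)⟩ : fiber f j) = a :=
          Subtype.ext (NZ.neg_neg _)
        rw [h6] at h5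
        linarith
      · rw [abs_of_pos h] at hna
        exact key3 a hna
    linarith
  · intro η η' h h'
    refine RelIso.ext fun a => lin.injective ?_
    obtain ⟨n₀, hn₀⟩ := exists_symOut f
    have hs := hn₀ (max n₀ (a.1 : ℤ).natAbs) (le_max_left _ _)
    have ha : |(a.1 : ℤ)| ≤ (max n₀ (a.1 : ℤ).natAbs : ℕ) := by
      rw [Int.abs_eq_natAbs]; exact_mod_cast le_max_right _ _
    have h1 := h.formula (hf.2 j) hs a ha
    have h2 := h'.formula (hf.2 j) hs a ha
    linarith

/-- The unique increasing bijection `η_j : f⁻¹(j) → ℤ \ {0}` with `η_j (-a) = -η_j a` for almost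
all `a`. -/
def eta (f : X) (hf : f ∈ Y) (j : Fin 2) : fiber f j ≃o NZ := (existsUnique_eta hf j).choose

lemma isEta_eta {f : X} (hf : f ∈ Y) (j : Fin 2) : IsEta f j (eta f hf j) :=
  (existsUnique_eta hf j).choose_spec.1

lemma eta_formula {f : X} (hf : f ∈ Y) {j : Fin 2} {n : ℕ} (hs : SymOut n f) (a : fiber f j)
    (ha : |(a.1 : ℤ)| ≤ n) : 2 * lin (eta f hf j a) =
      cnt f j n - 2 * (((box n).filter fun i => a.1 ≤ i ∧ f.1 i = j).card : ℤ) :=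
  (isEta_eta hf j).formula (hf.2 j) hs a ha

/-- The bijection `f⁻¹(j) → (g f)⁻¹(j)` given by `g`. -/
def fiberMap (g : GE) (f : X) (j : Fin 2) : fiber f j ≃ fiber (g • f) j where
  toFun a := ⟨g • a.1, by simpa using a.2⟩
  invFun a := ⟨g⁻¹ • a.1, a.2⟩
  left_inv a := by simp
  right_inv a := by simp

/-- The bijection `η_j^{gf} ∘ g ∘ (η_j^f)⁻¹` of `ℤ \ {0}`. -/
def cocPerm (j : Fin 2) (g : GE) (f : X) (hf : f ∈ Y) : Equiv.Perm NZ :=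
  ((eta f hf j).symm.toEquiv.trans (fiberMap g f j)).trans
    (eta (g • f) (smul_mem_Y g hf) j).toEquiv

lemma cocPerm_eta (j : Fin 2) (g : GE) (f : X) (hf : f ∈ Y) (a : fiber f j) :
    cocPerm j g f hf (eta f hf j a) =
      eta (g • f) (smul_mem_Y g hf) j ⟨g • a.1, by simpa using a.2⟩ := by
  simp [cocPerm, fiberMap]

lemma eta_far (j : Fin 2) {g : GE} {f : X} (hf : f ∈ Y) {n : ℕ} (hg : InG n g) (hs : SymOut n f)
    (a : fiber f j) (ha : (n : ℤ) < |(a.1 : ℤ)|) :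
    cocPerm j g f hf (eta f hf j a) = eta f hf j a := by
  rw [cocPerm_eta]
  apply lin.injective
  set N := (a.1 : ℤ).natAbs with hN
  have hNa : |(a.1 : ℤ)| = N := Int.abs_eq_natAbs _
  have hn : n ≤ N := by omega
  have hgN : InG N g := fun i hi => hg i (by omega)
  have hsN : SymOut N f := fun i hi => hs i (by omega)
  have h1 := eta_formula hf hsN a (by omega)
  have h2 := eta_formula (smul_mem_Y g hf) (hgN.symOut hsN) ⟨g • a.1, by simpa using a.2⟩
    (hgN.abs_le (by omega))
  simp only [hg _ ha] at h1 h2 ⊢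
  rw [hgN.cnt_eq] at h2
  have key : ((box N).filter fun i => a.1 ≤ i ∧ f.1 i = j).card =
      ((box N).filter fun i => a.1 ≤ i ∧ (g • f).1 i = j).card := by
    rcases lt_or_gt_of_ne a.1.2 with h | h
    · rw [abs_of_neg h] at hNa
      have h3 := hgN.cnt_eq f j
      unfold cnt at h3
      have h4 : ∀ f' : X, ((box N).filter fun i => a.1 ≤ i ∧ f'.1 i = j) =
          (box N).filter fun i => f'.1 i = j := by
        intro f'
        ext i
        simp only [Finset.mem_filter, mem_box, abs_le, ← Subtype.coe_le_coe]
        refine and_congr_right fun h => ⟨fun h => h.2, fun h' => ⟨by omega, h'⟩⟩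
      rw [h4 f, h4 (g • f), h3]
    · rw [abs_of_pos h] at hNa ha
      congr 1
      ext i
      simp only [Finset.mem_filter, smul_apply]
      refine and_congr_right fun _ => and_congr_right fun h => ?_
      rw [← Subtype.coe_le_coe] at h
      rw [hg.inv i (lt_of_lt_of_le (by omega) (le_abs_self _))]
  rw [← key] at h2
  linarith

lemma eta_of_eq {f f' : X} (h : f = f') (hf : f ∈ Y) (hf' : f' ∈ Y) (j : Fin 2) {a b : NZ}
    (hab : a = b) (ha : f.1 a = j) (hb : f'.1 b = j) :
    eta f hf j ⟨a, ha⟩ = eta f' hf' j ⟨b, hb⟩ := by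
  subst h hab; rfl

lemma cocPerm_finite (j : Fin 2) (g : GE) (f : X) (hf : f ∈ Y) :
    {i | cocPerm j g f hf i ≠ i}.Finite := by
  obtain ⟨n₁, h₁⟩ := exists_symOut f
  obtain ⟨n₂, h₂⟩ := exists_inG g
  have hs := h₁ (max n₁ n₂) (le_max_left _ _)
  have hg := h₂ (max n₁ n₂) (le_max_right _ _)
  have hfin : {a : fiber f j | a.1 ∈ box (max n₁ n₂)}.Finite :=
    (Finset.finite_toSet (box (max n₁ n₂))).preimage
      (f := (Subtype.val : fiber f j → NZ)) Subtype.val_injective.injOn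
  refine (hfin.image (eta f hf j)).subset ?_
  intro i hi
  obtain ⟨a, rfl⟩ := (eta f hf j).surjective i
  refine ⟨a, ?_, rfl⟩
  by_contra h
  simp only [Set.mem_ofPred_eq, mem_box, not_le] at h
  exact hi (eta_far j hf hg hs a h)

open Classical in
/-- The `j`-th component of the cocycle `c(g, f)`; for `f ∉ Y` it has the value `1`, which is
never used. -/
def coc (j : Fin 2) (g : GE) (f : X) : GE :=
  if hf : f ∈ Y then ofNZ (cocPerm j g f hf) (cocPerm_finite j g f hf) else 1

lemma ofNZ_ext {σ τ : Equiv.Perm NZ} (hσ hτ) (h : σ = τ) : ofNZ σ hσ = ofNZ τ hτ := by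
  subst h; rfl

lemma coc_one (j : Fin 2) (f : X) : coc j 1 f = 1 := by
  unfold coc
  split_ifs with hf
  · apply Subtype.ext
    have : cocPerm j 1 f hf = 1 := by
      ext1 i
      obtain ⟨a, rfl⟩ := (eta f hf j).surjective i
      rw [cocPerm_eta]
      exact eta_of_eq (one_smul _ _) _ _ _ (one_smul _ _) _ _
    simp [ofNZ, this]
  · rfl

/-- The cocycle identity. -/
lemma coc_mul (j : Fin 2) (g h : GE) (f : X) : coc j (g * h) f = coc j g (h • f) * coc j h f := by
  by_cases hf : f ∈ Y
  · have hf' := smul_mem_Y h hf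
    simp only [coc, hf, hf', dite_true]
    apply Subtype.ext
    have : cocPerm j (g * h) f hf = cocPerm j g (h • f) hf' * cocPerm j h f hf := by
      ext1 i
      obtain ⟨a, rfl⟩ := (eta f hf j).surjective i
      rw [Equiv.Perm.mul_apply, cocPerm_eta, cocPerm_eta, cocPerm_eta]
      exact eta_of_eq (mul_smul _ _ _) _ _ _ (mul_smul _ _ _) _ _
    simp only [ofNZ, this, map_mul, Subgroup.coe_mul]
  · have hf' : h • f ∉ Y := fun h' => hf ((smul_mem_Y_iff h).1 h')
    simp [coc, hf, hf']

/-- `f ∈ X_n` agrees with `s` at all `i` with `|i| ≤ n`. -/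
def cyl (n : ℕ) (s : NZ → Fin 2) : Set X := {f | (∀ i ∈ box n, f.1 i = s i) ∧ SymOut n f}

lemma cyl_smul {n : ℕ} {g : GE} (hg : InG n g) {s : NZ → Fin 2} {f : X} (hf : f ∈ cyl n s) :
    g • f ∈ cyl n (fun i => s (g⁻¹ • i)) :=
  ⟨fun i hi => hf.1 _ (by rw [mem_box] at hi ⊢; exact hg.inv.abs_le hi), hg.symOut hf.2⟩

lemma eta_congr (j : Fin 2) {n : ℕ} {s : NZ → Fin 2} {f f' : X} (hf : f ∈ cyl n s)
    (hf' : f' ∈ cyl n s) (hY : f ∈ Y) (hY' : f' ∈ Y) (a : NZ) (h : f.1 a = j) (h' : f'.1 a = j)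
    (ha : |(a : ℤ)| ≤ n) : eta f hY j ⟨a, h⟩ = eta f' hY' j ⟨a, h'⟩ := by
  apply lin.injective
  have h1 := eta_formula hY hf.2 ⟨a, h⟩ ha
  have h2 := eta_formula hY' hf'.2 ⟨a, h'⟩ ha
  have key : ∀ i ∈ box n, f.1 i = f'.1 i := fun i hi => (hf.1 i hi).trans (hf'.1 i hi).symm
  have h3 : ((box n).filter fun i => a ≤ i ∧ f.1 i = j) =
      (box n).filter fun i => a ≤ i ∧ f'.1 i = j :=
    Finset.filter_congr fun i hi => by rw [key i hi]
  have h4 : cnt f j n = cnt f' j n := by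
    unfold cnt
    rw [Finset.filter_congr fun i hi => by rw [key i hi]]
  simp only [h3, h4] at h1 h2
  linarith

/-- The cocycle `c(g, ·)`, `g ∈ G(n)`, is constant on the cylinders. -/
lemma coc_congr (j : Fin 2) {n : ℕ} {s : NZ → Fin 2} {g : GE} (hg : InG n g) {f f' : X}
    (hf : f ∈ cyl n s) (hf' : f' ∈ cyl n s) (hY : f ∈ Y) (hY' : f' ∈ Y) :
    coc j g f = coc j g f' := by
  simp only [coc, hY, hY', dite_true]
  apply ofNZ_ext
  have near : ∀ {f f' : X}, f ∈ cyl n s → f' ∈ cyl n s → ∀ (hY : f ∈ Y) (hY' : f' ∈ Y)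
      (a : fiber f j), |(a.1 : ℤ)| ≤ n →
      cocPerm j g f hY (eta f hY j a) = cocPerm j g f' hY' (eta f hY j a) := by
    intro f f' hf hf' hY hY' a ha
    have ha' : f'.1 a.1 = j := by
      rw [hf'.1 a.1 (mem_box.2 ha), ← hf.1 a.1 (mem_box.2 ha)]; exact a.2
    rw [cocPerm_eta, eta_congr j hf hf' hY hY' a.1 a.2 ha' ha, cocPerm_eta]
    exact eta_congr j (cyl_smul hg hf) (cyl_smul hg hf') _ _ _ _ _ (hg.abs_le ha)
  ext1 i
  obtain ⟨a, ha⟩ := (eta f hY j).surjective i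
  obtain ⟨b, hb⟩ := (eta f' hY' j).surjective i
  by_cases h1 : |(a.1 : ℤ)| ≤ n
  · rw [← ha]; exact near hf hf' hY hY' a h1
  by_cases h2 : |(b.1 : ℤ)| ≤ n
  · rw [← hb]; exact (near hf' hf hY' hY b h2).symm
  · push Not at h1 h2
    conv_lhs => rw [← ha, eta_far j hY hg hf.2 a h1, ha]
    conv_rhs => rw [← hb, eta_far j hY' hg hf'.2 b h2, hb]

/-! ### The measure on `X` -/

/-- Two positive numbers `p₁`, `p₂` with `p₁ + p₂ = 1`. -/
structure Weights where
  p₁ : ℝ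
  p₂ : ℝ
  pos₁ : 0 < p₁
  pos₂ : 0 < p₂
  sum_eq : p₁ + p₂ = 1

lemma Weights.le_one₁ (p : Weights) : p.p₁ ≤ 1 := by
  have := p.sum_eq; have := p.pos₂; linarith

lemma Weights.le_one₂ (p : Weights) : p.p₂ ≤ 1 := by
  have := p.sum_eq; have := p.pos₁; linarith

/-- The weight of a label. -/
def Weights.w (p : Weights) : Fin 2 → ℝ := ![p.p₁, p.p₂]

lemma Weights.w_pos (p : Weights) (j : Fin 2) : 0 < p.w j := by
  fin_cases j
  · exact p.pos₁
  · exact p.pos₂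

/-- The measure with the masses `a` and `1 - a`. -/
def coin (a : ℝ) : Measure (Fin 2) :=
  ENNReal.ofReal a • Measure.dirac 0 + ENNReal.ofReal (1 - a) • Measure.dirac 1

lemma coin_prob {a : ℝ} (h0 : 0 ≤ a) (h1 : a ≤ 1) : IsProbabilityMeasure (coin a) := ⟨by
  simp only [coin, Measure.coe_add, Measure.coe_smul, Pi.add_apply, Pi.smul_apply, measure_univ,
    smul_eq_mul, mul_one]
  rw [← ENNReal.ofReal_add h0 (by linarith)]
  simp⟩

/-- The law of the label `f i`, `i > 0`, given that `f (-i) ≠ f i` if and only if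
`i - 1 ∈ D`. -/
def law (p : Weights) (D : Finset ℕ) (k : ℕ) : Measure (Fin 2) :=
  if k ∈ D then coin (1 / 2) else coin p.p₁

instance (p : Weights) (D : Finset ℕ) (k : ℕ) : IsProbabilityMeasure (law p D k) := by
  unfold law
  split_ifs
  · exact coin_prob (by norm_num) (by norm_num)
  · exact coin_prob p.pos₁.le p.le_one₁

/-- The nonzero integer `k + 1`. -/
def pos (k : ℕ) : NZ := ⟨k + 1, by omega⟩

@[simp] lemma coe_pos (k : ℕ) : ((pos k : NZ) : ℤ) = k + 1 := rfl

lemma eq_pos_or (i : NZ) : ∃ k, i = pos k ∨ i = -pos k := by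
  have := i.2
  refine ⟨(i : ℤ).natAbs - 1, ?_⟩
  simp only [Subtype.ext_iff, NZ.coe_neg, coe_pos]
  omega

/-- The values of a function on `ℤ \ {0}` obtained from its values `h` on the positive integers,
and from the set `D` of all `k` with `f (-(k + 1)) ≠ f (k + 1)`. -/
def extFun (D : Finset ℕ) (h : ℕ → Fin 2) (i : NZ) : Fin 2 :=
  if 0 < (i : ℤ) then h ((i : ℤ).natAbs - 1)
  else if (i : ℤ).natAbs - 1 ∈ D then h ((i : ℤ).natAbs - 1) + 1 else h ((i : ℤ).natAbs - 1)

@[simp] lemma extFun_pos (D : Finset ℕ) (h : ℕ → Fin 2) (k : ℕ) : extFun D h (pos k) = h k := by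
  have h1 : (0 : ℤ) < k + 1 := by omega
  have h2 : ((k : ℤ) + 1).natAbs - 1 = k := by omega
  simp [extFun, h1, h2]

@[simp] lemma extFun_neg (D : Finset ℕ) (h : ℕ → Fin 2) (k : ℕ) :
    extFun D h (-pos k) = if k ∈ D then h k + 1 else h k := by
  have h1 : ¬ (0 : ℤ) < -(k + 1) := by omega
  have h2 : (-((k : ℤ) + 1)).natAbs - 1 = k := by omega
  simp only [extFun, NZ.coe_neg, coe_pos, h1, h2, if_false]

/-- The point of `X` given by `D` and `h`. -/
def mkX (D : Finset ℕ) (h : ℕ → Fin 2) : X := ⟨extFun D h, by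
  refine ((Finset.finite_toSet D).image pos |>.union
    ((Finset.finite_toSet D).image fun k => -pos k)).subset ?_
  intro i hi
  obtain ⟨k, rfl | rfl⟩ := eq_pos_or i
  · left
    refine ⟨k, ?_, rfl⟩
    by_contra hk
    simp only [Finset.mem_coe] at hk
    simp [hk] at hi
  · right
    refine ⟨k, ?_, rfl⟩
    by_contra hk
    simp only [Finset.mem_coe] at hk
    simp [hk, NZ.neg_neg] at hi⟩

lemma measurable_mkX (D : Finset ℕ) : Measurable (mkX D) := by
  refine Measurable.subtype_mk (measurable_pi_iff.2 fun i => ?_)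
  have : ∀ k, Measurable fun h : ℕ → Fin 2 => h k := fun k => measurable_pi_apply k
  unfold extFun
  split_ifs
  · exact this _
  · exact (measurable_from_top (f := fun x : Fin 2 => x + 1)).comp (this _)
  · exact this _

/-- The measure `ω` on `X`: the sum over all `D` of its restrictions to the sets of all `f` with
`{i > 0 | f (-i) ≠ f i} = {k + 1 | k ∈ D}`. See `omega_cyl` for its values on the cylinders. -/
def omega (p : Weights) : Measure X :=
  Measure.sum fun D : Finset ℕ =>
    (∏ _k ∈ D, ENNReal.ofReal (2 * √(p.p₁ * p.p₂))) •
      (Measure.infinitePi (law p D)).map (mkX D)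

lemma box_succ (k : ℕ) : box (k + 1) = insert (pos k) (insert (-pos k) (box k)) := by
  ext i
  simp only [mem_box, Finset.mem_insert, abs_le, Subtype.ext_iff, NZ.coe_neg, coe_pos]
  push_cast
  omega

lemma prod_box {M : Type*} [CommMonoid M] (F : NZ → M) (n : ℕ) :
    ∏ i ∈ box n, F i = ∏ k ∈ Finset.range n, (F (pos k) * F (-pos k)) := by
  induction n with
  | zero =>
    have : box 0 = ∅ := Finset.card_eq_zero.1 (card_box 0)
    simp [this]
  | succ k ih =>
    rw [box_succ, Finset.prod_insert, Finset.prod_insert, ih, Finset.prod_range_succ]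
    · rw [← mul_assoc, mul_comm]
    · simp only [mem_box, abs_le, NZ.coe_neg, coe_pos]; omega
    · simp only [mem_box, abs_le, Finset.mem_insert, Subtype.ext_iff, NZ.coe_neg, coe_pos]; omega

lemma measurable_apply (i : NZ) : Measurable fun f : X => f.1 i :=
  (measurable_pi_apply i).comp measurable_subtype_coe

lemma measurableSet_cyl (n : ℕ) (s : NZ → Fin 2) : MeasurableSet (cyl n s) := by
  have h1 : cyl n s = (⋂ i ∈ box n, {f : X | f.1 i = s i}) ∩
      ⋂ i : NZ, ⋂ _ : (n : ℤ) < |(i : ℤ)|, {f : X | f.1 i = f.1 (-i)} := by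
    ext f
    simp [cyl, SymOut]
  rw [h1]
  refine (Finset.measurableSet_biInter _ fun i _ => ?_).inter
    (MeasurableSet.iInter fun i => MeasurableSet.iInter fun _ => ?_)
  · exact measurable_apply i (measurableSet_singleton (s i))
  · exact measurableSet_eq_fun (measurable_apply i) (measurable_apply (-i))

lemma fin_two_flip {a b : Fin 2} : b = a + 1 ↔ a ≠ b := by
  revert a b; decide

lemma coin_half (a : Fin 2) : coin (1 / 2) {a} = ENNReal.ofReal (1 / 2) := by
  fin_cases a
  · simp [coin]
  · simp only [coin]
    rw [show (1 : ℝ) - 1 / 2 = 1 / 2 by norm_num]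
    simp

lemma coin_weight (p : Weights) (a : Fin 2) : coin p.p₁ {a} = ENNReal.ofReal (p.w a) := by
  have : 1 - p.p₁ = p.p₂ := by have := p.sum_eq; linarith
  fin_cases a <;> simp [coin, Weights.w, this]

/-- The measure of a cylinder is the product of the square roots of the weights. -/
theorem omega_cyl (p : Weights) (n : ℕ) (s : NZ → Fin 2) :
    omega p (cyl n s) = ∏ i ∈ box n, ENNReal.ofReal √(p.w (s i)) := by
  set D₀ : Finset ℕ := (Finset.range n).filter fun k => s (pos k) ≠ s (-pos k) with hD₀
  have hpre : ∀ D, mkX D ⁻¹' cyl n s =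
      if D = D₀ then Set.pi (Finset.range n : Set ℕ) (fun k => {s (pos k)}) else ∅ := by
    intro D
    have hmem : ∀ h, mkX D h ∈ cyl n s ↔
        (∀ k < n, h k = s (pos k) ∧ (if k ∈ D then h k + 1 else h k) = s (-pos k)) ∧
          ∀ k, n ≤ k → k ∉ D := by
      intro h
      constructor
      · rintro ⟨h1, h2⟩
        refine ⟨fun k hk => ⟨?_, ?_⟩, fun k hk hkD => ?_⟩
        · rw [← h1 (pos k) (by simp only [mem_box, abs_le, coe_pos]; omega)]
          exact (extFun_pos D h k).symm
        · rw [← h1 (-pos k) (by simp only [mem_box, abs_le, NZ.coe_neg, coe_pos]; omega)]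
          exact (extFun_neg D h k).symm
        · have h3 := h2 (pos k) (by simp only [coe_pos, lt_abs]; omega)
          change extFun D h (pos k) = extFun D h (-pos k) at h3
          rw [extFun_pos, extFun_neg, if_pos hkD] at h3
          exact fin_two_flip.1 h3 rfl
      · rintro ⟨h1, h2⟩
        refine ⟨fun i hi => ?_, fun i hi => ?_⟩
        · change extFun D h i = _
          rw [mem_box, abs_le] at hi
          obtain ⟨k, rfl | rfl⟩ := eq_pos_or i
          · rw [extFun_pos]; exact (h1 k (by simp at hi; omega)).1
          · rw [extFun_neg]; exact (h1 k (by simp at hi; omega)).2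
        · change extFun D h i = extFun D h (-i)
          rw [lt_abs] at hi
          obtain ⟨k, rfl | rfl⟩ := eq_pos_or i
          · rw [extFun_pos, extFun_neg, if_neg (h2 k (by simp at hi; omega))]
          · rw [NZ.neg_neg, extFun_pos, extFun_neg, if_neg (h2 k (by simp at hi; omega))]
    ext h
    rw [Set.mem_preimage, hmem]
    split_ifs with hD
    · simp only [Set.mem_pi, Finset.coe_range, Set.mem_Iio, Set.mem_singleton_iff]
      constructor
      · intro h' k hk; exact (h'.1 k hk).1
      · intro h'
        refine ⟨fun k hk => ⟨h' k hk, ?_⟩, fun k hk hkD => ?_⟩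
        · rw [h' k hk]
          split_ifs with hkD
          · rw [hD, hD₀, Finset.mem_filter] at hkD
            exact (fin_two_flip.2 hkD.2).symm
          · rw [hD, hD₀, Finset.mem_filter] at hkD
            by_contra hne
            exact hkD ⟨Finset.mem_range.2 hk, hne⟩
        · rw [hD, hD₀, Finset.mem_filter, Finset.mem_range] at hkD
          omega
    · simp only [Set.mem_empty_iff_false, iff_false]
      rintro ⟨h1, h2⟩
      apply hD
      ext k
      rw [hD₀, Finset.mem_filter, Finset.mem_range]
      constructor
      · intro hk
        have hkn : k < n := by by_contra hc; exact h2 k (by omega) hk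
        obtain ⟨h3, h4⟩ := h1 k hkn
        rw [if_pos hk, h3] at h4
        exact ⟨hkn, fin_two_flip.1 h4.symm⟩
      · rintro ⟨hkn, hk⟩
        by_contra hkD
        obtain ⟨h3, h4⟩ := h1 k hkn
        rw [if_neg hkD, h3] at h4
        exact hk h4
  rw [omega, Measure.sum_apply _ (measurableSet_cyl n s), tsum_eq_single D₀]
  · rw [Measure.smul_apply, Measure.map_apply (measurable_mkX _) (measurableSet_cyl n s), hpre,
      if_pos rfl, Measure.infinitePi_pi _ (fun _ _ => measurableSet_singleton _), prod_box,
      smul_eq_mul]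
    have h1 : ∏ _k ∈ D₀, ENNReal.ofReal (2 * √(p.p₁ * p.p₂)) =
        ∏ k ∈ Finset.range n, if s (pos k) ≠ s (-pos k) then
          ENNReal.ofReal (2 * √(p.p₁ * p.p₂)) else 1 := by
      rw [hD₀, Finset.prod_filter]
    rw [h1, ← Finset.prod_mul_distrib]
    refine Finset.prod_congr rfl fun k hk => ?_
    have h2 : k ∈ D₀ ↔ s (pos k) ≠ s (-pos k) := by
      rw [hD₀, Finset.mem_filter]; exact and_iff_right hk
    rw [← ENNReal.ofReal_mul (Real.sqrt_nonneg _)]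
    unfold law
    simp only [h2]
    split_ifs with h3
    · rw [coin_half, ← ENNReal.ofReal_mul (by positivity)]
      congr 1
      have h4 : √(p.w (s (pos k))) * √(p.w (s (-pos k))) = √(p.p₁ * p.p₂) := by
        rw [← Real.sqrt_mul (p.w_pos _).le]
        congr 1
        revert h3
        generalize s (pos k) = a
        generalize s (-pos k) = b
        intro h3
        fin_cases a <;> fin_cases b <;> simp [Weights.w] at h3 ⊢
        exact mul_comm _ _
      rw [h4]; ring
    · rw [one_mul, coin_weight]
      congr 1
      rw [not_not] at h3
      rw [← h3, Real.mul_self_sqrt (p.w_pos _).le]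
  · intro D hD
    rw [Measure.smul_apply, Measure.map_apply (measurable_mkX _) (measurableSet_cyl n s), hpre,
      if_neg hD]
    simp

lemma mem_cyl_self {n : ℕ} {f : X} (hf : SymOut n f) : f ∈ cyl n f.1 := ⟨fun _ _ => rfl, hf⟩

lemma exists_cyl (n₀ : ℕ) (f : X) : ∃ n, n₀ ≤ n ∧ f ∈ cyl n f.1 := by
  obtain ⟨n, hn⟩ := exists_symOut f
  exact ⟨max n₀ n, le_max_left _ _, mem_cyl_self (hn _ (le_max_right _ _))⟩

/-- The cylinders of order at least `n₀`. -/
def cyls (n₀ : ℕ) : Set (Set X) := {t | ∃ n s, n₀ ≤ n ∧ t = cyl n s}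

lemma cyls_countable (n₀ : ℕ) : (cyls n₀).Countable := by
  refine (Set.countable_range fun x : (Σ n : ℕ, (box n → Fin 2)) =>
    cyl x.1 fun i => if h : i ∈ box x.1 then x.2 ⟨i, h⟩ else 0).mono ?_
  rintro _ ⟨n, s, -, rfl⟩
  refine ⟨⟨n, fun i => s i⟩, ?_⟩
  ext f
  simp only [cyl, Set.mem_ofPred_eq]
  refine and_congr_left fun _ => forall₂_congr fun i hi => ?_
  rw [dif_pos hi]

lemma cyls_cover (n₀ : ℕ) : ⋃₀ cyls n₀ = Set.univ := by
  rw [Set.sUnion_eq_univ_iff]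
  intro f
  obtain ⟨n, hn, hf⟩ := exists_cyl n₀ f
  exact ⟨_, ⟨n, _, hn, rfl⟩, hf⟩

/-- A union of cylinders is measurable. -/
lemma union_cyls {A : Set X} {n₀ : ℕ} (h : ∀ f ∈ A, ∀ f₁, ∀ n, n₀ ≤ n → f ∈ cyl n f.1 →
    f₁ ∈ cyl n f.1 → f₁ ∈ A) : A = ⋃₀ {t ∈ cyls n₀ | t ⊆ A} := by
  refine Set.Subset.antisymm (fun f hf => ?_) (Set.sUnion_subset fun t ht => ht.2)
  obtain ⟨n, hn, hf'⟩ := exists_cyl n₀ f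
  exact ⟨_, ⟨⟨n, _, hn, rfl⟩, fun f₁ hf₁ => h f hf f₁ n hn hf' hf₁⟩, hf'⟩

lemma generateFrom_cyls (n₀ : ℕ) :
    (inferInstance : MeasurableSpace X) = MeasurableSpace.generateFrom (cyls n₀) := by
  refine le_antisymm ?_ (MeasurableSpace.generateFrom_le ?_)
  · suffices hm : @Measurable X X (MeasurableSpace.generateFrom (cyls n₀)) inferInstance id from
      fun t ht => hm ht
    refine @Measurable.subtype_mk _ _ (MeasurableSpace.generateFrom (cyls n₀)) _ _ _ ?_ _
    refine @measurable_pi_lambda _ _ _ (MeasurableSpace.generateFrom (cyls n₀)) _ _ fun i => ?_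
    refine @measurable_to_countable' _ _ _ _ (MeasurableSpace.generateFrom (cyls n₀)) _ fun j => ?_
    rw [union_cyls (A := (fun f : X => f.1 i) ⁻¹' {j}) (n₀ := max n₀ (i : ℤ).natAbs)
      (fun f hf f₁ n hn h1 h2 => ?_)]
    · refine MeasurableSet.sUnion (((cyls_countable _).mono (Set.sep_subset _ _))) ?_
      rintro t ⟨⟨n, s, hn, rfl⟩, -⟩
      exact MeasurableSpace.measurableSet_generateFrom ⟨n, s, (le_max_left _ _).trans hn, rfl⟩
    · have : i ∈ box n := by
        rw [mem_box, Int.abs_eq_natAbs]; exact_mod_cast (le_max_right _ _).trans hn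
      exact (h2.1 i this).trans hf
  · rintro _ ⟨n, s, -, rfl⟩
    exact measurableSet_cyl n s

lemma cyl_subset {n m : ℕ} (hnm : n ≤ m) {s t : NZ → Fin 2} {f : X} (h1 : f ∈ cyl n s)
    (h2 : f ∈ cyl m t) : cyl m t ⊆ cyl n s := by
  intro f' h
  have key : ∀ i ∈ box m, f'.1 i = f.1 i := fun i hi => (h.1 i hi).trans (h2.1 i hi).symm
  refine ⟨fun i hi => ?_, fun i hi => ?_⟩
  · rw [← h1.1 i hi, key]
    rw [mem_box] at hi ⊢; omega
  · by_cases h' : i ∈ box m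
    · rw [key i h', key (-i) (by simpa using h')]; exact h1.2 i hi
    · exact h.2 i (by simpa using h')

lemma isPiSystem_cyls (n₀ : ℕ) : IsPiSystem (cyls n₀) := by
  rintro _ ⟨n, s, hn, rfl⟩ _ ⟨m, t, hm, rfl⟩ ⟨f, hf, hf'⟩
  rcases le_total n m with h | h
  · rw [Set.inter_eq_right.2 (cyl_subset h hf hf')]; exact ⟨m, t, hm, rfl⟩
  · rw [Set.inter_eq_left.2 (cyl_subset h hf' hf)]; exact ⟨n, s, hn, rfl⟩

lemma measurable_smul' (g : GE) : Measurable fun f : X => g • f :=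
  Measurable.subtype_mk (measurable_pi_iff.2 fun _ => measurable_apply _)

/-- The group `G` preserves the measure `ω`. -/
lemma measurePreserving_smul (p : Weights) (g : GE) :
    MeasurePreserving (fun f : X => g • f) (omega p) (omega p) := by
  refine ⟨measurable_smul' g, ?_⟩
  obtain ⟨n₀, hn₀⟩ := exists_inG g
  have hval : ∀ t ∈ cyls n₀, (omega p).map (fun f : X => g • f) t = omega p t := by
    rintro _ ⟨n, s, hn, rfl⟩
    have hg := hn₀ n hn
    rw [Measure.map_apply (measurable_smul' g) (measurableSet_cyl n s)]
    have : (fun f : X => g • f) ⁻¹' cyl n s = cyl n (fun i => s (g • i)) := by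
      ext f
      constructor
      · intro hf
        have := cyl_smul hg.inv hf
        simpa using this
      · intro hf
        have := cyl_smul hg hf
        simpa using this
    rw [this, omega_cyl, omega_cyl]
    refine Finset.prod_nbij' (fun i => g • i) (fun i => g⁻¹ • i) ?_ ?_ ?_ ?_ ?_
    · intro i hi; rw [mem_box] at hi ⊢; exact hg.abs_le hi
    · intro i hi; rw [mem_box] at hi ⊢; exact hg.inv.abs_le hi
    · intro i _; simp
    · intro i _; simp
    · intro i _; rfl
  refine Measure.ext_of_generateFrom_of_cover_subset (generateFrom_cyls n₀) (isPiSystem_cyls n₀)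
    subset_rfl (cyls_countable n₀) (cyls_cover n₀) ?_ hval
  intro t ht
  rw [hval t ht]
  obtain ⟨n, s, -, rfl⟩ := ht
  rw [omega_cyl]
  exact ENNReal.prod_ne_top fun _ _ => ENNReal.ofReal_ne_top

lemma cnt_congr {n : ℕ} {f f' : X} (h : f' ∈ cyl n f.1) (j : Fin 2) : cnt f' j n = cnt f j n := by
  unfold cnt
  rw [Finset.filter_congr fun i hi => by rw [h.1 i hi]]

lemma measurableSet_Y : MeasurableSet Y := by
  have h : Y = {f : X | ∀ᶠ n : ℕ in atTop, Even (cnt f 0 n)} ∩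
      ⋂ j, ⋂ n : ℕ, ⋃ i : NZ, ⋃ _ : i ∉ box n, {f : X | f.1 i = j} := by
    ext f
    simp only [Y, Set.mem_ofPred_eq, Set.mem_inter_iff, Set.mem_iInter, Set.mem_iUnion,
      exists_prop]
    refine and_congr_right fun _ => forall_congr' fun j => ⟨fun h n => ?_, fun h hfin => ?_⟩
    · obtain ⟨i, hi, hi'⟩ := h.exists_notMem_finset (box n)
      exact ⟨i, hi', hi⟩
    · obtain ⟨n, hn⟩ := exists_bound hfin
      obtain ⟨i, hi, hi'⟩ := h n
      exact hn n le_rfl i (by simpa using hi) hi'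
  rw [h]
  refine MeasurableSet.inter ?_ (MeasurableSet.iInter fun j => MeasurableSet.iInter fun n =>
    MeasurableSet.iUnion fun i => MeasurableSet.iUnion fun _ =>
      measurable_apply i (measurableSet_singleton j))
  rw [union_cyls (A := {f : X | ∀ᶠ n : ℕ in atTop, Even (cnt f 0 n)}) (n₀ := 0)
    (fun f hf f₁ n hn h1 h2 => ?_)]
  · refine MeasurableSet.sUnion (((cyls_countable _).mono (Set.sep_subset _ _))) ?_
    rintro t ⟨⟨n, s, hn, rfl⟩, -⟩
    exact measurableSet_cyl n s
  · filter_upwards [hf, eventually_ge_atTop n] with m hm hnm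
    rw [cnt_add 0 h1.2 hnm, Nat.even_add] at hm
    rw [cnt_add 0 h2.2 hnm, Nat.even_add, cnt_congr h2]
    simpa using hm

/-- The restriction of the measure `ω` to `Y`. -/
def omegaY (p : Weights) : Measure X := (omega p).restrict Y

lemma measurePreserving_smul_Y (p : Weights) (g : GE) :
    MeasurePreserving (fun f : X => g • f) (omegaY p) (omegaY p) := by
  have := (measurePreserving_smul p g).restrict_preimage measurableSet_Y
  rwa [show (fun f : X => g • f) ⁻¹' Y = Y from Set.ext fun f => smul_mem_Y_iff g] at this

lemma ae_mem_Y (p : Weights) : ∀ᵐ f ∂(omegaY p), f ∈ Y := ae_restrict_mem measurableSet_Y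

/-! ### Unitary representations of the pair `(G, K)` -/

section Reps

variable {H : Type*} [NormedAddCommGroup H] [InnerProductSpace ℂ H]

/-- Unitary representations of `G` in `H`. -/
abbrev URep (H : Type*) [NormedAddCommGroup H] [InnerProductSpace ℂ H] := GE →* (H ≃ₗᵢ[ℂ] H)

/-- A unitary representation given by isometries. -/
def mkURep (ρ : GE → (H →ₗᵢ[ℂ] H)) (h1 : ∀ v, ρ 1 v = v)
    (hmul : ∀ g h v, ρ (g * h) v = ρ g (ρ h v)) : URep H where
  toFun g := LinearIsometryEquiv.mk
    (LinearEquiv.ofLinearMap (ρ g).toLinearMap (ρ g⁻¹).toLinearMap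
      (by ext v; simp [← hmul, h1]) (by ext v; simp [← hmul, h1])) (ρ g).norm_map
  map_one' := by ext v; exact h1 v
  map_mul' g h := by ext v; exact hmul g h v

@[simp] lemma mkURep_apply (ρ : GE → (H →ₗᵢ[ℂ] H)) (h1 hmul) (g : GE) (v : H) :
    mkURep ρ h1 hmul g v = ρ g v := rfl

/-- The space `H(π)_n` of `K_n`-invariant vectors. -/
def fixedSpace (π : URep H) (n : ℕ) : Submodule ℂ H where
  carrier := {v | ∀ g ∈ KEn n, π g v = v}
  zero_mem' := by simp
  add_mem' := by
    intro a b ha hb g hg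
    rw [map_add, ha g hg, hb g hg]
  smul_mem' := by
    intro c a ha g hg
    rw [map_smul, ha g hg]

/-- The union of the spaces `H(π)_n` is dense. -/
def IsAdmissible (π : URep H) : Prop := Dense (⋃ n, (fixedSpace π n : Set H))

/-- A subspace invariant under `G`. -/
def IsInvariantSubspace (π : URep H) (W : Submodule ℂ H) : Prop := ∀ g, ∀ v ∈ W, π g v ∈ W

/-- The representation is nonzero, and has no closed invariant subspaces except `0` and `H`. -/
def IsIrredRep (π : URep H) : Prop :=
  Nontrivial H ∧ ∀ W : Submodule ℂ H, IsClosed (W : Set H) → IsInvariantSubspace π W → W = ⊥ ∨ W = ⊤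

/-- The restriction of a representation to an invariant subspace. -/
def subrep (π : URep H) (W : Submodule ℂ H) (hW : IsInvariantSubspace π W) : URep W :=
  mkURep (fun g =>
    { toLinearMap := (π g).toLinearEquiv.toLinearMap.restrict (hW g)
      norm_map' := fun v => (π g).norm_map v })
    (fun v => Subtype.ext (by
      change π 1 v = v
      rw [map_one]; rfl))
    (fun g h v => Subtype.ext (by
      change π (g * h) v = π g (π h v)
      rw [map_mul]; rfl))

@[simp] lemma coe_subrep (π : URep H) (W : Submodule ℂ H) (hW : IsInvariantSubspace π W) (g : GE) (v : W) :
    ((subrep π W hW g v : W) : H) = π g v := rfl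

/-- The cyclic span of a set of vectors. -/
def cyclicSpan (π : URep H) (S : Set H) : Submodule ℂ H :=
  (Submodule.span ℂ {w | ∃ g, ∃ v ∈ S, w = π g v}).topologicalClosure

lemma isInvariant_cyclicSpan (π : URep H) (S : Set H) : IsInvariantSubspace π (cyclicSpan π S) := by
  intro g v hv
  have hle : Submodule.span ℂ {w | ∃ g, ∃ v ∈ S, w = π g v} ≤
      (Submodule.span ℂ {w | ∃ g, ∃ v ∈ S, w = π g v}).comap
        (π g).toLinearEquiv.toLinearMap := by
    rw [Submodule.span_le]
    rintro _ ⟨h, u, hu, rfl⟩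
    refine Submodule.subset_span ⟨g * h, u, hu, ?_⟩
    rw [map_mul]; rfl
  exact map_mem_closure (π g).continuous hv fun w hw => hle hw

/-- The depth of a representation: the least `n` with `H(π)_n ≠ 0`. -/
def depth (π : URep H) : ℕ := sInf {n | fixedSpace π n ≠ ⊥}

/-- The root of a representation: the space `H(π)_d`, where `d` is the depth. -/
def root (π : URep H) : Submodule ℂ H := fixedSpace π (depth π)

/-- The transposition `(i, j)`. -/
def transp (i j : NZ) : GE := ofNZ (Equiv.swap i j) (by
  refine (Set.toFinite {i, j}).subset fun k hk => ?_
  by_contra h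
  simp only [Set.mem_insert_iff, Set.mem_singleton_iff, not_or] at h
  exact hk (Equiv.swap_apply_of_ne_of_ne h.1 h.2))

/-- `A` is the limit of the operators `π((i, n))`, `n → ∞`, in the weak operator topology. -/
def IsWeakLimit (π : URep H) (i : NZ) (A : H →L[ℂ] H) : Prop :=
  ∀ v w : H, Tendsto (fun n : ℕ => inner ℂ w (π (transp i (pos n)) v)) atTop (𝓝 (inner ℂ w (A v)))

open Classical in
/-- The operator `A_i = lim π((i, n))`, `n → ∞`. The limit exists in every admissible
representation in a Hilbert space. -/
def opA (π : URep H) (i : NZ) : H →L[ℂ] H :=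
  if h : ∃ A, IsWeakLimit π i A then h.choose else 0

/-- `μ` is the spectral measure of the operator `A` and the vector `ζ`, on `[-1, 1]`: the matrix
element `(q(A) ζ, ζ)` is `∫ q dμ` for all polynomials `q`. -/
def IsSpectralMeasure (A : H →L[ℂ] H) (ζ : H) (μ : Measure ℝ) : Prop :=
  IsFiniteMeasure μ ∧ μ (Set.Icc (-1) 1)ᶜ = 0 ∧
    ∀ k : ℕ, inner ℂ ζ ((A ^ k) ζ) = ((∫ t, t ^ k ∂μ : ℝ) : ℂ)

/-- `μ` is the Thoma measure of `π`: the spectral measure of `A_{d+1}` and any unit vector of the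
root, where `d` is the depth. -/
def HasThomaMeasure (π : URep H) (μ : Measure ℝ) : Prop :=
  ∀ ζ ∈ root π, ‖ζ‖ = 1 → IsSpectralMeasure (opA π (pos (depth π))) ζ μ

end Reps

/-! ### Mixtures -/

section Mixture

variable {H₁ H₂ : Type*} [NormedAddCommGroup H₁] [InnerProductSpace ℂ H₁]
  [NormedAddCommGroup H₂] [InnerProductSpace ℂ H₂]

/-- The Hilbert space tensor product. -/
abbrev HT (H₁ H₂ : Type*) [NormedAddCommGroup H₁] [InnerProductSpace ℂ H₁]
    [NormedAddCommGroup H₂] [InnerProductSpace ℂ H₂] := UniformSpace.Completion (H₁ ⊗[ℂ] H₂)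

/-- The operator `π₁(g₁) ⊗ π₂(g₂)`. -/
def tensorOp (π₁ : URep H₁) (π₂ : URep H₂) (g₁ g₂ : GE) : HT H₁ H₂ →ₗᵢ[ℂ] HT H₁ H₂ where
  toLinearMap := (ContinuousLinearMap.completion
    (TensorProduct.congrIsometry (π₁ g₁) (π₂ g₂) : (H₁ ⊗[ℂ] H₂) →L[ℂ] (H₁ ⊗[ℂ] H₂))).toLinearMap
  norm_map' v := by
    induction v using UniformSpace.Completion.induction_on with
    | hp => exact isClosed_eq (by fun_prop) (by fun_prop)
    | ih v =>
      have h := (TensorProduct.congrIsometry (π₁ g₁) (π₂ g₂)).norm_map v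
      simpa using h

@[simp] lemma tensorOp_coe (π₁ : URep H₁) (π₂ : URep H₂) (g₁ g₂ : GE) (v : H₁ ⊗[ℂ] H₂) :
    tensorOp π₁ π₂ g₁ g₂ (v : HT H₁ H₂) =
      ((TensorProduct.congrIsometry (π₁ g₁) (π₂ g₂) v : H₁ ⊗[ℂ] H₂) : HT H₁ H₂) := by
  simp [tensorOp]

lemma tensorOp_one (π₁ : URep H₁) (π₂ : URep H₂) (v : HT H₁ H₂) : tensorOp π₁ π₂ 1 1 v = v := by
  induction v using UniformSpace.Completion.induction_on with
  | hp => exact isClosed_eq (by fun_prop) (by fun_prop)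
  | ih v =>
    rw [tensorOp_coe]
    congr 1
    induction v using TensorProduct.induction_on with
    | zero => simp
    | tmul x y => simp only [map_one]; rfl
    | add x y hx hy => rw [map_add, hx, hy]

lemma tensorOp_mul (π₁ : URep H₁) (π₂ : URep H₂) (g₁ g₂ h₁ h₂ : GE) (v : HT H₁ H₂) :
    tensorOp π₁ π₂ (g₁ * h₁) (g₂ * h₂) v = tensorOp π₁ π₂ g₁ g₂ (tensorOp π₁ π₂ h₁ h₂ v) := by
  induction v using UniformSpace.Completion.induction_on with
  | hp => exact isClosed_eq (by fun_prop) (by fun_prop)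
  | ih v =>
    rw [tensorOp_coe, tensorOp_coe, tensorOp_coe]
    congr 1
    induction v using TensorProduct.induction_on with
    | zero => simp
    | tmul x y => simp only [map_mul]; rfl
    | add x y hx hy => rw [map_add, hx, hy, map_add, map_add]

/-- The Hilbert space of the square integrable maps `Y → H₁ ⊗ H₂`. -/
abbrev L2Y (p : Weights) (H₁ H₂ : Type*) [NormedAddCommGroup H₁] [InnerProductSpace ℂ H₁]
    [NormedAddCommGroup H₂] [InnerProductSpace ℂ H₂] := Lp (HT H₁ H₂) 2 (omegaY p)

/-- The action of `g` on functions,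
`(g F)(f) = (π₁ ⊗ π₂)(c(g, g⁻¹ f)) F(g⁻¹ f)`. -/
def actFun (π₁ : URep H₁) (π₂ : URep H₂) (g : GE) (F : X → HT H₁ H₂) (f : X) : HT H₁ H₂ :=
  tensorOp π₁ π₂ (coc 0 g (g⁻¹ • f)) (coc 1 g (g⁻¹ • f)) (F (g⁻¹ • f))

lemma actFun_congr (p : Weights) (π₁ : URep H₁) (π₂ : URep H₂) (g : GE) {F F' : X → HT H₁ H₂}
    (h : F =ᵐ[omegaY p] F') : actFun π₁ π₂ g F =ᵐ[omegaY p] actFun π₁ π₂ g F' := by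
  have := (measurePreserving_smul_Y p g⁻¹).quasiMeasurePreserving.ae h
  filter_upwards [this] with f hf
  simp only [actFun, hf]

lemma actFun_one (π₁ : URep H₁) (π₂ : URep H₂) (F : X → HT H₁ H₂) : actFun π₁ π₂ 1 F = F := by
  funext f
  simp [actFun, coc_one, tensorOp_one]

lemma actFun_mul (π₁ : URep H₁) (π₂ : URep H₂) (g h : GE) (F : X → HT H₁ H₂) :
    actFun π₁ π₂ (g * h) F = actFun π₁ π₂ g (actFun π₁ π₂ h F) := by
  funext f
  have h1 : h • (g * h)⁻¹ • f = g⁻¹ • f := by rw [smul_smul]; simp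
  simp only [actFun, coc_mul, tensorOp_mul, h1]
  simp only [mul_inv_rev, mul_smul]

lemma aestronglyMeasurable_actFun (p : Weights) (π₁ : URep H₁) (π₂ : URep H₂) (g : GE)
    {F : X → HT H₁ H₂} (hF : AEStronglyMeasurable F (omegaY p)) :
    AEStronglyMeasurable (actFun π₁ π₂ g F) (omegaY p) := by
  have hG : AEStronglyMeasurable (fun f => F (g⁻¹ • f)) (omegaY p) :=
    hF.comp_measurePreserving (measurePreserving_smul_Y p g⁻¹)
  obtain ⟨n₀, hn₀⟩ := exists_inG g
  have : Countable (cyls n₀) := (cyls_countable n₀).to_subtype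
  rw [← Measure.restrict_univ (μ := omegaY p), ← cyls_cover n₀, Set.sUnion_eq_iUnion,
    aestronglyMeasurable_iUnion_iff]
  rintro ⟨_, n, s, hn, rfl⟩
  have hg := hn₀ n hn
  by_cases hne : ∃ f₀ ∈ cyl n s, f₀ ∈ Y
  · obtain ⟨f₀, hf₀, hY₀⟩ := hne
    refine ((tensorOp π₁ π₂ (coc 0 g (g⁻¹ • f₀)) (coc 1 g (g⁻¹ • f₀))).continuous
      |>.comp_aestronglyMeasurable (hG.restrict (s := cyl n s))).congr ?_
    filter_upwards [ae_restrict_mem (measurableSet_cyl n s), ae_restrict_of_ae (ae_mem_Y p)]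
      with f hf hY
    have h1 := cyl_smul hg.inv hf
    have h2 := cyl_smul hg.inv hf₀
    have h3 := smul_mem_Y g⁻¹ hY
    have h4 := smul_mem_Y g⁻¹ hY₀
    simp only [actFun]
    rw [coc_congr 0 hg h1 h2 h3 h4, coc_congr 1 hg h1 h2 h3 h4]
  · refine (aestronglyMeasurable_const (b := (0 : HT H₁ H₂))).congr ?_
    filter_upwards [ae_restrict_mem (measurableSet_cyl n s), ae_restrict_of_ae (ae_mem_Y p)]
      with f hf hY
    exact absurd ⟨f, hf, hY⟩ hne

lemma eLpNorm_actFun (p : Weights) (π₁ : URep H₁) (π₂ : URep H₂) (g : GE)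
    {F : X → HT H₁ H₂} (hF : AEStronglyMeasurable F (omegaY p)) :
    eLpNorm (actFun π₁ π₂ g F) 2 (omegaY p) = eLpNorm F 2 (omegaY p) := by
  rw [← eLpNorm_comp_measurePreserving hF (measurePreserving_smul_Y p g⁻¹)]
  refine eLpNorm_congr_norm_ae (Eventually.of_forall fun f => ?_)
  simp [actFun]

lemma memLp_actFun (p : Weights) (π₁ : URep H₁) (π₂ : URep H₂) (g : GE)
    (F : L2Y p H₁ H₂) : MemLp (actFun π₁ π₂ g F) 2 (omegaY p) :=
  ⟨aestronglyMeasurable_actFun p π₁ π₂ g (Lp.aestronglyMeasurable F), by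
    rw [eLpNorm_actFun p π₁ π₂ g (Lp.aestronglyMeasurable F)]; exact Lp.eLpNorm_lt_top F⟩

/-- The action of `g` on `L²`. -/
def actL2 (p : Weights) (π₁ : URep H₁) (π₂ : URep H₂) (g : GE) :
    L2Y p H₁ H₂ →ₗᵢ[ℂ] L2Y p H₁ H₂ where
  toFun F := (memLp_actFun p π₁ π₂ g F).toLp _
  map_add' F F' := by
    apply Lp.ext
    refine (MemLp.coeFn_toLp _).trans ((actFun_congr p π₁ π₂ g (Lp.coeFn_add F F')).trans ?_)
    filter_upwards [Lp.coeFn_add ((memLp_actFun p π₁ π₂ g F).toLp _)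
      ((memLp_actFun p π₁ π₂ g F').toLp _), MemLp.coeFn_toLp (memLp_actFun p π₁ π₂ g F),
      MemLp.coeFn_toLp (memLp_actFun p π₁ π₂ g F')] with f h1 h2 h3
    rw [h1, Pi.add_apply, h2, h3]
    simp [actFun]
  map_smul' c F := by
    apply Lp.ext
    refine (MemLp.coeFn_toLp _).trans ((actFun_congr p π₁ π₂ g (Lp.coeFn_smul c F)).trans ?_)
    filter_upwards [Lp.coeFn_smul c ((memLp_actFun p π₁ π₂ g F).toLp _),
      MemLp.coeFn_toLp (memLp_actFun p π₁ π₂ g F)] with f h1 h2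
    rw [RingHom.id_apply, h1, Pi.smul_apply, h2]
    simp [actFun]
  norm_map' F := by
    change ‖(memLp_actFun p π₁ π₂ g F).toLp _‖ = ‖F‖
    rw [Lp.norm_toLp, Lp.norm_def, eLpNorm_actFun p π₁ π₂ g (Lp.aestronglyMeasurable F)]

lemma coeFn_actL2 (p : Weights) (π₁ : URep H₁) (π₂ : URep H₂) (g : GE) (F : L2Y p H₁ H₂) :
    actL2 p π₁ π₂ g F =ᵐ[omegaY p] actFun π₁ π₂ g F :=
  MemLp.coeFn_toLp (memLp_actFun p π₁ π₂ g F)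

/-- The unitary representation of `G` in the space of square integrable maps `Y → H₁ ⊗ H₂`. -/
def fullRep (p : Weights) (π₁ : URep H₁) (π₂ : URep H₂) : URep (L2Y p H₁ H₂) :=
  mkURep (actL2 p π₁ π₂)
    (fun F => by
      apply Lp.ext
      refine (coeFn_actL2 p π₁ π₂ 1 F).trans ?_
      rw [actFun_one])
    (fun g h F => by
      apply Lp.ext
      refine (coeFn_actL2 p π₁ π₂ (g * h) F).trans ?_
      rw [actFun_mul]
      exact ((coeFn_actL2 p π₁ π₂ g _).trans
        (actFun_congr p π₁ π₂ g (coeFn_actL2 p π₁ π₂ h F))).symm)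

/-- The set `Y_{a,b}` of all `f ∈ Y` such that, for `n = a + b`, the set `{-n, …, n} \ {0}` has `2a`
points of `f⁻¹(1)` and `2b` points of `f⁻¹(2)`, and that `f i = f (-i)` for `|i| > n`. -/
def Yab (a b : ℕ) : Set X :=
  {f | f ∈ Y ∧ cnt f 0 (a + b) = 2 * a ∧ cnt f 1 (a + b) = 2 * b ∧ SymOut (a + b) f}

/-- The set `Y_{a,b,D}` of all `f ∈ Y_{a,b}` with `f⁻¹(1) ∩ {-n, …, n} = D`, `n = a + b`. -/
def YabD (a b : ℕ) (D : Finset NZ) : Set X :=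
  {f | f ∈ Yab a b ∧ (box (a + b)).filter (fun i => f.1 i = 0) = D}

/-- The Hilbert space tensor product of `H(π₁)_a` and `H(π₂)_b` in `H₁ ⊗ H₂`. -/
def fixedTensor (π₁ : URep H₁) (π₂ : URep H₂) (a b : ℕ) : Submodule ℂ (HT H₁ H₂) :=
  (Submodule.span ℂ {z | ∃ x ∈ fixedSpace π₁ a, ∃ y ∈ fixedSpace π₂ b,
    z = ((x ⊗ₜ[ℂ] y : H₁ ⊗[ℂ] H₂) : HT H₁ H₂)}).topologicalClosure

/-- The space `H_{a,b}` of the maps that vanish outside `Y_{a,b}`, and are constant on all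
`Y_{a,b,D}`, with values in the tensor product of `H(π₁)_a` and `H(π₂)_b`. -/
def Hab (p : Weights) (π₁ : URep H₁) (π₂ : URep H₂) (a b : ℕ) : Set (L2Y p H₁ H₂) :=
  {F | (∀ᵐ f ∂(omegaY p), f ∉ Yab a b → F f = 0) ∧
    ∀ D : Finset NZ, ∃ v ∈ fixedTensor π₁ π₂ a b, ∀ᵐ f ∂(omegaY p), f ∈ YabD a b D → F f = v}

/-- The space of the mixture: the cyclic span of `H_{d₁,d₂}`, where `d₁`, `d₂` are the depths. -/
abbrev mixtureSpace (p : Weights) (π₁ : URep H₁) (π₂ : URep H₂) : Submodule ℂ (L2Y p H₁ H₂) :=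
  cyclicSpan (fullRep p π₁ π₂) (Hab p π₁ π₂ (depth π₁) (depth π₂))

/-- The mixture of `π₁` and `π₂` with the weights `p₁`, `p₂`. -/
def mixture (p : Weights) (π₁ : URep H₁) (π₂ : URep H₂) : URep (mixtureSpace p π₁ π₂) :=
  subrep (fullRep p π₁ π₂) (mixtureSpace p π₁ π₂) (isInvariant_cyclicSpan _ _)

/-- The measure `p₁ μ₁(x / p₁) + p₂ μ₂(x / p₂)`. -/
def mixedMeasure (p : Weights) (μ₁ μ₂ : Measure ℝ) : Measure ℝ :=
  ENNReal.ofReal p.p₁ • μ₁.map (fun t => p.p₁ * t) +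
    ENNReal.ofReal p.p₂ • μ₂.map (fun t => p.p₂ * t)

/-- The masses of the points. -/
lemma mixedMeasure_singleton (p : Weights) (μ₁ μ₂ : Measure ℝ) (x : ℝ) :
    mixedMeasure p μ₁ μ₂ {x} =
      ENNReal.ofReal p.p₁ * μ₁ {x / p.p₁} + ENNReal.ofReal p.p₂ * μ₂ {x / p.p₂} := by
  have key : ∀ q : ℝ, 0 < q → (fun t : ℝ => q * t) ⁻¹' {x} = {x / q} := by
    intro q hq
    ext t
    simp [eq_div_iff hq.ne', mul_comm]
  simp only [mixedMeasure, Measure.coe_add, Measure.coe_smul, Pi.add_apply, Pi.smul_apply,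
    smul_eq_mul]
  rw [Measure.map_apply (by fun_prop) (measurableSet_singleton x),
    Measure.map_apply (by fun_prop) (measurableSet_singleton x), key _ p.pos₁, key _ p.pos₂]

end Mixture

/-! ### Young distributions -/

/-- A Young distribution: a map from `[-1, 1]` to the Young diagrams with finitely many nonempty
values. It is extended by the empty diagram to `ℝ`. -/
structure YoungDist where
  toFun : ℝ → YoungDiagram
  finite_supp : {x | toFun x ≠ ⊥}.Finite
  supp_subset : {x | toFun x ≠ ⊥} ⊆ Set.Icc (-1) 1

/-- The support of a Young distribution. -/
def YoungDist.supp (Λ : YoungDist) : Set ℝ := {x | Λ.toFun x ≠ ⊥}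

/-- The Young distribution `Λ(· / q)`, `0 < q ≤ 1`. -/
def YoungDist.scale (Λ : YoungDist) (q : ℝ) (h0 : 0 < q) (h1 : q ≤ 1) : YoungDist where
  toFun x := Λ.toFun (x / q)
  finite_supp := Λ.finite_supp.preimage fun a _ b _ h => (div_left_inj' h0.ne').1 h
  supp_subset := by
    intro x hx
    have := Λ.supp_subset hx
    rw [Set.mem_Icc, le_div_iff₀ h0, div_le_iff₀ h0] at this
    exact ⟨by linarith, by linarith⟩

/-- The pointwise union of two Young distributions. -/
def YoungDist.union (Λ M : YoungDist) : YoungDist where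
  toFun x := Λ.toFun x ⊔ M.toFun x
  finite_supp := (Λ.finite_supp.union M.finite_supp).subset fun x hx => by
    by_contra h
    simp only [Set.mem_union, Set.mem_ofPred_eq, not_or, not_not] at h
    simp [h.1, h.2] at hx
  supp_subset := fun x hx => by
    by_contra h
    have h1 : Λ.toFun x = ⊥ := by by_contra h'; exact h (Λ.supp_subset h')
    have h2 : M.toFun x = ⊥ := by by_contra h'; exact h (M.supp_subset h')
    simp [h1, h2] at hx

section Module

variable {ι : Type*} [Fintype ι] [DecidableEq ι] {Λ : YoungDist}

/-- A filling by `ι` of the cells of all the diagrams `Λ(x)`. It exists if and only if `ι` has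
`|Λ| = ∑ₓ |Λ(x)|` elements. -/
abbrev Filling (ι : Type*) (Λ : YoungDist) := ι ≃ Σ x : ℝ, (Λ.toFun x).cells

/-- The permutations that preserve the rows of every diagram. -/
def IsRow (T : Filling ι Λ) (σ : Equiv.Perm ι) : Prop :=
  ∀ i, (T (σ i)).1 = (T i).1 ∧ (T (σ i)).2.1.1 = (T i).2.1.1

/-- The permutations that preserve the columns of every diagram. -/
def IsCol (T : Filling ι Λ) (σ : Equiv.Perm ι) : Prop :=
  ∀ i, (T (σ i)).1 = (T i).1 ∧ (T (σ i)).2.1.2 = (T i).2.1.2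

open Classical in
/-- The product over `x` of the Young symmetrizers of the diagrams `Λ(x)`,
`∑ sgn(q) p q`, where `p` preserves the rows and `q` preserves the columns. An element
`∑ F(τ) τ` of the group algebra of `S(ι)` is written as the function `F`. -/
def symmetrizer (T : Filling ι Λ) (τ : Equiv.Perm ι) : ℂ :=
  ∑ p : Equiv.Perm ι, ∑ q : Equiv.Perm ι,
    if IsRow T p ∧ IsCol T q ∧ p * q = τ then ((Equiv.Perm.sign q : ℤ) : ℂ) else 0

/-- The element `σ c`, where `c` is the symmetrizer. -/
def translate (T : Filling ι Λ) (σ τ : Equiv.Perm ι) : ℂ := symmetrizer T (σ⁻¹ * τ)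

/-- The module `V_Λ` over the semigroup `S(ι) ⋉ (ℤ₊)^ι`: the left ideal `ℂ[S(ι)] c` of the group
algebra, where `c` is the symmetrizer. Let `χ i` be the point `x` with `T i` in `Λ(x)`, and
let `S(χ)` be the group of all `σ` with `χ ∘ σ = χ`, the product of the groups `S(χ⁻¹(x))`.
The left ideal `ℂ[S(χ)] c` is the exterior tensor product of the irreducible modules of the
diagrams `Λ(x)`, on which the generators `A_i` act by the numbers `χ i`, and `ℂ[S(ι)] c` is induced
from it. So the generators act by `A_i (σ c) = χ (σ⁻¹ i) σ c`. -/
def youngModule (T : Filling ι Λ) : Submodule ℂ (Equiv.Perm ι → ℂ) :=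
  Submodule.span ℂ (Set.range (translate T))

/-- The action of `σ ∈ S(ι)` on the group algebra. -/
def permFun (σ : Equiv.Perm ι) : (Equiv.Perm ι → ℂ) →ₗ[ℂ] (Equiv.Perm ι → ℂ) where
  toFun F τ := F (σ⁻¹ * τ)
  map_add' _ _ := rfl
  map_smul' _ _ := rfl

/-- The operator `τ ↦ χ (τ⁻¹ i) τ` of the group algebra. -/
def diagFun (T : Filling ι Λ) (i : ι) : (Equiv.Perm ι → ℂ) →ₗ[ℂ] (Equiv.Perm ι → ℂ) where
  toFun F τ := (((T (τ⁻¹ i)).1 : ℝ) : ℂ) * F τ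
  map_add' F F' := by funext τ; simp [mul_add]
  map_smul' c F := by funext τ; simp [mul_left_comm]

lemma permFun_translate (T : Filling ι Λ) (σ ρ : Equiv.Perm ι) :
    permFun σ (translate T ρ) = translate T (σ * ρ) := by
  funext τ
  simp [permFun, translate, mul_assoc]

lemma diagFun_translate (T : Filling ι Λ) (i : ι) (ρ : Equiv.Perm ι) :
    diagFun T i (translate T ρ) = (((T (ρ⁻¹ i)).1 : ℝ) : ℂ) • translate T ρ := by
  funext τ
  simp only [diagFun, LinearMap.coe_mk, AddHom.coe_mk, Pi.smul_apply, smul_eq_mul]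
  by_cases h : translate T ρ τ = 0
  · simp [h]
  · obtain ⟨p, -, hp⟩ := Finset.exists_ne_zero_of_sum_ne_zero h
    obtain ⟨q, -, hq⟩ := Finset.exists_ne_zero_of_sum_ne_zero hp
    have h' : IsRow T p ∧ IsCol T q ∧ p * q = ρ⁻¹ * τ := by
      by_contra hc
      rw [if_neg hc] at hq
      exact hq rfl
    obtain ⟨h1, h2, h3⟩ := h'
    have h4 : ρ⁻¹ i = p (q (τ⁻¹ i)) := by
      rw [← Equiv.Perm.mul_apply, h3]; simp
    have h5 : (T (ρ⁻¹ i)).1 = (T (τ⁻¹ i)).1 := by rw [h4, (h1 _).1, (h2 _).1]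
    rw [h5]

/-- The action of `σ ∈ S(ι)` on `V_Λ`. -/
def permAct (T : Filling ι Λ) (σ : Equiv.Perm ι) : youngModule T →ₗ[ℂ] youngModule T :=
  (permFun σ).restrict (p := youngModule T) (q := youngModule T) (by
    intro F hF
    have : youngModule T ≤ (youngModule T).comap (permFun σ) := by
      refine Submodule.span_le.2 ?_
      rintro _ ⟨ρ, rfl⟩
      rw [SetLike.mem_coe, Submodule.mem_comap, permFun_translate]
      exact Submodule.subset_span ⟨_, rfl⟩
    exact this hF)

/-- The action of the generator `A_i` on `V_Λ`. -/
def diagAct (T : Filling ι Λ) (i : ι) : youngModule T →ₗ[ℂ] youngModule T :=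
  (diagFun T i).restrict (p := youngModule T) (q := youngModule T) (by
    intro F hF
    have : youngModule T ≤ (youngModule T).comap (diagFun T i) := by
      refine Submodule.span_le.2 ?_
      rintro _ ⟨ρ, rfl⟩
      rw [SetLike.mem_coe, Submodule.mem_comap, diagFun_translate]
      exact Submodule.smul_mem _ _ (Submodule.subset_span ⟨_, rfl⟩)
    exact this hF)

end Module

/-- The element of `G(n)` given by a permutation of the nonzero `i` with `|i| ≤ n`. -/
def ofPerm {n : ℕ} (σ : Equiv.Perm (box n)) : GE := ofNZ (Equiv.Perm.ofSubtype σ) (by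
  refine (Finset.finite_toSet (box n)).subset fun i hi => ?_
  by_contra h
  exact hi (Equiv.Perm.ofSubtype_apply_of_not_mem σ h))

/-- `Λ` is the Young distribution of `π`: it satisfies `|Λ| = 2d`, where `d` is the depth, and the
module formed by the root with the action of `G(d)` and of the operators `A_i`, `0 < |i| ≤ d`, is
isomorphic to `V_Λ`. -/
def HasYoungDist {H : Type*} [NormedAddCommGroup H] [InnerProductSpace ℂ H] (π : URep H)
    (Λ : YoungDist) : Prop :=
  ∃ T : Filling (box (depth π)) Λ, ∃ Φ : youngModule T →ₗ[ℂ] H,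
    Function.Injective Φ ∧ LinearMap.range Φ = root π ∧
    (∀ σ v, Φ (permAct T σ v) = π (ofPerm σ) (Φ v)) ∧
    ∀ (i : box (depth π)) (v), Φ (diagAct T i v) = opA π i (Φ v)

end Olshanski

end

open Olshanski

noncomputable section

namespace Olshanski

/-! ### Elements of the group -/

/-! A representation generated by its root is controlled by the root, that is, by the space H_d of
invariant vectors of least level, with the action of G(d) and of the operators A_i, |i| ≤ d. So the
theorem is a computation of the root of the mixture.

From the root to the representation. If H_d generates, a nonzero closed invariant subspace meets
H_d. As H_d is finite dimensional, this gives a finite orthogonal decomposition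
(`exists_decomposition`), and irreducibility of the root gives that of the representation
(`isIrredRep_of_isIrredRoot`). For the converse, a subspace of H_d that is stable under G(d) and the
A_i must be stable under the compressions of all π(g) (`inner_rep_eq_zero`). Up to factors from K_d
on both sides, either g sends two points of {-d, …, d} to a pair ±(N + 1), and its compression
vanishes because there are no invariant vectors of level d - 1; or a transposition (i, N + 1) splits
off, which acts as A_i; or g preserves {-d, …, d}. In the last case there remains an element that
fixes these points, and it has to act by a scalar. This holds in π₁ and π₂ by Schur's lemma, and the
mixture inherits it (`exists_scalar_mixture`).

The root of the mixture. Let f be symmetric outside {-n, …, n}, with 2a and 2b points of the two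
labels inside. The cocycle at f maps K_n to K_a × K_b, and the stabilizer of f in K_n is mapped onto
it. If F is K_n-invariant, then |F|² has no mass off the functions symmetric outside {-n, …, n}, and
the asymptotic independence of the label of M + 1 from everything else makes F constant on
cylinders, with values in H(π₁)_a ⊗ H(π₂)_b (`exists_ae_eq_const`). Since a + b = n, there is
nothing below level d₁ + d₂, and at this level one finds exactly H_{d₁,d₂} (`Hab_eq`).

The operators A_i. Between vectors of H_M, the power A_i^k has the matrix elements of the cycle (i,
M + 1) ⋯ (i, M + k). In the mixture only those f contribute that are constant along the cycle. With
the label c they form a part p_c^k of the cylinder, and there the cocycle is the analogous cycle for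
π_c. So A_i acts as p_c A_{η(i)} on a cylinder where i has the label c. For i = d + 1 the label
itself has probability p_c, and the moments are the sums over c of p_c^{k+1} times the moments of
μ_c.

Irreducibility. Let e₁, e₂ be the vectors that correspond to the Young symmetrizers, and put e₁ ⊗ e₂
on one cylinder. If the scaled supports are disjoint, the row and column permutations of the union
split according to the labels, so its symmetrizer is the product of the two, and e₁ ⊗ e₂ generates
V_Λ (`isYoungVector_mixture`), which is irreducible (`youngModule_irreducible`). If the supports
have a common point x, there are places a, b with different labels and the same eigenvalue x. The
operator `swapOp`, a sum of transpositions (i, j) restricted to the vectors on which A_i = A_j,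
commutes with G(d) and all A_i, but has a nonzero matrix element between e₁ ⊗ e₂ and its translate
by (a, b), which lives on another cylinder; so it is not a scalar (`not_isIrredRoot_mixture`). -/

lemma GE.ext_smul {g h : GE} (H : ∀ i : NZ, g • i = h • i) : g = h := by
  apply Subtype.ext
  ext i
  by_cases hi : i = 0
  · rw [hi, g.2.2, h.2.2]
  · exact congrArg Subtype.val (H ⟨i, hi⟩)

/-- An element is determined by the finitely supported function i ↦ g i - i. Countability allows
almost-everywhere statements about single elements to hold for all elements at once, so that the
element may then be chosen depending on the point `f`. -/
instance : Countable GE := by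
  refine Function.Injective.countable (f := fun g : GE =>
    (Finsupp.ofSupportFinite (fun i : ℤ => g.1 i - i) (g.2.1.subset fun i hi => by
      simpa [sub_eq_zero] using hi) : ℤ →₀ ℤ)) fun g h H => ?_
  apply Subtype.ext
  ext i
  have : g.1 i - i = h.1 i - i := DFunLike.congr_fun H i
  linarith

@[simp] lemma ofNZ_smul (σ : Equiv.Perm NZ) (h) (i : NZ) : ofNZ σ h • i = σ i := by
  apply Subtype.ext
  rw [coe_smul]
  exact Equiv.Perm.ofSubtype_apply_coe σ i

lemma mem_KEn_iff {n : ℕ} {g : GE} :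
    g ∈ KEn n ↔ (∀ i : NZ, g • (-i) = -(g • i)) ∧ ∀ i : NZ, |(i : ℤ)| ≤ n → g • i = i := by
  constructor
  · rintro ⟨h1, h2⟩
    exact ⟨fun i => Subtype.ext (h1 i), fun i hi => Subtype.ext (h2 i hi)⟩
  · rintro ⟨h1, h2⟩
    refine ⟨fun i => ?_, fun i hi => ?_⟩
    · by_cases h : i = 0
      · simp [h, g.2.2]
      · exact congrArg Subtype.val (h1 ⟨i, h⟩)
    · by_cases h : i = 0
      · simp [h, g.2.2]
      · exact congrArg Subtype.val (h2 ⟨i, h⟩ hi)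

lemma KEn_mono {n m : ℕ} (h : n ≤ m) : KEn m ≤ KEn n := fun g hg =>
  ⟨hg.1, fun i hi => hg.2 i (hi.trans (by exact_mod_cast h))⟩

lemma InG.mono {n m : ℕ} (h : n ≤ m) {g : GE} (hg : InG n g) : InG m g := fun i hi =>
  hg i (lt_of_le_of_lt (by exact_mod_cast h) hi)

lemma InG.mul {n : ℕ} {g h : GE} (hg : InG n g) (hh : InG n h) : InG n (g * h) := fun i hi => by
  rw [mul_smul, hh i hi, hg i hi]

lemma SymOut.mono {n m : ℕ} (h : n ≤ m) {f : X} (hf : SymOut n f) : SymOut m f := fun i hi =>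
  hf i (lt_of_le_of_lt (by exact_mod_cast h) hi)

/-- Elements with disjoint supports commute. -/
lemma commute_of_fix {n : ℕ} {g c : GE} (hg : InG n g)
    (hc : ∀ i : NZ, |(i : ℤ)| ≤ n → c • i = i) : g * c = c * g := by
  refine GE.ext_smul fun i => ?_
  rw [mul_smul, mul_smul]
  by_cases hi : |(i : ℤ)| ≤ n
  · rw [hc i hi, hc _ (hg.abs_le hi)]
  · have hi' : (n : ℤ) < |((c • i : NZ) : ℤ)| := by
      by_contra h
      push Not at h
      have := hc _ h
      rw [smul_left_cancel_iff] at this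
      rw [this] at h
      exact hi h
    rw [hg _ (not_le.1 hi), hg _ hi']

@[simp] lemma transp_smul (i j k : NZ) : transp i j • k = Equiv.swap i j k := ofNZ_smul _ _ _

lemma conj_transp (g : GE) (i j : NZ) : g * transp i j * g⁻¹ = transp (g • i) (g • j) := by
  refine GE.ext_smul fun k => ?_
  rw [mul_smul, mul_smul, transp_smul, transp_smul]
  conv_rhs => rw [← smul_inv_smul g k]
  exact (Function.Injective.swap_apply (MulAction.injective g) i j (g⁻¹ • k)).symm

lemma transp_mul_self (i j : NZ) : transp i j * transp i j = 1 := by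
  refine GE.ext_smul fun k => ?_
  simp [mul_smul]

lemma transp_inv (i j : NZ) : (transp i j)⁻¹ = transp i j :=
  inv_eq_of_mul_eq_one_left (transp_mul_self i j)

lemma transp_comm (i j : NZ) : transp i j = transp j i :=
  GE.ext_smul fun k => by simp [Equiv.swap_comm]

lemma inG_transp {n : ℕ} {i j : NZ} (hi : |(i : ℤ)| ≤ n) (hj : |(j : ℤ)| ≤ n) :
    InG n (transp i j) := fun k hk => by
  rw [transp_smul, Equiv.swap_apply_of_ne_of_ne]
  · rintro rfl; omega
  · rintro rfl; omega

lemma pos_injective : Function.Injective pos := fun a b h => by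
  have := congrArg Subtype.val h
  simpa using this

@[simp] lemma pos_inj {a b : ℕ} : pos a = pos b ↔ a = b := pos_injective.eq_iff

lemma neg_inj' {a b : NZ} : -a = -b ↔ a = b := by
  simp [Subtype.ext_iff]

@[simp] lemma pos_ne_neg (a b : ℕ) : pos a ≠ -pos b := by
  simp only [ne_eq, Subtype.ext_iff, coe_pos, NZ.coe_neg]; omega

@[simp] lemma neg_ne_pos (a b : ℕ) : -pos a ≠ pos b := (pos_ne_neg b a).symm

lemma abs_pos' (k : ℕ) : |((pos k : NZ) : ℤ)| = k + 1 := by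
  rw [coe_pos, abs_of_pos (by omega)]

lemma abs_neg_pos (k : ℕ) : |((-pos k : NZ) : ℤ)| = k + 1 := by
  rw [NZ.coe_neg, abs_neg, abs_pos']

/-- The element of `K` that exchanges `±(a + 1)` and `±(b + 1)`. -/
def kap (a b : ℕ) : GE := transp (pos a) (pos b) * transp (-pos a) (-pos b)

@[simp] lemma kap_pos (a b k : ℕ) : kap a b • pos k = pos (Equiv.swap a b k) := by
  rw [kap, mul_smul, transp_smul (-pos a),
    Equiv.swap_apply_of_ne_of_ne (pos_ne_neg _ _) (pos_ne_neg _ _), transp_smul, Function.Injective.swap_apply pos_injective]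

@[simp] lemma kap_neg (a b k : ℕ) : kap a b • -pos k = -pos (Equiv.swap a b k) := by
  have h : Function.Injective fun k => -pos k := fun a b h => pos_injective (neg_inj'.1 h)
  rw [kap, mul_smul, transp_smul (-pos a), Function.Injective.swap_apply h a b k, transp_smul,
    Equiv.swap_apply_of_ne_of_ne (neg_ne_pos _ _) (neg_ne_pos _ _)]

lemma kap_mem {n a b : ℕ} (ha : n ≤ a) (hb : n ≤ b) : kap a b ∈ KEn n := by
  rw [mem_KEn_iff]
  constructor
  · intro i
    obtain ⟨k, rfl | rfl⟩ := eq_pos_or i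
    · simp
    · simp [NZ.neg_neg]
  · intro i hi
    obtain ⟨k, rfl | rfl⟩ := eq_pos_or i
    · rw [abs_pos'] at hi
      rw [kap_pos, Equiv.swap_apply_of_ne_of_ne] <;> omega
    · rw [abs_neg_pos] at hi
      rw [kap_neg, Equiv.swap_apply_of_ne_of_ne] <;> omega

lemma kap_inG {n a b : ℕ} (ha : a < n) (hb : b < n) : InG n (kap a b) := by
  unfold kap
  refine (inG_transp ?_ ?_).mul (inG_transp ?_ ?_)
  all_goals first | rw [abs_pos'] | rw [abs_neg_pos]
  all_goals omega

lemma kap_inv (a b : ℕ) : (kap a b)⁻¹ = kap a b := by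
  refine inv_eq_of_mul_eq_one_left (GE.ext_smul fun i => ?_)
  obtain ⟨k, rfl | rfl⟩ := eq_pos_or i <;> simp [mul_smul]

/-- The transposition of a + 1 and -(a + 1) commutes with i ↦ -i, so a single pair can be reversed
within K. -/
lemma flip_mem {n a : ℕ} (ha : n ≤ a) : transp (pos a) (-pos a) ∈ KEn n := by
  rw [mem_KEn_iff]
  constructor
  · intro i
    rw [transp_smul, transp_smul]
    by_cases h1 : i = pos a
    · subst h1; simp [NZ.neg_neg]
    by_cases h2 : i = -pos a
    · subst h2; simp [NZ.neg_neg]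
    rw [Equiv.swap_apply_of_ne_of_ne, Equiv.swap_apply_of_ne_of_ne h1 h2]
    · intro h; exact h2 (by rw [← h, NZ.neg_neg])
    · intro h; exact h1 (neg_inj'.1 h)
  · intro i hi
    rw [transp_smul, Equiv.swap_apply_of_ne_of_ne]
    · rintro rfl; rw [abs_pos'] at hi; omega
    · rintro rfl; rw [abs_neg_pos] at hi; omega

lemma flip_inG {n a : ℕ} (ha : a < n) : InG n (transp (pos a) (-pos a)) :=
  inG_transp (by rw [abs_pos']; omega) (by rw [abs_neg_pos]; omega)

lemma kap_conj (g : GE) {a b a' b' : ℕ} (h1 : g • pos a = pos a') (h2 : g • -pos a = -pos a')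
    (h3 : g • pos b = pos b') (h4 : g • -pos b = -pos b') :
    g * kap a b * g⁻¹ = kap a' b' := by
  have : g * kap a b * g⁻¹ = (g * transp (pos a) (pos b) * g⁻¹) *
      (g * transp (-pos a) (-pos b) * g⁻¹) := by unfold kap; group
  rw [this, conj_transp, conj_transp, h1, h2, h3, h4]; rfl

/-- The group `K_n` acts transitively on the points outside `{-n, …, n}`. -/
lemma exists_KEn_smul {n N : ℕ} {m : NZ} (hm : (n : ℤ) < |(m : ℤ)|) (hN : |(m : ℤ)| ≤ N + 1) :
    ∃ k ∈ KEn n, InG (N + 1) k ∧ k • m = pos N := by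
  obtain ⟨a, rfl | rfl⟩ := eq_pos_or m
  · rw [abs_pos'] at hm hN
    exact ⟨kap a N, kap_mem (by omega) (by omega), kap_inG (by omega) (by omega), by simp⟩
  · rw [abs_neg_pos] at hm hN
    refine ⟨kap a N * transp (pos a) (-pos a), mul_mem (kap_mem (by omega) (by omega))
      (flip_mem (by omega)), (kap_inG (by omega) (by omega)).mul (flip_inG (by omega)), ?_⟩
    rw [mul_smul, transp_smul, Equiv.swap_apply_right, kap_pos, Equiv.swap_apply_left]

/-- The group `G(n)` is doubly transitive. -/
lemma exists_inG_smul₂ {n : ℕ} {i j i' j' : NZ} (hi : |(i : ℤ)| ≤ n) (hj : |(j : ℤ)| ≤ n)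
    (hi' : |(i' : ℤ)| ≤ n) (hj' : |(j' : ℤ)| ≤ n) (hij : i ≠ j) (hij' : i' ≠ j') :
    ∃ g, InG n g ∧ g • i = i' ∧ g • j = j' := by
  have h1 := inG_transp hi hi'
  refine ⟨transp (transp i i' • j) j' * transp i i',
    (inG_transp (h1.abs_le hj) hj').mul h1, ?_, ?_⟩
  · rw [mul_smul, transp_smul i i' i, Equiv.swap_apply_left, transp_smul,
      Equiv.swap_apply_of_ne_of_ne _ hij']
    intro h
    have : transp i i' • i = transp i i' • j := by rw [← h]; simp
    exact hij (smul_left_cancel _ this)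
  · rw [mul_smul, transp_smul (transp i i' • j), Equiv.swap_apply_left]

/-! ### The bijections `η` -/

lemma cnt_two_mul_add {f : X} (n : ℕ) : cnt f 0 n + cnt f 1 n = 2 * n := by
  rw [← card_box]
  unfold cnt
  rw [← Finset.card_union_of_disjoint]
  · congr 1
    ext i
    simp only [Finset.mem_union, Finset.mem_filter]
    rcases Fin.exists_fin_two.1 ⟨f.1 i, rfl⟩ with h | h <;> simp [h]
  · rw [Finset.disjoint_filter]
    intro i _ h; simp [h]

lemma even_cnt_of_mem {f : X} (hf : f ∈ Y) {n : ℕ} (hs : SymOut n f) (j : Fin 2) :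
    Even (cnt f j n) := by
  refine even_cnt ?_ j
  obtain ⟨m, hm, hnm⟩ := (hf.1.and (eventually_ge_atTop n)).exists
  rw [cnt_add 0 hs hnm, Nat.even_add] at hm
  simpa using hm

/-- Half of the number of points of `f⁻¹(j)` among the `i` with `|i| ≤ n`. -/
def hc (f : X) (j : Fin 2) (n : ℕ) : ℕ := cnt f j n / 2

lemma two_mul_hc {f : X} (hf : f ∈ Y) {n : ℕ} (hs : SymOut n f) (j : Fin 2) :
    cnt f j n = 2 * hc f j n := by
  have := even_cnt_of_mem hf hs j
  unfold hc; obtain ⟨r, hr⟩ := this; omega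

/-- The number of points of f⁻¹(j) from a upwards, which occurs in `eta_formula`, lies between 1 and
2 hc, so that lin (η a) lies between -hc and hc - 1. -/
lemma eta_abs_le {f : X} (hf : f ∈ Y) {n : ℕ} (hs : SymOut n f) {j : Fin 2} (a : fiber f j)
    (ha : |(a.1 : ℤ)| ≤ n) : |((eta f hf j a : NZ) : ℤ)| ≤ hc f j n := by
  have h1 := eta_formula hf hs a ha
  have h2 : ((box n).filter fun i => a.1 ≤ i ∧ f.1 i = j).card ≤ cnt f j n :=
    Finset.card_le_card fun i hi => by
      simp only [Finset.mem_filter] at hi ⊢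
      exact ⟨hi.1, hi.2.2⟩
  have h3 : 0 < ((box n).filter fun i => a.1 ≤ i ∧ f.1 i = j).card :=
    Finset.card_pos.2 ⟨a.1, by simp [ha, a.2]⟩
  rw [two_mul_hc hf hs j] at h1 h2
  rw [lin_apply] at h1
  have := (eta f hf j a).2
  rw [abs_le]
  split_ifs at h1 <;> omega

/-- Counting: η maps the 2 hc points of f⁻¹(j) in `box n` injectively to `box hc`, which has as many
points, so no other point can go there. -/
lemma abs_le_of_eta {f : X} (hf : f ∈ Y) {n : ℕ} (hs : SymOut n f) {j : Fin 2} (a : fiber f j)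
    (ha : |((eta f hf j a : NZ) : ℤ)| ≤ hc f j n) : |(a.1 : ℤ)| ≤ n := by
  have h1 : (Finset.univ.image fun b : {b // b ∈ (box n).filter fun i => f.1 i = j} =>
      eta f hf j ⟨b.1, (Finset.mem_filter.1 b.2).2⟩) = box (hc f j n) := by
    refine Finset.eq_of_subset_of_card_le ?_ ?_
    · intro x hx
      obtain ⟨b, -, rfl⟩ := Finset.mem_image.1 hx
      rw [mem_box]
      exact eta_abs_le hf hs _ (mem_box.1 (Finset.mem_filter.1 b.2).1)
    · rw [Finset.card_image_of_injective, card_box, ← two_mul_hc hf hs j]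
      · simp [cnt]
      · intro b c h
        have := (eta f hf j).injective h
        exact Subtype.ext (congrArg (fun x : fiber f j => x.1) this)
  have h2 : eta f hf j a ∈ box (hc f j n) := mem_box.2 ha
  rw [← h1] at h2
  obtain ⟨b, -, hb⟩ := Finset.mem_image.1 h2
  have := (eta f hf j).injective hb
  rw [← this]
  exact mem_box.1 (Finset.mem_filter.1 b.2).1

lemma lin_pos (k : ℕ) : lin (pos k) = k := by
  rw [lin_apply, if_pos (by rw [coe_pos]; omega), coe_pos]; ring

/-- The largest point of `box (k + 1)` goes to the largest point hc of the smaller box; the -1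
appears because `pos m` is m + 1. -/
lemma eta_pos {f : X} (hf : f ∈ Y) {k : ℕ} (hs : SymOut (k + 1) f) {j : Fin 2}
    (h : f.1 (pos k) = j) : eta f hf j ⟨pos k, h⟩ = pos (hc f j (k + 1) - 1) := by
  apply lin.injective
  have h1 := eta_formula hf hs ⟨pos k, h⟩ (by rw [abs_pos']; push_cast; rfl)
  have h2 : ((box (k + 1)).filter fun i => pos k ≤ i ∧ f.1 i = j) = {pos k} := by
    ext i
    simp only [Finset.mem_filter, mem_box, Finset.mem_singleton, ← Subtype.coe_le_coe, coe_pos,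
      abs_le]
    constructor
    · rintro ⟨h3, h4, -⟩
      apply Subtype.ext
      rw [coe_pos]; push_cast at h3; omega
    · rintro rfl
      simp only [coe_pos]
      refine ⟨⟨by omega, by omega⟩, le_rfl, h⟩
  have h3 : 0 < cnt f j (k + 1) := Finset.card_pos.2 ⟨pos k, by
    rw [Finset.mem_filter, mem_box, abs_pos']; exact ⟨by omega, h⟩⟩
  rw [two_mul_hc hf hs j] at h1 h3
  rw [h2, Finset.card_singleton] at h1
  rw [lin_pos]
  omega

/-- By definition η commutes with negation at almost all points only; the counting formula gives
this at every point outside a box that contains all asymmetries of f. -/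
lemma eta_neg {f : X} (hf : f ∈ Y) {n : ℕ} (hs : SymOut n f) {j : Fin 2} {i : NZ}
    (hi : (n : ℤ) < |(i : ℤ)|) (h : f.1 i = j) (h' : f.1 (-i) = j) :
    eta f hf j ⟨-i, h'⟩ = -eta f hf j ⟨i, h⟩ := by
  have key : ∀ (k : ℕ) (h : f.1 (pos k) = j) (h' : f.1 (-pos k) = j), n ≤ k →
      eta f hf j ⟨-pos k, h'⟩ = -eta f hf j ⟨pos k, h⟩ := by
    intro k h h' hk
    have hs' : SymOut (k + 1) f := hs.mono (by omega)
    rw [eta_pos hf hs' h]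
    apply lin.injective
    have h1 := eta_formula hf hs' ⟨-pos k, h'⟩ (by rw [abs_neg_pos]; push_cast; rfl)
    have h2 : ((box (k + 1)).filter fun i => -pos k ≤ i ∧ f.1 i = j) =
        (box (k + 1)).filter fun i => f.1 i = j := by
      refine Finset.filter_congr fun i hi => ?_
      rw [mem_box, abs_le] at hi
      push_cast at hi
      simp only [← Subtype.coe_le_coe, NZ.coe_neg, coe_pos]
      exact and_iff_right (by omega)
    have h3 : 0 < cnt f j (k + 1) := Finset.card_pos.2 ⟨pos k, by
      rw [Finset.mem_filter, mem_box, abs_pos']; exact ⟨by omega, h⟩⟩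
    simp only [h2] at h1
    change 2 * lin _ = (cnt f j (k + 1) : ℤ) - 2 * (cnt f j (k + 1) : ℤ) at h1
    rw [two_mul_hc hf hs' j] at h1 h3
    rw [lin_neg, lin_pos]
    omega
  obtain ⟨k, rfl | rfl⟩ := eq_pos_or i
  · rw [abs_pos'] at hi
    exact key k h h' (by omega)
  · rw [abs_neg_pos] at hi
    have h'' : f.1 (pos k) = j := by rw [NZ.neg_neg] at h'; exact h'
    rw [key k h'' h (by omega)]
    refine Eq.trans ?_ (NZ.neg_neg _).symm
    exact eta_of_eq rfl hf hf j (NZ.neg_neg _) h' h''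

lemma coc_smul {f : X} (hf : f ∈ Y) (g : GE) {j : Fin 2} (a : fiber f j) :
    coc j g f • eta f hf j a =
      eta (g • f) (smul_mem_Y g hf) j ⟨g • a.1, by simpa using a.2⟩ := by
  rw [coc, dif_pos hf, ofNZ_smul, cocPerm_eta]

lemma inG_coc {f : X} (hf : f ∈ Y) {n : ℕ} (hs : SymOut n f) {g : GE} (hg : InG n g) (j : Fin 2) :
    InG (hc f j n) (coc j g f) := by
  intro i hi
  obtain ⟨a, rfl⟩ := (eta f hf j).surjective i
  have ha : (n : ℤ) < |(a.1 : ℤ)| := by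
    by_contra h
    exact absurd (eta_abs_le hf hs a (not_lt.1 h)) (not_le.2 hi)
  rw [coc, dif_pos hf, ofNZ_smul, eta_far j hf hg hs a ha]

lemma KEn.smul_gt {n : ℕ} {k : GE} (hk : k ∈ KEn n) {i : NZ} (hi : (n : ℤ) < |(i : ℤ)|) :
    (n : ℤ) < |((k • i : NZ) : ℤ)| := by
  by_contra h
  have h1 := (mem_KEn_iff.1 (inv_mem hk)).2 _ (not_lt.1 h)
  rw [inv_smul_smul] at h1
  rw [← h1] at h
  exact h hi

lemma KEn.smul_mem_cyl {n : ℕ} {k : GE} (hk : k ∈ KEn n) {f : X} {s : NZ → Fin 2}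
    (hs : f ∈ cyl n s) : k • f ∈ cyl n s := by
  have h := mem_KEn_iff.1 (inv_mem hk)
  refine ⟨fun i hi => ?_, fun i hi => ?_⟩
  · rw [smul_apply, h.2 i (mem_box.1 hi), hs.1 i hi]
  · rw [smul_apply, smul_apply, h.1, hs.2 _ (KEn.smul_gt (inv_mem hk) hi)]

/-- If `c` fixes the points `i` with `|i| ≤ n`, and `f`, `c f` are symmetric outside, then the
cocycle has the analogous property. -/
lemma coc_fix {f : X} (hf : f ∈ Y) {n : ℕ} (hs : SymOut n f) {c : GE}
    (hc' : ∀ i : NZ, |(i : ℤ)| ≤ n → c • i = i) (hcs : SymOut n (c • f)) (j : Fin 2) {i : NZ}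
    (hi : |(i : ℤ)| ≤ hc f j n) : coc j c f • i = i := by
  obtain ⟨a, rfl⟩ := (eta f hf j).surjective i
  have ha := abs_le_of_eta hf hs a hi
  rw [coc_smul]
  have hcyl : c • f ∈ cyl n f.1 := by
    refine ⟨fun i hi => ?_, hcs⟩
    rw [smul_apply]
    exact congrArg f.1 (inv_smul_eq_iff.2 (hc' i (mem_box.1 hi)).symm)
  have h1 : (c • f).1 a.1 = j := (hcyl.1 a.1 (mem_box.2 ha)).trans a.2
  rw [eta_of_eq rfl (smul_mem_Y c hf) (smul_mem_Y c hf) j (hc' a.1 ha) _ h1]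
  exact eta_congr j hcyl (mem_cyl_self hs) _ _ _ _ _ ha

/-- The cocycle maps `K_n` to `K_a`. -/
lemma coc_mem_KEn {f : X} (hf : f ∈ Y) {n : ℕ} (hs : SymOut n f) {k : GE} (hk : k ∈ KEn n)
    (j : Fin 2) : coc j k f ∈ KEn (hc f j n) := by
  have hk' := mem_KEn_iff.1 hk
  have hks : SymOut n (k • f) := (KEn.smul_mem_cyl hk (mem_cyl_self hs)).2
  have hsmall : ∀ i : NZ, |(i : ℤ)| ≤ hc f j n → coc j k f • i = i := fun i hi =>
    coc_fix hf hs hk'.2 hks j hi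
  rw [mem_KEn_iff]
  refine ⟨fun i => ?_, hsmall⟩
  by_cases hi : |(i : ℤ)| ≤ hc f j n
  · rw [hsmall i hi, hsmall (-i) (by simpa using hi)]
  obtain ⟨a, rfl⟩ := (eta f hf j).surjective i
  have ha : (n : ℤ) < |(a.1 : ℤ)| := by
    by_contra h
    exact hi (eta_abs_le hf hs a (not_lt.1 h))
  have ha' : f.1 (-a.1) = j := hs a.1 ha ▸ a.2
  rw [← eta_neg hf hs ha a.2 ha', coc_smul, coc_smul]
  have h1 : (k • f).1 (k • a.1) = j := by simpa using a.2
  have h2 : (k • f).1 (-(k • a.1)) = j := by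
    rw [← hks _ (KEn.smul_gt hk ha)]; exact h1
  rw [← eta_neg (smul_mem_Y k hf) hks (KEn.smul_gt hk ha) h1 h2]
  exact eta_of_eq rfl _ _ j (hk'.1 _) _ _

/-- The permutation with `η_j ∘ σ ∘ η_j⁻¹ = g_j`. -/
def blendPerm (f : X) (hf : f ∈ Y) (g : Fin 2 → GE) : Equiv.Perm NZ :=
  ((Equiv.sigmaFiberEquiv f.1).symm.trans (Equiv.sigmaCongrRight fun j =>
    ((eta f hf j).toEquiv.trans (MulAction.toPerm (g j))).trans
      (eta f hf j).symm.toEquiv)).trans (Equiv.sigmaFiberEquiv f.1)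

lemma blendPerm_apply (f : X) (hf : f ∈ Y) (g : Fin 2 → GE) {j : Fin 2} (a : fiber f j) :
    blendPerm f hf g a.1 = ((eta f hf j).symm (g j • eta f hf j a)).1 := by
  obtain ⟨a, rfl⟩ := a
  rfl

lemma blendPerm_finite (f : X) (hf : f ∈ Y) (g : Fin 2 → GE) :
    {i | blendPerm f hf g i ≠ i}.Finite := by
  refine ((Set.finite_iUnion fun j : Fin 2 => ((finite_ne (g j)).preimage
    (f := fun a : fiber f j => eta f hf j a) (eta f hf j).injective.injOn).image
      (Subtype.val : fiber f j → NZ))).subset ?_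
  intro i hi
  rw [Set.mem_iUnion]
  refine ⟨f.1 i, ⟨i, rfl⟩, ?_, rfl⟩
  intro h
  apply hi
  rw [blendPerm_apply f hf g ⟨i, rfl⟩, h]
  simp

/-- The element `k` of `G` with `k f = f` and `c(k, f) = (g_1, g_2)`. -/
def blend (f : X) (hf : f ∈ Y) (g : Fin 2 → GE) : GE := ofNZ _ (blendPerm_finite f hf g)

lemma blend_smul (f : X) (hf : f ∈ Y) (g : Fin 2 → GE) {j : Fin 2} (a : fiber f j) :
    blend f hf g • a.1 = ((eta f hf j).symm (g j • eta f hf j a)).1 := by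
  rw [blend, ofNZ_smul, blendPerm_apply]

lemma blend_color (f : X) (hf : f ∈ Y) (g : Fin 2 → GE) (i : NZ) :
    f.1 (blend f hf g • i) = f.1 i := by
  rw [blend_smul f hf g ⟨i, rfl⟩]
  exact ((eta f hf (f.1 i)).symm _).2

@[simp] lemma blend_fix (f : X) (hf : f ∈ Y) (g : Fin 2 → GE) : blend f hf g • f = f := by
  apply Subtype.ext
  funext i
  rw [smul_apply, ← blend_color f hf g, smul_inv_smul]

@[simp] lemma coc_blend (f : X) (hf : f ∈ Y) (g : Fin 2 → GE) (j : Fin 2) :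
    coc j (blend f hf g) f = g j := by
  refine GE.ext_smul fun i => ?_
  obtain ⟨a, rfl⟩ := (eta f hf j).surjective i
  rw [coc_smul, eta_of_eq (blend_fix f hf g) _ hf j (blend_smul f hf g a) _
    ((eta f hf j).symm (g j • eta f hf j a)).2]
  simp

lemma blend_inG {f : X} (hf : f ∈ Y) {n : ℕ} (hs : SymOut n f) {g : Fin 2 → GE}
    (hg : ∀ j, InG (hc f j n) (g j)) : InG n (blend f hf g) := by
  intro i hi
  rw [blend_smul f hf g ⟨i, rfl⟩, hg]
  · simp
  · by_contra h
    have := abs_le_of_eta hf hs ⟨i, rfl⟩ (not_lt.1 h)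
    simp only at this
    omega

/-- Outside `box n` the points ±i have the same label and η maps them to a pair, so conjugation by η
respects negation. Thus the stabilizer of f in K_n is mapped onto K_a × K_b by the cocycle; this is
what forces the values of invariant functions into the tensor product of the spaces of invariant
vectors. -/
lemma blend_mem_KEn {f : X} (hf : f ∈ Y) {n : ℕ} (hs : SymOut n f) {g : Fin 2 → GE}
    (hg : ∀ j, g j ∈ KEn (hc f j n)) : blend f hf g ∈ KEn n := by
  have hsmall : ∀ i : NZ, |(i : ℤ)| ≤ n → blend f hf g • i = i := by
    intro i hi
    rw [blend_smul f hf g ⟨i, rfl⟩, (mem_KEn_iff.1 (hg _)).2 _ (eta_abs_le hf hs _ hi)]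
    simp
  rw [mem_KEn_iff]
  refine ⟨fun i => ?_, hsmall⟩
  by_cases hi : |(i : ℤ)| ≤ n
  · rw [hsmall i hi, hsmall (-i) (by simpa using hi)]
  rw [not_le] at hi
  set j := f.1 i with hj
  have hi' : f.1 (-i) = j := (hs i hi).symm
  rw [blend_smul f hf g ⟨-i, hi'⟩, eta_neg hf hs hi hj.symm hi', (mem_KEn_iff.1 (hg j)).1,
    blend_smul f hf g ⟨i, hj.symm⟩]
  set b := (eta f hf j).symm (g j • eta f hf j ⟨i, hj.symm⟩) with hb
  have hb' : eta f hf j b = g j • eta f hf j ⟨i, hj.symm⟩ := by simp [hb]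
  have hbn : (n : ℤ) < |(b.1 : ℤ)| := by
    by_contra h
    have h1 := eta_abs_le hf hs b (not_lt.1 h)
    rw [hb'] at h1
    have h2 := (mem_KEn_iff.1 (inv_mem (hg j))).2 _ h1
    rw [inv_smul_smul] at h2
    rw [← h2] at h1
    exact not_le.2 hi (abs_le_of_eta hf hs _ h1)
  have hbj : f.1 (-b.1) = j := hs b.1 hbn ▸ b.2
  rw [← hb', ← eta_neg hf hs hbn b.2 hbj]
  simp

/-! ### Weak limits in admissible representations -/

section Abstract

variable {H : Type*} [NormedAddCommGroup H] [InnerProductSpace ℂ H] (π : URep H)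

lemma rep_mul (g h : GE) (v : H) : π (g * h) v = π g (π h v) := by rw [map_mul]; rfl

@[simp] lemma rep_one (v : H) : π 1 v = v := by rw [map_one]; rfl

@[simp] lemma rep_inv_rep (g : GE) (v : H) : π g⁻¹ (π g v) = v := by
  rw [← rep_mul, inv_mul_cancel, rep_one]

@[simp] lemma rep_rep_inv (g : GE) (v : H) : π g (π g⁻¹ v) = v := by
  rw [← rep_mul, mul_inv_cancel, rep_one]

lemma inner_rep_right (g : GE) (u v : H) : inner ℂ u (π g v) = inner ℂ (π g⁻¹ u) v := by
  rw [← LinearIsometryEquiv.inner_map_map (π g⁻¹) u (π g v), rep_inv_rep]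

lemma fixedSpace_mono {n m : ℕ} (h : n ≤ m) : fixedSpace π n ≤ fixedSpace π m :=
  fun _ hv g hg => hv g (KEn_mono h hg)

variable {π}

lemma rep_mem_fixedSpace {n : ℕ} {g : GE} (hg : InG n g) {v : H} (hv : v ∈ fixedSpace π n) :
    π g v ∈ fixedSpace π n := by
  intro k hk
  rw [← rep_mul, ← commute_of_fix hg (mem_KEn_iff.1 hk).2, rep_mul, hv k hk]

lemma inner_rep_left_fixed {n : ℕ} {k : GE} (hk : k ∈ KEn n) {u : H} (hu : u ∈ fixedSpace π n)
    (v : H) : inner ℂ u (π k v) = inner ℂ u v := by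
  rw [inner_rep_right, hu _ (inv_mem hk)]

variable (π) in
lemma isClosed_fixedSpace (n : ℕ) : IsClosed (fixedSpace π n : Set H) := by
  have : (fixedSpace π n : Set H) = ⋂ g ∈ KEn n, {v | π g v = v} := by
    ext v; simp [fixedSpace]
  rw [this]
  exact isClosed_biInter fun g _ => isClosed_eq (π g).continuous continuous_id

lemma exists_near (hadm : IsAdmissible π) (v : H) {ε : ℝ} (hε : 0 < ε) :
    ∃ n, ∃ v' ∈ fixedSpace π n, ‖v - v'‖ < ε := by
  obtain ⟨v', hv', h⟩ := Metric.mem_closure_iff.1 (hadm v) ε hε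
  obtain ⟨n, hn⟩ := Set.mem_iUnion.1 hv'
  exact ⟨n, v', hn, by rwa [dist_eq_norm] at h⟩

/-- Between K_M-invariant vectors, elements conjugate under K_M have equal matrix elements, so these
sequences are eventually constant. Admissibility gives invariant vectors near v and w, and unitarity
makes the error uniform in n. -/
lemma cauchySeq_inner_rep (hadm : IsAdmissible π) {t : ℕ → GE}
    (ht : ∀ M, ∃ n₀, ∀ n ≥ n₀, ∃ h ∈ KEn M, h * t n₀ * h⁻¹ = t n) (v w : H) :
    CauchySeq fun n => inner ℂ (π (t n) v) w := by
  rw [Metric.cauchySeq_iff']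
  intro ε hε
  -- Replacing v, w by v', w' costs at most ‖v‖ δ + δ (‖w‖ + 1), as ‖w'‖ ≤ ‖w‖ + 1; this is less
  -- than ε / 2.
  set δ := ε / (2 * (‖v‖ + ‖w‖ + 2)) with hδ
  have hpos : 0 < ‖v‖ + ‖w‖ + 2 := by positivity
  have hδ0 : 0 < δ := by positivity
  obtain ⟨n₁, v', hv', h1⟩ := exists_near hadm v hδ0
  obtain ⟨n₂, w', hw', h2⟩ := exists_near hadm w (lt_min hδ0 one_pos)
  rw [lt_min_iff] at h2
  have hv'' := fixedSpace_mono π (le_max_left n₁ n₂) hv'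
  have hw'' := fixedSpace_mono π (le_max_right n₁ n₂) hw'
  obtain ⟨n₀, hn₀⟩ := ht (max n₁ n₂)
  refine ⟨n₀, fun n hn => ?_⟩
  obtain ⟨h, hh, hconj⟩ := hn₀ n hn
  have hconst : inner ℂ (π (t n) v') w' = inner ℂ (π (t n₀) v') w' := by
    rw [← hconj, rep_mul, rep_mul, hv'' _ (inv_mem hh)]
    conv_lhs => rw [← hw'' h hh]
    rw [LinearIsometryEquiv.inner_map_map]
  have hw'n : ‖w'‖ ≤ ‖w‖ + 1 := by
    have := norm_sub_norm_le w' w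
    rw [norm_sub_rev] at this; linarith [h2.2]
  have key : ∀ m, ‖inner ℂ (π (t m) v) w - inner ℂ (π (t m) v') w'‖ < ε / 2 := by
    intro m
    have : inner ℂ (π (t m) v) w - inner ℂ (π (t m) v') w' =
        inner ℂ (π (t m) v) (w - w') + inner ℂ (π (t m) (v - v')) w' := by
      rw [map_sub, inner_sub_right, inner_sub_left]; ring
    rw [this]
    calc _ ≤ ‖v‖ * ‖w - w'‖ + ‖v - v'‖ * ‖w'‖ := by
            refine (norm_add_le _ _).trans (add_le_add ?_ ?_)
            · refine (norm_inner_le_norm _ _).trans ?_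
              rw [LinearIsometryEquiv.norm_map]
            · refine (norm_inner_le_norm _ _).trans ?_
              rw [LinearIsometryEquiv.norm_map]
      _ ≤ ‖v‖ * δ + δ * (‖w‖ + 1) := by
            gcongr
            · exact h2.1.le
      _ < δ * (‖v‖ + ‖w‖ + 2) := by nlinarith
      _ = ε / 2 := by rw [hδ]; field_simp
  rw [dist_eq_norm]
  have e : inner ℂ (π (t n) v) w - inner ℂ (π (t n₀) v) w =
      (inner ℂ (π (t n) v) w - inner ℂ (π (t n) v') w') -
        (inner ℂ (π (t n₀) v) w - inner ℂ (π (t n₀) v') w') := by rw [hconst]; ring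
  rw [e]
  refine (norm_sub_le _ _).trans_lt ?_
  linarith [key n, key n₀]

lemma eq_of_isWeakLimit {i : NZ} {A B : H →L[ℂ] H} (hA : IsWeakLimit π i A)
    (hB : IsWeakLimit π i B) : A = B := by
  ext v
  exact ext_inner_left ℂ fun w => tendsto_nhds_unique (hA v w) (hB v w)

variable [CompleteSpace H]

/-- A sequence of operators whose matrix elements between the spaces `H(π)_M` stabilize has a weak
limit. -/
lemma exists_weakLimit (hadm : IsAdmissible π) {t : ℕ → GE}
    (ht : ∀ M, ∃ n₀, ∀ n ≥ n₀, ∃ h ∈ KEn M, h * t n₀ * h⁻¹ = t n) :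
    ∃ A : H →L[ℂ] H, ∀ v w : H,
      Tendsto (fun n => inner ℂ w (π (t n) v)) atTop (𝓝 (inner ℂ w (A v))) := by
  choose L hL using fun v w => cauchySeq_tendsto_of_complete (cauchySeq_inner_rep hadm ht v w)
  let B : H →L⋆[ℂ] H →L[ℂ] ℂ := LinearMap.mkContinuous₂
    (LinearMap.mk₂'ₛₗ (starRingEnd ℂ) (RingHom.id ℂ) L
      (fun v v' w => tendsto_nhds_unique (hL _ _)
        (((hL v w).add (hL v' w)).congr fun n => by rw [map_add, inner_add_left]))
      (fun c v w => tendsto_nhds_unique (hL _ _)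
        (((hL v w).const_mul _).congr fun n => by rw [map_smul, inner_smul_left]))
      (fun v w w' => tendsto_nhds_unique (hL _ _)
        (((hL v w).add (hL v w')).congr fun n => by rw [inner_add_right]))
      (fun c v w => tendsto_nhds_unique (hL _ _)
        (((hL v w).const_mul _).congr fun n => by rw [inner_smul_right]; rfl))) 1 (fun v w => by
      rw [one_mul]
      refine le_of_tendsto (hL v w).norm (Eventually.of_forall fun n => ?_)
      refine (norm_inner_le_norm _ _).trans ?_
      rw [LinearIsometryEquiv.norm_map])
  refine ⟨InnerProductSpace.continuousLinearMapOfBilin B, fun v w => ?_⟩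
  have h1 : inner ℂ (InnerProductSpace.continuousLinearMapOfBilin B v) w = L v w :=
    InnerProductSpace.continuousLinearMapOfBilin_apply B v w
  have h2 := (Complex.continuous_conj.tendsto _).comp (hL v w)
  rw [← inner_conj_symm, h1]
  exact h2.congr fun n => inner_conj_symm _ _

lemma isWeakLimit_opA (hadm : IsAdmissible π) (i : NZ) : IsWeakLimit π i (opA π i) := by
  have h : ∃ A, IsWeakLimit π i A := by
    refine exists_weakLimit hadm fun M => ⟨max M (i : ℤ).natAbs, fun n hn =>
      ⟨kap (max M (i : ℤ).natAbs) n, kap_mem (by omega) (by omega), ?_⟩⟩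
    have hk : kap (max M (i : ℤ).natAbs) n ∈ KEn (max M (i : ℤ).natAbs) := kap_mem le_rfl hn
    rw [conj_transp, (mem_KEn_iff.1 hk).2 i (by rw [Int.abs_eq_natAbs]; omega)]
    simp
  unfold opA
  rw [dif_pos h]
  exact h.choose_spec

/-- Conjugation by g turns (i, n + 1) into (g i, n + 1) as soon as g fixes n + 1. -/
lemma rep_opA (hadm : IsAdmissible π) (g : GE) (i : NZ) (v : H) :
    π g (opA π i v) = opA π (g • i) (π g v) := by
  refine ext_inner_left ℂ fun w => ?_
  rw [inner_rep_right]
  refine tendsto_nhds_unique (isWeakLimit_opA hadm i v (π g⁻¹ w)) ?_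
  obtain ⟨n₀, hn₀⟩ := exists_inG g
  refine (isWeakLimit_opA hadm (g • i) (π g v) w).congr' ?_
  filter_upwards [eventually_ge_atTop n₀] with n hn
  have hp : g • pos n = pos n := hn₀ n hn _ (by rw [abs_pos']; omega)
  rw [← inner_rep_right, ← rep_mul, ← rep_mul]
  congr 2
  conv_lhs => rw [← hp, ← conj_transp]
  group

lemma opA_mem (hadm : IsAdmissible π) {M : ℕ} {i : NZ} (hi : |(i : ℤ)| ≤ M) {v : H}
    (hv : v ∈ fixedSpace π M) : opA π i v ∈ fixedSpace π M := by
  intro k hk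
  rw [rep_opA hadm, (mem_KEn_iff.1 hk).2 i hi, hv k hk]

/-- Transpositions are involutions, hence self-adjoint in a unitary representation, and this passes
to the weak limit. -/
lemma inner_opA_left (hadm : IsAdmissible π) (i : NZ) (u v : H) :
    inner ℂ (opA π i u) v = inner ℂ u (opA π i v) := by
  rw [← inner_conj_symm]
  refine tendsto_nhds_unique ((Complex.continuous_conj.tendsto _).comp
    (isWeakLimit_opA hadm i u v)) ?_
  refine (isWeakLimit_opA hadm i v u).congr fun n => ?_
  simp only [Function.comp_apply]
  rw [inner_conj_symm, inner_rep_right, transp_inv]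

/-- The matrix elements of `A_i` between vectors of `H(π)_M`. -/
lemma inner_opA (hadm : IsAdmissible π) {M m : ℕ} {i : NZ} (hi : |(i : ℤ)| ≤ M) (hm : M ≤ m)
    {u v : H} (hu : u ∈ fixedSpace π M) (hv : v ∈ fixedSpace π M) :
    inner ℂ u (opA π i v) = inner ℂ u (π (transp i (pos m)) v) := by
  refine tendsto_nhds_unique (isWeakLimit_opA hadm i v u) ?_
  refine tendsto_const_nhds.congr' ?_
  filter_upwards [eventually_ge_atTop M] with n hn
  -- K_M moves m + 1 to n + 1 and fixes i, so the sequence is constant once the second point lies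
  -- outside `box M`.
  have hk : kap m n ∈ KEn M := kap_mem hm hn
  have : transp i (pos n) = kap m n * transp i (pos m) * (kap m n)⁻¹ := by
    rw [conj_transp, (mem_KEn_iff.1 hk).2 i hi]; simp
  rw [this, rep_mul, rep_mul, inner_rep_left_fixed hk hu, hv _ (inv_mem hk)]

/-- The cycle `(i, M + 1) ⋯ (i, M + k)`. -/
def cyc (i : NZ) (M : ℕ) : ℕ → GE
  | 0 => 1
  | k + 1 => cyc i M k * transp i (pos (M + k))

lemma cyc_inG {i : NZ} {M : ℕ} (hi : |(i : ℤ)| ≤ M) (k : ℕ) : InG (M + k) (cyc i M k) := by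
  induction k with
  | zero => intro i _; simp [cyc]
  | succ k ih =>
    exact (ih.mono (by omega)).mul (inG_transp (by omega) (by rw [abs_pos']; push_cast; omega))

/-- The matrix elements of the powers of `A_i` between vectors of `H(π)_M`. -/
lemma inner_opA_pow (hadm : IsAdmissible π) {M : ℕ} {i : NZ} (hi : |(i : ℤ)| ≤ M) (k : ℕ)
    {u v : H} (hu : u ∈ fixedSpace π M) (hv : v ∈ fixedSpace π M) :
    inner ℂ u ((opA π i ^ k) v) = inner ℂ u (π (cyc i M k) v) := by
  induction k generalizing v with
  | zero => simp [cyc]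
  | succ k ih =>
    -- The cycle of length k belongs to G(M + k) and so preserves the invariant vectors of level M +
    -- k; at this level A_i has the matrix elements of the transposition with M + k + 1.
    rw [pow_succ, mul_apply_eq_comp, ih (opA_mem hadm hi hv), inner_rep_right,
      inner_opA hadm (M := M + k) (by omega) le_rfl
        (rep_mem_fixedSpace (cyc_inG hi k).inv (fixedSpace_mono π (by omega) hu))
        (fixedSpace_mono π (by omega) hv), ← inner_rep_right, cyc, rep_mul]

/-- If `H(π)_e = 0`, then the operators `π(κ)`, where `κ ∈ K` exchanges `e + 1` and `n + 1`, tend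
weakly to `0` on `H(π)_{e+1}`. -/
lemma tendsto_kap (hadm : IsAdmissible π) {e : ℕ} (he : fixedSpace π e = ⊥) {x : H}
    (hx : x ∈ fixedSpace π (e + 1)) (y : H) :
    Tendsto (fun n => inner ℂ y (π (kap e n) x)) atTop (𝓝 0) := by
  obtain ⟨A, hA⟩ := exists_weakLimit hadm (t := kap e) fun M => ⟨max M (e + 1), fun n hn =>
      ⟨kap (max M (e + 1)) n, kap_mem (by omega) (by omega), by
        have hk : kap (max M (e + 1)) n ∈ KEn (e + 1) := kap_mem (by omega) (by omega)
        refine kap_conj _ ?_ ?_ (by simp) (by simp)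
        · exact (mem_KEn_iff.1 hk).2 _ (by rw [abs_pos']; push_cast; rfl)
        · exact (mem_KEn_iff.1 hk).2 _ (by rw [abs_neg_pos]; push_cast; rfl)⟩⟩
  have hmem : A x ∈ fixedSpace π e := by
    intro h hh
    refine ext_inner_left ℂ fun w => ?_
    rw [inner_rep_right]
    refine tendsto_nhds_unique (hA x (π h⁻¹ w)) ((hA x w).congr' ?_)
    obtain ⟨n₀, hn₀⟩ := exists_inG h
    filter_upwards [eventually_ge_atTop n₀, eventually_ge_atTop e] with n hn hen
    have hk : kap e n ∈ KEn e := kap_mem le_rfl hen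
    -- For large n the element h fixes ±(n + 1), so the conjugate fixes ±(e + 1), and with it x.
    -- Hence the weak limit of π(kap e n) x is K_e-invariant, that is, zero.
    have hk' : (kap e n)⁻¹ * h * kap e n ∈ KEn (e + 1) := by
      have h1 : (kap e n)⁻¹ * h * kap e n ∈ KEn e := mul_mem (mul_mem (inv_mem hk) hh) hk
      have h2 := mem_KEn_iff.1 h1
      refine mem_KEn_iff.2 ⟨h2.1, fun i hi => ?_⟩
      rcases hi.lt_or_eq with h3 | h3
      · exact h2.2 i (by push_cast at h3; omega)
      · have hpn : h • pos n = pos n := hn₀ n hn _ (by rw [abs_pos']; omega)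
        have hnn : h • -pos n = -pos n := hn₀ n hn _ (by rw [abs_neg_pos]; omega)
        obtain ⟨k, rfl | rfl⟩ := eq_pos_or i
        · rw [abs_pos'] at h3
          obtain rfl : k = e := by omega
          rw [mul_smul, mul_smul, kap_pos, Equiv.swap_apply_left, hpn, kap_inv, kap_pos,
            Equiv.swap_apply_right]
        · rw [abs_neg_pos] at h3
          obtain rfl : k = e := by omega
          rw [mul_smul, mul_smul, kap_neg, Equiv.swap_apply_left, hnn, kap_inv, kap_neg,
            Equiv.swap_apply_right]
    rw [← inner_rep_right, ← rep_mul]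
    have : h * kap e n = kap e n * ((kap e n)⁻¹ * h * kap e n) := by group
    rw [this, rep_mul, hx _ hk']
  rw [he, Submodule.mem_bot] at hmem
  have := hA x y
  rwa [hmem, inner_zero_right] at this

/-- The matrix elements vanish if two points with `|i|, |j| ≤ d` go to a pair `±(N + 1)`. -/
lemma inner_rep_eq_zero_of_pair (hadm : IsAdmissible π) {d : ℕ}
    (hmin : ∀ n < d, fixedSpace π n = ⊥) {u v : H} (hu : u ∈ fixedSpace π d)
    (hv : v ∈ fixedSpace π d) {g : GE} {i j : NZ} {N : ℕ} (hi : |(i : ℤ)| ≤ d)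
    (hj : |(j : ℤ)| ≤ d) (hN : d ≤ N) (hgi : g • i = pos N) (hgj : g • j = -pos N) :
    inner ℂ u (π g v) = 0 := by
  have hd : d ≠ 0 := by
    rintro rfl
    exact i.2 (abs_eq_zero.1 (le_antisymm (by simpa using hi) (abs_nonneg _)))
  obtain ⟨e, rfl⟩ := Nat.exists_eq_succ_of_ne_zero hd
  have hij : i ≠ j := by
    rintro rfl
    exact pos_ne_neg N N (hgi.symm.trans hgj)
  -- Here t brings i, j to ±(e + 1). Conjugation by t g⁻¹ turns `kap N n`, which fixes u, into `kap
  -- e n`. So the matrix element does not change if π(kap e n) is inserted in front of π(t) v, and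
  -- `tendsto_kap` applies.
  obtain ⟨t, ht, hti, htj⟩ := exists_inG_smul₂ (i' := pos e) (j' := -pos e) hi hj
    (by rw [abs_pos']; push_cast; rfl) (by rw [abs_neg_pos]; push_cast; rfl) hij (pos_ne_neg _ _)
  have h1 : inner ℂ u (π g v) = inner ℂ (π (t * g⁻¹) u) (π t v) := by
    rw [rep_mul, LinearIsometryEquiv.inner_map_map, inner_rep_right]
  rw [h1]
  refine tendsto_nhds_unique ?_ (tendsto_kap hadm (hmin e (by omega))
    (rep_mem_fixedSpace ht hv) (π (t * g⁻¹) u))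
  refine tendsto_const_nhds.congr' ?_
  obtain ⟨n₀, hn₀⟩ := exists_inG (t * g⁻¹)
  filter_upwards [eventually_ge_atTop n₀, eventually_ge_atTop (N + 1)] with n hn hnN
  have hc : t * g⁻¹ * kap N n * (t * g⁻¹)⁻¹ = kap e n := by
    refine kap_conj _ ?_ ?_ (hn₀ n hn _ (by rw [abs_pos']; omega))
      (hn₀ n hn _ (by rw [abs_neg_pos]; omega))
    · rw [← hgi, mul_smul, inv_smul_smul, hti]
    · rw [← hgj, mul_smul, inv_smul_smul, htj]
  have hk : kap N n ∈ KEn (e + 1) := kap_mem hN (by omega)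
  have h2 : π (kap e n) (π (t * g⁻¹) u) = π (t * g⁻¹) u := by
    rw [← rep_mul, ← hc, inv_mul_cancel_right, rep_mul, hu _ hk]
  rw [inner_rep_right π (kap e n), kap_inv, h2]

/-- A subspace `V` of `H(π)_d`, where `d` is the depth, which is invariant under `G(d)` and the
operators `A_i`, `|i| ≤ d`, is invariant under the compressions of all operators of the
representation, provided that the elements that fix all `i` with `|i| ≤ d` act by scalars. -/
theorem inner_rep_eq_zero (hadm : IsAdmissible π) {d : ℕ}
    (hmin : ∀ n < d, fixedSpace π n = ⊥)
    (hscal : ∀ c : GE, (∀ i : NZ, |(i : ℤ)| ≤ d → c • i = i) → ∃ γ : ℂ,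
      ∀ u ∈ fixedSpace π d, ∀ v ∈ fixedSpace π d, inner ℂ u (π c v) = γ * inner ℂ u v)
    {V : Submodule ℂ H} (hV : V ≤ fixedSpace π d)
    (hG : ∀ g, InG d g → ∀ v ∈ V, π g v ∈ V)
    (hA : ∀ i : NZ, |(i : ℤ)| ≤ d → ∀ v ∈ V, opA π i v ∈ V)
    {u : H} (hu : u ∈ fixedSpace π d) (huV : ∀ v ∈ V, inner ℂ u v = 0) (g : GE) {v : H}
    (hv : v ∈ V) : inner ℂ u (π g v) = 0 := by
  -- Induction on the support: an element of G(d + n + 1) is reduced to one of G(d + n), at the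
  -- price of replacing v by A_i v, which is still in V.
  have main : ∀ n, ∀ g, InG (d + n) g → ∀ v ∈ V, inner ℂ u (π g v) = 0 := by
    intro n
    induction n with
    | zero => exact fun g hg v hv => huV _ (hG g hg v hv)
    | succ n ih =>
      intro g hg v hv
      by_cases hcase : ∃ i : NZ, |(i : ℤ)| ≤ d ∧ (d : ℤ) < |((g • i : NZ) : ℤ)|
      · obtain ⟨i, hi, hgi⟩ := hcase
        -- As u is fixed by K_d, multiplication from the left may bring g i to the last point d + n
        -- + 1.
        obtain ⟨k, hk, hkG, hki⟩ := exists_KEn_smul (N := d + n) hgi (by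
          have := hg.abs_le (i := i) (by omega)
          push_cast at this ⊢; omega)
        have h1 : inner ℂ u (π g v) = inner ℂ u (π (k * g) v) := by
          rw [rep_mul, inner_rep_left_fixed hk hu]
        rw [h1]
        have hkg : InG (d + n + 1) (k * g) := hkG.mul hg
        replace hki : (k * g) • i = pos (d + n) := by rw [mul_smul, hki]
        generalize k * g = g₁ at hkg hki
        -- If -(d + n + 1) also comes from a point of the box, the matrix element vanishes.
        -- Otherwise multiplication from the right by K_d, which fixes v and i, makes the element
        -- fix -(d + n + 1).
        by_cases hj : |((g₁⁻¹ • -pos (d + n) : NZ) : ℤ)| ≤ d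
        · exact inner_rep_eq_zero_of_pair hadm hmin hu (hV hv) hi hj (by omega) hki
            (smul_inv_smul _ _)
        · rw [not_le] at hj
          obtain ⟨k', hk', hkG', hkj'⟩ := exists_KEn_smul (N := d + n) hj (by
            refine (hkg.inv.abs_le ?_).trans (by push_cast; rfl)
            rw [abs_neg_pos]; push_cast; rfl)
          set q := k'⁻¹ * transp (pos (d + n)) (-pos (d + n)) with hq
          have hfl : transp (pos (d + n)) (-pos (d + n)) ∈ KEn d := flip_mem (by omega)
          have hqK : q ∈ KEn d := mul_mem (inv_mem hk') hfl
          have hqG : InG (d + n + 1) q := hkG'.inv.mul (flip_inG (by omega))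
          have hqn : (g₁ * q) • -pos (d + n) = -pos (d + n) := by
            rw [hq, mul_smul, mul_smul, transp_smul, Equiv.swap_apply_right,
              inv_smul_eq_iff.2 hkj'.symm, smul_inv_smul]
          have hqi : (g₁ * q) • i = pos (d + n) := by
            rw [mul_smul, (mem_KEn_iff.1 hqK).2 i hi, hki]
          have h2 : inner ℂ u (π g₁ v) = inner ℂ u (π (g₁ * q) v) := by
            rw [rep_mul, hV hv q hqK]
          rw [h2]
          have hgq : InG (d + n + 1) (g₁ * q) := hkg.mul hqG
          generalize g₁ * q = g₂ at hqn hqi hgq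
          -- Without the factor (i, d + n + 1) the element fixes both points ±(d + n + 1), so it
          -- lies in G(d + n), and at this level the transposition has the matrix elements of A_i.
          set g' := g₂ * transp i (pos (d + n)) with hg'
          have hg'G : InG (d + n) g' := by
            intro x hx
            have htr : InG (d + n + 1) (transp i (pos (d + n))) :=
              inG_transp (by omega) (by rw [abs_pos']; push_cast; rfl)
            by_cases hx' : ((d + n + 1 : ℕ) : ℤ) < |(x : ℤ)|
            · exact (hgq.mul htr) x hx'
            · obtain ⟨m, rfl | rfl⟩ := eq_pos_or x
              · rw [abs_pos'] at hx hx'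
                obtain rfl : m = d + n := by omega
                rw [hg', mul_smul, transp_smul, Equiv.swap_apply_right, hqi]
              · rw [abs_neg_pos] at hx hx'
                obtain rfl : m = d + n := by omega
                rw [hg', mul_smul, transp_smul, Equiv.swap_apply_of_ne_of_ne, hqn]
                · rintro rfl
                  rw [abs_neg_pos] at hi; omega
                · exact neg_ne_pos _ _
          have h3 : g₂ = g' * transp i (pos (d + n)) := by
            rw [hg', mul_assoc, transp_mul_self, mul_one]
          rw [h3, rep_mul, inner_rep_right, ← inner_opA hadm (M := d + n) (by omega) le_rfl
            (rep_mem_fixedSpace hg'G.inv (fixedSpace_mono π (by omega) hu))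
            (fixedSpace_mono π (by omega) (hV hv)), ← inner_rep_right]
          exact ih g' hg'G _ (hA i hi v hv)
      -- Now g permutes {-d, …, d}: it is an element of G(d) times an element that fixes all these
      -- points.
      · push Not at hcase
        have hbox : ∀ i ∈ box d, g • i ∈ box d := fun i hi =>
          mem_box.2 (hcase i (mem_box.1 hi))
        have hbij : ∀ i ∈ box d, g⁻¹ • i ∈ box d := by
          have himg : (box d).image (fun i => g • i) = box d :=
            Finset.eq_of_subset_of_card_le (fun x hx => by
              obtain ⟨i, hi, rfl⟩ := Finset.mem_image.1 hx; exact hbox i hi)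
              (by rw [Finset.card_image_of_injective _ (MulAction.injective g)])
          intro i hi
          rw [← himg] at hi
          obtain ⟨j, hj, rfl⟩ := Finset.mem_image.1 hi
          simpa using hj
        let σ : Equiv.Perm (box d) :=
          { toFun := fun i => ⟨g • i.1, hbox _ i.2⟩
            invFun := fun i => ⟨g⁻¹ • i.1, hbij _ i.2⟩
            left_inv := fun i => by simp
            right_inv := fun i => by simp }
        have hσ : ∀ i ∈ box d, ofPerm σ • i = g • i := fun i hi => by
          rw [ofPerm, ofNZ_smul, Equiv.Perm.ofSubtype_apply_of_mem σ hi]; rfl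
        have hσG : InG d (ofPerm σ) := fun i hi => by
          rw [ofPerm, ofNZ_smul, Equiv.Perm.ofSubtype_apply_of_not_mem σ]
          rw [mem_box]; omega
        obtain ⟨γ, hγ⟩ := hscal ((ofPerm σ)⁻¹ * g) fun i hi => by
          rw [mul_smul, ← hσ i (mem_box.2 hi), inv_smul_smul]
        have h1 : g = ofPerm σ * ((ofPerm σ)⁻¹ * g) := by group
        rw [h1, rep_mul, inner_rep_right,
          hγ _ (rep_mem_fixedSpace hσG.inv hu) _ (hV hv), ← inner_rep_right,
          huV _ (hG _ hσG v hv), mul_zero]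
  obtain ⟨n, hn⟩ := exists_inG g
  exact main n g (hn _ (by omega)) v hv

end Abstract

/-! ### Subrepresentations -/

section Sub

variable {H : Type*} [NormedAddCommGroup H] [InnerProductSpace ℂ H] {π : URep H}

lemma IsInvariantSubspace.orthogonal {W : Submodule ℂ H} (hW : IsInvariantSubspace π W) :
    IsInvariantSubspace π Wᗮ := by
  intro g v hv w hw
  rw [inner_rep_right]
  exact hv _ (hW _ w hw)

lemma IsInvariantSubspace.inf {W V : Submodule ℂ H} (hW : IsInvariantSubspace π W)
    (hV : IsInvariantSubspace π V) : IsInvariantSubspace π (W ⊓ V) :=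
  fun g v hv => ⟨hW g v hv.1, hV g v hv.2⟩

lemma subset_cyclicSpan (S : Set H) : S ⊆ cyclicSpan π S := fun v hv =>
  subset_closure (Submodule.subset_span ⟨1, v, hv, (rep_one π v).symm⟩)

lemma cyclicSpan_le {S : Set H} {W : Submodule ℂ H} (hc : IsClosed (W : Set H))
    (hW : IsInvariantSubspace π W) (hS : S ⊆ W) : cyclicSpan π S ≤ W := by
  refine Submodule.topologicalClosure_minimal _ ?_ hc
  rw [Submodule.span_le]
  rintro _ ⟨g, v, hv, rfl⟩
  exact hW g v (hS hv)

lemma isClosed_cyclicSpan (S : Set H) : IsClosed (cyclicSpan π S : Set H) :=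
  Submodule.isClosed_topologicalClosure _

/-- The cyclic span of a set of `K_d`-invariant vectors is admissible. -/
lemma dense_cyclicSpan {S : Set H} {d : ℕ} (hS : S ⊆ fixedSpace π d) :
    (cyclicSpan π S : Set H) ⊆
      closure (cyclicSpan π S ∩ ⋃ n, (fixedSpace π n : Set H)) := by
  refine closure_mono fun v hv => ⟨subset_closure hv, ?_⟩
  have h1 : Directed (· ≤ ·) fun n => fixedSpace π n :=
    (monotone_nat_of_le_succ fun n => fixedSpace_mono π (Nat.le_succ n)).directed_le
  rw [← Submodule.coe_iSup_of_directed _ h1]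
  refine Submodule.span_le.2 ?_ hv
  rintro _ ⟨g, v, hv, rfl⟩
  obtain ⟨n, hn⟩ := exists_inG g
  rw [Submodule.coe_iSup_of_directed _ h1, Set.mem_iUnion]
  exact ⟨max n d, rep_mem_fixedSpace (hn _ (le_max_left _ _))
    (fixedSpace_mono π (le_max_right _ _) (hS hv))⟩

lemma mem_fixedSpace_subrep {W : Submodule ℂ H} (hW : IsInvariantSubspace π W) {n : ℕ} {w : W} :
    w ∈ fixedSpace (subrep π W hW) n ↔ (w : H) ∈ fixedSpace π n :=
  forall₂_congr fun g _ => by rw [Subtype.ext_iff, coe_subrep]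

lemma isAdmissible_subrep_of {W : Submodule ℂ H} (hW : IsInvariantSubspace π W)
    (h : (W : Set H) ⊆ closure (W ∩ ⋃ n, (fixedSpace π n : Set H))) :
    IsAdmissible (subrep π W hW) := by
  intro w
  rw [closure_subtype]
  refine closure_mono ?_ (h w.2)
  rintro v ⟨hv, hv'⟩
  obtain ⟨n, hn⟩ := Set.mem_iUnion.1 hv'
  exact ⟨⟨v, hv⟩, Set.mem_iUnion.2 ⟨n, (mem_fixedSpace_subrep hW).2 hn⟩, rfl⟩

lemma isIrredRep_subrep {W : Submodule ℂ H} (hW : IsInvariantSubspace π W) (h0 : W ≠ ⊥)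
    (hc : IsClosed (W : Set H))
    (h : ∀ V ≤ W, IsClosed (V : Set H) → IsInvariantSubspace π V → V = ⊥ ∨ V = W) :
    IsIrredRep (subrep π W hW) := by
  refine ⟨Submodule.nontrivial_iff_ne_bot.2 h0, fun V hVc hV => ?_⟩
  have h1 : V.map W.subtype ≤ W := Submodule.map_subtype_le W V
  have h2 : IsClosed (V.map W.subtype : Set H) := by
    rw [Submodule.map_coe]
    exact hc.isClosedMap_subtype_val _ hVc
  have h3 : IsInvariantSubspace π (V.map W.subtype) := by
    rintro g _ ⟨v, hv, rfl⟩
    exact ⟨subrep π W hW g v, hV g v hv, rfl⟩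
  rcases h _ h1 h2 h3 with h4 | h4
  · left
    rw [Submodule.eq_bot_iff]
    intro v hv
    have h5 : W.subtype v ∈ V.map W.subtype := Submodule.mem_map_of_mem hv
    rw [h4, Submodule.mem_bot] at h5
    exact Subtype.ext h5
  · right
    refine Submodule.map_injective_of_injective (Submodule.injective_subtype W) ?_
    rw [h4, Submodule.map_top, Submodule.range_subtype]

lemma proj_rep {W : Submodule ℂ H} [W.HasOrthogonalProjection] (hW : IsInvariantSubspace π W)
    (g : GE) (v : H) : W.starProjection (π g v) = π g (W.starProjection v) := by
  refine (Submodule.eq_starProjection_of_mem_orthogonal (hW g _ (Submodule.coe_mem _)) ?_)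
  rw [← map_sub]
  exact hW.orthogonal g _ (Submodule.sub_starProjection_mem_orthogonal v)

lemma proj_mem_fixedSpace {W : Submodule ℂ H} [W.HasOrthogonalProjection]
    (hW : IsInvariantSubspace π W) {n : ℕ} {v : H} (hv : v ∈ fixedSpace π n) :
    W.starProjection v ∈ fixedSpace π n := fun g hg => by
  rw [← proj_rep hW, hv g hg]

lemma sup_inf_orthogonal {V W : Submodule ℂ H} [V.HasOrthogonalProjection] (h : V ≤ W) :
    V ⊔ (W ⊓ Vᗮ) = W := by
  rw [inf_comm]
  exact Submodule.sup_orthogonal_inf_of_hasOrthogonalProjection h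

variable [CompleteSpace H]

/-- The projection onto W commutes with G, so it maps the dense union of the spaces H(π)_n to
invariant vectors of W. -/
lemma isAdmissible_subrep (hadm : IsAdmissible π) {W : Submodule ℂ H}
    (hW : IsInvariantSubspace π W) (hc : IsClosed (W : Set H)) :
    IsAdmissible (subrep π W hW) := by
  have : CompleteSpace W := hc.completeSpace_coe
  refine isAdmissible_subrep_of hW fun w hw => ?_
  have h1 := map_mem_closure W.starProjection.continuous (hadm w)
    (t := W ∩ ⋃ n, (fixedSpace π n : Set H)) (by
      intro v hv
      obtain ⟨n, hn⟩ := Set.mem_iUnion.1 hv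
      exact ⟨Submodule.coe_mem _, Set.mem_iUnion.2 ⟨n, proj_mem_fixedSpace hW hn⟩⟩)
  rwa [Submodule.starProjection_eq_self_iff.2 hw] at h1

/-- The operators `A_i` of a subrepresentation. -/
lemma coe_opA_subrep (hadm : IsAdmissible π) {W : Submodule ℂ H} (hW : IsInvariantSubspace π W)
    (hc : IsClosed (W : Set H)) (i : NZ) (w : W) :
    ((opA (subrep π W hW) i w : W) : H) = opA π i w := by
  have : CompleteSpace W := hc.completeSpace_coe
  have hmem : opA π i w ∈ W := by
    suffices h : opA π i w ∈ Wᗮᗮ by rwa [Submodule.orthogonal_orthogonal] at h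
    intro u hu
    refine tendsto_nhds_unique (isWeakLimit_opA hadm i w u) (tendsto_const_nhds.congr fun n => ?_)
    rw [← inner_conj_symm, hu _ (hW _ _ w.2), map_zero]
  refine ext_inner_left ℂ fun u => ?_
  have h1 : ∀ z ∈ W, inner ℂ u z = inner ℂ (W.starProjection u) z := fun z hz => by
    have := Submodule.sub_starProjection_mem_orthogonal (K := W) u
    rw [← sub_eq_zero, ← inner_sub_left, ← inner_conj_symm, this z hz, map_zero]
  rw [h1 _ (Submodule.coe_mem _), h1 _ hmem]
  exact tendsto_nhds_unique (isWeakLimit_opA (isAdmissible_subrep hadm hW hc) i w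
    ⟨W.starProjection u, Submodule.coe_mem _⟩) (isWeakLimit_opA hadm i w (W.starProjection u))

lemma coe_opA_pow_subrep (hadm : IsAdmissible π) {W : Submodule ℂ H}
    (hW : IsInvariantSubspace π W) (hc : IsClosed (W : Set H)) (i : NZ) (k : ℕ) (w : W) :
    (((opA (subrep π W hW) i ^ k) w : W) : H) = (opA π i ^ k) w := by
  induction k with
  | zero => simp
  | succ k ih =>
    rw [pow_succ', pow_succ', mul_apply_eq_comp, mul_apply_eq_comp,
      coe_opA_subrep hadm hW hc, ih]

/-! ### Representations generated by the root -/

variable {d : ℕ}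

/-- The projection of H(π)_d to W consists of K_d-invariant vectors of W and so is zero; hence W is
orthogonal to a generating set. -/
lemma eq_bot_of_inf_eq_bot (hcyc : cyclicSpan π (fixedSpace π d : Set H) = ⊤)
    {W : Submodule ℂ H} (hc : IsClosed (W : Set H)) (hW : IsInvariantSubspace π W)
    (h : W ⊓ fixedSpace π d = ⊥) : W = ⊥ := by
  have : CompleteSpace W := hc.completeSpace_coe
  have h1 : (fixedSpace π d : Set H) ⊆ Wᗮ := by
    intro v hv
    have h2 : W.starProjection v ∈ W ⊓ fixedSpace π d :=
      ⟨Submodule.coe_mem _, proj_mem_fixedSpace hW hv⟩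
    rw [h, Submodule.mem_bot] at h2
    have h3 := Submodule.sub_starProjection_mem_orthogonal (K := W) v
    rwa [h2, sub_zero] at h3
  have h2 := cyclicSpan_le (Submodule.isClosed_orthogonal W) hW.orthogonal h1
  rw [hcyc, top_le_iff] at h2
  rw [← Submodule.orthogonal_orthogonal W, h2, Submodule.top_orthogonal_eq_bot]

/-- The orthogonal complement of V in W has no K_d-invariant vectors, so it is zero. -/
lemma eq_of_inf_le (hcyc : cyclicSpan π (fixedSpace π d : Set H) = ⊤)
    {V W : Submodule ℂ H} (hVc : IsClosed (V : Set H)) (hV : IsInvariantSubspace π V)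
    (hWc : IsClosed (W : Set H)) (hW : IsInvariantSubspace π W) (hVW : V ≤ W)
    (h : W ⊓ fixedSpace π d ≤ V) : V = W := by
  have : CompleteSpace V := hVc.completeSpace_coe
  have h1 : W ⊓ Vᗮ = ⊥ := by
    refine eq_bot_of_inf_eq_bot hcyc (hWc.inter (Submodule.isClosed_orthogonal V))
      (hW.inf hV.orthogonal) ?_
    rw [Submodule.eq_bot_iff]
    rintro v ⟨⟨h2, h3⟩, h4⟩
    exact (Submodule.mem_bot ℂ).1 (V.inf_orthogonal_eq_bot ▸ ⟨h ⟨h2, h4⟩, h3⟩)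
  rw [← sup_inf_orthogonal hVW, h1, sup_bot_eq]

/-- The irreducible closed invariant subspaces. -/
structure IsIrredSubspace (π : URep H) (V : Submodule ℂ H) : Prop where
  closed : IsClosed (V : Set H)
  inv : IsInvariantSubspace π V
  ne_bot : V ≠ ⊥
  irred : ∀ W ≤ V, IsClosed (W : Set H) → IsInvariantSubspace π W → W = ⊥ ∨ W = V

/-- Take V with the least dimension of V ∩ H(π)_d. A nonzero closed invariant subspace of V has the
same intersection with H(π)_d, and then it is V by `eq_of_inf_le`. -/
lemma exists_irredSubspace [FiniteDimensional ℂ (fixedSpace π d)]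
    (hcyc : cyclicSpan π (fixedSpace π d : Set H) = ⊤) {W : Submodule ℂ H}
    (hc : IsClosed (W : Set H)) (hW : IsInvariantSubspace π W) (h0 : W ≠ ⊥) :
    ∃ V ≤ W, IsIrredSubspace π V := by
  classical
  have hfin : ∀ V : Submodule ℂ H, FiniteDimensional ℂ (V ⊓ fixedSpace π d : Submodule ℂ H) :=
    fun V => Submodule.finiteDimensional_of_le inf_le_right
  let P : ℕ → Prop := fun m => ∃ V ≤ W, IsClosed (V : Set H) ∧ IsInvariantSubspace π V ∧ V ≠ ⊥ ∧
    Module.finrank ℂ (V ⊓ fixedSpace π d : Submodule ℂ H) = m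
  have hex : ∃ m, P m := ⟨_, W, le_rfl, hc, hW, h0, rfl⟩
  obtain ⟨V, hVW, hVc, hV, hV0, hm⟩ := Nat.find_spec hex
  refine ⟨V, hVW, hVc, hV, hV0, fun U hUV hUc hU => ?_⟩
  by_cases hU0 : U = ⊥
  · exact Or.inl hU0
  right
  refine eq_of_inf_le hcyc hUc hU hVc hV hUV ?_
  have h1 : U ⊓ fixedSpace π d ≤ V ⊓ fixedSpace π d := inf_le_inf_right _ hUV
  have h2 : Module.finrank ℂ (V ⊓ fixedSpace π d : Submodule ℂ H) ≤
      Module.finrank ℂ (U ⊓ fixedSpace π d : Submodule ℂ H) := by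
    rw [hm]
    exact Nat.find_min' hex ⟨U, hUV.trans hVW, hUc, hU, hU0, rfl⟩
  have := hfin V
  rw [← Submodule.eq_of_le_of_finrank_le h1 h2]
  exact inf_le_left

/-- A representation generated by a finite dimensional space of invariant vectors is a finite
orthogonal sum of irreducible representations. -/
theorem exists_decomposition [FiniteDimensional ℂ (fixedSpace π d)]
    (hcyc : cyclicSpan π (fixedSpace π d : Set H) = ⊤) :
    ∃ (n : ℕ) (V : Fin n → Submodule ℂ H), (∀ k, IsIrredSubspace π (V k)) ∧
      (Pairwise fun k l => V k ⟂ V l) ∧ ⨆ k, V k = ⊤ := by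
  classical
  have hfin : ∀ V : Submodule ℂ H, FiniteDimensional ℂ (V ⊓ fixedSpace π d : Submodule ℂ H) :=
    fun V => Submodule.finiteDimensional_of_le inf_le_right
  -- Splitting off an irreducible subspace lowers the dimension of W ∩ H(π)_d, since a nonzero
  -- closed invariant subspace meets H(π)_d.
  have main : ∀ m, ∀ W : Submodule ℂ H, IsClosed (W : Set H) → IsInvariantSubspace π W →
      Module.finrank ℂ (W ⊓ fixedSpace π d : Submodule ℂ H) ≤ m →
      ∃ s : Finset (Submodule ℂ H), (∀ V ∈ s, IsIrredSubspace π V) ∧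
        (s : Set (Submodule ℂ H)).Pairwise (fun V U => V ⟂ U) ∧
        sSup (s : Set (Submodule ℂ H)) = W := by
    intro m
    induction m with
    | zero =>
      intro W hc hW hm
      have h1 : W ⊓ fixedSpace π d = ⊥ := by
        have := hfin W
        exact Submodule.finrank_eq_zero.1 (Nat.le_zero.1 hm)
      exact ⟨∅, by simp, by simp, by simp [eq_bot_of_inf_eq_bot hcyc hc hW h1]⟩
    | succ m ih =>
      intro W hc hW hm
      by_cases h0 : W = ⊥
      · exact ⟨∅, by simp, by simp, by simp [h0]⟩
      obtain ⟨V, hVW, hV⟩ := exists_irredSubspace hcyc hc hW h0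
      have : CompleteSpace V := hV.closed.completeSpace_coe
      obtain ⟨s, hs1, hs2, hs3⟩ := ih (W ⊓ Vᗮ) (hc.inter (Submodule.isClosed_orthogonal V))
        (hW.inf hV.inv.orthogonal) (by
          rw [← Nat.lt_succ_iff]
          refine lt_of_lt_of_le ?_ hm
          have := hfin W
          refine Submodule.finrank_lt_finrank_of_lt (lt_of_le_of_ne
            (inf_le_inf_right _ inf_le_left) fun h => hV.ne_bot ?_)
          refine eq_bot_of_inf_eq_bot hcyc hV.closed hV.inv ?_
          rw [Submodule.eq_bot_iff]
          rintro v ⟨h2, h3⟩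
          have h4 : v ∈ W ⊓ Vᗮ ⊓ fixedSpace π d := h ▸ ⟨hVW h2, h3⟩
          exact (Submodule.mem_bot ℂ).1 (V.inf_orthogonal_eq_bot ▸ ⟨h2, h4.1.2⟩))
      have hsV : ∀ U ∈ s, U ≤ Vᗮ := fun U hU => by
        have : U ≤ W ⊓ Vᗮ := hs3 ▸ le_sSup hU
        exact this.trans inf_le_right
      refine ⟨insert V s, ?_, ?_, ?_⟩
      · intro U hU
        rcases Finset.mem_insert.1 hU with rfl | hU
        · exact hV
        · exact hs1 U hU
      · rw [Finset.coe_insert, Set.pairwise_insert]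
        refine ⟨hs2, fun U hU _ => ⟨?_, hsV U hU⟩⟩
        exact (show U ⟂ V from hsV U hU).symm
      · rw [Finset.coe_insert, sSup_insert, hs3, sup_inf_orthogonal hVW]
  obtain ⟨s, hs1, hs2, hs3⟩ := main _ ⊤ isClosed_univ (fun _ _ _ => trivial) le_rfl
  refine ⟨s.card, fun k => (s.equivFin.symm k).1, fun k => hs1 _ (s.equivFin.symm k).2,
    fun k l hkl => hs2 (s.equivFin.symm k).2 (s.equivFin.symm l).2 fun h =>
      hkl (s.equivFin.symm.injective (Subtype.ext h)), ?_⟩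
  rw [← hs3, sSup_eq_iSup']
  exact s.equivFin.symm.iSup_comp (g := fun V : s => V.1)

end Sub

/-! ### Young symmetrizers -/

section Young

variable {ι : Type*} {Λ : YoungDist}

lemma perm_apply_inv (σ : Equiv.Perm ι) (i : ι) : σ (σ⁻¹ i) = i := by simp

lemma perm_inv_apply (σ : Equiv.Perm ι) (i : ι) : σ⁻¹ (σ i) = i := by simp

lemma cell_ext {s t : Σ x : ℝ, (Λ.toFun x).cells} (h1 : s.1 = t.1) (h2 : s.2.1 = t.2.1) :
    s = t := by
  obtain ⟨x, c⟩ := s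
  obtain ⟨y, e⟩ := t
  simp only at h1
  subst h1
  exact congrArg (Sigma.mk x) (Subtype.ext h2)

variable {T : Filling ι Λ}

lemma IsRow.mul {σ τ : Equiv.Perm ι} (hσ : IsRow T σ) (hτ : IsRow T τ) : IsRow T (σ * τ) :=
  fun i => ⟨(hσ _).1.trans (hτ i).1, (hσ _).2.trans (hτ i).2⟩

lemma IsRow.inv {σ : Equiv.Perm ι} (hσ : IsRow T σ) : IsRow T σ⁻¹ := fun i => by
  have h := hσ (σ⁻¹ i)
  rw [perm_apply_inv] at h
  exact ⟨h.1.symm, h.2.symm⟩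

lemma IsCol.mul {σ τ : Equiv.Perm ι} (hσ : IsCol T σ) (hτ : IsCol T τ) : IsCol T (σ * τ) :=
  fun i => ⟨(hσ _).1.trans (hτ i).1, (hσ _).2.trans (hτ i).2⟩

lemma IsCol.inv {σ : Equiv.Perm ι} (hσ : IsCol T σ) : IsCol T σ⁻¹ := fun i => by
  have h := hσ (σ⁻¹ i)
  rw [perm_apply_inv] at h
  exact ⟨h.1.symm, h.2.symm⟩

lemma eq_one_of_isRow_isCol {σ : Equiv.Perm ι} (h1 : IsRow T σ) (h2 : IsCol T σ) : σ = 1 := by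
  ext i
  exact T.injective (cell_ext (h1 i).1 (Prod.ext (h1 i).2 (h2 i).2))

/-! The group algebra as an algebra of matrices. -/

/-- The matrix of the right multiplication by `a`. -/
def cmat (a : Equiv.Perm ι → ℂ) : Matrix (Equiv.Perm ι) (Equiv.Perm ι) ℂ :=
  Matrix.of fun σ τ => a (σ⁻¹ * τ)

/-- The involution of the group algebra. -/
def gstar (a : Equiv.Perm ι → ℂ) (τ : Equiv.Perm ι) : ℂ := star (a τ⁻¹)

lemma cmat_injective : Function.Injective (cmat (ι := ι)) := fun a b h => by
  funext τ
  have := congrFun (congrFun h 1) τ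
  simpa [cmat] using this

lemma cmat_gstar (a : Equiv.Perm ι → ℂ) : cmat (gstar a) = (cmat a).conjTranspose := by
  ext σ τ
  simp [cmat, gstar]

lemma cmat_zero : cmat (0 : Equiv.Perm ι → ℂ) = 0 := rfl

section Swap

variable [DecidableEq ι]

lemma swap_isRow {i j : ι} (h1 : (T i).1 = (T j).1) (h2 : (T i).2.1.1 = (T j).2.1.1) :
    IsRow T (Equiv.swap i j) := fun k => by
  rcases eq_or_ne k i with rfl | hi
  · rw [Equiv.swap_apply_left]; exact ⟨h1.symm, h2.symm⟩
  rcases eq_or_ne k j with rfl | hj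
  · rw [Equiv.swap_apply_right]; exact ⟨h1, h2⟩
  rw [Equiv.swap_apply_of_ne_of_ne hi hj]; exact ⟨rfl, rfl⟩

lemma swap_isCol {i j : ι} (h1 : (T i).1 = (T j).1) (h2 : (T i).2.1.2 = (T j).2.1.2) :
    IsCol T (Equiv.swap i j) := fun k => by
  rcases eq_or_ne k i with rfl | hi
  · rw [Equiv.swap_apply_left]; exact ⟨h1.symm, h2.symm⟩
  rcases eq_or_ne k j with rfl | hj
  · rw [Equiv.swap_apply_right]; exact ⟨h1, h2⟩
  rw [Equiv.swap_apply_of_ne_of_ne hi hj]; exact ⟨rfl, rfl⟩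

end Swap

variable [Fintype ι]

/-- A permutation that does not send two points of a row to points of a column is a product of a row
permutation and a column permutation. -/
lemma exists_isRow_isCol (τ : Equiv.Perm ι) (hτ : ∀ i, (T (τ⁻¹ i)).1 = (T i).1)
    (hinj : ∀ i j, (T i).1 = (T j).1 → (T i).2.1.1 = (T j).2.1.1 →
      (T (τ⁻¹ i)).2.1.2 = (T (τ⁻¹ j)).2.1.2 → i = j) :
    ∃ p q, IsRow T p ∧ IsCol T q ∧ τ = p * q := by
  classical
  -- The row permutation has to move i within its row to the column of τ⁻¹ i, so this cell must
  -- belong to the diagram. If i₀ violates this, let m be the length of the column b₀ of τ⁻¹ i₀;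
  -- then the row of i₀ is not among the first m, and counting the points of the first m rows by the
  -- columns of their images under τ⁻¹ gives a contradiction.
  have hcell : ∀ i, ((T i).2.1.1, (T (τ⁻¹ i)).2.1.2) ∈ Λ.toFun (T i).1 := by
    intro i₀
    by_contra hi₀
    obtain ⟨x, hx⟩ : ∃ x, x = (T i₀).1 := ⟨_, rfl⟩
    replace hi₀ : ((T i₀).2.1.1, (T (τ⁻¹ i₀)).2.1.2) ∉ Λ.toFun x := by
      subst hx
      exact hi₀
    set lam := Λ.toFun x with hlam
    set b₀ := (T (τ⁻¹ i₀)).2.1.2 with hb₀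
    set m := lam.colLen b₀ with hm
    rw [YoungDiagram.mem_iff_lt_colLen, not_lt] at hi₀
    have hmemT : ∀ i, (T i).1 = x → (T i).2.1 ∈ lam := by
      intro i hi
      subst hi
      exact (T i).2.2
    have hmemτ : ∀ i, (T i).1 = x → (T (τ⁻¹ i)).2.1 ∈ lam := fun i hi =>
      hmemT _ ((hτ i).trans hi)
    -- A b are the points of the first m rows that τ⁻¹ puts into column b, and C b are the cells of
    -- the first m rows in column b. Each row has at most one point in A b, whence |A b| ≤ min m
    -- (colLen b) ≤ |C b|; at b₀ the first inequality is strict, because i₀ also occupies a place of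
    -- this column. But every cell of the first m rows holds a point.
    let A : ℕ → Finset ι := fun b => Finset.univ.filter fun i =>
      ((T i).1 = x ∧ (T i).2.1.1 < m) ∧ (T (τ⁻¹ i)).2.1.2 = b
    let C : ℕ → Finset (ℕ × ℕ) := fun b => (lam.cells.filter fun c => c.1 < m).filter fun c =>
      c.2 = b
    have hcol : ∀ (S : Finset ι) (b : ℕ), (∀ i ∈ S, (T i).1 = x ∧ (T (τ⁻¹ i)).2.1.2 = b) →
        S.card ≤ lam.colLen b := by
      intro S b hS
      rw [← Finset.card_range (lam.colLen b)]
      refine Finset.card_le_card_of_injOn (fun i => (T (τ⁻¹ i)).2.1.1) ?_ ?_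
      · intro i hi
        have h1 := hmemτ i (hS i hi).1
        rw [Finset.coe_range, Set.mem_Iio, ← (hS i hi).2, ← YoungDiagram.mem_iff_lt_colLen]
        exact h1
      · intro i hi j hj hij
        refine τ⁻¹.injective (T.injective (cell_ext ?_ (Prod.ext hij ?_)))
        · rw [hτ, hτ, (hS i hi).1, (hS j hj).1]
        · rw [(hS i hi).2, (hS j hj).2]
    have hC : ∀ b, min m (lam.colLen b) ≤ (C b).card := by
      intro b
      rw [← Finset.card_range (min m (lam.colLen b))]
      refine Finset.card_le_card_of_injOn (fun a => (a, b)) ?_ ?_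
      · intro a ha
        rw [Finset.coe_range, Set.mem_Iio, lt_min_iff] at ha
        simp only [C, Finset.coe_filter, Finset.mem_filter, YoungDiagram.mem_cells,
          Set.mem_ofPred_eq, YoungDiagram.mem_iff_lt_colLen]
        exact ⟨⟨ha.2, ha.1⟩, trivial⟩
      · intro a _ a' _ h
        exact congrArg Prod.fst h
    have hA : ∀ b, (A b).card ≤ min m (lam.colLen b) := by
      intro b
      refine le_min ?_ (hcol _ b fun i hi => ?_)
      · rw [← Finset.card_range m]
        refine Finset.card_le_card_of_injOn (fun i => (T i).2.1.1) ?_ ?_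
        · intro i hi
          exact Finset.mem_coe.2 (Finset.mem_range.2 (Finset.mem_filter.1 hi).2.1.2)
        · intro i hi j hj hij
          have h1 := (Finset.mem_filter.1 hi).2
          have h2 := (Finset.mem_filter.1 hj).2
          exact hinj i j (h1.1.1.trans h2.1.1.symm) hij (h1.2.trans h2.2.symm)
      · have h1 := (Finset.mem_filter.1 hi).2
        exact ⟨h1.1.1, h1.2⟩
    have hA₀ : (A b₀).card < m := by
      have h1 : i₀ ∉ A b₀ := fun h => by
        have := (Finset.mem_filter.1 h).2.1.2
        omega
      have h2 := hcol (insert i₀ (A b₀)) b₀ fun i hi => by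
        rcases Finset.mem_insert.1 hi with rfl | hi
        · exact ⟨hx.symm, hb₀.symm⟩
        · have h1 := (Finset.mem_filter.1 hi).2
          exact ⟨h1.1.1, h1.2⟩
      rw [Finset.card_insert_of_notMem h1] at h2
      omega
    set t := lam.cells.image Prod.snd with ht
    have hsumA : (Finset.univ.filter fun i => (T i).1 = x ∧ (T i).2.1.1 < m).card =
        ∑ b ∈ t, (A b).card := by
      rw [Finset.card_eq_sum_card_fiberwise (f := fun i => (T (τ⁻¹ i)).2.1.2) (t := t)]
      · refine Finset.sum_congr rfl fun b _ => ?_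
        rw [Finset.filter_filter]
      · intro i hi
        exact Finset.mem_image_of_mem _ ((YoungDiagram.mem_cells _).2
          (hmemτ i (Finset.mem_filter.1 hi).2.1))
    have hsumC : (lam.cells.filter fun c => c.1 < m).card = ∑ b ∈ t, (C b).card :=
      Finset.card_eq_sum_card_fiberwise (f := Prod.snd) (t := t) fun c hc =>
        Finset.mem_image_of_mem _ (Finset.mem_filter.1 hc).1
    have hle : (lam.cells.filter fun c => c.1 < m).card ≤
        (Finset.univ.filter fun i => (T i).1 = x ∧ (T i).2.1.1 < m).card := by
      rw [← Finset.card_attach]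
      refine Finset.card_le_card_of_injOn
        (fun c => T.symm ⟨x, c.1, (Finset.mem_filter.1 c.2).1⟩) ?_ ?_
      · intro c _
        rw [Finset.mem_coe, Finset.mem_filter, T.apply_symm_apply]
        exact ⟨Finset.mem_univ _, rfl, (Finset.mem_filter.1 c.2).2⟩
      · intro c _ e _ h
        have h1 := T.symm.injective h
        rw [Sigma.mk.injEq] at h1
        exact Subtype.ext (congrArg (fun y : lam.cells => y.1) (eq_of_heq h1.2))
    have hlt : ∑ b ∈ t, (A b).card < ∑ b ∈ t, (C b).card := by
      refine Finset.sum_lt_sum (fun b _ => (hA b).trans (hC b)) ⟨b₀, ?_, ?_⟩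
      · exact Finset.mem_image_of_mem _ ((YoungDiagram.mem_cells _).2 (hmemτ i₀ hx.symm))
      · refine lt_of_lt_of_le ?_ (hC b₀)
        rwa [← hm, min_self]
    omega
  -- By `hinj` this map is injective, so it is a row permutation P. Then P τ preserves the columns,
  -- and τ = P⁻¹ (P τ).
  let ψ : ι → ι := fun i => T.symm ⟨(T i).1, ((T i).2.1.1, (T (τ⁻¹ i)).2.1.2),
    (YoungDiagram.mem_cells _).2 (hcell i)⟩
  have hψ : ∀ i, T (ψ i) = ⟨(T i).1, ((T i).2.1.1, (T (τ⁻¹ i)).2.1.2),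
    (YoungDiagram.mem_cells _).2 (hcell i)⟩ := fun i => T.apply_symm_apply _
  have h1 : ∀ i, (T (ψ i)).1 = (T i).1 := fun i => by rw [hψ]
  have h2 : ∀ i, (T (ψ i)).2.1.1 = (T i).2.1.1 := fun i => by rw [hψ]
  have h3 : ∀ i, (T (ψ i)).2.1.2 = (T (τ⁻¹ i)).2.1.2 := fun i => by rw [hψ]
  have hψinj : Function.Injective ψ := fun i j hij =>
    hinj i j (by rw [← h1 i, hij, h1]) (by rw [← h2 i, hij, h2]) (by rw [← h3 i, hij, h3])
  let P : Equiv.Perm ι := Equiv.ofBijective ψ (Finite.injective_iff_bijective.1 hψinj)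
  have hP : IsRow T P := fun i => ⟨h1 i, h2 i⟩
  refine ⟨P⁻¹, P * τ, hP.inv, fun i => ⟨?_, ?_⟩, by group⟩
  · rw [Equiv.Perm.mul_apply]
    refine (h1 _).trans ?_
    rw [← hτ, perm_inv_apply]
  · rw [Equiv.Perm.mul_apply]
    refine (h3 _).trans ?_
    rw [perm_inv_apply]

variable [DecidableEq ι]

/-- The functions with the symmetry of the symmetrizer. -/
structure IsYoungSymm (T : Filling ι Λ) (F : Equiv.Perm ι → ℂ) : Prop where
  row : ∀ p, IsRow T p → ∀ τ, F (p * τ) = F τ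
  col : ∀ q, IsCol T q → ∀ τ, F (τ * q) = ((Equiv.Perm.sign q : ℤ) : ℂ) * F τ
  supp : ∀ τ, F τ ≠ 0 → ∀ i, (T (τ⁻¹ i)).1 = (T i).1

lemma symmetrizer_supp {τ : Equiv.Perm ι} (h : symmetrizer T τ ≠ 0) :
    ∃ p q, IsRow T p ∧ IsCol T q ∧ p * q = τ := by
  obtain ⟨p, -, hp⟩ := Finset.exists_ne_zero_of_sum_ne_zero h
  obtain ⟨q, -, hq⟩ := Finset.exists_ne_zero_of_sum_ne_zero hp
  refine ⟨p, q, ?_⟩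
  by_contra hc
  rw [if_neg hc] at hq
  exact hq rfl

lemma isYoungSymm_symmetrizer (T : Filling ι Λ) : IsYoungSymm T (symmetrizer T) where
  row := by
    intro p₀ hp₀ τ
    unfold symmetrizer
    rw [← Equiv.sum_comp (Equiv.mulLeft p₀)]
    refine Finset.sum_congr rfl fun p _ => Finset.sum_congr rfl fun q _ => ?_
    have h1 : IsRow T (p₀ * p) ↔ IsRow T p :=
      ⟨fun h => by simpa using hp₀.inv.mul h, fun h => hp₀.mul h⟩
    have h2 : (IsRow T (p₀ * p) ∧ IsCol T q ∧ p₀ * p * q = p₀ * τ) ↔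
        (IsRow T p ∧ IsCol T q ∧ p * q = τ) := by rw [h1, mul_assoc, mul_right_inj]
    by_cases h : IsRow T p ∧ IsCol T q ∧ p * q = τ
    · exact (if_pos (h2.2 h)).trans (if_pos h).symm
    · exact (if_neg (mt h2.1 h)).trans (if_neg h).symm
  col := by
    intro q₀ hq₀ τ
    unfold symmetrizer
    rw [Finset.mul_sum]
    refine Finset.sum_congr rfl fun p _ => ?_
    rw [← Equiv.sum_comp (Equiv.mulRight q₀), Finset.mul_sum]
    refine Finset.sum_congr rfl fun q _ => ?_
    have h1 : IsCol T (q * q₀) ↔ IsCol T q :=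
      ⟨fun h => by simpa using h.mul hq₀.inv, fun h => h.mul hq₀⟩
    have h2 : (IsRow T p ∧ IsCol T (q * q₀) ∧ p * (q * q₀) = τ * q₀) ↔
        (IsRow T p ∧ IsCol T q ∧ p * q = τ) := by rw [h1, ← mul_assoc, mul_left_inj]
    by_cases h : IsRow T p ∧ IsCol T q ∧ p * q = τ
    · refine (if_pos (h2.2 h)).trans ?_
      rw [if_pos h, Equiv.coe_mulRight, map_mul]
      push_cast
      ring
    · rw [if_neg h, mul_zero]
      exact if_neg (mt h2.1 h)
  supp := by
    intro τ h i
    obtain ⟨p, q, hp, hq, rfl⟩ := symmetrizer_supp h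
    rw [mul_inv_rev, Equiv.Perm.mul_apply, (hq.inv _).1, (hp.inv _).1]

/-- If p q = 1, then p = q⁻¹ preserves rows and columns, so that p = q = 1 is the only term. -/
lemma symmetrizer_one (T : Filling ι Λ) : symmetrizer T 1 = 1 := by
  unfold symmetrizer
  rw [Finset.sum_eq_single 1, Finset.sum_eq_single 1]
  · rw [if_pos ⟨fun i => ⟨rfl, rfl⟩, fun i => ⟨rfl, rfl⟩, one_mul _⟩]
    simp
  · intro q _ hq
    exact if_neg fun h => hq (by simpa using h.2.2)
  · simp
  · intro p _ hp
    refine Finset.sum_eq_zero fun q _ => if_neg fun h => hp ?_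
    have : p = q⁻¹ := eq_inv_of_mul_eq_one_left h.2.2
    exact eq_one_of_isRow_isCol h.1 (this ▸ h.2.1.inv)
  · simp

/-- The symmetry determines the symmetrizer up to a factor. -/
theorem IsYoungSymm.eq_smul {F : Equiv.Perm ι → ℂ} (hF : IsYoungSymm T F) :
    F = F 1 • symmetrizer T := by
  -- Either τ = p q, and the symmetry expresses F τ by F 1; or τ⁻¹ sends two points of a row to one
  -- column, and their swap gives F τ = -F τ; or τ moves points between different diagrams and the
  -- support condition applies.
  have key : ∀ τ, (∃ p q, IsRow T p ∧ IsCol T q ∧ τ = p * q) ∨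
      ∀ F, IsYoungSymm T F → F τ = 0 := by
    intro τ
    by_cases hτ : ∀ i, (T (τ⁻¹ i)).1 = (T i).1
    · by_cases hinj : ∀ i j, (T i).1 = (T j).1 → (T i).2.1.1 = (T j).2.1.1 →
          (T (τ⁻¹ i)).2.1.2 = (T (τ⁻¹ j)).2.1.2 → i = j
      · exact Or.inl (exists_isRow_isCol τ hτ hinj)
      · right
        push Not at hinj
        obtain ⟨i, j, h1, h2, h3, hij⟩ := hinj
        intro F hF
        have e1 := hF.row _ (swap_isRow h1 h2) τ
        have e2 := hF.col _ (swap_isCol (i := τ⁻¹ i) (j := τ⁻¹ j) (by rw [hτ, hτ, h1]) h3) τ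
        have e3 : Equiv.swap i j * τ = τ * Equiv.swap (τ⁻¹ i) (τ⁻¹ j) := by
          rw [Equiv.mul_swap_eq_swap_mul]; simp
        rw [e3, e2, Equiv.Perm.sign_swap (fun h => hij (τ⁻¹.injective h))] at e1
        simp only [Units.val_neg, Units.val_one, Int.cast_neg, Int.cast_one, neg_mul,
          one_mul] at e1
        exact self_eq_neg.1 e1.symm
    · right
      intro F hF
      by_contra h
      exact hτ (hF.supp τ h)
  funext τ
  rcases key τ with ⟨p, q, hp, hq, rfl⟩ | h
  · have e : ∀ F, IsYoungSymm T F → F (p * q) = ((Equiv.Perm.sign q : ℤ) : ℂ) * F 1 :=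
      fun F hF => by rw [hF.row p hp, ← hF.col q hq, one_mul]
    rw [Pi.smul_apply, e F hF, e _ (isYoungSymm_symmetrizer T), symmetrizer_one, smul_eq_mul]
    ring
  · rw [Pi.smul_apply, h F hF, h _ (isYoungSymm_symmetrizer T), smul_zero]

/-- The product of the group algebra. -/
def conv (a b : Equiv.Perm ι → ℂ) (τ : Equiv.Perm ι) : ℂ := ∑ σ, a σ * b (σ⁻¹ * τ)

lemma cmat_conv (a b : Equiv.Perm ι → ℂ) : cmat (conv a b) = cmat a * cmat b := by
  ext σ τ
  rw [Matrix.mul_apply, ← Equiv.sum_comp (Equiv.mulLeft σ)]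
  simp [cmat, conv, mul_assoc]

lemma conv_assoc (a b c : Equiv.Perm ι → ℂ) : conv (conv a b) c = conv a (conv b c) :=
  cmat_injective (by simp only [cmat_conv, Matrix.mul_assoc])

lemma conv_eq_sum (a b : Equiv.Perm ι → ℂ) : conv a b = ∑ σ, a σ • permFun σ b := by
  funext τ
  simp [conv, permFun]

lemma conv_row {a b : Equiv.Perm ι → ℂ} (ha : ∀ p, IsRow T p → ∀ τ, a (p * τ) = a τ)
    (p : Equiv.Perm ι) (hp : IsRow T p) (τ : Equiv.Perm ι) : conv a b (p * τ) = conv a b τ := by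
  unfold conv
  rw [← Equiv.sum_comp (Equiv.mulLeft p)]
  refine Finset.sum_congr rfl fun σ _ => ?_
  simp [ha p hp, mul_assoc]

lemma conv_col {a b : Equiv.Perm ι → ℂ} {q : Equiv.Perm ι} {s : ℂ}
    (hb : ∀ τ, b (τ * q) = s * b τ) (τ : Equiv.Perm ι) : conv a b (τ * q) = s * conv a b τ := by
  unfold conv
  rw [Finset.mul_sum]
  refine Finset.sum_congr rfl fun σ _ => ?_
  rw [← mul_assoc, hb]
  ring

lemma conv_supp {a b : Equiv.Perm ι → ℂ} (ha : ∀ τ, a τ ≠ 0 → ∀ i, (T (τ⁻¹ i)).1 = (T i).1)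
    (hb : ∀ τ, b τ ≠ 0 → ∀ i, (T (τ⁻¹ i)).1 = (T i).1) (τ : Equiv.Perm ι)
    (h : conv a b τ ≠ 0) (i : ι) : (T (τ⁻¹ i)).1 = (T i).1 := by
  obtain ⟨σ, -, hσ⟩ := Finset.exists_ne_zero_of_sum_ne_zero h
  have h1 := ha σ (left_ne_zero_of_mul hσ) i
  have h2 := hb _ (right_ne_zero_of_mul hσ) (σ⁻¹ i)
  rw [← h1, ← h2]
  simp

/-- The symmetrizer is a multiple of an idempotent. -/
theorem exists_conv_symmetrizer (T : Filling ι Λ) :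
    ∃ c : ℂ, c ≠ 0 ∧ conv (symmetrizer T) (symmetrizer T) = c • symmetrizer T := by
  have hs := isYoungSymm_symmetrizer T
  have h : IsYoungSymm T (conv (symmetrizer T) (symmetrizer T)) :=
    ⟨conv_row hs.row, fun q hq => conv_col (hs.col q hq), conv_supp hs.supp hs.supp⟩
  refine ⟨_, fun h0 => ?_, h.eq_smul⟩
  have h1 := h.eq_smul
  rw [h0, zero_smul] at h1
  -- If the square of the symmetrizer were zero, the right multiplication by it would be nilpotent.
  -- But its trace is the order of the group, because the symmetrizer has the value 1 at the
  -- identity.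
  have h2 : IsNilpotent (cmat (symmetrizer T)) :=
    ⟨2, by rw [pow_two, ← cmat_conv, h1, cmat_zero]⟩
  have h3 := (Matrix.isNilpotent_trace_of_isNilpotent h2).eq_zero
  simp [Matrix.trace, cmat, symmetrizer_one] at h3

lemma exists_conv_of_mem {w : Equiv.Perm ι → ℂ} (hw : w ∈ youngModule T) :
    ∃ a, w = conv a (symmetrizer T) := by
  have h1 : ∀ σ, symmetrizer T ∘ (fun τ => σ⁻¹ * τ) = translate T σ := fun σ => rfl
  induction hw using Submodule.span_induction with
  | mem w hw =>
    obtain ⟨σ, rfl⟩ := hw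
    refine ⟨Pi.single σ 1, ?_⟩
    funext τ
    unfold conv
    rw [Finset.sum_eq_single σ]
    · simp [translate]
    · intro ρ _ hρ; simp [hρ]
    · simp
  | zero => exact ⟨0, by funext τ; simp [conv]⟩
  | add x y _ _ hx hy =>
    obtain ⟨a, rfl⟩ := hx
    obtain ⟨b, rfl⟩ := hy
    exact ⟨a + b, by funext τ; simp [conv, add_mul, Finset.sum_add_distrib]⟩
  | smul c x _ hx =>
    obtain ⟨a, rfl⟩ := hx
    exact ⟨c • a, by funext τ; simp [conv, Finset.mul_sum, mul_assoc]⟩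

open scoped ComplexOrder in
/-- The module `V_Λ` is irreducible. -/
theorem youngModule_irreducible {N : Submodule ℂ (Equiv.Perm ι → ℂ)} (hN : N ≤ youngModule T)
    (h0 : N ≠ ⊥) (hperm : ∀ σ, ∀ F ∈ N, permFun σ F ∈ N) (hdiag : ∀ i, ∀ F ∈ N, diagFun T i F ∈ N) :
    N = youngModule T := by
  classical
  have hconv : ∀ a, ∀ w ∈ N, conv a w ∈ N := fun a w hw => by
    rw [conv_eq_sum]
    exact Submodule.sum_mem _ fun σ _ => N.smul_mem _ (hperm σ w hw)
  -- Among the elements of N that do not vanish at 1, take one with the smallest support. If τ in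
  -- the support changed the diagram of some point i, then A_i minus its eigenvalue at τ would
  -- remove τ from the support and keep 1.
  obtain ⟨w, hwN, hw1, hwS⟩ : ∃ w ∈ N, w 1 ≠ 0 ∧ ∀ τ, w τ ≠ 0 → ∀ i, (T (τ⁻¹ i)).1 = (T i).1 := by
    let P : ℕ → Prop := fun m => ∃ w ∈ N, w 1 ≠ 0 ∧
      (Finset.univ.filter fun τ => w τ ≠ 0).card = m
    have hex : ∃ m, P m := by
      obtain ⟨w, hw, hw0⟩ := Submodule.exists_mem_ne_zero_of_ne_bot h0
      obtain ⟨σ, hσ⟩ := Function.ne_iff.1 hw0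
      exact ⟨_, permFun σ⁻¹ w, hperm _ w hw, by simpa [permFun] using hσ, rfl⟩
    obtain ⟨w, hwN, hw1, hm⟩ := Nat.find_spec hex
    refine ⟨w, hwN, hw1, fun τ hτ i => ?_⟩
    by_contra hne
    set w' := diagFun T i w - (((T (τ⁻¹ i)).1 : ℝ) : ℂ) • w with hw'
    have hval : ∀ ρ, w' ρ = ((((T (ρ⁻¹ i)).1 : ℝ) : ℂ) - (((T (τ⁻¹ i)).1 : ℝ) : ℂ)) * w ρ := by
      intro ρ
      simp only [hw', diagFun, LinearMap.coe_mk, AddHom.coe_mk, Pi.sub_apply, Pi.smul_apply,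
        smul_eq_mul]
      ring
    have hw'N : w' ∈ N := N.sub_mem (hdiag i w hwN) (N.smul_mem _ hwN)
    have hw'1 : w' 1 ≠ 0 := by
      rw [hval]
      refine mul_ne_zero (sub_ne_zero.2 fun h => hne ?_) hw1
      simpa using (Complex.ofReal_inj.1 h).symm
    refine absurd (Nat.find_min' hex ⟨w', hw'N, hw'1, rfl⟩) (not_le.2 ?_)
    rw [← hm]
    refine Finset.card_lt_card ((Finset.ssubset_iff_of_subset ?_).2 ⟨τ, by simpa using hτ, ?_⟩)
    · intro ρ hρ
      simp only [Finset.mem_filter, Finset.mem_univ, true_and] at hρ ⊢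
      intro h
      exact hρ (by rw [hval, h, mul_zero])
    · simp [hval]
  obtain ⟨a, ha⟩ := exists_conv_of_mem (hN hwN)
  have hs := isYoungSymm_symmetrizer T
  -- With s the symmetrizer and w = a s, the product x = s w* w has the row symmetry by its left
  -- factor and the column symmetry by the right factor of w, so it is a multiple of s. It is not
  -- zero, since a x = w w* w and w w* w = 0 would imply w = 0.
  set x := conv (symmetrizer T) (conv (gstar w) w) with hx
  have hxN : x ∈ N := hconv _ _ (hconv _ _ hwN)
  have hstar : ∀ τ, gstar w τ ≠ 0 → ∀ i, (T (τ⁻¹ i)).1 = (T i).1 := fun τ hτ i => by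
    have h1 := hwS τ⁻¹ (fun h => hτ (by simp [gstar, h])) (τ⁻¹ i)
    simpa using h1.symm
  have hxY : IsYoungSymm T x := by
    refine ⟨conv_row hs.row, fun q hq => conv_col (conv_col fun τ => ?_),
      conv_supp hs.supp (conv_supp hstar hwS)⟩
    rw [ha]
    exact conv_col (hs.col q hq) τ
  have hx0 : x ≠ 0 := by
    intro h
    have h1 : conv a x = 0 := by rw [h]; funext τ; simp [conv]
    rw [hx, ← conv_assoc, ← ha] at h1
    have h2 := congrArg cmat h1
    rw [cmat_conv, cmat_conv, cmat_gstar, cmat_zero, ← Matrix.mul_assoc,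
      Matrix.self_mul_conjTranspose_mul_eq_zero, Matrix.conjTranspose_mul_self_eq_zero,
      ← cmat_zero] at h2
    exact hw1 (congrFun (cmat_injective h2) 1)
  have hx1 : x 1 ≠ 0 := fun h => hx0 (by rw [hxY.eq_smul, h, zero_smul])
  have hcN : symmetrizer T ∈ N := by
    have : symmetrizer T = (x 1)⁻¹ • x := by
      rw [hxY.eq_smul]
      simp [symmetrizer_one, hx1]
    rw [this]
    exact N.smul_mem _ hxN
  refine le_antisymm hN (Submodule.span_le.2 ?_)
  rintro _ ⟨σ, rfl⟩
  exact hperm σ _ hcN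

end Young

/-! ### The Hilbert space tensor product -/

section Tensor

variable {H₁ H₂ : Type*} [NormedAddCommGroup H₁] [InnerProductSpace ℂ H₁]
  [NormedAddCommGroup H₂] [InnerProductSpace ℂ H₂]

/-- The pure tensors. -/
def pt (x : H₁) (y : H₂) : HT H₁ H₂ := ((x ⊗ₜ[ℂ] y : H₁ ⊗[ℂ] H₂) : HT H₁ H₂)

lemma inner_pt (x x' : H₁) (y y' : H₂) :
    inner ℂ (pt x y) (pt x' y') = inner ℂ x x' * inner ℂ y y' := by
  rw [pt, pt, UniformSpace.Completion.inner_coe, TensorProduct.inner_tmul]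

lemma norm_pt (x : H₁) (y : H₂) : ‖pt x y‖ = ‖x‖ * ‖y‖ := by
  rw [pt, UniformSpace.Completion.norm_coe, TensorProduct.norm_tmul]

lemma pt_add_left (x x' : H₁) (y : H₂) : pt (x + x') y = pt x y + pt x' y := by
  rw [pt, TensorProduct.add_tmul, UniformSpace.Completion.coe_add]; rfl

lemma pt_add_right (x : H₁) (y y' : H₂) : pt x (y + y') = pt x y + pt x y' := by
  rw [pt, TensorProduct.tmul_add, UniformSpace.Completion.coe_add]; rfl

lemma pt_smul_left (c : ℂ) (x : H₁) (y : H₂) : pt (c • x) y = c • pt x y := by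
  rw [pt, ← TensorProduct.smul_tmul', UniformSpace.Completion.coe_smul]; rfl

lemma pt_smul_right (c : ℂ) (x : H₁) (y : H₂) : pt x (c • y) = c • pt x y := by
  rw [pt, TensorProduct.tmul_smul, UniformSpace.Completion.coe_smul]; rfl

/-- Pure tensors as a bilinear map. -/
def ptₗ : H₁ →ₗ[ℂ] H₂ →ₗ[ℂ] HT H₁ H₂ :=
  LinearMap.mk₂ ℂ pt pt_add_left pt_smul_left pt_add_right pt_smul_right

@[simp] lemma tensorOp_pt (π₁ : URep H₁) (π₂ : URep H₂) (g₁ g₂ : GE) (x : H₁) (y : H₂) :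
    tensorOp π₁ π₂ g₁ g₂ (pt x y) = pt (π₁ g₁ x) (π₂ g₂ y) := by
  rw [pt, tensorOp_coe]; rfl

lemma eq_zero_of_inner_pt {z : HT H₁ H₂} (h : ∀ x y, inner ℂ z (pt x y) = 0) : z = 0 := by
  have h1 : ∀ t : H₁ ⊗[ℂ] H₂, inner ℂ z (t : HT H₁ H₂) = 0 := by
    intro t
    induction t using TensorProduct.induction_on with
    | zero => rw [UniformSpace.Completion.coe_zero, inner_zero_right]
    | tmul x y => exact h x y
    | add t t' ht ht' => rw [UniformSpace.Completion.coe_add, inner_add_right, ht, ht', add_zero]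
  rw [← inner_self_eq_zero (𝕜 := ℂ)]
  refine UniformSpace.Completion.induction_on
    (p := fun w : HT H₁ H₂ => inner ℂ z w = 0) z ?_ h1
  exact isClosed_eq (by fun_prop) continuous_const

lemma tensorOp_fixedTensor {π₁ : URep H₁} {π₂ : URep H₂} {a b : ℕ} {g₁ g₂ : GE}
    (h₁ : g₁ ∈ KEn a) (h₂ : g₂ ∈ KEn b) {v : HT H₁ H₂} (hv : v ∈ fixedTensor π₁ π₂ a b) :
    tensorOp π₁ π₂ g₁ g₂ v = v := by
  have hc : IsClosed {v | tensorOp π₁ π₂ g₁ g₂ v = v} :=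
    isClosed_eq (tensorOp π₁ π₂ g₁ g₂).continuous continuous_id
  refine closure_minimal ?_ hc hv
  intro v hv
  change v ∈ LinearMap.eqLocus (tensorOp π₁ π₂ g₁ g₂).toLinearMap LinearMap.id
  refine Submodule.span_le.2 ?_ hv
  rintro _ ⟨x, hx, y, hy, rfl⟩
  change tensorOp π₁ π₂ g₁ g₂ (pt x y) = pt x y
  rw [tensorOp_pt, hx _ h₁, hy _ h₂]

lemma pt_mem_fixedTensor {π₁ : URep H₁} {π₂ : URep H₂} {a b : ℕ} {x : H₁} {y : H₂}
    (hx : x ∈ fixedSpace π₁ a) (hy : y ∈ fixedSpace π₂ b) : pt x y ∈ fixedTensor π₁ π₂ a b :=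
  subset_closure (Submodule.subset_span ⟨x, hx, y, hy, rfl⟩)

lemma fixedTensor_eq_bot {π₁ : URep H₁} {π₂ : URep H₂} {a b : ℕ}
    (h : fixedSpace π₁ a = ⊥ ∨ fixedSpace π₂ b = ⊥) : fixedTensor π₁ π₂ a b = ⊥ := by
  have h1 : Submodule.span ℂ {z | ∃ x ∈ fixedSpace π₁ a, ∃ y ∈ fixedSpace π₂ b,
      z = ((x ⊗ₜ[ℂ] y : H₁ ⊗[ℂ] H₂) : HT H₁ H₂)} = ⊥ := by
    rw [Submodule.span_eq_bot]
    rintro _ ⟨x, hx, y, hy, rfl⟩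
    rcases h with h | h
    · rw [h, Submodule.mem_bot] at hx
      rw [hx, TensorProduct.zero_tmul, UniformSpace.Completion.coe_zero]
    · rw [h, Submodule.mem_bot] at hy
      rw [hy, TensorProduct.tmul_zero, UniformSpace.Completion.coe_zero]
  rw [fixedTensor, h1]
  exact (isClosed_singleton (x := (0 : HT H₁ H₂))).submodule_topologicalClosure_eq

lemma span_range_eq_map₂ (π₁ : URep H₁) (π₂ : URep H₂) (a b : ℕ) :
    Submodule.span ℂ {z | ∃ x ∈ fixedSpace π₁ a, ∃ y ∈ fixedSpace π₂ b,
      z = ((x ⊗ₜ[ℂ] y : H₁ ⊗[ℂ] H₂) : HT H₁ H₂)} =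
      Submodule.map₂ ptₗ (fixedSpace π₁ a) (fixedSpace π₂ b) := by
  rw [Submodule.map₂_eq_span_image2]
  congr 1
  ext z
  simp only [Set.mem_ofPred_eq, Set.mem_image2, SetLike.mem_coe]
  exact ⟨fun ⟨x, hx, y, hy, h⟩ => ⟨x, hx, y, hy, h.symm⟩,
    fun ⟨x, hx, y, hy, h⟩ => ⟨x, hx, y, hy, h.symm⟩⟩

lemma finiteDimensional_map₂ (π₁ : URep H₁) (π₂ : URep H₂) (a b : ℕ)
    [FiniteDimensional ℂ (fixedSpace π₁ a)] [FiniteDimensional ℂ (fixedSpace π₂ b)] :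
    FiniteDimensional ℂ (Submodule.map₂ (ptₗ (H₁ := H₁) (H₂ := H₂)) (fixedSpace π₁ a)
      (fixedSpace π₂ b)) :=
  Module.Finite.iff_fg.2 ((Module.Finite.iff_fg.1 inferInstance).map₂ _
    (Module.Finite.iff_fg.1 inferInstance))

/-- In the finite dimensional case, the tensor product of the spaces of invariant vectors is
spanned by the pure tensors. -/
lemma fixedTensor_eq_map₂ (π₁ : URep H₁) (π₂ : URep H₂) (a b : ℕ)
    [FiniteDimensional ℂ (fixedSpace π₁ a)] [FiniteDimensional ℂ (fixedSpace π₂ b)] :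
    fixedTensor π₁ π₂ a b = Submodule.map₂ ptₗ (fixedSpace π₁ a) (fixedSpace π₂ b) := by
  have := finiteDimensional_map₂ π₁ π₂ a b
  rw [fixedTensor, span_range_eq_map₂]
  exact (Submodule.closed_of_finiteDimensional _).submodule_topologicalClosure_eq

/-- The bilinear form `(x, y) ↦ (z, x ⊗ y)` is given by vectors of the factors. -/
lemma exists_riesz_left [CompleteSpace H₁] (z : HT H₁ H₂) (y : H₂) :
    ∃ u : H₁, ∀ x, inner ℂ u x = inner ℂ z (pt x y) := by
  let ψ : H₁ →L[ℂ] ℂ := (((innerSL ℂ z).toLinearMap).comp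
    ((ptₗ (H₁ := H₁) (H₂ := H₂)).flip y)).mkContinuous (‖z‖ * ‖y‖) fun x => by
      refine (norm_inner_le_norm (𝕜 := ℂ) z (pt x y)).trans ?_
      rw [norm_pt]
      exact le_of_eq (by ring)
  exact ⟨(InnerProductSpace.toDual ℂ H₁).symm ψ, fun x => by
    rw [InnerProductSpace.toDual_symm_apply]; rfl⟩

lemma exists_riesz_right [CompleteSpace H₂] (z : HT H₁ H₂) (x : H₁) :
    ∃ u : H₂, ∀ y, inner ℂ u y = inner ℂ z (pt x y) := by
  let ψ : H₂ →L[ℂ] ℂ := (((innerSL ℂ z).toLinearMap).comp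
    ((ptₗ (H₁ := H₁) (H₂ := H₂)) x)).mkContinuous (‖z‖ * ‖x‖) fun y => by
      refine (norm_inner_le_norm (𝕜 := ℂ) z (pt x y)).trans ?_
      rw [norm_pt]
      exact le_of_eq (by ring)
  exact ⟨(InnerProductSpace.toDual ℂ H₂).symm ψ, fun y => by
    rw [InnerProductSpace.toDual_symm_apply]; rfl⟩

lemma eq_of_inner_fixed {H : Type*} [NormedAddCommGroup H] [InnerProductSpace ℂ H]
    {K : Submodule ℂ H} [K.HasOrthogonalProjection] {u : H} (hu : u ∈ K) (x : H) :
    inner ℂ u x = inner ℂ u (K.starProjection x) := by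
  rw [← sub_eq_zero, ← inner_sub_right]
  exact Submodule.sub_starProjection_mem_orthogonal x u hu

/-- The vectors of `H₁ ⊗ H₂` that are invariant under `K_a × K_b`. -/
theorem mem_fixedTensor [CompleteSpace H₁] [CompleteSpace H₂] {π₁ : URep H₁} {π₂ : URep H₂}
    {a b : ℕ} {z : HT H₁ H₂}
    (hz : ∀ g₁ ∈ KEn a, ∀ g₂ ∈ KEn b, tensorOp π₁ π₂ g₁ g₂ z = z) :
    z ∈ fixedTensor π₁ π₂ a b := by
  have hc1 : CompleteSpace (fixedSpace π₁ a) := (isClosed_fixedSpace π₁ a).completeSpace_coe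
  have hc2 : CompleteSpace (fixedSpace π₂ b) := (isClosed_fixedSpace π₂ b).completeSpace_coe
  have hcW : CompleteSpace (fixedTensor π₁ π₂ a b) :=
    (Submodule.isClosed_topologicalClosure _).completeSpace_coe
  set W := fixedTensor π₁ π₂ a b with hW
  set w := z - W.starProjection z with hw
  have hwW : w ∈ Wᗮ := Submodule.sub_starProjection_mem_orthogonal z
  have hwinv : ∀ g₁ ∈ KEn a, ∀ g₂ ∈ KEn b, tensorOp π₁ π₂ g₁ g₂ w = w := fun g₁ h₁ g₂ h₂ => by
    rw [hw, map_sub, hz g₁ h₁ g₂ h₂, tensorOp_fixedTensor h₁ h₂ (Submodule.starProjection_apply_mem _ _)]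
  have hw0 : w = 0 := by
    refine eq_zero_of_inner_pt fun x y => ?_
    -- For fixed y the functional x ↦ (w, x ⊗ y) is given by a vector of H₁ that inherits the
    -- K_a-invariance of w, so only the invariant part of x counts. The same holds for y, and w is
    -- orthogonal to the tensors of invariant vectors.
    have h1 : inner ℂ w (pt x y) = inner ℂ w (pt ((fixedSpace π₁ a).starProjection x) y) := by
      obtain ⟨u, hu⟩ := exists_riesz_left w y
      have hu' : u ∈ fixedSpace π₁ a := by
        intro k hk
        refine ext_inner_right ℂ fun x => ?_
        rw [← LinearIsometryEquiv.inner_map_map (π₁ k⁻¹), rep_inv_rep, hu, hu]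
        conv_rhs => rw [← hwinv k hk 1 (one_mem _)]
        rw [← LinearIsometry.inner_map_map (tensorOp π₁ π₂ k 1) w, tensorOp_pt, rep_rep_inv,
          rep_one]
      rw [← hu, ← hu, eq_of_inner_fixed hu']
    have h2 : ∀ x, inner ℂ w (pt x y) =
        inner ℂ w (pt x ((fixedSpace π₂ b).starProjection y)) := by
      intro x
      obtain ⟨u, hu⟩ := exists_riesz_right w x
      have hu' : u ∈ fixedSpace π₂ b := by
        intro k hk
        refine ext_inner_right ℂ fun y => ?_
        rw [← LinearIsometryEquiv.inner_map_map (π₂ k⁻¹), rep_inv_rep, hu, hu]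
        conv_rhs => rw [← hwinv 1 (one_mem _) k hk]
        rw [← LinearIsometry.inner_map_map (tensorOp π₁ π₂ 1 k) w, tensorOp_pt, rep_rep_inv,
          rep_one]
      rw [← hu, ← hu, eq_of_inner_fixed hu']
    rw [h1, h2, ← inner_conj_symm, hwW _ (pt_mem_fixedTensor (Submodule.starProjection_apply_mem _ _)
      (Submodule.starProjection_apply_mem _ _)), map_zero]
  rw [sub_eq_zero.1 hw0]
  exact Submodule.starProjection_apply_mem _ _

end Tensor

/-! ### The measure of cylinders in `Y` -/

lemma omega_cyl_ne_top (p : Weights) (n : ℕ) (s : NZ → Fin 2) : omega p (cyl n s) ≠ ∞ := by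
  rw [omega_cyl]
  exact ENNReal.prod_ne_top fun _ _ => ENNReal.ofReal_ne_top

lemma omega_cyl_ne_zero (p : Weights) (n : ℕ) (s : NZ → Fin 2) : omega p (cyl n s) ≠ 0 := by
  rw [omega_cyl, Finset.prod_ne_zero_iff]
  intro i _
  rw [Ne, ENNReal.ofReal_eq_zero, not_le]
  exact Real.sqrt_pos.2 (p.w_pos _)

lemma omegaY_cyl_ne_top (p : Weights) (n : ℕ) (s : NZ → Fin 2) : omegaY p (cyl n s) ≠ ∞ :=
  ne_top_of_le_ne_top (omega_cyl_ne_top p n s) (Measure.restrict_apply_le _ _)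

/-- The function that agrees with `s`, except for the value `c` at `±(n + 1)`. -/
def extend (n : ℕ) (s : NZ → Fin 2) (c : Fin 2) : NZ → Fin 2 :=
  fun i => if i = pos n ∨ i = -pos n then c else s i

lemma extend_pos (n : ℕ) (s : NZ → Fin 2) (c : Fin 2) : extend n s c (pos n) = c := by
  simp [extend]

lemma extend_neg (n : ℕ) (s : NZ → Fin 2) (c : Fin 2) : extend n s c (-pos n) = c := by
  simp [extend]

lemma pos_notMem_box (n : ℕ) : pos n ∉ box n ∧ -pos n ∉ box n := by
  rw [mem_box, mem_box, abs_pos', abs_neg_pos]; omega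

lemma extend_of_mem {n : ℕ} (s : NZ → Fin 2) (c : Fin 2) {i : NZ} (hi : i ∈ box n) :
    extend n s c i = s i := by
  rw [extend, if_neg]
  rintro (rfl | rfl)
  · exact (pos_notMem_box n).1 hi
  · exact (pos_notMem_box n).2 hi

lemma cyl_inter_pos (n : ℕ) (s : NZ → Fin 2) (c : Fin 2) :
    cyl n s ∩ {f | f.1 (pos n) = c} = cyl (n + 1) (extend n s c) := by
  ext f
  constructor
  · rintro ⟨⟨h1, h2⟩, h3⟩
    refine ⟨fun i hi => ?_, h2.mono n.le_succ⟩
    rw [box_succ, Finset.mem_insert, Finset.mem_insert] at hi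
    rcases hi with rfl | rfl | hi
    · rw [extend_pos]; exact h3
    · rw [extend_neg, ← h2 (pos n) (by rw [abs_pos']; omega)]; exact h3
    · rw [extend_of_mem _ _ hi, h1 i hi]
  · rintro ⟨h1, h2⟩
    have hp := h1 (pos n) (by rw [mem_box, abs_pos']; push_cast; omega)
    have hm := h1 (-pos n) (by rw [mem_box, abs_neg_pos]; push_cast; omega)
    rw [extend_pos] at hp
    rw [extend_neg] at hm
    refine ⟨⟨fun i hi => ?_, fun i hi => ?_⟩, hp⟩
    · rw [h1 i (by rw [mem_box] at hi ⊢; push_cast; omega), extend_of_mem _ _ hi]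
    · by_cases h : ((n + 1 : ℕ) : ℤ) < |(i : ℤ)|
      · exact h2 i h
      · obtain ⟨k, rfl | rfl⟩ := eq_pos_or i
        · rw [abs_pos'] at hi h
          obtain rfl : k = n := by push_cast at h; omega
          rw [hp, hm]
        · rw [abs_neg_pos] at hi h
          obtain rfl : k = n := by push_cast at h; omega
          rw [hm, NZ.neg_neg, hp]

/-- Each of the two points ±(n + 1) contributes the square root of the weight. -/
lemma omega_cyl_extend (p : Weights) (n : ℕ) (s : NZ → Fin 2) (c : Fin 2) :
    omega p (cyl (n + 1) (extend n s c)) = ENNReal.ofReal (p.w c) * omega p (cyl n s) := by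
  rw [omega_cyl, omega_cyl, box_succ, Finset.prod_insert, Finset.prod_insert (pos_notMem_box n).2,
    extend_pos, extend_neg, ← mul_assoc, ← ENNReal.ofReal_mul (Real.sqrt_nonneg _),
    Real.mul_self_sqrt (p.w_pos c).le]
  · congr 1
    exact Finset.prod_congr rfl fun i hi => by rw [extend_of_mem _ _ hi]
  · rw [Finset.mem_insert, not_or]
    exact ⟨pos_ne_neg n n, (pos_notMem_box n).1⟩

lemma Weights.w_lt_one (p : Weights) (c : Fin 2) : p.w c < 1 := by
  have h1 := p.pos₁
  have h2 := p.pos₂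
  have h3 := p.sum_eq
  fin_cases c
  · change p.p₁ < 1; linarith
  · change p.p₂ < 1; linarith

/-- Prescribing r further labels multiplies the measure by the r-th power of a weight less than 1.
-/
lemma omega_const_null (p : Weights) (n : ℕ) (s : NZ → Fin 2) (c : Fin 2) :
    omega p (cyl n s ∩ {f | ∀ m, n ≤ m → f.1 (pos m) = c}) = 0 := by
  have key : ∀ r : ℕ, ∃ t, cyl n s ∩ {f | ∀ m, n ≤ m → f.1 (pos m) = c} ⊆ cyl (n + r) t ∧
      omega p (cyl (n + r) t) = ENNReal.ofReal (p.w c) ^ r * omega p (cyl n s) := by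
    intro r
    induction r with
    | zero => exact ⟨s, Set.inter_subset_left, by simp⟩
    | succ r ih =>
      obtain ⟨t, h1, h2⟩ := ih
      refine ⟨extend (n + r) t c, ?_, ?_⟩
      · rw [← add_assoc, ← cyl_inter_pos]
        exact fun f hf => ⟨h1 hf, hf.2 _ (by omega)⟩
      · rw [← add_assoc, omega_cyl_extend, h2, pow_succ]
        ring
  have hlim : Tendsto (fun r : ℕ => ENNReal.ofReal (p.w c) ^ r * omega p (cyl n s)) atTop
      (𝓝 (0 * omega p (cyl n s))) := by
    refine ENNReal.Tendsto.mul_const (ENNReal.tendsto_pow_atTop_nhds_zero_of_lt_one ?_)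
      (Or.inr (omega_cyl_ne_top p n s))
    rw [ENNReal.ofReal_lt_one]
    exact p.w_lt_one c
  rw [zero_mul] at hlim
  refine le_antisymm (ge_of_tendsto' hlim fun r => ?_) zero_le
  obtain ⟨t, h1, h2⟩ := key r
  rw [← h2]
  exact measure_mono h1

/-- If f⁻¹(j) is finite, all labels far out are j + 1, the other element of `Fin 2`. The cylinder
from which on this happens is one of countably many, and `omega_const_null` applies in each. -/
lemma ae_infinite_fiber (p : Weights) (j : Fin 2) : ∀ᵐ f ∂(omega p), {i | f.1 i = j}.Infinite := by
  have hsub : {f : X | ¬ {i | f.1 i = j}.Infinite} ⊆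
      ⋃ t ∈ cyls 0, t ∩ {f | ∃ n s, t = cyl n s ∧ ∀ m, n ≤ m → f.1 (pos m) = j + 1} := by
    intro f hf
    rw [Set.mem_ofPred_eq, Set.not_infinite] at hf
    obtain ⟨n₀, hn₀⟩ := exists_bound hf
    obtain ⟨n, hn, hfn⟩ := exists_cyl n₀ f
    refine Set.mem_biUnion (x := cyl n f.1) ⟨n, f.1, n.zero_le, rfl⟩
      ⟨hfn, n, f.1, rfl, fun m hm => ?_⟩
    have := hn₀ m (by omega) (pos m) (by rw [abs_pos']; omega)
    exact fin_two_flip.2 (Ne.symm this)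
  refine measure_mono_null hsub ((measure_biUnion_null_iff (cyls_countable 0)).2 ?_)
  rintro _ ⟨n, s, -, rfl⟩
  by_cases hne : (cyl n s).Nonempty
  · have : ∀ r : ℕ, omega p (cyl n s ∩ {f | ∀ m, r ≤ m → f.1 (pos m) = j + 1}) = 0 := by
      intro r
      have hs : cyl n s ∩ {f | ∀ m, r ≤ m → f.1 (pos m) = j + 1} ⊆
          ⋃ t ∈ cyls r, t ∩ {f | ∃ n s, r ≤ n ∧ t = cyl n s ∧ f ∈ cyl n s ∧
            ∀ m, r ≤ m → f.1 (pos m) = j + 1} := by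
        intro f hf
        obtain ⟨n', hn', hfn⟩ := exists_cyl r f
        exact Set.mem_biUnion (x := cyl n' f.1) ⟨n', f.1, hn', rfl⟩
          ⟨hfn, n', f.1, hn', rfl, hfn, hf.2⟩
      refine measure_mono_null hs ((measure_biUnion_null_iff (cyls_countable r)).2 ?_)
      rintro _ ⟨n', s', hn', rfl⟩
      refine measure_mono_null ?_ (omega_const_null p n' s' (j + 1))
      rintro f ⟨hf, -, -, -, -, -, h⟩
      exact ⟨hf, fun m hm => h m (by omega)⟩
    refine measure_mono_null ?_ (measure_iUnion_null this)
    rintro f ⟨hf, n', s', -, h⟩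
    exact Set.mem_iUnion.2 ⟨n', hf, h⟩
  · rw [Set.not_nonempty_iff_eq_empty.1 hne]; simp

/-- Outside {-n, …, n} the points of each label come in pairs ±i, so the parity condition at
infinity is decided by the cylinder. -/
lemma mem_Y_iff_of_cyl {n : ℕ} {s : NZ → Fin 2} {f : X} (hf : f ∈ cyl n s)
    (hinf : ∀ j, {i | f.1 i = j}.Infinite) :
    f ∈ Y ↔ Even ((box n).filter fun i => s i = 0).card := by
  have h1 : ((box n).filter fun i => s i = 0).card = cnt f 0 n := by
    unfold cnt
    rw [Finset.filter_congr fun i hi => by rw [← hf.1 i hi]]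
  have h2 : ∀ m, n ≤ m → (Even (cnt f 0 m) ↔ Even (cnt f 0 n)) := fun m hm => by
    rw [cnt_add 0 hf.2 hm, Nat.even_add]; simp
  rw [h1]
  constructor
  · rintro ⟨h, -⟩
    obtain ⟨m, hm, he⟩ := ((eventually_ge_atTop n).and h).exists
    exact (h2 m hm).1 he
  · intro h
    refine ⟨?_, hinf⟩
    filter_upwards [eventually_ge_atTop n] with m hm
    exact (h2 m hm).2 h

/-- Up to null sets a cylinder is contained in Y or disjoint from it, so the restriction of ω to Y
is still multiplicative in the labels. -/
lemma omegaY_cyl (p : Weights) (n : ℕ) (s : NZ → Fin 2) :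
    omegaY p (cyl n s) =
      if Even ((box n).filter fun i => s i = 0).card then omega p (cyl n s) else 0 := by
  rw [omegaY, Measure.restrict_apply (measurableSet_cyl n s)]
  have hinf : ∀ᵐ f ∂(omega p), ∀ j, {i | f.1 i = j}.Infinite :=
    ae_all_iff.2 fun j => ae_infinite_fiber p j
  split_ifs with h
  · refine measure_congr ?_
    filter_upwards [hinf] with f hf
    refine propext ⟨fun h' => h'.1, fun h' => ⟨h', (mem_Y_iff_of_cyl h' hf).2 h⟩⟩
  · refine measure_mono_null (t := {f | ¬ ∀ j, {i | f.1 i = j}.Infinite}) ?_ hinf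
    intro f hf hc
    exact h ((mem_Y_iff_of_cyl hf.1 hc).1 hf.2)

lemma even_card_extend (n : ℕ) (s : NZ → Fin 2) (c : Fin 2) :
    Even ((box (n + 1)).filter fun i => extend n s c i = 0).card ↔
      Even ((box n).filter fun i => s i = 0).card := by
  have h : ((box n).filter fun i => extend n s c i = 0) = (box n).filter fun i => s i = 0 :=
    Finset.filter_congr fun i hi => by rw [extend_of_mem _ _ hi]
  rw [box_succ, Finset.filter_insert, Finset.filter_insert, extend_pos, extend_neg, h]
  split_ifs with hc
  · rw [Finset.card_insert_of_notMem, Finset.card_insert_of_notMem, Nat.even_add_one,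
      Nat.even_add_one, not_not]
    · exact fun h => (pos_notMem_box n).2 (Finset.mem_filter.1 h).1
    · rw [Finset.mem_insert, not_or]
      exact ⟨pos_ne_neg n n, fun h => (pos_notMem_box n).1 (Finset.mem_filter.1 h).1⟩
  · rfl

lemma omegaY_cyl_extend (p : Weights) (n : ℕ) (s : NZ → Fin 2) (c : Fin 2) :
    omegaY p (cyl (n + 1) (extend n s c)) = ENNReal.ofReal (p.w c) * omegaY p (cyl n s) := by
  rw [omegaY_cyl, omegaY_cyl]
  simp only [even_card_extend, omega_cyl_extend]
  split_ifs <;> simp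

lemma omegaY_cyl_ne_zero (p : Weights) {n : ℕ} {f : X} (hf : f ∈ Y) (hs : SymOut n f) :
    omegaY p (cyl n f.1) ≠ 0 := by
  rw [omegaY_cyl, if_pos ((mem_Y_iff_of_cyl (mem_cyl_self hs) hf.2).1 hf)]
  exact omega_cyl_ne_zero p n f.1

/-- The map `f ↦ g f` as a measurable equivalence. -/
def smulEquiv (g : GE) : X ≃ᵐ X where
  toEquiv := MulAction.toPerm g
  measurable_toFun := measurable_smul' g
  measurable_invFun := measurable_smul' g⁻¹

@[simp] lemma smulEquiv_apply (g : GE) (f : X) : smulEquiv g f = g • f := rfl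

lemma KEn.preimage_cyl {n : ℕ} {k : GE} (hk : k ∈ KEn n) (s : NZ → Fin 2) :
    (fun f : X => k • f) ⁻¹' cyl n s = cyl n s := by
  ext f
  refine ⟨fun h => ?_, fun h => KEn.smul_mem_cyl hk h⟩
  have := KEn.smul_mem_cyl (inv_mem hk) h
  rwa [inv_smul_smul] at this

lemma kap_smul_apply_pos (a b : ℕ) (f : X) : (kap a b • f).1 (pos b) = f.1 (pos a) := by
  rw [smul_apply, kap_inv, kap_pos, Equiv.swap_apply_right]

/-- K_n preserves the measure and the cylinder and moves M + 1 to n + 1, which reduces the claim to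
the first free point. -/
lemma omegaY_cyl_inter (p : Weights) {n M : ℕ} (hM : n ≤ M) (s : NZ → Fin 2) (c : Fin 2) :
    omegaY p (cyl n s ∩ {f | f.1 (pos M) = c}) = ENNReal.ofReal (p.w c) * omegaY p (cyl n s) := by
  rw [← omegaY_cyl_extend, ← cyl_inter_pos]
  have hm : MeasurableSet (cyl n s ∩ {f | f.1 (pos M) = c}) :=
    (measurableSet_cyl n s).inter (measurable_apply _ (measurableSet_singleton c))
  rw [← (measurePreserving_smul_Y p (kap n M)).measure_preimage hm.nullMeasurableSet,
    Set.preimage_inter, KEn.preimage_cyl (kap_mem le_rfl hM)]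
  congr 2
  ext f
  simp only [Set.mem_preimage, Set.mem_ofPred_eq, kap_smul_apply_pos]

/-- The countably many cylinders of order at least n₀ cover X, and those that do not meet Y may be
ignored. -/
lemma ae_of_cyls {p : Weights} {P : X → Prop} (n₀ : ℕ)
    (h : ∀ n, n₀ ≤ n → ∀ f₀ ∈ Y, SymOut n f₀ → ∀ᵐ f ∂(omegaY p), f ∈ cyl n f₀.1 → P f) :
    ∀ᵐ f ∂(omegaY p), P f := by
  have h1 : ∀ t ∈ cyls n₀, ∀ᵐ f ∂(omegaY p), f ∈ t → P f := by
    rintro _ ⟨n, s, hn, rfl⟩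
    by_cases hne : ∃ f₀ ∈ cyl n s, f₀ ∈ Y
    · obtain ⟨f₀, hf₀, hY⟩ := hne
      filter_upwards [h n hn f₀ hY hf₀.2] with f hf hf'
      exact hf ⟨fun i hi => (hf'.1 i hi).trans (hf₀.1 i hi).symm, hf'.2⟩
    · filter_upwards [ae_mem_Y p] with f hf hf'
      exact absurd ⟨f, hf', hf⟩ hne
  filter_upwards [(ae_ball_iff (cyls_countable n₀)).2 h1] with f hf
  have : f ∈ ⋃₀ cyls n₀ := by rw [cyls_cover]; trivial
  obtain ⟨t, ht, hft⟩ := this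
  exact hf t ht hft

/-! ### Cylinder functions -/

/-- Approximating x by y in the span causes an error of at most C ‖x - y‖ for all n. This reduces
the asymptotic independence of labels to cylinder functions, where it is an equality from some point
on. -/
lemma tendsto_inner_zero {E : Type*} [NormedAddCommGroup E] [InnerProductSpace ℂ E]
    {e : ℕ → E} {C : ℝ} (hC : ∀ n, ‖e n‖ ≤ C) {S : Set E}
    (hS : Dense (Submodule.span ℂ S : Set E))
    (h : ∀ s ∈ S, Tendsto (fun n => inner ℂ (e n) s) atTop (𝓝 0)) (x : E) :
    Tendsto (fun n => inner ℂ (e n) x) atTop (𝓝 0) := by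
  have h1 : ∀ s ∈ Submodule.span ℂ S, Tendsto (fun n => inner ℂ (e n) s) atTop (𝓝 0) := by
    intro s hs
    induction hs using Submodule.span_induction with
    | mem s hs => exact h s hs
    | zero => simp
    | add a b _ _ ha hb => simpa [inner_add_right] using ha.add hb
    | smul c a _ ha => simpa [inner_smul_right] using ha.const_mul c
  have hC0 : 0 ≤ C := (norm_nonneg _).trans (hC 0)
  rw [Metric.tendsto_atTop]
  intro ε hε
  obtain ⟨y, hy, hxy⟩ := Metric.mem_closure_iff.1 (hS x) (ε / (2 * (C + 1))) (by positivity)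
  obtain ⟨N, hN⟩ := Metric.tendsto_atTop.1 (h1 y hy) (ε / 2) (by positivity)
  refine ⟨N, fun n hn => ?_⟩
  have h2 := hN n hn
  rw [dist_zero_right] at h2 ⊢
  rw [dist_eq_norm, lt_div_iff₀ (by positivity)] at hxy
  have h3 : ‖inner ℂ (e n) (x - y)‖ ≤ C * ‖x - y‖ :=
    (norm_inner_le_norm _ _).trans (by gcongr; exact hC n)
  rw [show x = y + (x - y) by abel, inner_add_right]
  refine (norm_add_le _ _).trans_lt ?_
  nlinarith [norm_nonneg (x - y)]

section Cyl

variable {H₁ H₂ : Type*} [NormedAddCommGroup H₁] [InnerProductSpace ℂ H₁]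
  [NormedAddCommGroup H₂] [InnerProductSpace ℂ H₂] {p : Weights}

/-- The function with the value `v` on a cylinder. -/
def cylVec (p : Weights) (n : ℕ) (s : NZ → Fin 2) (v : HT H₁ H₂) : L2Y p H₁ H₂ :=
  indicatorConstLp 2 (measurableSet_cyl n s) (omegaY_cyl_ne_top p n s) v

lemma coeFn_cylVec (n : ℕ) (s : NZ → Fin 2) (v : HT H₁ H₂) :
    cylVec p n s v =ᵐ[omegaY p] (cyl n s).indicator fun _ => v := indicatorConstLp_coeFn

lemma cylVec_add (n : ℕ) (s : NZ → Fin 2) (v w : HT H₁ H₂) :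
    cylVec p n s (v + w) = cylVec p n s v + cylVec p n s w := by
  apply Lp.ext
  filter_upwards [coeFn_cylVec (p := p) n s (v + w), coeFn_cylVec (p := p) n s v,
    coeFn_cylVec (p := p) n s w, Lp.coeFn_add (cylVec p n s v) (cylVec p n s w)] with f h1 h2 h3 h4
  rw [h1, h4, Pi.add_apply, h2, h3]
  by_cases hf : f ∈ cyl n s <;> simp [hf]

lemma cylVec_smul (n : ℕ) (s : NZ → Fin 2) (c : ℂ) (v : HT H₁ H₂) :
    cylVec p n s (c • v) = c • cylVec p n s v := by
  apply Lp.ext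
  filter_upwards [coeFn_cylVec (p := p) n s (c • v), coeFn_cylVec (p := p) n s v,
    Lp.coeFn_smul c (cylVec p n s v)] with f h1 h2 h3
  rw [h1, h3, Pi.smul_apply, h2]
  by_cases hf : f ∈ cyl n s <;> simp [hf]

/-- Cylinder functions as a linear map. -/
def cylVecₗ (p : Weights) (n : ℕ) (s : NZ → Fin 2) : HT H₁ H₂ →ₗ[ℂ] L2Y p H₁ H₂ where
  toFun := cylVec p n s
  map_add' := cylVec_add n s
  map_smul' := cylVec_smul n s

@[simp] lemma cylVecₗ_apply (n : ℕ) (s : NZ → Fin 2) (v : HT H₁ H₂) :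
    cylVecₗ p n s v = cylVec p n s v := rfl

lemma cylVec_congr {n : ℕ} {s t : NZ → Fin 2} (h : ∀ i ∈ box n, s i = t i) (v : HT H₁ H₂) :
    cylVec p n s v = cylVec p n t v := by
  have : cyl n s = cyl n t := by
    ext f
    exact and_congr_left fun _ => forall₂_congr fun i hi => by rw [h i hi]
  unfold cylVec
  congr

lemma inner_cylVec (n : ℕ) (s : NZ → Fin 2) (v : HT H₁ H₂) (F : L2Y p H₁ H₂) :
    inner ℂ (cylVec p n s v) F = inner ℂ v (∫ f in cyl n s, F f ∂(omegaY p)) :=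
  L2.inner_indicatorConstLp_eq_inner_setIntegral ℂ (measurableSet_cyl n s) _ v F

lemma integrableOn_cyl (n : ℕ) (s : NZ → Fin 2) (F : L2Y p H₁ H₂) :
    IntegrableOn F (cyl n s) (omegaY p) :=
  integrableOn_Lp_of_measure_ne_top F fact_one_le_two_ennreal.elim (omegaY_cyl_ne_top p n s)

lemma integral_cylVec (n : ℕ) (s : NZ → Fin 2) (v : HT H₁ H₂) {A : Set X} (hA : MeasurableSet A) :
    ∫ f in A, cylVec p n s v f ∂(omegaY p) = (((omegaY p).real (cyl n s ∩ A) : ℝ) : ℂ) • v :=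
  (setIntegral_indicatorConstLp hA (measurableSet_cyl n s) (omegaY_cyl_ne_top p n s) v).trans
    (Complex.coe_smul _ v).symm

lemma inner_cylVec_same (n : ℕ) (s : NZ → Fin 2) (v w : HT H₁ H₂) :
    inner ℂ (cylVec p n s v) (cylVec p n s w) =
      (((omegaY p).real (cyl n s) : ℝ) : ℂ) * inner ℂ v w := by
  rw [inner_cylVec, integral_cylVec n s w (measurableSet_cyl n s), Set.inter_self,
    inner_smul_right]

lemma cyl_inter_eq_empty {n : ℕ} {s t : NZ → Fin 2} (h : ¬ ∀ i ∈ box n, s i = t i) :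
    cyl n s ∩ cyl n t = ∅ := by
  rw [Set.eq_empty_iff_forall_notMem]
  rintro f ⟨h1, h2⟩
  exact h fun i hi => (h1.1 i hi).symm.trans (h2.1 i hi)

lemma inner_cylVec_ne {n : ℕ} {s t : NZ → Fin 2} (h : ¬ ∀ i ∈ box n, s i = t i)
    (v w : HT H₁ H₂) : inner ℂ (cylVec p n s v) (cylVec p n t w) = 0 := by
  rw [inner_cylVec, integral_cylVec n t w (measurableSet_cyl n s), Set.inter_comm,
    cyl_inter_eq_empty h, inner_smul_right]
  simp

/-- A function on a cylinder is determined by its integrals over the smaller cylinders. -/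
lemma ae_eq_zero_on_cyl {F : X → HT H₁ H₂} {n : ℕ} {s : NZ → Fin 2}
    (hF : IntegrableOn F (cyl n s) (omegaY p))
    (h : ∀ m t, n ≤ m → cyl m t ⊆ cyl n s → ∫ f in cyl m t, F f ∂(omegaY p) = 0) :
    ∀ᵐ f ∂(omegaY p), f ∈ cyl n s → F f = 0 := by
  rw [← ae_restrict_iff' (measurableSet_cyl n s)]
  refine Integrable.ae_eq_zero_of_forall_setIntegral_eq_zero hF fun A hA hfin => ?_
  clear hfin
  rw [Measure.restrict_restrict hA]
  -- The cylinders of order at least n form a π-system that generates the σ-algebra, and those that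
  -- meet `cyl n s` are contained in it.
  induction A, hA using MeasurableSpace.induction_on_inter (generateFrom_cyls n)
      (isPiSystem_cyls n) with
  | empty => simp
  | basic A hA =>
    obtain ⟨m, t, hm, rfl⟩ := hA
    rcases Set.eq_empty_or_nonempty (cyl m t ∩ cyl n s) with h0 | ⟨f, hf⟩
    · rw [h0]; simp
    · have hsub := cyl_subset hm hf.2 hf.1
      rw [Set.inter_eq_left.2 hsub]
      exact h m t hm hsub
  | compl A hA ih =>
    have h1 := integral_inter_add_sdiff (μ := (omegaY p)) (s := cyl n s) hA hF
    rw [Set.inter_comm, ih, zero_add, h n s le_rfl subset_rfl] at h1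
    rw [Set.inter_comm, ← Set.sdiff_eq, h1]
  | iUnion A hdisj hA ih =>
    rw [Set.iUnion_inter, integral_iUnion (fun i => (hA i).inter (measurableSet_cyl n s))
      (fun i j hij => (hdisj hij).mono Set.inter_subset_left Set.inter_subset_left)
      (hF.mono_set (Set.iUnion_subset fun i => Set.inter_subset_right))]
    simp only [ih, tsum_zero]

/-- A function orthogonal to all cylinder functions has zero integral over every cylinder, so
`ae_eq_zero_on_cyl` applies. -/
lemma dense_span_cylVec :
    Dense (Submodule.span ℂ {F : L2Y p H₁ H₂ | ∃ n s v, F = cylVec p n s v} :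
      Set (L2Y p H₁ H₂)) := by
  rw [Submodule.dense_iff_topologicalClosure_eq_top, Submodule.topologicalClosure_eq_top_iff,
    Submodule.eq_bot_iff]
  intro F hF
  have h0 : ∀ n s, ∫ f in cyl n s, F f ∂(omegaY p) = 0 := by
    intro n s
    rw [← inner_self_eq_zero (𝕜 := ℂ), ← inner_cylVec]
    exact hF _ (Submodule.subset_span ⟨n, s, _, rfl⟩)
  apply Lp.ext
  refine EventuallyEq.trans ?_ (Lp.coeFn_zero _ _ _).symm
  refine ae_of_cyls 0 fun n _ f₀ _ _ => ?_
  exact ae_eq_zero_on_cyl (integrableOn_cyl n f₀.1 F) fun m t _ _ => h0 m t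

/-- The part of a cylinder where `f (M + 1) = c` is asymptotically independent of everything. -/
lemma tendsto_integral_cyl_inter (n : ℕ) (s : NZ → Fin 2) (c : Fin 2) (F : L2Y p H₁ H₂)
    (w : HT H₁ H₂) :
    Tendsto (fun M => inner ℂ w (∫ f in cyl n s ∩ {f | f.1 (pos M) = c}, F f ∂(omegaY p))) atTop
      (𝓝 ((p.w c : ℂ) * inner ℂ w (∫ f in cyl n s, F f ∂(omegaY p)))) := by
  have hms : ∀ M, MeasurableSet (cyl n s ∩ {f : X | f.1 (pos M) = c}) := fun M =>
    (measurableSet_cyl n s).inter (measurable_apply _ (measurableSet_singleton c))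
  have htop : ∀ M, omegaY p (cyl n s ∩ {f : X | f.1 (pos M) = c}) ≠ ∞ := fun M =>
    measure_ne_top_of_subset Set.inter_subset_left (omegaY_cyl_ne_top p n s)
  set e : ℕ → L2Y p H₁ H₂ := fun M => indicatorConstLp 2 (hms M) (htop M) w -
    (p.w c : ℂ) • cylVec p n s w with he
  have h1 : ∀ M (F : L2Y p H₁ H₂), inner ℂ (e M) F =
      inner ℂ w (∫ f in cyl n s ∩ {f | f.1 (pos M) = c}, F f ∂(omegaY p)) -
        (p.w c : ℂ) * inner ℂ w (∫ f in cyl n s, F f ∂(omegaY p)) := by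
    intro M F
    rw [he, inner_sub_left, inner_smul_left, Complex.conj_ofReal, inner_cylVec,
      L2.inner_indicatorConstLp_eq_inner_setIntegral ℂ]
  have hmain := tendsto_inner_zero (e := e) (C := ‖w‖ * (omegaY p).real (cyl n s) ^ (1 / 2 : ℝ) +
      p.w c * ‖cylVec (p := p) n s w‖) (fun M => ?_) dense_span_cylVec ?_ F
  · have := hmain.add_const ((p.w c : ℂ) * inner ℂ w (∫ f in cyl n s, F f ∂(omegaY p)))
    simpa [h1] using this
  · refine (norm_sub_le _ _).trans (add_le_add ?_ ?_)
    · refine norm_indicatorConstLp_le.trans ?_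
      simp only [ENNReal.toReal_ofNat]
      gcongr
      exact omegaY_cyl_ne_top p n s
      exact Set.inter_subset_left
    · rw [norm_smul, Complex.norm_real, Real.norm_of_nonneg (p.w_pos c).le]
  · rintro _ ⟨m, t, v, rfl⟩
    refine tendsto_const_nhds.congr' ?_
    filter_upwards [eventually_ge_atTop n, eventually_ge_atTop m] with M hn hm
    rw [h1, integral_cylVec _ _ _ (hms M), integral_cylVec _ _ _ (measurableSet_cyl n s),
      inner_smul_right, inner_smul_right, ← mul_assoc,
      ← sub_mul, zero_eq_mul]
    left
    -- Cylinders are nested or disjoint. So the intersection is empty or a cylinder of order at most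
    -- M, from which the label of M + 1 is independent.
    have key : ∃ k t', k ≤ M ∧ cyl m t ∩ cyl n s = cyl k t' ∨ cyl m t ∩ cyl n s = ∅ := by
      rcases Set.eq_empty_or_nonempty (cyl m t ∩ cyl n s) with h0 | hne
      · exact ⟨0, t, Or.inr h0⟩
      · obtain ⟨f, hf⟩ := hne
        rcases le_total m n with h | h
        · exact ⟨n, s, Or.inl ⟨hn, Set.inter_eq_right.2 (cyl_subset h hf.1 hf.2)⟩⟩
        · exact ⟨m, t, Or.inl ⟨hm, Set.inter_eq_left.2 (cyl_subset h hf.2 hf.1)⟩⟩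
    obtain ⟨k, t', ⟨hk, h⟩ | h⟩ := key
    · rw [← Set.inter_assoc, h, measureReal_def, omegaY_cyl_inter p hk, measureReal_def,
        ENNReal.toReal_mul, ENNReal.toReal_ofReal (p.w_pos c).le]
      push_cast
      ring
    · rw [← Set.inter_assoc, h]; simp

end Cyl

/-! ### Invariant vectors in the space of square integrable functions -/

section Fixed

variable {H₁ H₂ : Type*} [NormedAddCommGroup H₁] [InnerProductSpace ℂ H₁]
  [NormedAddCommGroup H₂] [InnerProductSpace ℂ H₂] {p : Weights} {π₁ : URep H₁} {π₂ : URep H₂}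

lemma coeFn_fullRep (g : GE) (F : L2Y p H₁ H₂) :
    fullRep p π₁ π₂ g F =ᵐ[omegaY p] actFun π₁ π₂ g F := coeFn_actL2 p π₁ π₂ g F

/-- The action of `G(n)` on cylinder functions. -/
lemma fullRep_cylVec {n : ℕ} {g : GE} (hg : InG n g) {f₀ : X} (hf₀ : f₀ ∈ Y) (hs : SymOut n f₀)
    (v : HT H₁ H₂) : fullRep p π₁ π₂ g (cylVec p n f₀.1 v) =
      cylVec p n (g • f₀).1 (tensorOp π₁ π₂ (coc 0 g f₀) (coc 1 g f₀) v) := by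
  apply Lp.ext
  filter_upwards [coeFn_fullRep (π₁ := π₁) (π₂ := π₂) g (cylVec p n f₀.1 v),
    actFun_congr p π₁ π₂ g (coeFn_cylVec (p := p) n f₀.1 v), coeFn_cylVec (p := p) n (g • f₀).1
    (tensorOp π₁ π₂ (coc 0 g f₀) (coc 1 g f₀) v), ae_mem_Y p] with f h1 h2 h3 hY
  rw [h1, h2, h3, actFun]
  have hiff : g⁻¹ • f ∈ cyl n f₀.1 ↔ f ∈ cyl n (g • f₀).1 := by
    constructor
    · intro h
      have := cyl_smul hg h
      rwa [smul_inv_smul] at this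
    · intro h
      have := cyl_smul hg.inv h
      simpa using this
  by_cases h : f ∈ cyl n (g • f₀).1
  · have h' := hiff.2 h
    have hc : ∀ j, coc j g (g⁻¹ • f) = coc j g f₀ := fun j =>
      coc_congr j hg h' (mem_cyl_self hs) (smul_mem_Y _ hY) hf₀
    rw [Set.indicator_of_mem h, Set.indicator_of_mem h', hc, hc]
  · rw [Set.indicator_of_notMem h, Set.indicator_of_notMem (fun h' => h (hiff.1 h')), map_zero]

lemma hc_congr {n : ℕ} {f f' : X} (h : f' ∈ cyl n f.1) (j : Fin 2) : hc f' j n = hc f j n := by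
  rw [hc, hc, cnt_congr h]

/-- K_n preserves the cylinder, and the values of the cocycle on it are in K_a × K_b, which fixes v.
-/
lemma cylVec_mem_fixedSpace {n : ℕ} {f₀ : X} {v : HT H₁ H₂}
    (hv : v ∈ fixedTensor π₁ π₂ (hc f₀ 0 n) (hc f₀ 1 n)) :
    cylVec p n f₀.1 v ∈ fixedSpace (fullRep p π₁ π₂) n := by
  intro k hk
  apply Lp.ext
  filter_upwards [coeFn_fullRep (π₁ := π₁) (π₂ := π₂) k (cylVec p n f₀.1 v),
    actFun_congr p π₁ π₂ k (coeFn_cylVec (p := p) n f₀.1 v), coeFn_cylVec (p := p) n f₀.1 v,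
    ae_mem_Y p] with f h1 h2 h3 hY
  rw [h1, h2, h3, actFun]
  have hiff : k⁻¹ • f ∈ cyl n f₀.1 ↔ f ∈ cyl n f₀.1 :=
    Set.ext_iff.1 (KEn.preimage_cyl (inv_mem hk) f₀.1) f
  by_cases h : f ∈ cyl n f₀.1
  · have h' := hiff.2 h
    have hc' : ∀ j, coc j k (k⁻¹ • f) ∈ KEn (hc f₀ j n) := fun j => by
      rw [← hc_congr h']
      exact coc_mem_KEn (smul_mem_Y _ hY) h'.2 hk j
    rw [Set.indicator_of_mem h, Set.indicator_of_mem h', tensorOp_fixedTensor (hc' 0) (hc' 1) hv]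
  · rw [Set.indicator_of_notMem h, Set.indicator_of_notMem (fun h' => h (hiff.1 h')), map_zero]

/-- One null set serves all k because G is countable. -/
lemma ae_apply_smul {n : ℕ} {F : L2Y p H₁ H₂} (hF : F ∈ fixedSpace (fullRep p π₁ π₂) n) :
    ∀ᵐ f ∂(omegaY p), ∀ k ∈ KEn n,
      F (k • f) = tensorOp π₁ π₂ (coc 0 k f) (coc 1 k f) (F f) := by
  rw [ae_all_iff]
  intro k
  by_cases hk : k ∈ KEn n
  · have h1 := coeFn_fullRep (π₁ := π₁) (π₂ := π₂) k F
    rw [hF k hk] at h1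
    filter_upwards [(measurePreserving_smul_Y p k).quasiMeasurePreserving.ae h1] with f hf _
    rw [hf, actFun, inv_smul_smul]
  · exact Eventually.of_forall fun f h => absurd h hk

/-- Invariant vectors vanish outside `X_n`. -/
lemma ae_eq_zero_of_not_symOut {n : ℕ} {F : L2Y p H₁ H₂}
    (hF : F ∈ fixedSpace (fullRep p π₁ π₂) n) :
    ∀ᵐ f ∂(omegaY p), ¬ SymOut n f → F f = 0 := by
  -- The operators of the tensor product are isometries, so K_n preserves |F|². It moves the set S m
  -- of all f that are asymmetric at ±(m + 1) to S M, so these sets have the same mass for m, M ≥ n.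
  -- Their tail unions T m decrease to the empty set, so this mass is zero.
  set φ : X → ℝ≥0∞ := fun f => ‖F f‖ₑ ^ (2 : ℝ) with hφ
  have hφm : AEMeasurable φ (omegaY p) := (Lp.aestronglyMeasurable F).enorm.pow_const _
  have hfin : ∫⁻ f, φ f ∂(omegaY p) ≠ ∞ := by
    have := lintegral_rpow_enorm_lt_top_of_eLpNorm_lt_top two_ne_zero ENNReal.ofNat_ne_top
      (Lp.eLpNorm_lt_top F)
    simpa [hφ] using this.ne
  have : IsFiniteMeasure ((omegaY p).withDensity φ) := isFiniteMeasure_withDensity hfin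
  set S : ℕ → Set X := fun m => {f | f.1 (pos m) ≠ f.1 (-pos m)} with hS
  set T : ℕ → Set X := fun m => {f | ¬ SymOut m f} with hT
  have hSm : ∀ m, MeasurableSet (S m) := fun m =>
    (measurableSet_eq_fun (measurable_apply (pos m)) (measurable_apply (-pos m))).compl
  have hTS : ∀ m, T m = ⋃ k, ⋃ _ : m ≤ k, S k := by
    intro m
    ext f
    simp only [hT, hS, Set.mem_ofPred_eq, SymOut, not_forall, Set.mem_iUnion, exists_prop]
    constructor
    · rintro ⟨i, hi, h⟩
      obtain ⟨k, rfl | rfl⟩ := eq_pos_or i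
      · exact ⟨k, by rw [abs_pos'] at hi; omega, h⟩
      · rw [NZ.neg_neg] at h
        exact ⟨k, by rw [abs_neg_pos] at hi; omega, Ne.symm h⟩
    · rintro ⟨k, hk, h⟩
      exact ⟨pos k, by rw [abs_pos']; omega, h⟩
  have hTm : ∀ m, MeasurableSet (T m) := fun m => by
    rw [hTS]
    exact MeasurableSet.iUnion fun k => MeasurableSet.iUnion fun _ => hSm k
  have hlim : Tendsto (fun m => (omegaY p).withDensity φ (T m)) atTop (𝓝 0) := by
    have h1 := tendsto_measure_iInter_atTop (μ := (omegaY p).withDensity φ) (s := T)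
      (fun m => (hTm m).nullMeasurableSet)
      (fun a b hab f hf h => hf (SymOut.mono hab h)) ⟨0, measure_ne_top _ _⟩
    have h2 : ⋂ m, T m = ∅ := by
      rw [Set.eq_empty_iff_forall_notMem]
      intro f hf
      obtain ⟨m, hm⟩ := exists_symOut f
      exact (Set.mem_iInter.1 hf m) (hm m le_rfl)
    rwa [h2, measure_empty] at h1
  have hconst : ∀ m M, n ≤ m → n ≤ M →
      (omegaY p).withDensity φ (S m) = (omegaY p).withDensity φ (S M) := by
    intro m M hm hM
    rw [withDensity_apply _ (hSm m), withDensity_apply _ (hSm M)]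
    have hpre : smulEquiv (kap m M) ⁻¹' S M = S m := by
      ext f
      have h1 : (kap m M • f).1 (-pos M) = f.1 (-pos m) := by
        rw [smul_apply, kap_inv, kap_neg, Equiv.swap_apply_right]
      simp only [hS, Set.mem_preimage, smulEquiv_apply, Set.mem_ofPred_eq, kap_smul_apply_pos, h1]
    have h2 := (show MeasurePreserving (smulEquiv (kap m M)) (omegaY p) (omegaY p) from
      measurePreserving_smul_Y p (kap m M)).setLIntegral_comp_preimage_emb
        (smulEquiv (kap m M)).measurableEmbedding φ (S M)
    rw [← h2, hpre]
    refine setLIntegral_congr_fun_ae (hSm m) ?_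
    filter_upwards [ae_apply_smul hF] with f hf _
    simp only [hφ, smulEquiv_apply]
    rw [hf _ (kap_mem hm hM)]
    simp [enorm_eq_nnnorm]
  have hzero : ∀ m, n ≤ m → (omegaY p).withDensity φ (S m) = 0 := by
    intro m hm
    refine le_antisymm (ge_of_tendsto hlim ?_) zero_le
    filter_upwards [eventually_ge_atTop n] with M hM
    rw [hconst m M hm hM]
    refine measure_mono ?_
    rw [hTS]
    exact Set.subset_iUnion₂_of_subset M le_rfl subset_rfl
  have hTn : (omegaY p).withDensity φ (T n) = 0 := by
    rw [hTS, measure_iUnion_null_iff]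
    intro k
    rw [measure_iUnion_null_iff]
    exact hzero k
  rw [withDensity_apply _ (hTm n), lintegral_eq_zero_iff' hφm.restrict] at hTn
  have h3 := (ae_restrict_iff' (hTm n)).1 hTn
  filter_upwards [h3] with f hf hsym
  have := hf hsym
  simpa [hφ] using this

/-- For (g₁, g₂) in K_a × K_b, `blend` gives an element k of K_n with k f = f and this cocycle; the
invariance of F under k, read at f itself, is the invariance of the value F f under g₁ ⊗ g₂. The
element k depends on f. -/
lemma ae_mem_fixedTensor [CompleteSpace H₁] [CompleteSpace H₂] {n : ℕ} {F : L2Y p H₁ H₂}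
    (hF : F ∈ fixedSpace (fullRep p π₁ π₂) n) (f₀ : X) :
    ∀ᵐ f ∂(omegaY p), f ∈ cyl n f₀.1 → F f ∈ fixedTensor π₁ π₂ (hc f₀ 0 n) (hc f₀ 1 n) := by
  filter_upwards [ae_apply_smul hF, ae_mem_Y p] with f hf hY hc'
  refine mem_fixedTensor fun g₁ h₁ g₂ h₂ => ?_
  have h := hf (blend f hY ![g₁, g₂]) (blend_mem_KEn hY hc'.2 (fun j => by
    rw [hc_congr hc']
    fin_cases j
    · exact h₁
    · exact h₂))
  rw [blend_fix, coc_blend, coc_blend] at h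
  exact h.symm

/-- The values on the cylinder are already fixed by K_a × K_b, so the cocycle disappears and F is
invariant in the ordinary sense. -/
lemma ae_apply_smul_eq [CompleteSpace H₁] [CompleteSpace H₂] {n : ℕ} {F : L2Y p H₁ H₂}
    (hF : F ∈ fixedSpace (fullRep p π₁ π₂) n) (f₀ : X) :
    ∀ᵐ f ∂(omegaY p), f ∈ cyl n f₀.1 → ∀ k ∈ KEn n, F (k • f) = F f := by
  filter_upwards [ae_apply_smul hF, ae_mem_fixedTensor hF f₀, ae_mem_Y p] with f h1 h2 hY hf k hk
  have hc' : ∀ j, coc j k f ∈ KEn (hc f₀ j n) := fun j => by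
    rw [← hc_congr hf]
    exact coc_mem_KEn hY hf.2 hk j
  rw [h1 k hk, tensorOp_fixedTensor (hc' 0) (hc' 1) (h2 hf)]

/-- By invariance the integral over the part where M + 1 has the label c is the same for all M ≥ m,
and by asymptotic independence it tends to the weight of c times the integral over the whole
cylinder. -/
lemma integral_cyl_extend [CompleteSpace H₁] [CompleteSpace H₂] {n m : ℕ} (hnm : n ≤ m)
    {F : L2Y p H₁ H₂} (hF : F ∈ fixedSpace (fullRep p π₁ π₂) n) {f₀ : X} {s : NZ → Fin 2}
    (hs : cyl m s ⊆ cyl n f₀.1) (c : Fin 2) :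
    ∫ f in cyl (m + 1) (extend m s c), F f ∂(omegaY p) =
      (p.w c : ℂ) • ∫ f in cyl m s, F f ∂(omegaY p) := by
  have key : ∀ M, m ≤ M → ∫ f in cyl m s ∩ {f | f.1 (pos M) = c}, F f ∂(omegaY p) =
      ∫ f in cyl (m + 1) (extend m s c), F f ∂(omegaY p) := by
    intro M hM
    have hpre : smulEquiv (kap m M) ⁻¹' (cyl m s ∩ {f | f.1 (pos M) = c}) =
        cyl (m + 1) (extend m s c) := by
      rw [← cyl_inter_pos, Set.preimage_inter]
      congr 1
      · exact KEn.preimage_cyl (kap_mem le_rfl hM) s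
      · ext f
        simp only [Set.mem_preimage, smulEquiv_apply, Set.mem_ofPred_eq, kap_smul_apply_pos]
    have h2 := (show MeasurePreserving (smulEquiv (kap m M)) (omegaY p) (omegaY p) from
      measurePreserving_smul_Y p (kap m M)).setIntegral_preimage_emb
        (smulEquiv (kap m M)).measurableEmbedding F (cyl m s ∩ {f | f.1 (pos M) = c})
    rw [← h2, hpre]
    refine setIntegral_congr_ae (measurableSet_cyl _ _) ?_
    filter_upwards [ae_apply_smul_eq hF f₀] with f hf hfc
    rw [← cyl_inter_pos] at hfc
    exact hf (hs hfc.1) _ (kap_mem hnm (hnm.trans hM))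
  refine ext_inner_left ℂ fun w => ?_
  rw [inner_smul_right]
  refine tendsto_nhds_unique ?_ (tendsto_integral_cyl_inter m s c F w)
  refine tendsto_const_nhds.congr' ?_
  filter_upwards [eventually_ge_atTop m] with M hM
  rw [key M hM]

/-- Invariant vectors are constant on cylinders. -/
theorem exists_ae_eq_const [CompleteSpace H₁] [CompleteSpace H₂] {n : ℕ} {F : L2Y p H₁ H₂}
    (hF : F ∈ fixedSpace (fullRep p π₁ π₂) n) {f₀ : X} (hf₀ : f₀ ∈ Y) (hs : SymOut n f₀) :
    ∃ v ∈ fixedTensor π₁ π₂ (hc f₀ 0 n) (hc f₀ 1 n),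
      ∀ᵐ f ∂(omegaY p), f ∈ cyl n f₀.1 → F f = v := by
  have hC0 : (omegaY p).real (cyl n f₀.1) ≠ 0 := by
    rw [measureReal_def, Ne, ENNReal.toReal_eq_zero_iff, not_or]
    exact ⟨omegaY_cyl_ne_zero p hf₀ hs, omegaY_cyl_ne_top p n _⟩
  set v : HT H₁ H₂ := (((omegaY p).real (cyl n f₀.1) : ℝ) : ℂ)⁻¹ •
    ∫ f in cyl n f₀.1, F f ∂(omegaY p) with hv
  -- The integrals over smaller cylinders are proportional to their measures, so they are those of
  -- the constant v, the mean value of F.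
  have key : ∀ r t, cyl (n + r) t ⊆ cyl n f₀.1 → (cyl (n + r) t).Nonempty →
      ∫ f in cyl (n + r) t, F f ∂(omegaY p) =
        (((omegaY p).real (cyl (n + r) t) : ℝ) : ℂ) • v := by
    intro r
    induction r with
    | zero =>
      rintro t ht ⟨f, hf⟩
      have : cyl (n + 0) t = cyl n f₀.1 := Set.Subset.antisymm ht (cyl_subset le_rfl hf (ht hf))
      rw [this, hv, smul_smul, mul_inv_cancel₀ (by exact_mod_cast hC0), one_smul]
    | succ r ih =>
      rintro t ht ⟨f, hf⟩
      have hsym : SymOut (n + r) f := (ht hf).2.mono (by omega)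
      have hself := mem_cyl_self hsym
      have heq : cyl (n + r + 1) t = cyl (n + r + 1) (extend (n + r) f.1 (f.1 (pos (n + r)))) := by
        have hf' : f ∈ cyl (n + r + 1) (extend (n + r) f.1 (f.1 (pos (n + r)))) := by
          rw [← cyl_inter_pos]; exact ⟨hself, rfl⟩
        exact Set.Subset.antisymm (cyl_subset le_rfl hf' hf) (cyl_subset le_rfl hf hf')
      have hsub : cyl (n + r) f.1 ⊆ cyl n f₀.1 := cyl_subset (by omega) (ht hf) hself
      rw [← add_assoc, heq, integral_cyl_extend (by omega) hF hsub, ih _ hsub ⟨f, hself⟩,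
        measureReal_def, measureReal_def, omegaY_cyl_extend, ENNReal.toReal_mul,
        ENNReal.toReal_ofReal (p.w_pos _).le, smul_smul, Complex.ofReal_mul]
  have hint : IntegrableOn (fun f => F f - cylVec p n f₀.1 v f) (cyl n f₀.1) (omegaY p) :=
    (integrableOn_cyl n f₀.1 F).sub (integrableOn_cyl n f₀.1 _)
  have hzero := ae_eq_zero_on_cyl (n := n) hint fun m t hm ht => by
    rw [integral_sub ((integrableOn_cyl n f₀.1 F).mono_set ht)
      ((integrableOn_cyl n f₀.1 _).mono_set ht), integral_cylVec _ _ _ (measurableSet_cyl m t),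
      Set.inter_eq_right.2 ht, sub_eq_zero]
    obtain ⟨r, rfl⟩ := Nat.exists_eq_add_of_le hm
    rcases Set.eq_empty_or_nonempty (cyl (n + r) t) with h0 | hne
    · rw [h0]
      simp only [Measure.restrict_empty, integral_zero_measure, measureReal_empty,
        Complex.ofReal_zero, zero_smul]
    · exact key r t ht hne
  have hval : ∀ᵐ f ∂(omegaY p), f ∈ cyl n f₀.1 → F f = v := by
    filter_upwards [hzero, coeFn_cylVec (p := p) n f₀.1 v] with f h1 h2 hf
    have := h1 hf
    rwa [h2, Set.indicator_of_mem hf, sub_eq_zero] at this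
  refine ⟨v, ?_, hval⟩
  -- The cylinder has positive measure, so v is one of the values of F that lie in the tensor
  -- product.
  by_contra hcon
  apply omegaY_cyl_ne_zero p hf₀ hs
  refine measure_mono_null (t := {f | ¬ ((f ∈ cyl n f₀.1 → F f = v) ∧ (f ∈ cyl n f₀.1 →
    F f ∈ fixedTensor π₁ π₂ (hc f₀ 0 n) (hc f₀ 1 n)))}) ?_
    (hval.and (ae_mem_fixedTensor hF f₀))
  rintro f hf ⟨h1, h2⟩
  exact hcon (h1 hf ▸ h2 hf)

end Fixed

/-! ### The invariant vectors of least depth -/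

section Root

variable {H₁ H₂ : Type*} [NormedAddCommGroup H₁] [InnerProductSpace ℂ H₁]
  [NormedAddCommGroup H₂] [InnerProductSpace ℂ H₂] {p : Weights} {π₁ : URep H₁} {π₂ : URep H₂}

lemma hc_add {f : X} (hf : f ∈ Y) {n : ℕ} (hs : SymOut n f) : hc f 0 n + hc f 1 n = n := by
  have h1 := two_mul_hc hf hs 0
  have h2 := two_mul_hc hf hs 1
  have h3 := cnt_two_mul_add (f := f) n
  omega

lemma mem_Yab_iff {f : X} {a b : ℕ} :
    f ∈ Yab a b ↔ f ∈ Y ∧ SymOut (a + b) f ∧ hc f 0 (a + b) = a ∧ hc f 1 (a + b) = b := by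
  constructor
  · rintro ⟨h1, h2, h3, h4⟩
    exact ⟨h1, h4, by rw [hc, h2]; omega, by rw [hc, h3]; omega⟩
  · rintro ⟨h1, h2, h3, h4⟩
    exact ⟨h1, by rw [two_mul_hc h1 h2, h3], by rw [two_mul_hc h1 h2, h4], h2⟩

lemma mem_Yab_of_cyl {f f' : X} {a b : ℕ} (hf : f ∈ Yab a b) (hY : f' ∈ Y)
    (h : f' ∈ cyl (a + b) f.1) : f' ∈ Yab a b := by
  rw [mem_Yab_iff] at hf ⊢
  rw [hc_congr h, hc_congr h]
  exact ⟨hY, h.2, hf.2.2⟩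

lemma ae_of_symOut {P : X → Prop} (n : ℕ)
    (h : ∀ f₀ ∈ Y, SymOut n f₀ → ∀ᵐ f ∂(omegaY p), f ∈ cyl n f₀.1 → P f) :
    ∀ᵐ f ∂(omegaY p), SymOut n f → P f := by
  have h1 : ∀ t ∈ {t | ∃ s, t = cyl n s}, ∀ᵐ f ∂(omegaY p), f ∈ t → P f := by
    rintro _ ⟨s, rfl⟩
    by_cases hne : ∃ f₀ ∈ cyl n s, f₀ ∈ Y
    · obtain ⟨f₀, hf₀, hY⟩ := hne
      filter_upwards [h f₀ hY hf₀.2] with f hf hf'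
      exact hf ⟨fun i hi => (hf'.1 i hi).trans (hf₀.1 i hi).symm, hf'.2⟩
    · filter_upwards [ae_mem_Y p] with f hf hf'
      exact absurd ⟨f, hf', hf⟩ hne
  have hc : {t | ∃ s, t = cyl n s}.Countable :=
    (cyls_countable n).mono (by rintro t ⟨s, hs⟩; exact ⟨n, s, le_rfl, hs⟩)
  filter_upwards [(ae_ball_iff hc).2 h1] with f hf hs
  exact hf _ ⟨f.1, rfl⟩ (mem_cyl_self hs)

/-- There are no invariant vectors below the sum of the depths. -/
lemma fixedSpace_fullRep_eq_bot [CompleteSpace H₁] [CompleteSpace H₂] {a b n : ℕ}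
    (h₁ : ∀ m < a, fixedSpace π₁ m = ⊥) (h₂ : ∀ m < b, fixedSpace π₂ m = ⊥) (hn : n < a + b) :
    fixedSpace (fullRep p π₁ π₂) n = ⊥ := by
  rw [Submodule.eq_bot_iff]
  intro F hF
  apply Lp.ext
  refine EventuallyEq.trans ?_ (Lp.coeFn_zero _ _ _).symm
  have h3 : ∀ᵐ f ∂(omegaY p), SymOut n f → F f = 0 := by
    refine ae_of_symOut n fun f₀ hf₀ hs => ?_
    obtain ⟨v, hv, hFv⟩ := exists_ae_eq_const hF hf₀ hs
    have hsum := hc_add hf₀ hs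
    -- The two halves add up to n < a + b, so one of them is below its bound and that factor has no
    -- invariant vectors.
    have hbot : fixedTensor π₁ π₂ (hc f₀ 0 n) (hc f₀ 1 n) = ⊥ := by
      refine fixedTensor_eq_bot ?_
      by_cases h : hc f₀ 0 n < a
      · exact Or.inl (h₁ _ h)
      · exact Or.inr (h₂ _ (by omega))
    rw [hbot, Submodule.mem_bot] at hv
    rwa [hv] at hFv
  filter_upwards [h3, ae_eq_zero_of_not_symOut hF] with f h4 h5
  by_cases h : SymOut n f
  · exact h4 h
  · exact h5 h

/-- The span of the functions with the value `x ⊗ y` on a cylinder of `Y_{a,b}`, where `x`, `y` are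
invariant vectors. -/
def cylSpan (p : Weights) (π₁ : URep H₁) (π₂ : URep H₂) (a b : ℕ) :
    Submodule ℂ (L2Y p H₁ H₂) :=
  Submodule.span ℂ {F | ∃ f₀ ∈ Yab a b, ∃ x ∈ fixedSpace π₁ a, ∃ y ∈ fixedSpace π₂ b,
    F = cylVec p (a + b) f₀.1 (pt x y)}

lemma finiteDimensional_span_image {ι E F : Type*} [Finite ι] [AddCommGroup E] [Module ℂ E]
    [AddCommGroup F] [Module ℂ F] (L : ι → E →ₗ[ℂ] F) (W : Submodule ℂ E)
    [FiniteDimensional ℂ W] {S : Set F} (hS : ∀ s ∈ S, ∃ i, ∃ w ∈ W, L i w = s) :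
    FiniteDimensional ℂ (Submodule.span ℂ S) := by
  have : FiniteDimensional ℂ (⨆ i, W.map (L i) : Submodule ℂ F) :=
    Submodule.finiteDimensional_iSup _
  refine Submodule.finiteDimensional_of_le (S₂ := ⨆ i, W.map (L i)) (Submodule.span_le.2 ?_)
  intro s hs
  obtain ⟨i, w, hw, h⟩ := hS s hs
  exact Submodule.mem_iSup_of_mem i ⟨w, hw, h⟩

/-- A cylinder depends only on the labels in the box, so finitely many linear maps produce all
generators of `cylSpan`; hence its finite dimension. -/
lemma exists_cylVecₗ_eq (a b : ℕ) {F : L2Y p H₁ H₂}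
    (hF : F ∈ {F | ∃ f₀ ∈ Yab a b, ∃ x ∈ fixedSpace π₁ a, ∃ y ∈ fixedSpace π₂ b,
      F = cylVec p (a + b) f₀.1 (pt x y)}) :
    ∃ t : box (a + b) → Fin 2, ∃ w ∈ Submodule.map₂ (ptₗ (H₁ := H₁) (H₂ := H₂))
      (fixedSpace π₁ a) (fixedSpace π₂ b),
      cylVecₗ p (a + b) (fun i => if h : i ∈ box (a + b) then t ⟨i, h⟩ else 0) w = F := by
  obtain ⟨f₀, -, x, hx, y, hy, rfl⟩ := hF
  refine ⟨fun i => f₀.1 i, pt x y, Submodule.apply_mem_map₂ ptₗ hx hy, ?_⟩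
  rw [cylVecₗ_apply]
  refine cylVec_congr (fun i hi => ?_) _
  exact dif_pos hi

lemma finiteDimensional_cylSpan (a b : ℕ) [FiniteDimensional ℂ (fixedSpace π₁ a)]
    [FiniteDimensional ℂ (fixedSpace π₂ b)] : FiniteDimensional ℂ (cylSpan p π₁ π₂ a b) := by
  have h1 := finiteDimensional_map₂ π₁ π₂ a b
  exact finiteDimensional_span_image _ _ fun s hs => exists_cylVecₗ_eq a b hs
lemma cylVec_mem_cylSpan {a b : ℕ} [FiniteDimensional ℂ (fixedSpace π₁ a)]
    [FiniteDimensional ℂ (fixedSpace π₂ b)] {f₀ : X} (hf₀ : f₀ ∈ Yab a b) {v : HT H₁ H₂}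
    (hv : v ∈ fixedTensor π₁ π₂ a b) : cylVec p (a + b) f₀.1 v ∈ cylSpan p π₁ π₂ a b := by
  rw [fixedTensor_eq_map₂] at hv
  have : Submodule.map₂ ptₗ (fixedSpace π₁ a) (fixedSpace π₂ b) ≤
      (cylSpan p π₁ π₂ a b).comap (cylVecₗ p (a + b) f₀.1) := by
    rw [Submodule.map₂_le]
    intro x hx y hy
    exact Submodule.subset_span ⟨f₀, hf₀, x, hx, y, hy, rfl⟩
  exact this hv

lemma cylSpan_le (a b : ℕ) :
    cylSpan p π₁ π₂ a b ≤ fixedSpace (fullRep p π₁ π₂) (a + b) := by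
  refine Submodule.span_le.2 ?_
  rintro _ ⟨f₀, hf₀, x, hx, y, hy, rfl⟩
  rw [mem_Yab_iff] at hf₀
  refine cylVec_mem_fixedSpace ?_
  rw [hf₀.2.2.1, hf₀.2.2.2]
  exact pt_mem_fixedTensor hx hy

/-- F is constant on the cylinders of order a + b. If such a cylinder is not in Y_{a,b}, one of the
two factors has no invariant vectors at its level. Within Y, a nonempty set Y_{a,b,D} is such a
cylinder, as D determines the labels in the box. -/
lemma mem_Hab_of_mem_fixedSpace [CompleteSpace H₁] [CompleteSpace H₂] {a b : ℕ}
    (h₁ : ∀ m < a, fixedSpace π₁ m = ⊥) (h₂ : ∀ m < b, fixedSpace π₂ m = ⊥)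
    {F : L2Y p H₁ H₂} (hF : F ∈ fixedSpace (fullRep p π₁ π₂) (a + b)) :
    F ∈ Hab p π₁ π₂ a b := by
  refine ⟨?_, fun D => ?_⟩
  · have h3 : ∀ᵐ f ∂(omegaY p), SymOut (a + b) f → f ∉ Yab a b → F f = 0 := by
      refine ae_of_symOut (a + b) fun f₀ hf₀ hs => ?_
      by_cases hab : f₀ ∈ Yab a b
      · filter_upwards [ae_mem_Y p] with f hY hf hn
        exact absurd (mem_Yab_of_cyl hab hY hf) hn
      · obtain ⟨v, hv, hFv⟩ := exists_ae_eq_const hF hf₀ hs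
        have hsum := hc_add hf₀ hs
        have hbot : fixedTensor π₁ π₂ (hc f₀ 0 (a + b)) (hc f₀ 1 (a + b)) = ⊥ := by
          refine fixedTensor_eq_bot ?_
          by_cases h : hc f₀ 0 (a + b) < a
          · exact Or.inl (h₁ _ h)
          · refine Or.inr (h₂ _ ?_)
            by_contra h'
            exact hab (mem_Yab_iff.2 ⟨hf₀, hs, by omega, by omega⟩)
        rw [hbot, Submodule.mem_bot] at hv
        rw [hv] at hFv
        filter_upwards [hFv] with f hf hf' _
        exact hf hf'
    filter_upwards [h3, ae_eq_zero_of_not_symOut hF] with f h4 h5 hn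
    by_cases h : SymOut (a + b) f
    · exact h4 h hn
    · exact h5 h
  · by_cases hne : ∃ f₀, f₀ ∈ YabD a b D
    · obtain ⟨f₀, hf₀, hD⟩ := hne
      have hf₀' := mem_Yab_iff.1 hf₀
      obtain ⟨v, hv, hFv⟩ := exists_ae_eq_const hF hf₀'.1 hf₀'.2.1
      rw [hf₀'.2.2.1, hf₀'.2.2.2] at hv
      refine ⟨v, hv, ?_⟩
      filter_upwards [hFv] with f hf hfD
      refine hf ⟨fun i hi => ?_, hfD.1.2.2.2⟩
      have h3 := hfD.2.trans hD.symm
      have h4 := Finset.ext_iff.1 h3 i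
      simp only [Finset.mem_filter, hi, true_and] at h4
      revert h4
      generalize f.1 i = u
      generalize f₀.1 i = w
      revert u w
      decide
    · exact ⟨0, zero_mem _, Eventually.of_forall fun f hf => absurd ⟨f, hf⟩ hne⟩

lemma Hab_sub {a b : ℕ} {F F' : L2Y p H₁ H₂} (hF : F ∈ Hab p π₁ π₂ a b)
    (hF' : F' ∈ Hab p π₁ π₂ a b) : F - F' ∈ Hab p π₁ π₂ a b := by
  refine ⟨?_, fun D => ?_⟩
  · filter_upwards [hF.1, hF'.1, Lp.coeFn_sub F F'] with f h1 h2 h3 hn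
    rw [h3, Pi.sub_apply, h1 hn, h2 hn, sub_zero]
  · obtain ⟨v, hv, h1⟩ := hF.2 D
    obtain ⟨v', hv', h1'⟩ := hF'.2 D
    refine ⟨v - v', sub_mem hv hv', ?_⟩
    filter_upwards [h1, h1', Lp.coeFn_sub F F'] with f h2 h3 h4 hf
    rw [h4, Pi.sub_apply, h2 hf, h3 hf]

/-- The part of F orthogonal to the finite dimensional span is again in H_{a,b}. On each cylinder it
has a constant value v and is orthogonal to the cylinder function with this very value, so v = 0. -/
lemma mem_cylSpan_of_mem_Hab [CompleteSpace H₁] [CompleteSpace H₂] {a b : ℕ}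
    [FiniteDimensional ℂ (fixedSpace π₁ a)] [FiniteDimensional ℂ (fixedSpace π₂ b)]
    (h₁ : ∀ m < a, fixedSpace π₁ m = ⊥) (h₂ : ∀ m < b, fixedSpace π₂ m = ⊥)
    {F : L2Y p H₁ H₂} (hF : F ∈ Hab p π₁ π₂ a b) : F ∈ cylSpan p π₁ π₂ a b := by
  have hfd := finiteDimensional_cylSpan (p := p) (π₁ := π₁) (π₂ := π₂) a b
  set S := cylSpan p π₁ π₂ a b with hS
  have hmem : S.starProjection F ∈ S := Submodule.starProjection_apply_mem _ _
  set F' := F - S.starProjection F with hF'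
  have h3 : F' ∈ Hab p π₁ π₂ a b :=
    Hab_sub hF (mem_Hab_of_mem_fixedSpace h₁ h₂ (cylSpan_le a b hmem))
  have h4 : F' ∈ Sᗮ := Submodule.sub_starProjection_mem_orthogonal F
  have h5 : F' = 0 := by
    apply Lp.ext
    refine EventuallyEq.trans ?_ (Lp.coeFn_zero _ _ _).symm
    have h6 : ∀ᵐ f ∂(omegaY p), SymOut (a + b) f → f ∈ Yab a b → F' f = 0 := by
      refine ae_of_symOut (a + b) fun f₀ hf₀ hs => ?_
      by_cases hab : f₀ ∈ Yab a b
      · obtain ⟨v, hv, hFv⟩ := h3.2 ((box (a + b)).filter fun i => f₀.1 i = 0)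
        have h7 : ∀ᵐ f ∂(omegaY p), f ∈ cyl (a + b) f₀.1 → F' f = v := by
          filter_upwards [hFv, ae_mem_Y p] with f hf hY hc'
          exact hf ⟨mem_Yab_of_cyl hab hY hc', Finset.filter_congr fun i hi => by rw [hc'.1 i hi]⟩
        have h8 : inner ℂ (cylVec p (a + b) f₀.1 v) F' = 0 := h4 _ (cylVec_mem_cylSpan hab hv)
        have h9 : ∫ f in cyl (a + b) f₀.1, F' f ∂(omegaY p) =
            ∫ f in cyl (a + b) f₀.1, cylVec p (a + b) f₀.1 v f ∂(omegaY p) := by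
          refine setIntegral_congr_ae (measurableSet_cyl _ _) ?_
          filter_upwards [h7, coeFn_cylVec (p := p) (a + b) f₀.1 v] with f hf hf' hc'
          rw [hf hc', hf', Set.indicator_of_mem hc']
        rw [inner_cylVec, h9, ← inner_cylVec, inner_cylVec_same, mul_eq_zero,
          inner_self_eq_zero] at h8
        have hv0 : v = 0 := by
          refine h8.resolve_left ?_
          rw [Complex.ofReal_eq_zero, measureReal_def, ENNReal.toReal_eq_zero_iff, not_or]
          exact ⟨omegaY_cyl_ne_zero p hf₀ hs, omegaY_cyl_ne_top p _ _⟩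
        filter_upwards [h7] with f hf hc' _
        rw [hf hc', hv0]
      · filter_upwards [ae_mem_Y p] with f hY hf hn
        refine absurd (mem_Yab_of_cyl hn hf₀ ⟨fun i hi => (hf.1 i hi).symm, hs⟩) hab
    filter_upwards [h6, h3.1] with f h7 h8
    by_cases h : f ∈ Yab a b
    · exact h7 h.2.2.2 h
    · exact h8 h
  rw [hF', sub_eq_zero] at h5
  rw [h5]
  exact hmem

theorem fixedSpace_fullRep_eq [CompleteSpace H₁] [CompleteSpace H₂] {a b : ℕ}
    [FiniteDimensional ℂ (fixedSpace π₁ a)] [FiniteDimensional ℂ (fixedSpace π₂ b)]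
    (h₁ : ∀ m < a, fixedSpace π₁ m = ⊥) (h₂ : ∀ m < b, fixedSpace π₂ m = ⊥) :
    fixedSpace (fullRep p π₁ π₂) (a + b) = cylSpan p π₁ π₂ a b :=
  le_antisymm (fun _ hF => mem_cylSpan_of_mem_Hab h₁ h₂ (mem_Hab_of_mem_fixedSpace h₁ h₂ hF))
    (cylSpan_le a b)

theorem Hab_eq [CompleteSpace H₁] [CompleteSpace H₂] {a b : ℕ}
    [FiniteDimensional ℂ (fixedSpace π₁ a)] [FiniteDimensional ℂ (fixedSpace π₂ b)]
    (h₁ : ∀ m < a, fixedSpace π₁ m = ⊥) (h₂ : ∀ m < b, fixedSpace π₂ m = ⊥) :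
    Hab p π₁ π₂ a b = fixedSpace (fullRep p π₁ π₂) (a + b) :=
  Set.Subset.antisymm (fun _ hF => cylSpan_le a b (mem_cylSpan_of_mem_Hab h₁ h₂ hF))
    fun _ hF => mem_Hab_of_mem_fixedSpace h₁ h₂ hF

end Root

/-! ### Irreducibility of the root and Schur's lemma -/

section Schur

variable {H : Type*} [NormedAddCommGroup H] [InnerProductSpace ℂ H] {π : URep H}

lemma fixedSpace_eq_bot_of_lt_depth {n : ℕ} (hn : n < depth π) : fixedSpace π n = ⊥ := by
  by_contra h
  exact Nat.notMem_of_lt_sInf hn h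

lemma depth_eq {d : ℕ} (h : ∀ n < d, fixedSpace π n = ⊥) (hd : fixedSpace π d ≠ ⊥) :
    depth π = d := by
  refine le_antisymm (Nat.sInf_le hd) ?_
  by_contra hc
  push Not at hc
  have : depth π ∈ {n | fixedSpace π n ≠ ⊥} := Nat.sInf_mem ⟨d, hd⟩
  exact this (h _ hc)

lemma root_ne_bot [Nontrivial H] (hadm : IsAdmissible π) : root π ≠ ⊥ := by
  have hne : {n | fixedSpace π n ≠ ⊥}.Nonempty := by
    by_contra h
    rw [Set.not_nonempty_iff_eq_empty, Set.eq_empty_iff_forall_notMem] at h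
    simp only [Set.mem_ofPred_eq, not_not] at h
    have h1 : (⋃ n, (fixedSpace π n : Set H)) = {0} := by
      simp [h]
    rw [IsAdmissible, h1] at hadm
    obtain ⟨x, hx⟩ := exists_ne (0 : H)
    have := hadm x
    rw [closure_singleton, Set.mem_singleton_iff] at this
    exact hx this
  exact Nat.sInf_mem hne

lemma ofPerm_smul {n : ℕ} (σ : Equiv.Perm (box n)) (i : box n) : ofPerm σ • (i : NZ) = σ i := by
  rw [ofPerm, ofNZ_smul, Equiv.Perm.ofSubtype_apply_coe]

lemma inG_ofPerm {n : ℕ} (σ : Equiv.Perm (box n)) : InG n (ofPerm σ) := fun i hi => by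
  rw [ofPerm, ofNZ_smul, Equiv.Perm.ofSubtype_apply_of_not_mem]
  rw [mem_box]; omega

lemma ofPerm_mul {n : ℕ} (σ τ : Equiv.Perm (box n)) : ofPerm (σ * τ) = ofPerm σ * ofPerm τ := by
  refine GE.ext_smul fun i => ?_
  rw [mul_smul]
  by_cases hi : i ∈ box n
  · have h1 := ofPerm_smul (σ * τ) ⟨i, hi⟩
    have h2 := ofPerm_smul τ ⟨i, hi⟩
    simp only at h1 h2
    rw [h1, h2, ofPerm_smul, Equiv.Perm.mul_apply]
  · rw [mem_box, not_le] at hi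
    rw [inG_ofPerm _ i hi, inG_ofPerm τ i hi, inG_ofPerm σ i hi]

lemma exists_ofPerm {n : ℕ} {g : GE} (hg : InG n g) : ∃ σ : Equiv.Perm (box n), ofPerm σ = g := by
  refine ⟨⟨fun i => ⟨g • i.1, mem_box.2 (hg.abs_le (mem_box.1 i.2))⟩,
    fun i => ⟨g⁻¹ • i.1, mem_box.2 (hg.inv.abs_le (mem_box.1 i.2))⟩,
    fun i => Subtype.ext (inv_smul_smul _ _), fun i => Subtype.ext (smul_inv_smul _ _)⟩, ?_⟩
  refine GE.ext_smul fun i => ?_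
  by_cases hi : i ∈ box n
  · exact ofPerm_smul _ ⟨i, hi⟩
  · rw [mem_box, not_le] at hi
    rw [inG_ofPerm _ i hi, hg i hi]

/-- The root is irreducible under `G(d)` and the operators `A_i`, `0 < |i| ≤ d`. -/
def IsIrredRoot (π : URep H) (d : ℕ) : Prop :=
  ∀ V ≤ fixedSpace π d, V ≠ ⊥ → (∀ g, InG d g → ∀ v ∈ V, π g v ∈ V) →
    (∀ i : NZ, |(i : ℤ)| ≤ d → ∀ v ∈ V, opA π i v ∈ V) → V = fixedSpace π d

/-- The isomorphism pulls stable subspaces back to submodules of V_Λ, which is irreducible by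
`youngModule_irreducible`. -/
lemma HasYoungDist.isIrredRoot {Λ : YoungDist} (h : HasYoungDist π Λ) :
    IsIrredRoot π (depth π) := by
  obtain ⟨T, Φ, hinj, hran, hperm, hdiag⟩ := h
  intro V hV h0 hG hA
  have hVr : V ≤ LinearMap.range Φ := by rw [hran]; exact hV
  have hmap : (V.comap Φ).map Φ = V := by
    rw [Submodule.map_comap_eq, inf_eq_right.2 hVr]
  set N : Submodule ℂ (Equiv.Perm (box (depth π)) → ℂ) := (V.comap Φ).map (youngModule T).subtype
    with hN
  have hNtop : N = youngModule T := by
    refine youngModule_irreducible (T := T) ?_ ?_ ?_ ?_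
    · rintro _ ⟨v, -, rfl⟩; exact v.2
    · intro hbot
      apply h0
      have hbot' := Submodule.map_injective_of_injective (youngModule T).injective_subtype
        (hbot.trans (Submodule.map_bot _).symm)
      rw [← hmap, hbot', Submodule.map_bot]
    · rintro σ _ ⟨v, hv, rfl⟩
      refine ⟨permAct T σ v, ?_, rfl⟩
      change Φ _ ∈ V
      rw [hperm]
      exact hG _ (inG_ofPerm σ) _ hv
    · rintro i _ ⟨v, hv, rfl⟩
      refine ⟨diagAct T i v, ?_, rfl⟩
      change Φ _ ∈ V
      rw [hdiag]
      exact hA _ (mem_box.1 i.2) _ hv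
  change V = root π
  rw [← hran]
  refine le_antisymm hVr ?_
  rintro _ ⟨v, rfl⟩
  have hv : (v : Equiv.Perm (box (depth π)) → ℂ) ∈ N := by rw [hNtop]; exact v.2
  obtain ⟨w, hw, hwv⟩ := hv
  have : w = v := Subtype.ext hwv
  rw [← this]
  exact hw

lemma HasYoungDist.finiteDimensional {Λ : YoungDist} (h : HasYoungDist π Λ) :
    FiniteDimensional ℂ (fixedSpace π (depth π)) := by
  obtain ⟨T, Φ, hinj, hran, -, -⟩ := h
  have h1 : FiniteDimensional ℂ (LinearMap.range Φ) := inferInstance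
  rw [hran] at h1
  exact h1

/-- The vectors of `R` that are eigenvectors of the compression of `S` to `R`. -/
def eigenSub (R : Submodule ℂ H) (S : H →ₗ[ℂ] H) (θ : ℂ) : Submodule ℂ H where
  carrier := {v | v ∈ R ∧ ∀ u ∈ R, inner ℂ u (S v) = θ * inner ℂ u v}
  zero_mem' := ⟨zero_mem _, by simp⟩
  add_mem' := by
    rintro v w ⟨hv, hv'⟩ ⟨hw, hw'⟩
    refine ⟨add_mem hv hw, fun u hu => ?_⟩
    rw [map_add, inner_add_right, hv' u hu, hw' u hu, inner_add_right, mul_add]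
  smul_mem' := by
    rintro c v ⟨hv, hv'⟩
    refine ⟨R.smul_mem c hv, fun u hu => ?_⟩
    rw [map_smul, inner_smul_right, hv' u hu, inner_smul_right, mul_left_comm]

lemma eigenSub_le (R : Submodule ℂ H) (S : H →ₗ[ℂ] H) (θ : ℂ) : eigenSub R S θ ≤ R :=
  fun _ hv => And.left hv

/-- The compression of S to a finite dimensional space has an eigenvalue. Working with matrix
elements allows operators S that do not preserve R, as π(c) in `IsIrredRoot.exists_scalar_rep`. -/
lemma exists_eigenSub {R : Submodule ℂ H} [FiniteDimensional ℂ R] (hR : R ≠ ⊥) (S : H →ₗ[ℂ] H) :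
    ∃ θ, eigenSub R S θ ≠ ⊥ := by
  have : Nontrivial R := (Submodule.nontrivial_iff_ne_bot).2 hR
  obtain ⟨θ, hθ⟩ := Module.End.exists_eigenvalue
    ((R.orthogonalProjectionOnto.toLinearMap ∘ₗ S ∘ₗ R.subtype : R →ₗ[ℂ] R) : Module.End ℂ R)
  obtain ⟨v, hv⟩ := hθ.exists_hasEigenvector
  refine ⟨θ, fun hbot => hv.2 ?_⟩
  have h1 : (v : H) ∈ eigenSub R S θ := by
    refine ⟨v.2, fun u hu => ?_⟩
    have h2 : (R.starProjection (S v) : H) = θ • (v : H) := congrArg Subtype.val hv.apply_eq_smul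
    rw [eq_of_inner_fixed hu, h2, inner_smul_right]
  rw [hbot, Submodule.mem_bot] at h1
  exact Subtype.ext h1

variable {d : ℕ}

lemma eigenSub_rep {S : H →ₗ[ℂ] H} (θ : ℂ)
    (hS : ∀ g, InG d g → ∀ u ∈ fixedSpace π d, ∀ v ∈ fixedSpace π d,
      inner ℂ u (S (π g v)) = inner ℂ (π g⁻¹ u) (S v)) {g : GE} (hg : InG d g) {v : H}
    (hv : v ∈ eigenSub (fixedSpace π d) S θ) : π g v ∈ eigenSub (fixedSpace π d) S θ := by
  refine ⟨rep_mem_fixedSpace hg hv.1, fun u hu => ?_⟩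
  rw [hS g hg u hu v hv.1, hv.2 _ (rep_mem_fixedSpace hg.inv hu), inner_rep_right]

lemma eigenSub_opA [CompleteSpace H] (hadm : IsAdmissible π) {S : H →ₗ[ℂ] H} (θ : ℂ)
    (hS : ∀ i : NZ, |(i : ℤ)| ≤ d → ∀ u ∈ fixedSpace π d, ∀ v ∈ fixedSpace π d,
      inner ℂ u (S (opA π i v)) = inner ℂ (opA π i u) (S v)) {i : NZ} (hi : |(i : ℤ)| ≤ d) {v : H}
    (hv : v ∈ eigenSub (fixedSpace π d) S θ) : opA π i v ∈ eigenSub (fixedSpace π d) S θ := by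
  refine ⟨opA_mem hadm hi hv.1, fun u hu => ?_⟩
  rw [hS i hi u hu v hv.1, hv.2 _ (opA_mem hadm hi hu), inner_opA_left hadm]

/-- Schur's lemma. -/
theorem IsIrredRoot.exists_scalar [CompleteSpace H] (hirr : IsIrredRoot π d)
    (hadm : IsAdmissible π) [FiniteDimensional ℂ (fixedSpace π d)] {S : H →ₗ[ℂ] H}
    (hG : ∀ g, InG d g → ∀ u ∈ fixedSpace π d, ∀ v ∈ fixedSpace π d,
      inner ℂ u (S (π g v)) = inner ℂ (π g⁻¹ u) (S v))
    (hA : ∀ i : NZ, |(i : ℤ)| ≤ d → ∀ u ∈ fixedSpace π d, ∀ v ∈ fixedSpace π d,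
      inner ℂ u (S (opA π i v)) = inner ℂ (opA π i u) (S v)) :
    ∃ θ : ℂ, ∀ u ∈ fixedSpace π d, ∀ v ∈ fixedSpace π d, inner ℂ u (S v) = θ * inner ℂ u v := by
  by_cases h0 : fixedSpace π d = ⊥
  · refine ⟨0, fun u hu v _ => ?_⟩
    rw [h0, Submodule.mem_bot] at hu
    rw [hu]; simp
  obtain ⟨θ, hθ⟩ := exists_eigenSub h0 S
  have := hirr _ (eigenSub_le _ S θ) hθ (fun g hg v hv => eigenSub_rep θ hG hg hv)
    (fun i hi v hv => eigenSub_opA hadm θ hA hi hv)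
  exact ⟨θ, fun u hu v hv => (this.symm ▸ hv : v ∈ eigenSub (fixedSpace π d) S θ).2 u hu⟩

/-- Elements that fix `-d, …, d` act by scalars on an irreducible root. -/
theorem IsIrredRoot.exists_scalar_rep [CompleteSpace H] (hirr : IsIrredRoot π d)
    (hadm : IsAdmissible π) [FiniteDimensional ℂ (fixedSpace π d)] {c : GE}
    (hc : ∀ i : NZ, |(i : ℤ)| ≤ d → c • i = i) :
    ∃ θ : ℂ, ∀ u ∈ fixedSpace π d, ∀ v ∈ fixedSpace π d, inner ℂ u (π c v) = θ * inner ℂ u v := by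
  refine hirr.exists_scalar hadm (S := (π c).toLinearEquiv.toLinearMap) ?_ ?_
  · intro g hg u _ v _
    change inner ℂ u (π c (π g v)) = inner ℂ _ (π c v)
    rw [← rep_mul, ← commute_of_fix hg hc, rep_mul, inner_rep_right]
  · intro i hi u _ v _
    change inner ℂ u (π c (opA π i v)) = inner ℂ _ (π c v)
    rw [rep_opA hadm, hc i hi, inner_opA_left hadm]

end Schur

/-! ### Matrix elements -/

lemma transp_smul_eq_self {f : X} {u v : NZ} (h : f.1 u = f.1 v) : transp u v • f = f := by
  apply Subtype.ext
  funext i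
  rw [smul_apply, transp_inv, transp_smul]
  rcases eq_or_ne i u with rfl | hu
  · rw [Equiv.swap_apply_left, h]
  rcases eq_or_ne i v with rfl | hv
  · rw [Equiv.swap_apply_right, h]
  · rw [Equiv.swap_apply_of_ne_of_ne hu hv]

lemma coc_smul_of_fix {f : X} (hf : f ∈ Y) {g : GE} (hg : g • f = f) {j : Fin 2} {a : NZ}
    (h : f.1 a = j) (h' : f.1 (g • a) = j) :
    coc j g f • eta f hf j ⟨a, h⟩ = eta f hf j ⟨g • a, h'⟩ := by
  rw [coc_smul]
  exact eta_of_eq hg _ _ _ rfl _ _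

/-- The transposition of two points with the same label fixes f, so that the cocycle is just
conjugation by η. -/
lemma coc_transp_same {f : X} (hf : f ∈ Y) {c : Fin 2} {u v : NZ} (hu : f.1 u = c)
    (hv : f.1 v = c) :
    coc c (transp u v) f = transp (eta f hf c ⟨u, hu⟩) (eta f hf c ⟨v, hv⟩) := by
  refine GE.ext_smul fun i => ?_
  obtain ⟨⟨a, ha⟩, rfl⟩ := (eta f hf c).surjective i
  have hfix := transp_smul_eq_self (hu.trans hv.symm)
  have ha' : f.1 (transp u v • a) = c := by
    have := smul_apply (transp u v) f (transp u v • a)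
    rw [hfix, inv_smul_smul] at this
    rw [this, ha]
  rw [coc_smul_of_fix hf hfix ha ha', transp_smul (eta f hf c _)]
  rcases eq_or_ne a u with rfl | h1
  · rw [Equiv.swap_apply_left]
    congr 1
    simp
  rcases eq_or_ne a v with rfl | h2
  · rw [Equiv.swap_apply_right]
    congr 1
    simp
  · rw [Equiv.swap_apply_of_ne_of_ne]
    · congr 1
      simp [Equiv.swap_apply_of_ne_of_ne h1 h2]
    · exact fun h => h1 (congrArg Subtype.val ((eta f hf c).injective h))
    · exact fun h => h2 (congrArg Subtype.val ((eta f hf c).injective h))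

lemma coc_transp_ne {f : X} (hf : f ∈ Y) {c j : Fin 2} (hj : j ≠ c) {u v : NZ} (hu : f.1 u = c)
    (hv : f.1 v = c) : coc j (transp u v) f = 1 := by
  refine GE.ext_smul fun i => ?_
  obtain ⟨⟨a, ha⟩, rfl⟩ := (eta f hf j).surjective i
  have hfix := transp_smul_eq_self (hu.trans hv.symm)
  have h1 : a ≠ u := by rintro rfl; exact hj (ha.symm.trans hu)
  have h2 : a ≠ v := by rintro rfl; exact hj (ha.symm.trans hv)
  have h3 : transp u v • a = a := by rw [transp_smul, Equiv.swap_apply_of_ne_of_ne h1 h2]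
  rw [coc_smul_of_fix hf hfix ha (by rw [h3]; exact ha), one_smul]
  congr 1
  exact Subtype.ext h3

lemma cyc_smul_of_ne {i x : NZ} {M k : ℕ} (hi : x ≠ i) (h : ∀ j < k, x ≠ pos (M + j)) :
    cyc i M k • x = x := by
  induction k with
  | zero => exact one_smul _ _
  | succ k ih =>
    rw [cyc, mul_smul, transp_smul, Equiv.swap_apply_of_ne_of_ne hi (h k k.lt_succ_self)]
    exact ih fun j hj => h j (hj.trans k.lt_succ_self)

lemma cyc_smul_self {i : NZ} {M k : ℕ} (hi : |(i : ℤ)| ≤ M) :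
    cyc i M (k + 1) • i = pos (M + k) := by
  rw [cyc, mul_smul, transp_smul, Equiv.swap_apply_left]
  refine cyc_smul_of_ne (fun h => ?_) fun j hj h => ?_
  · rw [← h, abs_pos'] at hi
    push_cast at hi; omega
  · rw [pos_inj] at h; omega

lemma cyc_smul_pos {i : NZ} {M j k : ℕ} (hi : |(i : ℤ)| ≤ M) (hj : j < k) :
    cyc i M k • pos (M + j) = cyc i M j • i := by
  induction k with
  | zero => omega
  | succ k ih =>
    rw [cyc, mul_smul, transp_smul]
    rcases Nat.lt_succ_iff_lt_or_eq.1 hj with h | rfl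
    · rw [Equiv.swap_apply_of_ne_of_ne, ih h]
      · intro h'
        rw [← h', abs_pos'] at hi
        push_cast at hi; omega
      · rw [Ne, pos_inj]; omega
    · rw [Equiv.swap_apply_right]

lemma cyc_smul_eq_self {f : X} {i : NZ} {M k : ℕ} (h : ∀ j < k, f.1 (pos (M + j)) = f.1 i) :
    cyc i M k • f = f := by
  induction k with
  | zero => exact one_smul _ _
  | succ k ih =>
    rw [cyc, mul_smul, transp_smul_eq_self (h k k.lt_succ_self).symm]
    exact ih fun j hj => h j (hj.trans k.lt_succ_self)

/-- If the cycle keeps `f` in `X_n`, then `f` is constant along the cycle. -/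
lemma apply_eq_of_symOut_cyc {f : X} {i : NZ} {n k : ℕ} (hi : |(i : ℤ)| ≤ n) (hs : SymOut n f)
    (hs' : SymOut n (cyc i n k • f)) : ∀ j < k, f.1 (pos (n + j)) = f.1 i := by
  have happ : ∀ x, (cyc i n k • f).1 (cyc i n k • x) = f.1 x := fun x => by
    rw [smul_apply, inv_smul_smul]
  -- The cycle fixes the negative points beyond n, so by symmetry f and its image also agree at the
  -- positive points beyond n. But the cycle shifts these points, with i going to the last one; so
  -- the labels are equal, step by step from the last point downwards.
  have hneg : ∀ m, (cyc i n k • f).1 (-pos (n + m)) = f.1 (-pos (n + m)) := fun m => by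
    have h1 : cyc i n k • -pos (n + m) = -pos (n + m) :=
      cyc_smul_of_ne (fun h => by rw [← h, abs_neg_pos] at hi; push_cast at hi; omega)
        fun j _ => neg_ne_pos _ _
    have h2 := happ (-pos (n + m))
    rwa [h1] at h2
  have hpos : ∀ m, (cyc i n k • f).1 (pos (n + m)) = f.1 (pos (n + m)) := fun m => by
    have hm : (n : ℤ) < |((pos (n + m) : NZ) : ℤ)| := by rw [abs_pos']; push_cast; omega
    rw [hs' _ hm, hs _ hm, hneg]
  have key : ∀ r < k, f.1 (pos (n + (k - 1 - r))) = f.1 i := by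
    intro r
    induction r with
    | zero =>
      intro hk
      obtain ⟨l, rfl⟩ : ∃ l, k = l + 1 := ⟨k - 1, by omega⟩
      have h1 := happ i
      rw [cyc_smul_self hi, hpos] at h1
      simpa using h1
    | succ r ih =>
      intro hk
      have h1 := ih (by omega)
      obtain ⟨l, hl⟩ : ∃ l, k - 1 - r = l + 1 := ⟨k - 1 - (r + 1), by omega⟩
      rw [hl] at h1
      have h2 := happ (pos (n + (l + 1)))
      rw [cyc_smul_pos hi (by omega), cyc_smul_self hi, hpos, h1] at h2
      rwa [show k - 1 - (r + 1) = l by omega]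
  intro j hj
  have := key (k - 1 - j) (by omega)
  rwa [show k - 1 - (k - 1 - j) = j by omega] at this

lemma hc_succ {f : X} {m : ℕ} (hs : SymOut m f) {c : Fin 2}
    (h : f.1 (pos m) = c) : hc f c (m + 1) = hc f c m + 1 := by
  have h1 : f.1 (-pos m) = c := by rw [← hs _ (by rw [abs_pos']; omega), h]
  have h2 : cnt f c (m + 1) = cnt f c m + 2 := by
    unfold cnt
    rw [box_succ, Finset.filter_insert, Finset.filter_insert, if_pos h, if_pos h1,
      Finset.card_insert_of_notMem, Finset.card_insert_of_notMem]
    · exact fun h => (pos_notMem_box m).2 (Finset.mem_filter.1 h).1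
    · rw [Finset.mem_insert, not_or]
      exact ⟨pos_ne_neg m m, fun h => (pos_notMem_box m).1 (Finset.mem_filter.1 h).1⟩
  rw [hc, hc, h2]
  omega

/-- The cocycle at a cycle along which `f` is constant. -/
lemma coc_cyc {f : X} (hf : f ∈ Y) {i : NZ} {n k : ℕ} (hs : SymOut n f)
    {c : Fin 2} (hc' : f.1 i = c) (h : ∀ j < k, f.1 (pos (n + j)) = c) :
    coc c (cyc i n k) f = cyc (eta f hf c ⟨i, hc'⟩) (hc f c n) k ∧
      ∀ j ≠ c, coc j (cyc i n k) f = 1 := by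
  have key : ∀ k, (∀ j < k, f.1 (pos (n + j)) = c) → hc f c (n + k) = hc f c n + k := by
    intro k
    induction k with
    | zero => intro _; rfl
    | succ k ih =>
      intro h
      rw [← add_assoc, hc_succ (hs.mono (by omega)) (h k k.lt_succ_self),
        ih fun j hj => h j (hj.trans k.lt_succ_self)]
      rfl
  induction k with
  | zero => exact ⟨coc_one _ _, fun j _ => coc_one _ _⟩
  | succ k ih =>
    have hk := h k k.lt_succ_self
    obtain ⟨h1, h2⟩ := ih fun j hj => h j (hj.trans k.lt_succ_self)
    have hfix : transp i (pos (n + k)) • f = f := transp_smul_eq_self (hc'.trans hk.symm)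
    refine ⟨?_, fun j hj => ?_⟩
    · rw [cyc, coc_mul, hfix, h1, coc_transp_same hf hc' hk, eta_pos hf (hs.mono (by omega)),
        add_assoc, key _ h, cyc]
      rfl
    · rw [cyc, coc_mul, hfix, h2 j hj, coc_transp_ne hf hj hc' hk, one_mul]

section Matrix

variable {H₁ H₂ : Type*} [NormedAddCommGroup H₁] [InnerProductSpace ℂ H₁]
  [NormedAddCommGroup H₂] [InnerProductSpace ℂ H₂] {p : Weights} {π₁ : URep H₁} {π₂ : URep H₂}

open Classical in
/-- The matrix elements at cylinder functions. -/
lemma inner_fullRep_cylVec (g : GE) (n : ℕ) (s t : NZ → Fin 2) (v w : HT H₁ H₂) :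
    inner ℂ (cylVec p n t w) (fullRep p π₁ π₂ g (cylVec p n s v)) =
      ∫ f in cyl n t, (if g⁻¹ • f ∈ cyl n s then
        inner ℂ w (tensorOp π₁ π₂ (coc 0 g (g⁻¹ • f)) (coc 1 g (g⁻¹ • f)) v) else 0)
        ∂(omegaY p) := by
  refine (L2.inner_indicatorConstLp_eq_setIntegral_inner ℂ _ (measurableSet_cyl n t) w
    (omegaY_cyl_ne_top p n t)).trans ?_
  refine setIntegral_congr_ae (measurableSet_cyl n t) ?_
  filter_upwards [coeFn_fullRep (π₁ := π₁) (π₂ := π₂) g (cylVec p n s v),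
    actFun_congr p π₁ π₂ g (coeFn_cylVec (p := p) n s v)] with f h1 h2 _
  rw [h1, h2, actFun]
  split_ifs with h
  · rw [Set.indicator_of_mem h]
  · rw [Set.indicator_of_notMem h, map_zero, inner_zero_right]

/-- Where the integrand is not zero, f and its preimage under the cycle are both symmetric outside
{-n, …, n}; then the cycle fixes f, and f lies in both cylinders. -/
lemma inner_cyc_eq_zero {n : ℕ} {i : NZ} (hi : |(i : ℤ)| ≤ n) (k : ℕ) {s t : NZ → Fin 2}
    (hst : ¬ ∀ i ∈ box n, t i = s i) (v w : HT H₁ H₂) :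
    inner ℂ (cylVec p n t w) (fullRep p π₁ π₂ (cyc i n k) (cylVec p n s v)) = 0 := by
  classical
  rw [inner_fullRep_cylVec]
  refine setIntegral_eq_zero_of_forall_eq_zero fun f hf => ?_
  refine if_neg fun h => hst fun j hj => ?_
  have h2 : SymOut n (cyc i n k • (cyc i n k)⁻¹ • f) := by rw [smul_inv_smul]; exact hf.2
  have h3 := cyc_smul_eq_self (apply_eq_of_symOut_cyc hi h.2 h2)
  rw [smul_inv_smul] at h3
  rw [← hf.1 j hj, h3, h.1 j hj]

lemma exists_cyl_const (p : Weights) (n : ℕ) (s : NZ → Fin 2) (c : Fin 2) (k : ℕ) :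
    ∃ t, cyl n s ∩ {f | ∀ j < k, f.1 (pos (n + j)) = c} = cyl (n + k) t ∧
      omegaY p (cyl (n + k) t) = ENNReal.ofReal (p.w c) ^ k * omegaY p (cyl n s) := by
  induction k with
  | zero => exact ⟨s, by simp, by simp⟩
  | succ k ih =>
    obtain ⟨t, h1, h2⟩ := ih
    refine ⟨extend (n + k) t c, ?_, ?_⟩
    · rw [← add_assoc, ← cyl_inter_pos, ← h1]
      ext f
      simp only [Set.mem_inter_iff, Set.mem_ofPred_eq, Nat.lt_succ_iff_lt_or_eq]
      constructor
      · rintro ⟨h, h'⟩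
        exact ⟨⟨h, fun j hj => h' j (Or.inl hj)⟩, h' k (Or.inr rfl)⟩
      · rintro ⟨⟨h, h'⟩, h''⟩
        refine ⟨h, ?_⟩
        rintro j (hj | rfl)
        · exact h' j hj
        · exact h''
    · rw [← add_assoc, omegaY_cyl_extend, h2, pow_succ]
      ring

/-- The matrix elements of cycles. -/
lemma inner_cyc_cylVec {n : ℕ} {i : NZ} (hi : |(i : ℤ)| ≤ n) (k : ℕ) {f₀ : X} (hf₀ : f₀ ∈ Y)
    (hs : SymOut n f₀) {c : Fin 2} (hc' : f₀.1 i = c) (G : Fin 2 → GE)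
    (hG : G c = cyc (eta f₀ hf₀ c ⟨i, hc'⟩) (hc f₀ c n) k) (hG' : ∀ j ≠ c, G j = 1)
    (v w : HT H₁ H₂) :
    inner ℂ (cylVec p n f₀.1 w) (fullRep p π₁ π₂ (cyc i n k) (cylVec p n f₀.1 v)) =
      (p.w c : ℂ) ^ k * (((omegaY p).real (cyl n f₀.1) : ℝ) : ℂ) *
        inner ℂ w (tensorOp π₁ π₂ (G 0) (G 1) v) := by
  classical
  obtain ⟨t, ht, hν⟩ := exists_cyl_const p n f₀.1 c k
  have hcoc : ∀ f ∈ Y, f ∈ cyl n f₀.1 → (∀ j < k, f.1 (pos (n + j)) = c) →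
      ∀ j, coc j (cyc i n k) f = G j := by
    intro f hY hf hk j
    have hfi : f.1 i = c := by rw [hf.1 i (mem_box.2 hi), hc']
    obtain ⟨h1, h2⟩ := coc_cyc hY hf.2 hfi hk
    by_cases hj : j = c
    · subst hj
      rw [h1, hG, hc_congr hf, eta_congr j hf (mem_cyl_self hs) hY hf₀ i hfi hc' hi]
    · rw [h2 j hj, hG' j hj]
  rw [inner_fullRep_cylVec]
  -- Only functions with the label c along the whole cycle contribute. They are fixed by the cycle,
  -- the cocycle is constant on them, and they form a cylinder with the k-th power of the weight as
  -- its relative measure.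
  have h1 : ∫ f in cyl n f₀.1, (if (cyc i n k)⁻¹ • f ∈ cyl n f₀.1 then
        inner ℂ w (tensorOp π₁ π₂ (coc 0 (cyc i n k) ((cyc i n k)⁻¹ • f))
          (coc 1 (cyc i n k) ((cyc i n k)⁻¹ • f)) v) else 0) ∂(omegaY p) =
      ∫ f in cyl n f₀.1, (cyl (n + k) t).indicator
        (fun _ => inner ℂ w (tensorOp π₁ π₂ (G 0) (G 1) v)) f ∂(omegaY p) := by
    refine setIntegral_congr_ae (measurableSet_cyl _ _) ?_
    filter_upwards [ae_mem_Y p] with f hY hf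
    by_cases h : f ∈ cyl (n + k) t
    · have h' := h
      rw [← ht] at h'
      have hfi : f.1 i = c := by rw [hf.1 i (mem_box.2 hi), hc']
      have hfix : cyc i n k • f = f :=
        cyc_smul_eq_self fun j hj => by rw [h'.2 j hj, hfi]
      have hfix' : (cyc i n k)⁻¹ • f = f := by rw [inv_smul_eq_iff, hfix]
      rw [Set.indicator_of_mem h, hfix', if_pos hf, hcoc f hY hf h'.2, hcoc f hY hf h'.2]
    · rw [Set.indicator_of_notMem h, if_neg]
      intro hf'
      apply h
      have hsym : SymOut n (cyc i n k • (cyc i n k)⁻¹ • f) := by rw [smul_inv_smul]; exact hf.2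
      have h2 := apply_eq_of_symOut_cyc hi hf'.2 hsym
      have h3 := cyc_smul_eq_self h2
      rw [smul_inv_smul] at h3
      rw [← ht]
      refine ⟨hf, fun j hj => ?_⟩
      have h4 := h2 j hj
      rw [← h3] at h4
      rw [h4, hf.1 i (mem_box.2 hi), hc']
  rw [h1, setIntegral_indicator (measurableSet_cyl _ _), setIntegral_const,
    Set.inter_eq_right.2 (by rw [← ht]; exact Set.inter_subset_left), measureReal_def, hν,
    ENNReal.toReal_mul, ENNReal.toReal_pow, ENNReal.toReal_ofReal (p.w_pos c).le, measureReal_def,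
    Complex.real_smul]
  push_cast
  ring

end Matrix

/-! ### The root of the mixture -/

/-- A representation with a finite dimensional irreducible root. -/
structure HasIrredRoot {H : Type*} [NormedAddCommGroup H] [InnerProductSpace ℂ H]
    (π : URep H) : Prop where
  adm : IsAdmissible π
  ne_bot : fixedSpace π (depth π) ≠ ⊥
  fin : FiniteDimensional ℂ (fixedSpace π (depth π))
  irred : IsIrredRoot π (depth π)

lemma HasYoungDist.hasIrredRoot {H : Type*} [NormedAddCommGroup H] [InnerProductSpace ℂ H]
    {π : URep H} {Λ : YoungDist} (h : HasYoungDist π Λ) (hadm : IsAdmissible π)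
    (hirr : IsIrredRep π) : HasIrredRoot π :=
  have := hirr.1
  ⟨hadm, root_ne_bot hadm, h.finiteDimensional, h.isIrredRoot⟩

/-- The moments of the Thoma measure as matrix elements on the root. -/
lemma HasThomaMeasure.inner_pow {H : Type*} [NormedAddCommGroup H] [InnerProductSpace ℂ H]
    [CompleteSpace H] {π : URep H} {μ : Measure ℝ} (h : HasThomaMeasure π μ)
    [FiniteDimensional ℂ (fixedSpace π (depth π))] (k : ℕ) {u v : H}
    (hu : u ∈ fixedSpace π (depth π)) (hv : v ∈ fixedSpace π (depth π)) :
    inner ℂ u ((opA π (pos (depth π)) ^ k) v) = ((∫ t, t ^ k ∂μ : ℝ) : ℂ) * inner ℂ u v := by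
  set R := fixedSpace π (depth π) with hR
  set A := opA π (pos (depth π)) ^ k with hA
  set m : ℂ := ((∫ t, t ^ k ∂μ : ℝ) : ℂ) with hm
  have h1 : ∀ x ∈ R, inner ℂ x (A x) = m * inner ℂ x x := by
    intro x hx
    by_cases h0 : x = 0
    · simp [h0]
    have hn : (‖x‖ : ℂ) ≠ 0 := by exact_mod_cast norm_ne_zero_iff.2 h0
    have h2 := (h ((‖x‖ : ℂ)⁻¹ • x) (R.smul_mem _ hx) (norm_smul_inv_norm h0)).2.2 k
    rw [map_smul, inner_smul_left, inner_smul_right, map_inv₀, Complex.conj_ofReal] at h2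
    change (‖x‖ : ℂ)⁻¹ * ((‖x‖ : ℂ)⁻¹ * inner ℂ x (A x)) = m at h2
    have h3 : inner ℂ x x = (‖x‖ : ℂ) * ‖x‖ := by rw [inner_self_eq_norm_sq_to_K, sq]; rfl
    rw [h3, ← h2]
    field_simp
  -- Polarization: the compression of A - m to the root has zero quadratic form, and over ℂ this
  -- makes it zero.
  set T : R →ₗ[ℂ] R := R.orthogonalProjectionOnto.toLinearMap ∘ₗ
    (A.toLinearMap - m • LinearMap.id) ∘ₗ R.subtype with hT
  have h4 : ∀ x y : R, inner ℂ x (T y) = inner ℂ (x : H) (A y) - m * inner ℂ (x : H) (y : H) := by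
    intro x y
    have : inner ℂ x (T y) = inner ℂ (x : H) (R.starProjection (A y - m • (y : H))) := rfl
    rw [this, ← eq_of_inner_fixed x.2, inner_sub_right, inner_smul_right]
  have h5 : T = 0 := by
    rw [← inner_map_self_eq_zero]
    intro x
    rw [← inner_conj_symm, h4, h1 _ x.2, sub_self, map_zero]
  have h6 := h4 ⟨u, hu⟩ ⟨v, hv⟩
  rw [h5, LinearMap.zero_apply, inner_zero_right] at h6
  exact (sub_eq_zero.1 h6.symm)

section Mix

variable {H₁ H₂ : Type*} [NormedAddCommGroup H₁] [InnerProductSpace ℂ H₁]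
  [NormedAddCommGroup H₂] [InnerProductSpace ℂ H₂] {p : Weights} {π₁ : URep H₁} {π₂ : URep H₂}

instance : CompleteSpace (mixtureSpace p π₁ π₂) := (isClosed_cyclicSpan _).completeSpace_coe

lemma coe_mixture (g : GE) (F : mixtureSpace p π₁ π₂) :
    ((mixture p π₁ π₂ g F : mixtureSpace p π₁ π₂) : L2Y p H₁ H₂) = fullRep p π₁ π₂ g F := rfl

lemma mem_fixedSpace_mixture {n : ℕ} {F : mixtureSpace p π₁ π₂} :
    F ∈ fixedSpace (mixture p π₁ π₂) n ↔ (F : L2Y p H₁ H₂) ∈ fixedSpace (fullRep p π₁ π₂) n :=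
  mem_fixedSpace_subrep _

variable [CompleteSpace H₁] [CompleteSpace H₂] (h₁ : HasIrredRoot π₁) (h₂ : HasIrredRoot π₂)
include h₁ h₂

lemma Hab_depth_eq : Hab p π₁ π₂ (depth π₁) (depth π₂) =
    fixedSpace (fullRep p π₁ π₂) (depth π₁ + depth π₂) :=
  have := h₁.fin
  have := h₂.fin
  Hab_eq (fun _ h => fixedSpace_eq_bot_of_lt_depth h) fun _ h => fixedSpace_eq_bot_of_lt_depth h

lemma fixedSpace_depth_eq : fixedSpace (fullRep p π₁ π₂) (depth π₁ + depth π₂) =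
    cylSpan p π₁ π₂ (depth π₁) (depth π₂) :=
  have := h₁.fin
  have := h₂.fin
  fixedSpace_fullRep_eq (fun _ h => fixedSpace_eq_bot_of_lt_depth h)
    fun _ h => fixedSpace_eq_bot_of_lt_depth h

theorem isAdmissible_mixture : IsAdmissible (mixture p π₁ π₂) :=
  isAdmissible_subrep_of _ (dense_cyclicSpan (Hab_depth_eq h₁ h₂).subset)

omit h₁ h₂ in
lemma fixedSpace_mixture_eq_bot {n : ℕ} (hn : n < depth π₁ + depth π₂) :
    fixedSpace (mixture p π₁ π₂) n = ⊥ := by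
  rw [Submodule.eq_bot_iff]
  intro F hF
  rw [mem_fixedSpace_mixture, fixedSpace_fullRep_eq_bot
    (fun _ h => fixedSpace_eq_bot_of_lt_depth h) (fun _ h => fixedSpace_eq_bot_of_lt_depth h) hn]
    at hF
  exact Subtype.ext hF

lemma fixedSpace_le_mixtureSpace :
    fixedSpace (fullRep p π₁ π₂) (depth π₁ + depth π₂) ≤ mixtureSpace p π₁ π₂ := by
  intro F hF
  refine subset_cyclicSpan _ ?_
  rw [Hab_depth_eq h₁ h₂]
  exact hF

lemma cylVec_mem_root {f₀ : X} (hf₀ : f₀ ∈ Yab (depth π₁) (depth π₂)) {x : H₁}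
    (hx : x ∈ fixedSpace π₁ (depth π₁)) {y : H₂} (hy : y ∈ fixedSpace π₂ (depth π₂)) :
    cylVec p (depth π₁ + depth π₂) f₀.1 (pt x y) ∈
      fixedSpace (fullRep p π₁ π₂) (depth π₁ + depth π₂) := by
  rw [fixedSpace_depth_eq h₁ h₂]
  exact Submodule.subset_span ⟨f₀, hf₀, x, hx, y, hy, rfl⟩

lemma cylVec_mem_mixtureSpace {f₀ : X} (hf₀ : f₀ ∈ Yab (depth π₁) (depth π₂)) {x : H₁}
    (hx : x ∈ fixedSpace π₁ (depth π₁)) {y : H₂} (hy : y ∈ fixedSpace π₂ (depth π₂)) :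
    cylVec p (depth π₁ + depth π₂) f₀.1 (pt x y) ∈ mixtureSpace p π₁ π₂ :=
  fixedSpace_le_mixtureSpace h₁ h₂ (cylVec_mem_root h₁ h₂ hf₀ hx hy)

/-- The root of the mixture is spanned by the functions with the value `x ⊗ y` on a cylinder. -/
lemma span_fixedSpace_mixture : fixedSpace (mixture p π₁ π₂) (depth π₁ + depth π₂) =
    Submodule.span ℂ {F : mixtureSpace p π₁ π₂ | ∃ f₀ ∈ Yab (depth π₁) (depth π₂),
      ∃ x ∈ fixedSpace π₁ (depth π₁), ∃ y ∈ fixedSpace π₂ (depth π₂),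
      (F : L2Y p H₁ H₂) = cylVec p (depth π₁ + depth π₂) f₀.1 (pt x y)} := by
  apply Submodule.map_injective_of_injective (mixtureSpace p π₁ π₂).injective_subtype
  have h3 : (fixedSpace (mixture p π₁ π₂) (depth π₁ + depth π₂)).map
      (mixtureSpace p π₁ π₂).subtype =
      fixedSpace (fullRep p π₁ π₂) (depth π₁ + depth π₂) := by
    ext F
    constructor
    · rintro ⟨F, hF, rfl⟩
      exact mem_fixedSpace_mixture.1 hF
    · intro hF
      exact ⟨⟨F, fixedSpace_le_mixtureSpace h₁ h₂ hF⟩, mem_fixedSpace_mixture.2 hF, rfl⟩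
  rw [h3, fixedSpace_depth_eq h₁ h₂, Submodule.map_span, cylSpan]
  congr 1
  ext F
  constructor
  · rintro ⟨f₀, hf₀, x, hx, y, hy, rfl⟩
    exact ⟨⟨_, cylVec_mem_mixtureSpace h₁ h₂ hf₀ hx hy⟩, ⟨f₀, hf₀, x, hx, y, hy, rfl⟩, rfl⟩
  · rintro ⟨F, ⟨f₀, hf₀, x, hx, y, hy, h⟩, rfl⟩
    exact ⟨f₀, hf₀, x, hx, y, hy, h⟩

lemma finiteDimensional_root_mixture :
    FiniteDimensional ℂ (fixedSpace (mixture p π₁ π₂) (depth π₁ + depth π₂)) := by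
  have := h₁.fin
  have := h₂.fin
  have h3 := finiteDimensional_cylSpan (p := p) (π₁ := π₁) (π₂ := π₂) (depth π₁) (depth π₂)
  have h4 : ∀ F : fixedSpace (mixture p π₁ π₂) (depth π₁ + depth π₂),
      (((mixtureSpace p π₁ π₂).subtype ∘ₗ
        (fixedSpace (mixture p π₁ π₂) (depth π₁ + depth π₂)).subtype) F) ∈
        cylSpan p π₁ π₂ (depth π₁) (depth π₂) := fun F => by
    rw [← fixedSpace_depth_eq h₁ h₂]
    exact mem_fixedSpace_mixture.1 F.2
  refine FiniteDimensional.of_injective (LinearMap.codRestrict _ _ h4) fun F F' h => ?_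
  have h5 := congrArg Subtype.val h
  exact Subtype.ext (Subtype.ext h5)

/-- Sesquilinear identities on the root of the mixture are checked on the generators. -/
lemma inner_root_induction {A : mixtureSpace p π₁ π₂ →ₗ[ℂ] mixtureSpace p π₁ π₂} {γ : ℂ}
    (h : ∀ f₀ ∈ Yab (depth π₁) (depth π₂), ∀ f₁ ∈ Yab (depth π₁) (depth π₂),
      ∀ x ∈ fixedSpace π₁ (depth π₁), ∀ x' ∈ fixedSpace π₁ (depth π₁),
      ∀ y ∈ fixedSpace π₂ (depth π₂), ∀ y' ∈ fixedSpace π₂ (depth π₂),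
      ∀ F F' : mixtureSpace p π₁ π₂,
      (F : L2Y p H₁ H₂) = cylVec p (depth π₁ + depth π₂) f₀.1 (pt x y) →
      (F' : L2Y p H₁ H₂) = cylVec p (depth π₁ + depth π₂) f₁.1 (pt x' y') →
      inner ℂ F' (A F) = γ * inner ℂ F' F) {u v : mixtureSpace p π₁ π₂}
    (hu : u ∈ fixedSpace (mixture p π₁ π₂) (depth π₁ + depth π₂))
    (hv : v ∈ fixedSpace (mixture p π₁ π₂) (depth π₁ + depth π₂)) :
    inner ℂ u (A v) = γ * inner ℂ u v := by
  rw [span_fixedSpace_mixture h₁ h₂] at hu hv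
  induction hv using Submodule.span_induction with
  | mem F hF =>
    obtain ⟨f₀, hf₀, x, hx, y, hy, hF⟩ := hF
    induction hu using Submodule.span_induction with
    | mem F' hF' =>
      obtain ⟨f₁, hf₁, x', hx', y', hy', hF'⟩ := hF'
      exact h f₀ hf₀ f₁ hf₁ x hx x' hx' y hy y' hy' F F' hF hF'
    | zero => simp
    | add a b _ _ ha hb => rw [inner_add_left, inner_add_left, ha, hb, mul_add]
    | smul c a _ ha => rw [inner_smul_left, inner_smul_left, ha, mul_left_comm]
  | zero => simp
  | add a b _ _ ha hb => rw [map_add, inner_add_right, inner_add_right, ha, hb, mul_add]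
  | smul c a _ ha => rw [map_smul, inner_smul_right, inner_smul_right, ha, mul_left_comm]

lemma eq_of_inner_root {u v : mixtureSpace p π₁ π₂}
    (hu : u ∈ fixedSpace (mixture p π₁ π₂) (depth π₁ + depth π₂))
    (hv : v ∈ fixedSpace (mixture p π₁ π₂) (depth π₁ + depth π₂))
    (h : ∀ f₀ ∈ Yab (depth π₁) (depth π₂), ∀ x ∈ fixedSpace π₁ (depth π₁),
      ∀ y ∈ fixedSpace π₂ (depth π₂), ∀ F : mixtureSpace p π₁ π₂,
      (F : L2Y p H₁ H₂) = cylVec p (depth π₁ + depth π₂) f₀.1 (pt x y) →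
      inner ℂ F u = inner ℂ F v) : u = v := by
  rw [← sub_eq_zero]
  have h3 : ∀ w ∈ fixedSpace (mixture p π₁ π₂) (depth π₁ + depth π₂),
      inner ℂ w (u - v) = 0 := by
    intro w hw
    rw [span_fixedSpace_mixture h₁ h₂] at hw
    induction hw using Submodule.span_induction with
    | mem F hF =>
      obtain ⟨f₀, hf₀, x, hx, y, hy, hF⟩ := hF
      rw [inner_sub_right, h f₀ hf₀ x hx y hy F hF, sub_self]
    | zero => simp
    | add a b _ _ ha hb => rw [inner_add_left, ha, hb, add_zero]
    | smul c a _ ha => rw [inner_smul_left, ha, mul_zero]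
  exact inner_self_eq_zero.1 (h3 _ (sub_mem hu hv))

end Mix

/-! ### The operators `A_i` of the mixture -/

lemma card_box_eq (f : X) (c : Fin 2) (n : ℕ) :
    Fintype.card {i : box n // f.1 i = c} = cnt f c n := by
  rw [Fintype.card_subtype, cnt]
  refine Finset.card_bij (fun i _ => i.1) (fun i hi => ?_) (fun i _ j _ h => Subtype.ext h)
    fun i hi => ?_
  · exact Finset.mem_filter.2 ⟨i.2, (Finset.mem_filter.1 hi).2⟩
  · obtain ⟨h1, h2⟩ := Finset.mem_filter.1 hi
    exact ⟨⟨i, h1⟩, Finset.mem_filter.2 ⟨Finset.mem_univ _, h2⟩, rfl⟩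

/-- `G(n)` acts transitively on the cylinders of `Y_{a,b}`. -/
lemma exists_inG_smul_eq {a b : ℕ} {f f₁ : X} (hf : f ∈ Yab a b) (hf₁ : f₁ ∈ Yab a b) :
    ∃ g, InG (a + b) g ∧ ∀ i ∈ box (a + b), (g • f).1 i = f₁.1 i := by
  have e : {i : box (a + b) // f.1 i = 0} ≃ {i : box (a + b) // f₁.1 i = 0} :=
    Fintype.equivOfCardEq (by rw [card_box_eq, card_box_eq, hf.2.1, hf₁.2.1])
  refine ⟨ofPerm e.extendSubtype, inG_ofPerm _, fun i hi => ?_⟩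
  obtain ⟨j, hj⟩ := e.extendSubtype.surjective ⟨i, hi⟩
  have h1 : (ofPerm e.extendSubtype)⁻¹ • i = j := by
    rw [inv_smul_eq_iff, ofPerm_smul, hj]
  rw [smul_apply, h1]
  by_cases h0 : f.1 j = 0
  · have := e.extendSubtype_mem j h0
    rw [hj] at this
    rw [h0, this]
  · have := e.extendSubtype_not_mem j h0
    rw [hj] at this
    revert h0 this
    generalize f.1 j = u
    generalize f₁.1 i = w
    revert u w
    decide

section Mix

variable {H₁ H₂ : Type*} [NormedAddCommGroup H₁] [InnerProductSpace ℂ H₁]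
  [NormedAddCommGroup H₂] [InnerProductSpace ℂ H₂] {p : Weights} {π₁ : URep H₁} {π₂ : URep H₂}

/-- The operator A_{n+1} acts differently on the two parts, as it depends on the label of n + 1. -/
lemma cylVec_eq_add (n : ℕ) (s : NZ → Fin 2) (v : HT H₁ H₂) :
    cylVec p n s v = cylVec p (n + 1) (extend n s 0) v + cylVec p (n + 1) (extend n s 1) v := by
  apply Lp.ext
  filter_upwards [coeFn_cylVec (p := p) n s v, coeFn_cylVec (p := p) (n + 1) (extend n s 0) v,
    coeFn_cylVec (p := p) (n + 1) (extend n s 1) v,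
    Lp.coeFn_add (cylVec p (n + 1) (extend n s 0) v) (cylVec p (n + 1) (extend n s 1) v)]
    with f h1 h2 h3 h4
  rw [h4, Pi.add_apply, h1, h2, h3, ← cyl_inter_pos, ← cyl_inter_pos]
  by_cases hf : f ∈ cyl n s
  · rcases Fin.exists_fin_two.1 ⟨f.1 (pos n), rfl⟩ with h | h <;> simp [Set.indicator, hf, h]
  · simp [Set.indicator, hf]

/-- A cylinder of positive measure in Y contains a point of Y. The weights 1/2 are auxiliary, since
Y does not depend on the weights. -/
lemma exists_mem_Y_extend {f₀ : X} (hf₀ : f₀ ∈ Y) {n : ℕ} (hs : SymOut n f₀) (c : Fin 2) :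
    ∃ f ∈ Y, f ∈ cyl n f₀.1 ∧ f.1 (pos n) = c ∧ ∀ i ∈ box (n + 1), extend n f₀.1 c i = f.1 i := by
  by_contra hcon
  push Not at hcon
  let p : Weights := ⟨1 / 2, 1 / 2, by norm_num, by norm_num, by norm_num⟩
  have h1 : omegaY p (cyl (n + 1) (extend n f₀.1 c)) ≠ 0 := by
    rw [omegaY_cyl_extend]
    refine mul_ne_zero ?_ (omegaY_cyl_ne_zero p hf₀ hs)
    rw [Ne, ENNReal.ofReal_eq_zero, not_le]
    exact p.w_pos c
  apply h1
  rw [omegaY, Measure.restrict_apply (measurableSet_cyl _ _)]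
  refine measure_mono_null (t := ∅) ?_ measure_empty
  rintro f ⟨hf, hY⟩
  have hf' := hf
  rw [← cyl_inter_pos] at hf'
  obtain ⟨i, hi, h⟩ := hcon f hY hf'.1 hf'.2
  exact h (hf.1 i hi).symm

variable [CompleteSpace H₁] [CompleteSpace H₂]

-- On this cylinder the cycle acts in the first factor as the cycle through η(i) that starts behind
-- `box (hc f₀ 0 n)`, and there its matrix elements are those of a power of an operator A.
omit [CompleteSpace H₂] in
lemma inner_cyc_pt_left (hadm : IsAdmissible π₁) {n : ℕ} {i : NZ} (hi : |(i : ℤ)| ≤ n) (k : ℕ)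
    {f₀ : X} (hf₀ : f₀ ∈ Y) (hs : SymOut n f₀) (hc' : f₀.1 i = 0) {x x' : H₁}
    (hx : x ∈ fixedSpace π₁ (hc f₀ 0 n)) (hx' : x' ∈ fixedSpace π₁ (hc f₀ 0 n)) (y y' : H₂) :
    inner ℂ (cylVec p n f₀.1 (pt x' y'))
        (fullRep p π₁ π₂ (cyc i n k) (cylVec p n f₀.1 (pt x y))) =
      (p.w 0 : ℂ) ^ k * (((omegaY p).real (cyl n f₀.1) : ℝ) : ℂ) *
        (inner ℂ x' ((opA π₁ (eta f₀ hf₀ 0 ⟨i, hc'⟩) ^ k) x) * inner ℂ y' y) := by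
  rw [inner_cyc_cylVec hi k hf₀ hs hc'
    ![cyc (eta f₀ hf₀ 0 ⟨i, hc'⟩) (hc f₀ 0 n) k, 1] rfl (fun j hj => ?_) _ _, tensorOp_pt,
    inner_pt, inner_opA_pow hadm (eta_abs_le hf₀ hs _ hi) k hx' hx]
  · simp
  · fin_cases j
    · exact absurd rfl hj
    · rfl

omit [CompleteSpace H₁] in
lemma inner_cyc_pt_right (hadm : IsAdmissible π₂) {n : ℕ} {i : NZ} (hi : |(i : ℤ)| ≤ n) (k : ℕ)
    {f₀ : X} (hf₀ : f₀ ∈ Y) (hs : SymOut n f₀) (hc' : f₀.1 i = 1) (x x' : H₁) {y y' : H₂}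
    (hy : y ∈ fixedSpace π₂ (hc f₀ 1 n)) (hy' : y' ∈ fixedSpace π₂ (hc f₀ 1 n)) :
    inner ℂ (cylVec p n f₀.1 (pt x' y'))
        (fullRep p π₁ π₂ (cyc i n k) (cylVec p n f₀.1 (pt x y))) =
      (p.w 1 : ℂ) ^ k * (((omegaY p).real (cyl n f₀.1) : ℝ) : ℂ) *
        (inner ℂ x' x * inner ℂ y' ((opA π₂ (eta f₀ hf₀ 1 ⟨i, hc'⟩) ^ k) y)) := by
  rw [inner_cyc_cylVec hi k hf₀ hs hc'
    ![1, cyc (eta f₀ hf₀ 1 ⟨i, hc'⟩) (hc f₀ 1 n) k] rfl (fun j hj => ?_) _ _, tensorOp_pt,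
    inner_pt, inner_opA_pow hadm (eta_abs_le hf₀ hs _ hi) k hy' hy]
  · simp
  · fin_cases j
    · rfl
    · exact absurd rfl hj

variable (h₁ : HasIrredRoot π₁) (h₂ : HasIrredRoot π₂)
include h₁ h₂

lemma inner_opA_pow_mixture {n : ℕ} {i : NZ} (hi : |(i : ℤ)| ≤ n) (k : ℕ)
    {F F' : mixtureSpace p π₁ π₂} (hF : F ∈ fixedSpace (mixture p π₁ π₂) n)
    (hF' : F' ∈ fixedSpace (mixture p π₁ π₂) n) :
    inner ℂ F' ((opA (mixture p π₁ π₂) i ^ k) F) =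
      inner ℂ (F' : L2Y p H₁ H₂) (fullRep p π₁ π₂ (cyc i n k) F) :=
  inner_opA_pow (isAdmissible_mixture h₁ h₂) hi k hF' hF

lemma mem_root_of_eq {f₀ : X} (hf₀ : f₀ ∈ Yab (depth π₁) (depth π₂)) {x : H₁}
    (hx : x ∈ fixedSpace π₁ (depth π₁)) {y : H₂} (hy : y ∈ fixedSpace π₂ (depth π₂))
    {F : mixtureSpace p π₁ π₂}
    (hF : (F : L2Y p H₁ H₂) = cylVec p (depth π₁ + depth π₂) f₀.1 (pt x y)) :
    F ∈ fixedSpace (mixture p π₁ π₂) (depth π₁ + depth π₂) := by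
  rw [mem_fixedSpace_mixture, hF]
  exact cylVec_mem_root h₁ h₂ hf₀ hx hy

/-- `A_i` for `i` with the label `1`. -/
theorem coe_opA_mixture_left {f₀ : X} (hf₀ : f₀ ∈ Yab (depth π₁) (depth π₂)) {x : H₁}
    (hx : x ∈ fixedSpace π₁ (depth π₁)) {y : H₂} (hy : y ∈ fixedSpace π₂ (depth π₂)) {i : NZ}
    (hi : |(i : ℤ)| ≤ (depth π₁ + depth π₂ : ℕ)) (hc' : f₀.1 i = 0) {F : mixtureSpace p π₁ π₂}
    (hF : (F : L2Y p H₁ H₂) = cylVec p (depth π₁ + depth π₂) f₀.1 (pt x y)) :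
    ((opA (mixture p π₁ π₂) i F : mixtureSpace p π₁ π₂) : L2Y p H₁ H₂) =
      (p.p₁ : ℂ) • cylVec p (depth π₁ + depth π₂) f₀.1
        (pt (opA π₁ (eta f₀ hf₀.1 0 ⟨i, hc'⟩) x) y) := by
  have hab := mem_Yab_iff.1 hf₀
  have hx1 : opA π₁ (eta f₀ hf₀.1 0 ⟨i, hc'⟩) x ∈ fixedSpace π₁ (depth π₁) := by
    refine opA_mem h₁.adm ?_ hx
    have := eta_abs_le hf₀.1 hab.2.1 (j := 0) ⟨i, hc'⟩ hi
    rwa [hab.2.2.1] at this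
  set F₁ : mixtureSpace p π₁ π₂ := ⟨_, cylVec_mem_mixtureSpace h₁ h₂ hf₀ hx1 hy⟩ with hF₁
  have hF₁' := mem_root_of_eq h₁ h₂ hf₀ hx1 hy (F := F₁) rfl
  have hFm := mem_root_of_eq h₁ h₂ hf₀ hx hy hF
  -- Both sides are in the root, so it suffices to compare matrix elements with cylinder functions;
  -- the cycle of length 1 gives the factor p₁.
  have key : opA (mixture p π₁ π₂) i F = (p.p₁ : ℂ) • F₁ := by
    refine eq_of_inner_root h₁ h₂ (opA_mem (isAdmissible_mixture h₁ h₂) hi hFm)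
      (Submodule.smul_mem _ _ hF₁') fun f₁ hf₁ x' hx' y' hy' F' hF' => ?_
    have hF'm := mem_root_of_eq h₁ h₂ hf₁ hx' hy' hF'
    have h3 := inner_opA_pow_mixture h₁ h₂ hi 1 hFm hF'm
    rw [pow_one] at h3
    rw [h3, inner_smul_right, Submodule.coe_inner, hF, hF']
    by_cases hagree : ∀ j ∈ box (depth π₁ + depth π₂), f₁.1 j = f₀.1 j
    · rw [cylVec_congr hagree, inner_cyc_pt_left h₁.adm hi 1 hf₀.1 hab.2.1 hc'
        (by rw [hab.2.2.1]; exact hx) (by rw [hab.2.2.1]; exact hx') y y', hF₁,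
        inner_cylVec_same, inner_pt, pow_one, pow_one]
      change (p.p₁ : ℂ) * _ * _ = _
      ring
    · rw [inner_cyc_eq_zero hi 1 hagree, hF₁, inner_cylVec_ne hagree, mul_zero]
  rw [key]
  rfl

/-- `A_i` for `i` with the label `2`. -/
theorem coe_opA_mixture_right {f₀ : X} (hf₀ : f₀ ∈ Yab (depth π₁) (depth π₂)) {x : H₁}
    (hx : x ∈ fixedSpace π₁ (depth π₁)) {y : H₂} (hy : y ∈ fixedSpace π₂ (depth π₂)) {i : NZ}
    (hi : |(i : ℤ)| ≤ (depth π₁ + depth π₂ : ℕ)) (hc' : f₀.1 i = 1) {F : mixtureSpace p π₁ π₂}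
    (hF : (F : L2Y p H₁ H₂) = cylVec p (depth π₁ + depth π₂) f₀.1 (pt x y)) :
    ((opA (mixture p π₁ π₂) i F : mixtureSpace p π₁ π₂) : L2Y p H₁ H₂) =
      (p.p₂ : ℂ) • cylVec p (depth π₁ + depth π₂) f₀.1
        (pt x (opA π₂ (eta f₀ hf₀.1 1 ⟨i, hc'⟩) y)) := by
  have hab := mem_Yab_iff.1 hf₀
  have hy1 : opA π₂ (eta f₀ hf₀.1 1 ⟨i, hc'⟩) y ∈ fixedSpace π₂ (depth π₂) := by
    refine opA_mem h₂.adm ?_ hy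
    have := eta_abs_le hf₀.1 hab.2.1 (j := 1) ⟨i, hc'⟩ hi
    rwa [hab.2.2.2] at this
  set F₁ : mixtureSpace p π₁ π₂ := ⟨_, cylVec_mem_mixtureSpace h₁ h₂ hf₀ hx hy1⟩ with hF₁
  have hF₁' := mem_root_of_eq h₁ h₂ hf₀ hx hy1 (F := F₁) rfl
  have hFm := mem_root_of_eq h₁ h₂ hf₀ hx hy hF
  have key : opA (mixture p π₁ π₂) i F = (p.p₂ : ℂ) • F₁ := by
    refine eq_of_inner_root h₁ h₂ (opA_mem (isAdmissible_mixture h₁ h₂) hi hFm)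
      (Submodule.smul_mem _ _ hF₁') fun f₁ hf₁ x' hx' y' hy' F' hF' => ?_
    have hF'm := mem_root_of_eq h₁ h₂ hf₁ hx' hy' hF'
    have h3 := inner_opA_pow_mixture h₁ h₂ hi 1 hFm hF'm
    rw [pow_one] at h3
    rw [h3, inner_smul_right, Submodule.coe_inner, hF, hF']
    by_cases hagree : ∀ j ∈ box (depth π₁ + depth π₂), f₁.1 j = f₀.1 j
    · rw [cylVec_congr hagree, inner_cyc_pt_right h₂.adm hi 1 hf₀.1 hab.2.1 hc' x x'
        (by rw [hab.2.2.2]; exact hy) (by rw [hab.2.2.2]; exact hy'), hF₁,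
        inner_cylVec_same, inner_pt, pow_one, pow_one]
      change (p.p₂ : ℂ) * _ * _ = _
      ring
    · rw [inner_cyc_eq_zero hi 1 hagree, hF₁, inner_cylVec_ne hagree, mul_zero]
  rw [key]
  rfl

/-- The moments of `A_{d+1}` on the root of the mixture. -/
theorem inner_opA_pow_root {μ₁ μ₂ : Measure ℝ} (hμ₁ : HasThomaMeasure π₁ μ₁)
    (hμ₂ : HasThomaMeasure π₂ μ₂) (k : ℕ) {u v : mixtureSpace p π₁ π₂}
    (hu : u ∈ fixedSpace (mixture p π₁ π₂) (depth π₁ + depth π₂))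
    (hv : v ∈ fixedSpace (mixture p π₁ π₂) (depth π₁ + depth π₂)) :
    inner ℂ u ((opA (mixture p π₁ π₂) (pos (depth π₁ + depth π₂)) ^ k) v) =
      ((p.p₁ : ℂ) ^ (k + 1) * ((∫ t, t ^ k ∂μ₁ : ℝ) : ℂ) +
        (p.p₂ : ℂ) ^ (k + 1) * ((∫ t, t ^ k ∂μ₂ : ℝ) : ℂ)) * inner ℂ u v := by
  have hfin₁ := h₁.fin
  have hfin₂ := h₂.fin
  refine inner_root_induction h₁ h₂
    (A := (opA (mixture p π₁ π₂) (pos (depth π₁ + depth π₂)) ^ k).toLinearMap) ?_ hu hv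
  intro f₀ hf₀ f₁ hf₁ x hx x' hx' y hy y' hy' F F' hF hF'
  set d := depth π₁ + depth π₂ with hd
  have hab := mem_Yab_iff.1 hf₀
  have hFm := fixedSpace_mono _ d.le_succ (mem_root_of_eq h₁ h₂ hf₀ hx hy hF)
  have hF'm := fixedSpace_mono _ d.le_succ (mem_root_of_eq h₁ h₂ hf₁ hx' hy' hF')
  -- The point d + 1 lies outside `box d`, so the computation takes place at level d + 1, where each
  -- cylinder is split by the label of d + 1.
  have hi : |((pos d : NZ) : ℤ)| ≤ (d + 1 : ℕ) := by rw [abs_pos']; push_cast; rfl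
  change inner ℂ F' ((opA (mixture p π₁ π₂) (pos d) ^ k) F) = _
  rw [inner_opA_pow_mixture h₁ h₂ hi k hFm hF'm, Submodule.coe_inner, hF, hF']
  by_cases hagree : ∀ j ∈ box d, f₁.1 j = f₀.1 j
  · rw [cylVec_congr hagree]
    have hne : ∀ c c' : Fin 2, c ≠ c' →
        ¬ ∀ j ∈ box (d + 1), extend d f₀.1 c j = extend d f₀.1 c' j := fun c c' hcc h => by
      have := h (pos d) (by rw [mem_box]; exact hi)
      rw [extend_pos, extend_pos] at this
      exact hcc this
    obtain ⟨g₀, hg₀, hg₀c, hg₀p, hg₀e⟩ := exists_mem_Y_extend hf₀.1 hab.2.1 0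
    obtain ⟨g₁, hg₁, hg₁c, hg₁p, hg₁e⟩ := exists_mem_Y_extend hf₀.1 hab.2.1 1
    have hs₀ := hg₀c.2.mono d.le_succ
    have hs₁ := hg₁c.2.mono d.le_succ
    -- If d + 1 has the first label, η maps it to d₁ + 1, the index that defines the Thoma measure
    -- of π₁.
    have hc₀ : hc g₀ 0 (d + 1) = depth π₁ + 1 := by
      rw [hc_succ hg₀c.2 hg₀p, hc_congr hg₀c, hab.2.2.1]
    have hc₁ : hc g₁ 1 (d + 1) = depth π₂ + 1 := by
      rw [hc_succ hg₁c.2 hg₁p, hc_congr hg₁c, hab.2.2.2]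
    have hν : ∀ (g : X) (c : Fin 2), (∀ i ∈ box (d + 1), extend d f₀.1 c i = g.1 i) →
        (omegaY p).real (cyl (d + 1) g.1) = p.w c * (omegaY p).real (cyl d f₀.1) := by
      intro g c h
      have : cyl (d + 1) g.1 = cyl (d + 1) (extend d f₀.1 c) := by
        ext f
        exact and_congr_left fun _ => forall₂_congr fun i hi => by rw [h i hi]
      rw [this, measureReal_def, omegaY_cyl_extend, ENNReal.toReal_mul,
        ENNReal.toReal_ofReal (p.w_pos c).le, measureReal_def]
    -- The cycle contributes p₁^k, and the measure of the smaller cylinder one more factor p₁.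
    have hm₀ : inner ℂ (cylVec p (d + 1) (extend d f₀.1 0) (pt x' y'))
        (fullRep p π₁ π₂ (cyc (pos d) (d + 1) k)
          (cylVec p (d + 1) (extend d f₀.1 0) (pt x y))) =
        (p.p₁ : ℂ) ^ (k + 1) * ((∫ t, t ^ k ∂μ₁ : ℝ) : ℂ) *
          inner ℂ (cylVec p d f₀.1 (pt x' y')) (cylVec p d f₀.1 (pt x y)) := by
      rw [cylVec_congr hg₀e, cylVec_congr hg₀e, inner_cyc_pt_left h₁.adm hi k hg₀ hs₀ hg₀p
        (by rw [hc₀]; exact fixedSpace_mono _ (Nat.le_succ _) hx)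
        (by rw [hc₀]; exact fixedSpace_mono _ (Nat.le_succ _) hx'), eta_pos hg₀ hs₀, hc₀,
        Nat.add_sub_cancel, hμ₁.inner_pow k hx' hx, hν g₀ 0 hg₀e, inner_cylVec_same, inner_pt,
        Complex.ofReal_mul]
      change (p.p₁ : ℂ) ^ k * ((p.p₁ : ℂ) * _) * _ = _
      ring
    have hm₁ : inner ℂ (cylVec p (d + 1) (extend d f₀.1 1) (pt x' y'))
        (fullRep p π₁ π₂ (cyc (pos d) (d + 1) k)
          (cylVec p (d + 1) (extend d f₀.1 1) (pt x y))) =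
        (p.p₂ : ℂ) ^ (k + 1) * ((∫ t, t ^ k ∂μ₂ : ℝ) : ℂ) *
          inner ℂ (cylVec p d f₀.1 (pt x' y')) (cylVec p d f₀.1 (pt x y)) := by
      rw [cylVec_congr hg₁e, cylVec_congr hg₁e, inner_cyc_pt_right h₂.adm hi k hg₁ hs₁ hg₁p _ _
        (by rw [hc₁]; exact fixedSpace_mono _ (Nat.le_succ _) hy)
        (by rw [hc₁]; exact fixedSpace_mono _ (Nat.le_succ _) hy'), eta_pos hg₁ hs₁, hc₁,
        Nat.add_sub_cancel, hμ₂.inner_pow k hy' hy, hν g₁ 1 hg₁e, inner_cylVec_same, inner_pt,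
        Complex.ofReal_mul]
      change (p.p₂ : ℂ) ^ k * ((p.p₂ : ℂ) * _) * _ = _
      ring
    rw [cylVec_eq_add d f₀.1 (pt x' y'), cylVec_eq_add d f₀.1 (pt x y), map_add, inner_add_left,
      inner_add_right, inner_add_right, hm₀, hm₁, inner_cyc_eq_zero hi k (hne 0 1 (by decide)),
      inner_cyc_eq_zero hi k (hne 1 0 (by decide)), ← cylVec_eq_add, ← cylVec_eq_add]
    ring
  · have hne : ∀ c c' : Fin 2,
        ¬ ∀ j ∈ box (d + 1), extend d f₁.1 c j = extend d f₀.1 c' j := fun c c' h => by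
      refine hagree fun j hj => ?_
      have := h j (by rw [mem_box] at hj ⊢; push_cast; omega)
      rwa [extend_of_mem _ _ hj, extend_of_mem _ _ hj] at this
    rw [inner_cylVec_ne hagree, cylVec_eq_add d f₁.1, cylVec_eq_add d f₀.1, map_add,
      inner_add_left, inner_add_right, inner_add_right, inner_cyc_eq_zero hi k (hne 0 0),
      inner_cyc_eq_zero hi k (hne 0 1), inner_cyc_eq_zero hi k (hne 1 0),
      inner_cyc_eq_zero hi k (hne 1 1)]
    ring

end Mix

/-! ### Elements that fix the points `-d, …, d` -/

section Mix

variable {H₁ H₂ : Type*} [NormedAddCommGroup H₁] [InnerProductSpace ℂ H₁]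
  [NormedAddCommGroup H₂] [InnerProductSpace ℂ H₂] {p : Weights} {π₁ : URep H₁} {π₂ : URep H₂}

lemma inner_fix_eq_zero {n : ℕ} {c : GE} (hc' : ∀ i : NZ, |(i : ℤ)| ≤ n → c • i = i)
    {s t : NZ → Fin 2} (hst : ¬ ∀ i ∈ box n, t i = s i) (v w : HT H₁ H₂) :
    inner ℂ (cylVec p n t w) (fullRep p π₁ π₂ c (cylVec p n s v)) = 0 := by
  classical
  rw [inner_fullRep_cylVec]
  refine setIntegral_eq_zero_of_forall_eq_zero fun f hf => ?_
  refine if_neg fun h => hst fun j hj => ?_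
  have h2 : c⁻¹⁻¹ • j = j := by rw [inv_inv]; exact hc' j (mem_box.1 hj)
  rw [← hf.1 j hj, ← h.1 j hj, smul_apply, h2]

variable [CompleteSpace H₁] [CompleteSpace H₂] (h₁ : HasIrredRoot π₁) (h₂ : HasIrredRoot π₂)
include h₁ h₂

/-- On the functions that are concentrated on one cylinder, `c` acts by a scalar. -/
lemma exists_scalar_cylVec {c : GE}
    (hc' : ∀ i : NZ, |(i : ℤ)| ≤ (depth π₁ + depth π₂ : ℕ) → c • i = i) {f₀ : X}
    (hf₀ : f₀ ∈ Yab (depth π₁) (depth π₂)) :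
    ∃ γ : ℂ, ∀ x ∈ fixedSpace π₁ (depth π₁), ∀ x' ∈ fixedSpace π₁ (depth π₁),
      ∀ y ∈ fixedSpace π₂ (depth π₂), ∀ y' ∈ fixedSpace π₂ (depth π₂),
      inner ℂ (cylVec p (depth π₁ + depth π₂) f₀.1 (pt x' y'))
        (fullRep p π₁ π₂ c (cylVec p (depth π₁ + depth π₂) f₀.1 (pt x y))) =
      γ * inner ℂ (cylVec p (depth π₁ + depth π₂) f₀.1 (pt x' y'))
        (cylVec p (depth π₁ + depth π₂) f₀.1 (pt x y)) := by
  classical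
  have hfin₁ := h₁.fin
  have hfin₂ := h₂.fin
  obtain ⟨x₀, hx₀, hx₀n⟩ := Submodule.exists_mem_ne_zero_of_ne_bot h₁.ne_bot
  obtain ⟨y₀, hy₀, hy₀n⟩ := Submodule.exists_mem_ne_zero_of_ne_bot h₂.ne_bot
  set d := depth π₁ + depth π₂ with hd
  have hab := mem_Yab_iff.1 hf₀
  have hx₀' : inner ℂ x₀ x₀ ≠ (0 : ℂ) := inner_self_ne_zero.2 hx₀n
  have hy₀' : inner ℂ y₀ y₀ ≠ (0 : ℂ) := inner_self_ne_zero.2 hy₀n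
  have hN : inner ℂ x₀ x₀ * inner ℂ y₀ y₀ ≠ (0 : ℂ) := mul_ne_zero hx₀' hy₀'
  have hν : (((omegaY p).real (cyl d f₀.1) : ℝ) : ℂ) ≠ 0 := by
    rw [Ne, Complex.ofReal_eq_zero, measureReal_def, ENNReal.toReal_eq_zero_iff, not_or]
    exact ⟨omegaY_cyl_ne_zero p hf₀.1 hab.2.1, omegaY_cyl_ne_top p _ _⟩
  refine ⟨inner ℂ (cylVec p d f₀.1 (pt x₀ y₀))
    (fullRep p π₁ π₂ c (cylVec p d f₀.1 (pt x₀ y₀))) *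
    ((((omegaY p).real (cyl d f₀.1) : ℝ) : ℂ) * (inner ℂ x₀ x₀ * inner ℂ y₀ y₀))⁻¹, ?_⟩
  intro x hx x' hx' y hy y' hy'
  -- Where the integrand is not zero, the components of the cocycle fix the boxes of the two roots
  -- and act there by scalars θ₁, θ₂. These depend on f, but not on the vectors, so comparison with
  -- fixed vectors x₀, y₀ under the integral eliminates them.
  have key : inner ℂ (cylVec p d f₀.1 (pt x' y'))
        (fullRep p π₁ π₂ c (cylVec p d f₀.1 (pt x y))) * (inner ℂ x₀ x₀ * inner ℂ y₀ y₀) =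
      inner ℂ (cylVec p d f₀.1 (pt x₀ y₀))
        (fullRep p π₁ π₂ c (cylVec p d f₀.1 (pt x₀ y₀))) * (inner ℂ x' x * inner ℂ y' y) := by
    rw [inner_fullRep_cylVec, inner_fullRep_cylVec, ← integral_mul_const, ← integral_mul_const]
    refine setIntegral_congr_ae (measurableSet_cyl _ _) ?_
    filter_upwards [ae_mem_Y p] with f hY hf
    split_ifs with h
    · have hYh := smul_mem_Y c⁻¹ hY
      have hsym : SymOut d (c • c⁻¹ • f) := by rw [smul_inv_smul]; exact hf.2
      obtain ⟨θ₁, hθ₁⟩ := h₁.irred.exists_scalar_rep h₁.adm (c := coc 0 c (c⁻¹ • f))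
        fun i hi => coc_fix hYh h.2 hc' hsym 0 (by rw [hc_congr h, hab.2.2.1]; exact hi)
      obtain ⟨θ₂, hθ₂⟩ := h₂.irred.exists_scalar_rep h₂.adm (c := coc 1 c (c⁻¹ • f))
        fun i hi => coc_fix hYh h.2 hc' hsym 1 (by rw [hc_congr h, hab.2.2.2]; exact hi)
      rw [tensorOp_pt, tensorOp_pt, inner_pt, inner_pt, hθ₁ _ hx' _ hx, hθ₁ _ hx₀ _ hx₀,
        hθ₂ _ hy' _ hy, hθ₂ _ hy₀ _ hy₀]
      ring
    · rw [zero_mul, zero_mul]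
  rw [inner_cylVec_same, inner_pt, ← mul_right_inj' hN]
  rw [mul_comm (inner ℂ x₀ x₀ * inner ℂ y₀ y₀) (inner ℂ (cylVec p d f₀.1 (pt x' y')) _), key]
  field_simp

/-- Elements that fix `-d, …, d` act by scalars on the root of the mixture. -/
theorem exists_scalar_mixture {c : GE}
    (hc' : ∀ i : NZ, |(i : ℤ)| ≤ (depth π₁ + depth π₂ : ℕ) → c • i = i) :
    ∃ γ : ℂ, ∀ u ∈ fixedSpace (mixture p π₁ π₂) (depth π₁ + depth π₂),
      ∀ v ∈ fixedSpace (mixture p π₁ π₂) (depth π₁ + depth π₂),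
      inner ℂ u (mixture p π₁ π₂ c v) = γ * inner ℂ u v := by
  by_cases hne : ∃ f₀, f₀ ∈ Yab (depth π₁) (depth π₂)
  swap
  · refine ⟨0, fun u hu v hv => inner_root_induction h₁ h₂
      (A := (mixture p π₁ π₂ c).toLinearEquiv.toLinearMap) (fun f₀ hf₀ => absurd ⟨f₀, hf₀⟩ hne)
      hu hv⟩
  obtain ⟨f₀, hf₀⟩ := hne
  obtain ⟨γ, hγ⟩ := exists_scalar_cylVec (p := p) h₁ h₂ hc' hf₀
  refine ⟨γ, fun u hu v hv => inner_root_induction h₁ h₂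
      (A := (mixture p π₁ π₂ c).toLinearEquiv.toLinearMap) ?_ hu hv⟩
  intro f hf f₁ hf₁ x hx x' hx' y hy y' hy' F F' hF hF'
  set d := depth π₁ + depth π₂ with hd
  have hab := mem_Yab_iff.1 hf₀
  change inner ℂ (F' : L2Y p H₁ H₂) (fullRep p π₁ π₂ c (F : L2Y p H₁ H₂)) =
    γ * inner ℂ (F' : L2Y p H₁ H₂) (F : L2Y p H₁ H₂)
  rw [hF, hF']
  by_cases hagree : ∀ j ∈ box d, f₁.1 j = f.1 j
  · rw [cylVec_congr hagree]
    -- G(d) commutes with c and acts transitively on the cylinders, so the scalar is the same on all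
    -- of them.
    obtain ⟨g, hg, hgf⟩ := exists_inG_smul_eq hf₀ hf
    have hr₁ : InG (depth π₁) (coc 0 g f₀) := by
      have := inG_coc hf₀.1 hab.2.1 hg 0
      rwa [hab.2.2.1] at this
    have hr₂ : InG (depth π₂) (coc 1 g f₀) := by
      have := inG_coc hf₀.1 hab.2.1 hg 1
      rwa [hab.2.2.2] at this
    have hmove : ∀ x y, cylVec p d f.1 (pt x y) = fullRep p π₁ π₂ g
        (cylVec p d f₀.1 (pt (π₁ (coc 0 g f₀)⁻¹ x) (π₂ (coc 1 g f₀)⁻¹ y))) := by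
      intro x y
      rw [fullRep_cylVec hg hf₀.1 hab.2.1, tensorOp_pt, rep_rep_inv, rep_rep_inv,
        cylVec_congr hgf]
    rw [hmove, hmove, ← rep_mul, ← commute_of_fix hg hc', rep_mul,
      LinearIsometryEquiv.inner_map_map, LinearIsometryEquiv.inner_map_map]
    exact hγ _ (rep_mem_fixedSpace hr₁.inv hx) _ (rep_mem_fixedSpace hr₁.inv hx') _
      (rep_mem_fixedSpace hr₂.inv hy) _ (rep_mem_fixedSpace hr₂.inv hy')
  · rw [inner_fix_eq_zero hc' hagree, inner_cylVec_ne hagree, mul_zero]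

end Mix

/-! ### Decomposition of the mixture -/

/-- The cylinder with the first label exactly in `box a` has an even number 2a of such points, hence
positive measure in Y. The weights are auxiliary. -/
lemma exists_mem_Yab (a b : ℕ) : ∃ f, f ∈ Yab a b := by
  let p : Weights := ⟨1 / 2, 1 / 2, by norm_num, by norm_num, by norm_num⟩
  set s : NZ → Fin 2 := fun i => if i ∈ box a then 0 else 1 with hs
  have h1 : ((box (a + b)).filter fun i => s i = 0) = box a := by
    ext i
    rw [Finset.mem_filter, hs]
    constructor
    · rintro ⟨-, h⟩
      by_contra hi
      exact absurd (show (1 : Fin 2) = 0 by simpa only [if_neg hi] using h) (by decide)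
    · intro hi
      exact ⟨by rw [mem_box] at hi ⊢; push_cast; omega, if_pos hi⟩
  have h2 : omegaY p (cyl (a + b) s) ≠ 0 := by
    rw [omegaY_cyl, h1, card_box, if_pos (even_two_mul a)]
    exact omega_cyl_ne_zero p _ _
  have h3 : ∃ f ∈ Y, f ∈ cyl (a + b) s := by
    by_contra hcon
    push Not at hcon
    apply h2
    rw [omegaY, Measure.restrict_apply (measurableSet_cyl _ _)]
    exact measure_mono_null (t := ∅) (fun f hf => hcon f hf.2 hf.1) measure_empty
  obtain ⟨f, hY, hf⟩ := h3
  have h4 : cnt f 0 (a + b) = 2 * a := by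
    rw [← card_box, ← h1, cnt]
    congr 1
    exact Finset.filter_congr fun i hi => by rw [hf.1 i hi]
  have h5 := cnt_two_mul_add (f := f) (a + b)
  exact ⟨f, hY, h4, by omega, hf.2⟩

lemma integrable_pow {μ : Measure ℝ} (hfin : IsFiniteMeasure μ) (h : μ (Set.Icc (-1) 1)ᶜ = 0)
    (k : ℕ) : Integrable (fun t => t ^ k) μ := by
  refine Integrable.of_bound (by fun_prop) 1 ?_
  have h1 : ∀ᵐ t ∂μ, t ∈ Set.Icc (-1 : ℝ) 1 := h
  filter_upwards [h1] with t ht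
  rw [norm_pow, Real.norm_eq_abs]
  exact pow_le_one₀ (abs_nonneg t) (abs_le.2 ht)

/-- Scaling by q gives q^k, and the mass q one more factor; these are the coefficients in
`inner_opA_pow_root`. -/
lemma integral_pow_mixedMeasure (p : Weights) {μ₁ μ₂ : Measure ℝ} [IsFiniteMeasure μ₁]
    [IsFiniteMeasure μ₂] (h₁ : μ₁ (Set.Icc (-1) 1)ᶜ = 0) (h₂ : μ₂ (Set.Icc (-1) 1)ᶜ = 0) (k : ℕ) :
    ∫ t, t ^ k ∂(mixedMeasure p μ₁ μ₂) =
      p.p₁ ^ (k + 1) * (∫ t, t ^ k ∂μ₁) + p.p₂ ^ (k + 1) * ∫ t, t ^ k ∂μ₂ := by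
  have key : ∀ (q : ℝ) (μ : Measure ℝ), 0 < q → IsFiniteMeasure μ → μ (Set.Icc (-1) 1)ᶜ = 0 →
      Integrable (fun t => t ^ k) (ENNReal.ofReal q • μ.map fun t => q * t) ∧
      ∫ t, t ^ k ∂(ENNReal.ofReal q • μ.map fun t => q * t) = q ^ (k + 1) * ∫ t, t ^ k ∂μ := by
    intro q μ hq hfin hμ
    have hm : AEMeasurable (fun t : ℝ => q * t) μ := by fun_prop
    constructor
    · refine Integrable.smul_measure ?_ ENNReal.ofReal_ne_top
      rw [integrable_map_measure (by fun_prop) hm]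
      simp only [Function.comp_def, mul_pow]
      exact (integrable_pow hfin hμ k).const_mul _
    · rw [integral_smul_measure, integral_map hm (by fun_prop), ENNReal.toReal_ofReal hq.le]
      simp only [mul_pow, integral_const_mul, smul_eq_mul]
      ring
  obtain ⟨i₁, e₁⟩ := key p.p₁ μ₁ p.pos₁ inferInstance h₁
  obtain ⟨i₂, e₂⟩ := key p.p₂ μ₂ p.pos₂ inferInstance h₂
  rw [mixedMeasure, integral_add_measure i₁ i₂, e₁, e₂]

lemma mixedMeasure_compl (p : Weights) {μ₁ μ₂ : Measure ℝ} (h₁ : μ₁ (Set.Icc (-1) 1)ᶜ = 0)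
    (h₂ : μ₂ (Set.Icc (-1) 1)ᶜ = 0) : mixedMeasure p μ₁ μ₂ (Set.Icc (-1) 1)ᶜ = 0 := by
  have key : ∀ (q : ℝ) (μ : Measure ℝ), 0 < q → q ≤ 1 → μ (Set.Icc (-1) 1)ᶜ = 0 →
      μ.map (fun t => q * t) (Set.Icc (-1) 1)ᶜ = 0 := by
    intro q μ h0 hle hμ
    rw [Measure.map_apply (by fun_prop) measurableSet_Icc.compl]
    refine measure_mono_null (t := (Set.Icc (-1) 1)ᶜ) (fun t ht hI => ht ?_) hμ
    rw [Set.mem_Icc, ← abs_le] at hI ⊢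
    rw [abs_mul, abs_of_pos h0]
    nlinarith [abs_nonneg t]
  simp only [mixedMeasure, Measure.coe_add, Measure.coe_smul, Pi.add_apply, Pi.smul_apply,
    smul_eq_mul, key _ _ p.pos₁ p.le_one₁ h₁, key _ _ p.pos₂ p.le_one₂ h₂, mul_zero, add_zero]

lemma isFiniteMeasure_mixedMeasure (p : Weights) (μ₁ μ₂ : Measure ℝ) [IsFiniteMeasure μ₁]
    [IsFiniteMeasure μ₂] : IsFiniteMeasure (mixedMeasure p μ₁ μ₂) := by
  have h : ∀ (q : ℝ) (μ : Measure ℝ), IsFiniteMeasure μ →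
      IsFiniteMeasure (ENNReal.ofReal q • μ.map fun t => q * t) := fun q μ _ =>
    Measure.smul_finite _ ENNReal.ofReal_ne_top
  have h1 := h p.p₁ μ₁ inferInstance
  have h2 := h p.p₂ μ₂ inferInstance
  unfold mixedMeasure
  infer_instance

lemma HasThomaMeasure.exists_isSpectralMeasure {H : Type*} [NormedAddCommGroup H]
    [InnerProductSpace ℂ H] {π : URep H} {μ : Measure ℝ} (h : HasThomaMeasure π μ)
    (h0 : fixedSpace π (depth π) ≠ ⊥) : IsFiniteMeasure μ ∧ μ (Set.Icc (-1) 1)ᶜ = 0 := by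
  obtain ⟨x, hx, hx0⟩ := Submodule.exists_mem_ne_zero_of_ne_bot h0
  have := h ((‖x‖ : ℂ)⁻¹ • x) (Submodule.smul_mem _ _ hx) (norm_smul_inv_norm hx0)
  exact ⟨this.1, this.2.1⟩

/-- A closed subspace of the closed space `cyclicSpan π S` is closed in H, so the image of the
cyclic span of S' is a closed invariant subspace that contains S. -/
lemma cyclicSpan_subrep {H : Type*} [NormedAddCommGroup H] [InnerProductSpace ℂ H] (π : URep H)
    (S : Set H) (S' : Set (cyclicSpan π S)) (hS : ∀ v (h : v ∈ S), ⟨v, subset_cyclicSpan S h⟩ ∈ S') :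
    cyclicSpan (subrep π (cyclicSpan π S) (isInvariant_cyclicSpan π S)) S' = ⊤ := by
  set V := cyclicSpan (subrep π (cyclicSpan π S) (isInvariant_cyclicSpan π S)) S' with hV
  have hc : IsClosed ((V.map (cyclicSpan π S).subtype : Submodule ℂ H) : Set H) := by
    rw [Submodule.map_coe]
    exact ((isClosed_cyclicSpan S).isClosedEmbedding_subtypeVal.isClosed_iff_image_isClosed).1
      (isClosed_cyclicSpan S')
  have hinv : IsInvariantSubspace π (V.map (cyclicSpan π S).subtype) := by
    rintro g _ ⟨v, hv, rfl⟩
    exact ⟨_, isInvariant_cyclicSpan _ S' g v hv, rfl⟩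
  have hle := cyclicSpan_le hc hinv fun v hv =>
    ⟨⟨v, subset_cyclicSpan S hv⟩, subset_cyclicSpan S' (hS v hv), rfl⟩
  rw [eq_top_iff]
  intro w _
  obtain ⟨v, hv, h⟩ := hle w.2
  rwa [← Subtype.ext h]

section Abstract

variable {H : Type*} [NormedAddCommGroup H] [InnerProductSpace ℂ H] [CompleteSpace H]
  {π : URep H} {d : ℕ}

lemma IsInvariantSubspace.opA_mem (hadm : IsAdmissible π) {W : Submodule ℂ H}
    (hW : IsInvariantSubspace π W) (hc : IsClosed (W : Set H)) (i : NZ) {v : H} (hv : v ∈ W) :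
    opA π i v ∈ W := by
  have := coe_opA_subrep hadm hW hc i ⟨v, hv⟩
  rw [← this]
  exact Subtype.mem _

/-- A representation generated by an irreducible root is irreducible. -/
theorem isIrredRep_of_isIrredRoot (hadm : IsAdmissible π)
    (hcyc : cyclicSpan π (fixedSpace π d : Set H) = ⊤) (h0 : fixedSpace π d ≠ ⊥)
    (hirr : IsIrredRoot π d) : IsIrredRep π := by
  refine ⟨?_, fun W hc hW => ?_⟩
  · obtain ⟨x, -, hx⟩ := Submodule.exists_mem_ne_zero_of_ne_bot h0
    exact ⟨x, 0, hx⟩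
  · by_cases hb : W ⊓ fixedSpace π d = ⊥
    · exact Or.inl (eq_bot_of_inf_eq_bot hcyc hc hW hb)
    · right
      have := hirr _ inf_le_right hb (fun g hg v hv => ⟨hW g v hv.1, rep_mem_fixedSpace hg hv.2⟩)
        fun i hi v hv => ⟨hW.opA_mem hadm hc i hv.1, opA_mem hadm hi hv.2⟩
      rw [eq_top_iff, ← hcyc]
      exact cyclicSpan_le hc hW (show fixedSpace π d ≤ W from inf_eq_right.1 this)

/-- The root of an irreducible representation is irreducible, if the elements that fix
`-d, …, d` act by scalars. -/
theorem IsIrredRep.isIrredRoot (hirr : IsIrredRep π) (hadm : IsAdmissible π)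
    [FiniteDimensional ℂ (fixedSpace π d)] (hmin : ∀ n < d, fixedSpace π n = ⊥)
    (hscal : ∀ c : GE, (∀ i : NZ, |(i : ℤ)| ≤ d → c • i = i) → ∃ γ : ℂ,
      ∀ u ∈ fixedSpace π d, ∀ v ∈ fixedSpace π d, inner ℂ u (π c v) = γ * inner ℂ u v) :
    IsIrredRoot π d := by
  intro V hV h0 hG hA
  have hfin : FiniteDimensional ℂ V := Submodule.finiteDimensional_of_le hV
  refine le_antisymm hV fun v hv => ?_
  set u := v - V.starProjection v with hu
  have hmem : V.starProjection v ∈ V := Submodule.starProjection_apply_mem _ _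
  have huR : u ∈ fixedSpace π d := sub_mem hv (hV hmem)
  have huV : ∀ w ∈ V, inner ℂ u w = 0 := fun w hw => by
    rw [← inner_conj_symm, Submodule.sub_starProjection_mem_orthogonal v w hw, map_zero]
  -- A vector u of the root orthogonal to V is orthogonal to the cyclic span of V, which is
  -- everything; so u is orthogonal to itself.
  have key := inner_rep_eq_zero hadm hmin hscal hV hG hA huR huV
  have h1 : cyclicSpan π (V : Set H) ≤ (Submodule.span ℂ {u})ᗮ := by
    refine Submodule.topologicalClosure_minimal _ (Submodule.span_le.2 ?_)
      (Submodule.isClosed_orthogonal _)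
    rintro _ ⟨g, w, hw, rfl⟩
    rw [SetLike.mem_coe, Submodule.mem_orthogonal_singleton_iff_inner_right]
    exact key g hw
  rcases hirr.2 _ (isClosed_cyclicSpan (V : Set H)) (isInvariant_cyclicSpan π V) with h | h
  · exfalso
    apply h0
    rw [eq_bot_iff, ← h]
    exact subset_cyclicSpan (V : Set H)
  · have h2 : u ∈ (Submodule.span ℂ {u})ᗮ := h1 (by rw [h]; trivial)
    rw [Submodule.mem_orthogonal_singleton_iff_inner_right, inner_self_eq_zero, hu, sub_eq_zero]
      at h2
    rw [h2]
    exact hmem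

/-- A nonzero closed invariant subspace meets the root, so it has the same depth, and its root
consists of vectors with the common moments. -/
theorem HasThomaMeasure.subrep (hadm : IsAdmissible π)
    (hcyc : cyclicSpan π (fixedSpace π d : Set H) = ⊤) (hmin : ∀ n < d, fixedSpace π n = ⊥)
    {μ : Measure ℝ} (hfin : IsFiniteMeasure μ) (hs : μ (Set.Icc (-1) 1)ᶜ = 0)
    (hmom : ∀ k : ℕ, ∀ v ∈ fixedSpace π d,
      inner ℂ v ((opA π (pos d) ^ k) v) = ((∫ t, t ^ k ∂μ : ℝ) : ℂ) * inner ℂ v v)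
    {V : Submodule ℂ H} (hV : IsInvariantSubspace π V) (hc : IsClosed (V : Set H)) (h0 : V ≠ ⊥) :
    HasThomaMeasure (subrep π V hV) μ := by
  have hd : depth (Olshanski.subrep π V hV) = d := by
    refine depth_eq (fun n hn => ?_) fun hbot => ?_
    · rw [Submodule.eq_bot_iff]
      intro w hw
      rw [mem_fixedSpace_subrep, hmin n hn, Submodule.mem_bot] at hw
      exact Subtype.ext hw
    · apply h0
      refine eq_bot_of_inf_eq_bot hcyc hc hV ?_
      rw [Submodule.eq_bot_iff]
      rintro w ⟨hw, hw'⟩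
      have : (⟨w, hw⟩ : V) ∈ fixedSpace (Olshanski.subrep π V hV) d :=
        (mem_fixedSpace_subrep hV).2 hw'
      rw [hbot, Submodule.mem_bot] at this
      exact congrArg Subtype.val this
  intro ζ hζ hn
  rw [root, hd, mem_fixedSpace_subrep] at hζ
  refine ⟨hfin, hs, fun k => ?_⟩
  rw [hd, Submodule.coe_inner, coe_opA_pow_subrep hadm hV hc, hmom k _ hζ,
    inner_self_eq_norm_sq_to_K]
  have hn' : ‖(ζ : H)‖ = 1 := hn
  rw [hn']
  simp

end Abstract

section Mix

variable {H₁ H₂ : Type*} [NormedAddCommGroup H₁] [InnerProductSpace ℂ H₁]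
  [NormedAddCommGroup H₂] [InnerProductSpace ℂ H₂] {p : Weights} {π₁ : URep H₁} {π₂ : URep H₂}
  [CompleteSpace H₁] [CompleteSpace H₂] (h₁ : HasIrredRoot π₁) (h₂ : HasIrredRoot π₂)
include h₁ h₂

lemma cyclicSpan_mixture : cyclicSpan (mixture p π₁ π₂)
    (fixedSpace (mixture p π₁ π₂) (depth π₁ + depth π₂) : Set (mixtureSpace p π₁ π₂)) = ⊤ := by
  refine cyclicSpan_subrep _ _ _ fun F hF => ?_
  rw [Hab_depth_eq h₁ h₂] at hF
  exact mem_fixedSpace_mixture.2 hF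

omit [CompleteSpace H₁] [CompleteSpace H₂] h₁ h₂ in
lemma cylVec_pt_ne_zero {f₀ : X} (hf₀ : f₀ ∈ Yab (depth π₁) (depth π₂)) {x : H₁} (hx : x ≠ 0)
    {y : H₂} (hy : y ≠ 0) : cylVec p (depth π₁ + depth π₂) f₀.1 (pt x y) ≠ 0 := by
  intro h
  have h3 := inner_cylVec_same (p := p) (depth π₁ + depth π₂) f₀.1 (pt x y) (pt x y)
  rw [h, inner_zero_left, inner_pt, eq_comm, mul_eq_zero, mul_eq_zero, inner_self_eq_zero,
    inner_self_eq_zero, Complex.ofReal_eq_zero, measureReal_def, ENNReal.toReal_eq_zero_iff] at h3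
  rcases h3 with (h3 | h3) | h3 | h3
  · exact omegaY_cyl_ne_zero p hf₀.1 hf₀.2.2.2 h3
  · exact omegaY_cyl_ne_top p _ _ h3
  · exact hx h3
  · exact hy h3

lemma root_mixture_ne_bot : fixedSpace (mixture p π₁ π₂) (depth π₁ + depth π₂) ≠ ⊥ := by
  obtain ⟨x, hx, hx0⟩ := Submodule.exists_mem_ne_zero_of_ne_bot h₁.ne_bot
  obtain ⟨y, hy, hy0⟩ := Submodule.exists_mem_ne_zero_of_ne_bot h₂.ne_bot
  obtain ⟨f₀, hf₀⟩ := exists_mem_Yab (depth π₁) (depth π₂)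
  intro h
  have h3 := mem_root_of_eq (p := p) h₁ h₂ hf₀ hx hy
    (F := ⟨_, cylVec_mem_mixtureSpace h₁ h₂ hf₀ hx hy⟩) rfl
  rw [h, Submodule.mem_bot] at h3
  exact cylVec_pt_ne_zero hf₀ hx0 hy0 (congrArg Subtype.val h3)

theorem depth_mixture : depth (mixture p π₁ π₂) = depth π₁ + depth π₂ :=
  depth_eq (fun _ h => fixedSpace_mixture_eq_bot h) (root_mixture_ne_bot h₁ h₂)

/-- The mixture is generated by its root, which gives one direction. The other one needs that the
elements fixing {-d, …, d} act by scalars on the root. -/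
theorem isIrredRep_mixture_iff : IsIrredRep (mixture p π₁ π₂) ↔
    IsIrredRoot (mixture p π₁ π₂) (depth π₁ + depth π₂) := by
  have := finiteDimensional_root_mixture (p := p) h₁ h₂
  exact ⟨fun h => h.isIrredRoot (isAdmissible_mixture h₁ h₂)
    (fun _ h => fixedSpace_mixture_eq_bot h) fun c hc => exists_scalar_mixture h₁ h₂ hc,
    isIrredRep_of_isIrredRoot (isAdmissible_mixture h₁ h₂) (cyclicSpan_mixture h₁ h₂)
      (root_mixture_ne_bot h₁ h₂)⟩

/-- The Thoma measure of the subrepresentations of the mixture. -/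
theorem hasThomaMeasure_subrep {μ₁ μ₂ : Measure ℝ} (hμ₁ : HasThomaMeasure π₁ μ₁)
    (hμ₂ : HasThomaMeasure π₂ μ₂) {V : Submodule ℂ (mixtureSpace p π₁ π₂)}
    (hV : IsInvariantSubspace (mixture p π₁ π₂) V)
    (hc : IsClosed (V : Set (mixtureSpace p π₁ π₂))) (h0 : V ≠ ⊥) :
    HasThomaMeasure (subrep (mixture p π₁ π₂) V hV) (mixedMeasure p μ₁ μ₂) := by
  obtain ⟨hfin₁, hs₁⟩ := hμ₁.exists_isSpectralMeasure h₁.ne_bot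
  obtain ⟨hfin₂, hs₂⟩ := hμ₂.exists_isSpectralMeasure h₂.ne_bot
  refine HasThomaMeasure.subrep (isAdmissible_mixture h₁ h₂) (cyclicSpan_mixture h₁ h₂)
    (fun _ h => fixedSpace_mixture_eq_bot h) (isFiniteMeasure_mixedMeasure p μ₁ μ₂)
    (mixedMeasure_compl p hs₁ hs₂) (fun k v hv => ?_) hV hc h0
  rw [inner_opA_pow_root h₁ h₂ hμ₁ hμ₂ k hv hv, integral_pow_mixedMeasure p hs₁ hs₂]
  push_cast
  rfl

theorem exists_decomposition_mixture {μ₁ μ₂ : Measure ℝ} (hμ₁ : HasThomaMeasure π₁ μ₁)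
    (hμ₂ : HasThomaMeasure π₂ μ₂) :
    ∃ (n : ℕ) (V : Fin n → Submodule ℂ (mixtureSpace p π₁ π₂))
      (hV : ∀ k, IsInvariantSubspace (mixture p π₁ π₂) (V k)),
      (∀ k, IsClosed (V k : Set (mixtureSpace p π₁ π₂))) ∧
      (Pairwise fun k l => V k ⟂ V l) ∧
      (⨆ k, V k = ⊤) ∧
      ∀ k, IsAdmissible (subrep (mixture p π₁ π₂) (V k) (hV k)) ∧
        IsIrredRep (subrep (mixture p π₁ π₂) (V k) (hV k)) ∧
        HasThomaMeasure (subrep (mixture p π₁ π₂) (V k) (hV k)) (mixedMeasure p μ₁ μ₂) := by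
  have := finiteDimensional_root_mixture (p := p) h₁ h₂
  obtain ⟨n, V, hV, hpair, hsup⟩ := exists_decomposition (cyclicSpan_mixture (p := p) h₁ h₂)
  exact ⟨n, V, fun k => (hV k).inv, fun k => (hV k).closed, hpair, hsup, fun k =>
    ⟨isAdmissible_subrep (isAdmissible_mixture h₁ h₂) _ (hV k).closed,
      isIrredRep_subrep _ (hV k).ne_bot (hV k).closed (hV k).irred,
      hasThomaMeasure_subrep h₁ h₂ hμ₁ hμ₂ _ (hV k).closed (hV k).ne_bot⟩⟩

end Mix

/-! ### An operator commuting with the root -/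

section Commutant

variable {H : Type*} [NormedAddCommGroup H] [InnerProductSpace ℂ H] [CompleteSpace H]
  {π : URep H} {d : ℕ}

/-- The operators `A_i` commute. -/
theorem opA_comm (hadm : IsAdmissible π) {i j : NZ} (hi : |(i : ℤ)| ≤ d) (hj : |(j : ℤ)| ≤ d)
    {v : H} (hv : v ∈ fixedSpace π d) : opA π i (opA π j v) = opA π j (opA π i v) := by
  by_cases hij : i = j
  · rw [hij]
  -- A_i is represented by a transposition with d + 1 and A_j by one with d + 2, at the levels d and
  -- d + 1; these transpositions have disjoint supports.
  have hcomm : transp j (pos (d + 1)) * transp i (pos d) =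
      transp i (pos d) * transp j (pos (d + 1)) := by
    have h := conj_transp (transp j (pos (d + 1))) i (pos d)
    have hne : ∀ {k : NZ} {m : ℕ}, |(k : ℤ)| ≤ d → d ≤ m → k ≠ pos m := by
      rintro k m hk hm rfl
      rw [abs_pos'] at hk
      omega
    rw [transp_smul, transp_smul, Equiv.swap_apply_of_ne_of_ne hij (hne hi (by omega)),
      Equiv.swap_apply_of_ne_of_ne (hne hj le_rfl).symm (by simp)] at h
    exact mul_inv_eq_iff_eq_mul.1 h
  have hdd : d ≤ d + 1 := by omega
  have hin : InG (d + 1) (transp i (pos d)) :=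
    inG_transp (by push_cast; omega) (by rw [abs_pos']; push_cast; omega)
  have hj' : |(j : ℤ)| ≤ (d + 1 : ℕ) := by push_cast; omega
  have key : ∀ u ∈ fixedSpace π d,
      inner ℂ u (opA π i (opA π j v)) = inner ℂ u (opA π j (opA π i v)) := by
    intro u hu
    have hu' := fixedSpace_mono π hdd hu
    have hv' := fixedSpace_mono π hdd hv
    rw [inner_opA hadm hi le_rfl hu (opA_mem hadm hj hv), inner_rep_right,
      inner_opA hadm hj' le_rfl (rep_mem_fixedSpace hin.inv hu') hv', ← inner_rep_right,
      ← inner_opA_left hadm j, inner_opA hadm hi le_rfl (opA_mem hadm hj hu) hv,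
      inner_opA_left hadm j, inner_opA hadm hj' le_rfl hu' (rep_mem_fixedSpace hin hv'),
      ← rep_mul, ← rep_mul, hcomm]
  rw [← sub_eq_zero, ← inner_self_eq_zero (𝕜 := ℂ), inner_sub_right, key, sub_self]
  exact sub_mem (opA_mem hadm hi (opA_mem hadm hj hv)) (opA_mem hadm hj (opA_mem hadm hi hv))

/-- The vectors of `H_d` on which `A_i` and `A_j` agree. -/
def agreeSub (π : URep H) (d : ℕ) (i j : NZ) : Submodule ℂ H :=
  fixedSpace π d ⊓ LinearMap.ker (opA π i - opA π j).toLinearMap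

omit [CompleteSpace H] in
lemma mem_agreeSub {i j : NZ} {v : H} :
    v ∈ agreeSub π d i j ↔ v ∈ fixedSpace π d ∧ opA π i v = opA π j v := by
  simp [agreeSub, sub_eq_zero]

instance [FiniteDimensional ℂ (fixedSpace π d)] (i j : NZ) :
    FiniteDimensional ℂ (agreeSub π d i j) :=
  Submodule.finiteDimensional_of_le inf_le_left

lemma rep_mem_agreeSub (hadm : IsAdmissible π) {g : GE} (hg : InG d g) {i j : NZ} {v : H}
    (hv : v ∈ agreeSub π d i j) : π g v ∈ agreeSub π d (g • i) (g • j) := by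
  rw [mem_agreeSub] at hv ⊢
  exact ⟨rep_mem_fixedSpace hg hv.1, by rw [← rep_opA hadm, ← rep_opA hadm, hv.2]⟩

lemma opA_mem_agreeSub (hadm : IsAdmissible π) {i j k : NZ} (hi : |(i : ℤ)| ≤ d)
    (hj : |(j : ℤ)| ≤ d) (hk : |(k : ℤ)| ≤ d) {v : H} (hv : v ∈ agreeSub π d i j) :
    opA π k v ∈ agreeSub π d i j := by
  rw [mem_agreeSub] at hv ⊢
  exact ⟨opA_mem hadm hk hv.1, by
    rw [opA_comm hadm hi hk hv.1, opA_comm hadm hj hk hv.1, hv.2]⟩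

variable [FiniteDimensional ℂ (fixedSpace π d)]

lemma starProjection_agreeSub_rep (hadm : IsAdmissible π) {g : GE} (hg : InG d g) (i j : NZ)
    (v : H) : (agreeSub π d (g • i) (g • j)).starProjection (π g v) =
      π g ((agreeSub π d i j).starProjection v) := by
  refine Submodule.eq_starProjection_of_mem_of_inner_eq_zero
    (rep_mem_agreeSub hadm hg (Submodule.starProjection_apply_mem _ _)) fun w hw => ?_
  have hw' : π g⁻¹ w ∈ agreeSub π d i j := by
    have := rep_mem_agreeSub hadm hg.inv hw
    rwa [inv_smul_smul, inv_smul_smul] at this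
  rw [← map_sub, ← inner_conj_symm, inner_rep_right, inner_conj_symm]
  exact (Submodule.mem_orthogonal' _ _).1 (Submodule.sub_starProjection_mem_orthogonal v) _ hw'

lemma starProjection_agreeSub_opA (hadm : IsAdmissible π) {i j k : NZ} (hi : |(i : ℤ)| ≤ d)
    (hj : |(j : ℤ)| ≤ d) (hk : |(k : ℤ)| ≤ d) (v : H) :
    (agreeSub π d i j).starProjection (opA π k v) =
      opA π k ((agreeSub π d i j).starProjection v) := by
  refine Submodule.eq_starProjection_of_mem_of_inner_eq_zero
    (opA_mem_agreeSub hadm hi hj hk (Submodule.starProjection_apply_mem _ _)) fun w hw => ?_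
  rw [← map_sub, inner_opA_left hadm]
  exact (Submodule.mem_orthogonal' _ _).1 (Submodule.sub_starProjection_mem_orthogonal v) _
    (opA_mem_agreeSub hadm hi hj hk hw)

/-- The sum over all `i`, `j` of the products of `(i, j)` and the projection onto the kernel of
`A_i - A_j`. -/
def swapOp (π : URep H) (d : ℕ) [FiniteDimensional ℂ (fixedSpace π d)] : H →ₗ[ℂ] H :=
  ∑ i ∈ box d, ∑ j ∈ box d, (π (transp i j)).toLinearEquiv.toLinearMap ∘ₗ
    (agreeSub π d i j).starProjection.toLinearMap

omit [CompleteSpace H] in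
lemma swapOp_apply (v : H) : swapOp π d v =
    ∑ i ∈ box d, ∑ j ∈ box d, π (transp i j) ((agreeSub π d i j).starProjection v) := by
  simp [swapOp, LinearMap.sum_apply]

lemma sum_box_smul {M : Type*} [AddCommMonoid M] {g : GE} (hg : InG d g) (φ : NZ → M) :
    ∑ i ∈ box d, φ (g • i) = ∑ i ∈ box d, φ i := by
  refine Finset.sum_nbij' (fun i => g • i) (fun i => g⁻¹ • i) ?_ ?_ ?_ ?_ ?_
  · exact fun i hi => mem_box.2 (hg.abs_le (mem_box.1 hi))
  · exact fun i hi => mem_box.2 (hg.inv.abs_le (mem_box.1 hi))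
  · exact fun i _ => inv_smul_smul _ _
  · exact fun i _ => smul_inv_smul _ _
  · exact fun i _ => rfl

lemma swapOp_rep (hadm : IsAdmissible π) {g : GE} (hg : InG d g) (v : H) :
    swapOp π d (π g v) = π g (swapOp π d v) := by
  rw [swapOp_apply, swapOp_apply, map_sum, ← sum_box_smul hg]
  refine Finset.sum_congr rfl fun i _ => ?_
  rw [map_sum, ← sum_box_smul hg]
  refine Finset.sum_congr rfl fun j _ => ?_
  rw [starProjection_agreeSub_rep hadm hg, ← rep_mul, ← rep_mul, ← conj_transp]
  congr 2
  group

/-- In general (i, j) exchanges A_i and A_j, but on the range of the projection these operators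
agree, so that (i, j) commutes with every A_k there. -/
lemma swapOp_opA (hadm : IsAdmissible π) {k : NZ} (hk : |(k : ℤ)| ≤ d) (v : H) :
    swapOp π d (opA π k v) = opA π k (swapOp π d v) := by
  rw [swapOp_apply, swapOp_apply, map_sum]
  refine Finset.sum_congr rfl fun i hi => ?_
  rw [map_sum]
  refine Finset.sum_congr rfl fun j hj => ?_
  rw [mem_box] at hi hj
  rw [starProjection_agreeSub_opA hadm hi hj hk]
  have hmem := mem_agreeSub.1
    (Submodule.starProjection_apply_mem (agreeSub π d i j) v)
  set x := (agreeSub π d i j).starProjection v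
  have h1 : opA π k (π (transp i j) x) = π (transp i j) (opA π (transp i j • k) x) := by
    rw [rep_opA hadm, ← mul_smul, transp_mul_self, one_smul]
  have h2 : opA π (transp i j • k) x = opA π k x := by
    rw [transp_smul]
    by_cases h : k = i
    · rw [h, Equiv.swap_apply_left, hmem.2]
    by_cases h' : k = j
    · rw [h', Equiv.swap_apply_right, hmem.2]
    rw [Equiv.swap_apply_of_ne_of_ne h h']
  rw [h1, h2]

/-- As the A_i are self-adjoint, an eigenvector with χ i ≠ χ j is orthogonal to the kernel of A_i -
A_j; so each projection keeps F or kills it. -/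
lemma swapOp_of_eigenvector (hadm : IsAdmissible π) {F : H} (hF : F ∈ fixedSpace π d)
    {χ : NZ → ℝ} (hχ : ∀ i : NZ, |(i : ℤ)| ≤ d → opA π i F = (χ i : ℂ) • F) :
    swapOp π d F = ∑ i ∈ box d, ∑ j ∈ box d, if χ i = χ j then π (transp i j) F else 0 := by
  rw [swapOp_apply]
  refine Finset.sum_congr rfl fun i hi => Finset.sum_congr rfl fun j hj => ?_
  rw [mem_box] at hi hj
  split_ifs with h
  · rw [Submodule.starProjection_eq_self_iff.2 (mem_agreeSub.2 ⟨hF, by rw [hχ i hi, hχ j hj, h]⟩)]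
  · rw [(Submodule.starProjection_apply_eq_zero_iff _).2, map_zero]
    rw [Submodule.mem_orthogonal']
    intro w hw
    have h1 := congrArg (inner ℂ F) (mem_agreeSub.1 hw).2
    rw [← inner_opA_left hadm, ← inner_opA_left hadm, hχ i hi, hχ j hj, inner_smul_left,
      inner_smul_left, Complex.conj_ofReal, Complex.conj_ofReal, ← sub_eq_zero, ← sub_mul,
      mul_eq_zero] at h1
    refine h1.resolve_left fun h2 => h ?_
    rw [sub_eq_zero] at h2
    exact_mod_cast h2

/-- A root with a joint eigenvector of the `A_i`, that has the same eigenvalue at `a` and `b` and is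
orthogonal to its other translates by transpositions, is reducible. -/
theorem not_isIrredRoot_of_eigenvector (hadm : IsAdmissible π) {F : H} (hF : F ∈ fixedSpace π d)
    (hF0 : F ≠ 0) {χ : NZ → ℝ} (hχ : ∀ i : NZ, |(i : ℤ)| ≤ d → opA π i F = (χ i : ℂ) • F)
    {a b : NZ} (ha : |(a : ℤ)| ≤ d) (hb : |(b : ℤ)| ≤ d) (hab : χ a = χ b)
    (h1 : inner ℂ (π (transp a b) F) F = 0)
    (h2 : ∀ i j : NZ, |(i : ℤ)| ≤ d → |(j : ℤ)| ≤ d → transp i j = transp a b ∨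
      inner ℂ (π (transp a b) F) (π (transp i j) F) = 0) : ¬ IsIrredRoot π d := by
  intro hirr
  -- If `swapOp` acted by a scalar, its matrix element between F and the orthogonal vector π((a, b))
  -- F would be zero. But the summands have nonnegative real parts, and the one for (a, b) is ‖F‖².
  obtain ⟨θ, hθ⟩ := hirr.exists_scalar hadm (S := swapOp π d)
    (fun g hg u _ v _ => by rw [swapOp_rep hadm hg, inner_rep_right])
    (fun i hi u _ v _ => by rw [swapOp_opA hadm hi, inner_opA_left hadm])
  have h3 := hθ _ (rep_mem_fixedSpace (inG_transp ha hb) hF) _ hF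
  rw [h1, mul_zero, swapOp_of_eigenvector hadm hF hχ, inner_sum] at h3
  have h4 := congrArg Complex.re h3
  rw [Complex.re_sum, Complex.zero_re] at h4
  have hterm : ∀ i ∈ box d, ∀ j ∈ box d, 0 ≤ (inner ℂ (π (transp a b) F)
      (if χ i = χ j then π (transp i j) F else 0)).re := by
    intro i hi j hj
    split_ifs
    · rcases h2 i j (mem_box.1 hi) (mem_box.1 hj) with h | h
      · rw [h]
        exact inner_self_nonneg (𝕜 := ℂ)
      · rw [h, Complex.zero_re]
    · simp
  have hsum : ∀ i ∈ box d, 0 ≤ (inner ℂ (π (transp a b) F)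
      (∑ j ∈ box d, if χ i = χ j then π (transp i j) F else 0)).re := by
    intro i hi
    rw [inner_sum, Complex.re_sum]
    exact Finset.sum_nonneg (hterm i hi)
  have h5 := (Finset.sum_eq_zero_iff_of_nonneg hsum).1 h4 a (mem_box.2 ha)
  rw [inner_sum, Complex.re_sum] at h5
  have h6 := (Finset.sum_eq_zero_iff_of_nonneg (hterm a (mem_box.2 ha))).1 h5 b (mem_box.2 hb)
  rw [if_pos hab, LinearIsometryEquiv.inner_map_map] at h6
  have h7 : (inner ℂ F F : ℂ).re = ‖F‖ ^ 2 := inner_self_eq_norm_sq (𝕜 := ℂ) F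
  rw [h7, sq_eq_zero_iff, norm_eq_zero] at h6
  exact hF0 h6

end Commutant

/-! ### Vectors that generate a Young module -/

section YoungVector

variable {H : Type*} [NormedAddCommGroup H] [InnerProductSpace ℂ H] {π : URep H} {d : ℕ}
  {Λ : YoungDist}

/-- A vector of `H_d` that corresponds to the symmetrizer under an isomorphism with `V_Λ`. -/
structure IsYoungVector (π : URep H) (T : Filling (box d) Λ) (e : H) : Prop where
  mem : e ∈ fixedSpace π d
  ne_zero : e ≠ 0
  opA_eq : ∀ i : box d, opA π i e = (((T i).1 : ℝ) : ℂ) • e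
  symm : ∃ c : ℂ, c ≠ 0 ∧ ∑ σ, symmetrizer T σ • π (ofPerm σ) e = c • e
  span : fixedSpace π d ≤ Submodule.span ℂ (Set.range fun σ : Equiv.Perm (box d) => π (ofPerm σ) e)

/-- The vector is the image of the symmetrizer s, and the constant c comes from s² = c s. -/
lemma HasYoungDist.exists_isYoungVector (h : HasYoungDist π Λ) :
    ∃ (T : Filling (box (depth π)) Λ) (e : H), IsYoungVector π T e := by
  obtain ⟨T, Φ, hinj, hran, hperm, hdiag⟩ := h
  have hone : translate T 1 = symmetrizer T := by funext τ; simp [translate]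
  set s : youngModule T := ⟨symmetrizer T, hone ▸ Submodule.subset_span ⟨1, rfl⟩⟩ with hs
  have hconv : ∀ (a : Equiv.Perm (box (depth π)) → ℂ) (w : youngModule T),
      (w : Equiv.Perm (box (depth π)) → ℂ) = conv a (symmetrizer T) →
      Φ w = ∑ σ, a σ • π (ofPerm σ) (Φ s) := by
    intro a w hw
    have : w = ∑ σ, a σ • permAct T σ s := by
      apply Subtype.ext
      rw [hw, conv_eq_sum, AddSubmonoidClass.coe_finsetSum]
      rfl
    rw [this, map_sum]
    exact Finset.sum_congr rfl fun σ _ => by rw [map_smul, hperm]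
  refine ⟨T, Φ s, ?_, ?_, ?_, ?_, ?_⟩
  · change Φ s ∈ root π
    rw [← hran]; exact ⟨s, rfl⟩
  · intro h0
    have h1 : s = 0 := hinj (h0.trans (map_zero Φ).symm)
    have h2 : symmetrizer T 1 = 0 := congrFun (congrArg Subtype.val h1) 1
    rw [symmetrizer_one] at h2
    exact one_ne_zero h2
  · intro i
    rw [← hdiag, ← map_smul]
    congr 1
    apply Subtype.ext
    change diagFun T i (symmetrizer T) = _ • symmetrizer T
    rw [← hone, diagFun_translate, inv_one, Equiv.Perm.one_apply]
  · obtain ⟨c, hc, h⟩ := exists_conv_symmetrizer T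
    refine ⟨c, hc, ?_⟩
    rw [← hconv (symmetrizer T) (c • s) h.symm, map_smul]
  · change root π ≤ _
    rw [← hran]
    rintro _ ⟨w, rfl⟩
    obtain ⟨a, ha⟩ := exists_conv_of_mem w.2
    rw [hconv a w ha]
    exact Submodule.sum_mem _ fun σ _ => Submodule.smul_mem _ _ (Submodule.subset_span ⟨σ, rfl⟩)

lemma ofPerm_inv_smul {n : ℕ} (σ : Equiv.Perm (box n)) (i : box n) :
    ofPerm σ • ((σ⁻¹ i : box n) : NZ) = i := by
  rw [ofPerm_smul, perm_apply_inv]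

/-- The map a ↦ ∑ a(σ) π(σ) e intertwines the actions on the group algebra with those on the root.
It sends the symmetrizer to c e ≠ 0, so its kernel in the irreducible module V_Λ is zero, and its
image contains the translates of e. -/
lemma IsYoungVector.hasYoungDist [CompleteSpace H] (hadm : IsAdmissible π) {T : Filling (box d) Λ}
    {e : H} (h : IsYoungVector π T e) (hd : depth π = d) : HasYoungDist π Λ := by
  subst hd
  set Ψ : (Equiv.Perm (box (depth π)) → ℂ) →ₗ[ℂ] H :=
    ∑ σ, (LinearMap.proj σ : (Equiv.Perm (box (depth π)) → ℂ) →ₗ[ℂ] ℂ).smulRight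
      (π (ofPerm σ) e) with hΨ
  have hΨa : ∀ a, Ψ a = ∑ σ, a σ • π (ofPerm σ) e := fun a => by
    simp [hΨ, LinearMap.sum_apply]
  have hperm : ∀ σ a, Ψ (permFun σ a) = π (ofPerm σ) (Ψ a) := by
    intro σ a
    rw [hΨa, hΨa, map_sum, ← Equiv.sum_comp (Equiv.mulLeft σ)]
    refine Finset.sum_congr rfl fun τ _ => ?_
    rw [map_smul, ← rep_mul, ← ofPerm_mul]
    simp [permFun]
  have hdiag : ∀ (i : box (depth π)) a, Ψ (diagFun T i a) = opA π i (Ψ a) := by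
    intro i a
    rw [hΨa, hΨa, map_sum]
    refine Finset.sum_congr rfl fun τ _ => ?_
    rw [map_smul, ← ofPerm_inv_smul τ i, ← rep_opA hadm, h.opA_eq, map_smul, smul_smul, mul_comm]
    rfl
  obtain ⟨c, hc, hcs⟩ := h.symm
  have hsymm : Ψ (symmetrizer T) = c • e := by rw [hΨa, hcs]
  have hone : translate T 1 = symmetrizer T := by funext τ; simp [translate]
  have hmem : symmetrizer T ∈ youngModule T := hone ▸ Submodule.subset_span ⟨1, rfl⟩
  refine ⟨T, Ψ ∘ₗ (youngModule T).subtype, ?_, ?_, fun σ v => hperm σ v, fun i v => hdiag i v⟩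
  · rw [← LinearMap.ker_eq_bot]
    by_contra hne
    have hN : youngModule T ⊓ LinearMap.ker Ψ = youngModule T := by
      refine youngModule_irreducible inf_le_left (fun hbot => hne ?_) ?_ ?_
      · rw [eq_bot_iff]
        intro v hv
        have : (v : Equiv.Perm (box (depth π)) → ℂ) ∈ youngModule T ⊓ LinearMap.ker Ψ :=
          ⟨v.2, hv⟩
        rw [hbot, Submodule.mem_bot] at this
        exact Subtype.ext this
      · intro σ F hF
        refine ⟨(permAct T σ ⟨F, hF.1⟩).2, ?_⟩
        change Ψ _ = 0
        rw [hperm, show Ψ F = 0 from hF.2, map_zero]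
      · intro i F hF
        refine ⟨(diagAct T i ⟨F, hF.1⟩).2, ?_⟩
        change Ψ _ = 0
        rw [hdiag, show Ψ F = 0 from hF.2, map_zero]
    have h0 : Ψ (symmetrizer T) = 0 := (hN.symm ▸ hmem :
      symmetrizer T ∈ youngModule T ⊓ LinearMap.ker Ψ).2
    rw [hsymm] at h0
    exact smul_ne_zero hc h.ne_zero h0
  · refine le_antisymm ?_ (h.span.trans (Submodule.span_le.2 ?_))
    · rintro _ ⟨v, rfl⟩
      change Ψ v ∈ fixedSpace π (depth π)
      rw [hΨa]
      exact Submodule.sum_mem _ fun σ _ => Submodule.smul_mem _ _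
        (rep_mem_fixedSpace (inG_ofPerm σ) h.mem)
    · rintro _ ⟨σ, rfl⟩
      refine ⟨c⁻¹ • permAct T σ ⟨_, hmem⟩, ?_⟩
      change Ψ (c⁻¹ • permFun σ (symmetrizer T)) = π (ofPerm σ) e
      rw [map_smul, hperm, hsymm, map_smul, smul_smul, inv_mul_cancel₀ hc, one_smul]

end YoungVector

/-! ### Joint eigenvectors in the root of the mixture, and reducibility when the supports meet -/

section Reducible

variable {H₁ H₂ : Type*} [NormedAddCommGroup H₁] [InnerProductSpace ℂ H₁] [CompleteSpace H₁]
  [NormedAddCommGroup H₂] [InnerProductSpace ℂ H₂] [CompleteSpace H₂] {p : Weights}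
  {π₁ : URep H₁} {π₂ : URep H₂} (h₁ : HasIrredRoot π₁) (h₂ : HasIrredRoot π₂)
  {Λ₁ Λ₂ : YoungDist} {T₁ : Filling (box (depth π₁)) Λ₁} {T₂ : Filling (box (depth π₂)) Λ₂}
  {e₁ : H₁} {e₂ : H₂}

lemma scale_apply_mul {Λ : YoungDist} {q x : ℝ} (h0 : 0 < q) (h1 : q ≤ 1) :
    (Λ.scale q h0 h1).toFun (q * x) = Λ.toFun x := by
  change Λ.toFun (q * x / q) = _
  rw [mul_div_cancel_left₀ _ h0.ne']

/-- The indices of the two fillings, placed in `f₀⁻¹(1)` and `f₀⁻¹(2)`. -/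
def place {a b : ℕ} (f₀ : X) (hf₀ : f₀ ∈ Yab a b) : box a ⊕ box b → box (a + b) :=
  Sum.elim
    (fun i => ⟨((eta f₀ hf₀.1 0).symm i.1).1, mem_box.2 (abs_le_of_eta hf₀.1
      (mem_Yab_iff.1 hf₀).2.1 _ (by
        rw [OrderIso.apply_symm_apply, (mem_Yab_iff.1 hf₀).2.2.1]; exact mem_box.1 i.2))⟩)
    (fun i => ⟨((eta f₀ hf₀.1 1).symm i.1).1, mem_box.2 (abs_le_of_eta hf₀.1
      (mem_Yab_iff.1 hf₀).2.1 _ (by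
        rw [OrderIso.apply_symm_apply, (mem_Yab_iff.1 hf₀).2.2.2]; exact mem_box.1 i.2))⟩)

lemma coe_place_inl {a b : ℕ} {f₀ : X} (hf₀ : f₀ ∈ Yab a b) (i : box a) :
    (place f₀ hf₀ (Sum.inl i) : NZ) = ((eta f₀ hf₀.1 0).symm i.1).1 := rfl

lemma coe_place_inr {a b : ℕ} {f₀ : X} (hf₀ : f₀ ∈ Yab a b) (i : box b) :
    (place f₀ hf₀ (Sum.inr i) : NZ) = ((eta f₀ hf₀.1 1).symm i.1).1 := rfl

lemma color_place_inl {a b : ℕ} {f₀ : X} (hf₀ : f₀ ∈ Yab a b) (i : box a) :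
    f₀.1 (place f₀ hf₀ (Sum.inl i)) = 0 := ((eta f₀ hf₀.1 0).symm i.1).2

lemma color_place_inr {a b : ℕ} {f₀ : X} (hf₀ : f₀ ∈ Yab a b) (i : box b) :
    f₀.1 (place f₀ hf₀ (Sum.inr i)) = 1 := ((eta f₀ hf₀.1 1).symm i.1).2

lemma place_bijective {a b : ℕ} {f₀ : X} (hf₀ : f₀ ∈ Yab a b) :
    Function.Bijective (place f₀ hf₀) := by
  constructor
  · rintro (i | i) (j | j) h
    · have := congrArg Subtype.val h
      rw [coe_place_inl, coe_place_inl] at this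
      rw [Subtype.ext ((eta f₀ hf₀.1 0).symm.injective (Subtype.ext this))]
    · have := color_place_inl hf₀ i
      rw [h, color_place_inr] at this
      exact absurd this (by decide)
    · have := color_place_inr hf₀ i
      rw [h, color_place_inl] at this
      exact absurd this (by decide)
    · have := congrArg Subtype.val h
      rw [coe_place_inr, coe_place_inr] at this
      rw [Subtype.ext ((eta f₀ hf₀.1 1).symm.injective (Subtype.ext this))]
  · intro k
    have hab := mem_Yab_iff.1 hf₀
    rcases Fin.exists_fin_two.1 ⟨f₀.1 k, rfl⟩ with h | h
    · have h1 := eta_abs_le hf₀.1 hab.2.1 (j := 0) ⟨k, h⟩ (mem_box.1 k.2)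
      rw [hab.2.2.1] at h1
      refine ⟨Sum.inl ⟨_, mem_box.2 h1⟩, Subtype.ext ?_⟩
      rw [coe_place_inl, OrderIso.symm_apply_apply]
    · have h1 := eta_abs_le hf₀.1 hab.2.1 (j := 1) ⟨k, h⟩ (mem_box.1 k.2)
      rw [hab.2.2.2] at h1
      refine ⟨Sum.inr ⟨_, mem_box.2 h1⟩, Subtype.ext ?_⟩
      rw [coe_place_inr, OrderIso.symm_apply_apply]

/-- The numbering of the points of `f₀⁻¹(1)` and `f₀⁻¹(2)`. -/
def placeEquiv {a b : ℕ} (f₀ : X) (hf₀ : f₀ ∈ Yab a b) : box a ⊕ box b ≃ box (a + b) :=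
  Equiv.ofBijective _ (place_bijective hf₀)

@[simp] lemma placeEquiv_apply {a b : ℕ} {f₀ : X} (hf₀ : f₀ ∈ Yab a b) (i : box a ⊕ box b) :
    placeEquiv f₀ hf₀ i = place f₀ hf₀ i := rfl

/-- The eigenvalues of the `A_i` on `e₁ ⊗ e₂`. -/
def mixedValue (p : Weights) (T₁ : Filling (box (depth π₁)) Λ₁) (T₂ : Filling (box (depth π₂)) Λ₂) :
    box (depth π₁) ⊕ box (depth π₂) → ℝ :=
  Sum.elim (fun i => p.p₁ * (T₁ i).1) fun i => p.p₂ * (T₂ i).1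

include h₁ h₂ in
lemma opA_place (he₁ : IsYoungVector π₁ T₁ e₁) (he₂ : IsYoungVector π₂ T₂ e₂) {f₀ : X}
    (hf₀ : f₀ ∈ Yab (depth π₁) (depth π₂)) {F : mixtureSpace p π₁ π₂}
    (hF : (F : L2Y p H₁ H₂) = cylVec p (depth π₁ + depth π₂) f₀.1 (pt e₁ e₂))
    (i : box (depth π₁) ⊕ box (depth π₂)) :
    opA (mixture p π₁ π₂) (place f₀ hf₀ i) F = (mixedValue p T₁ T₂ i : ℂ) • F := by
  apply Subtype.ext
  rcases i with i | i
  · rw [coe_opA_mixture_left h₁ h₂ hf₀ he₁.mem he₂.mem (mem_box.1 (place f₀ hf₀ _).2)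
      (color_place_inl hf₀ i) hF]
    have h3 : eta f₀ hf₀.1 0 ⟨place f₀ hf₀ (Sum.inl i), color_place_inl hf₀ i⟩ = i.1 :=
      (eta f₀ hf₀.1 0).apply_symm_apply i.1
    rw [h3, he₁.opA_eq, pt_smul_left, cylVec_smul, smul_smul, ← hF, mixedValue, Sum.elim_inl]
    push_cast
    rfl
  · rw [coe_opA_mixture_right h₁ h₂ hf₀ he₁.mem he₂.mem (mem_box.1 (place f₀ hf₀ _).2)
      (color_place_inr hf₀ i) hF]
    have h3 : eta f₀ hf₀.1 1 ⟨place f₀ hf₀ (Sum.inr i), color_place_inr hf₀ i⟩ = i.1 :=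
      (eta f₀ hf₀.1 1).apply_symm_apply i.1
    rw [h3, he₂.opA_eq, pt_smul_right, cylVec_smul, smul_smul, ← hF, mixedValue, Sum.elim_inr]
    push_cast
    rfl

omit [CompleteSpace H₁] [CompleteSpace H₂] in
lemma inner_transp_cylVec_eq_zero {n : ℕ} {f₀ : X} (hf₀ : f₀ ∈ Y) (hs : SymOut n f₀) {g h : GE}
    (hg : InG n g) (hh : InG n h) (hne : ¬ ∀ i ∈ box n, (g • f₀).1 i = (h • f₀).1 i)
    (v w : HT H₁ H₂) :
    inner ℂ (fullRep p π₁ π₂ g (cylVec p n f₀.1 v)) (fullRep p π₁ π₂ h (cylVec p n f₀.1 w)) = 0 := by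
  rw [fullRep_cylVec hg hf₀ hs, fullRep_cylVec hh hf₀ hs, inner_cylVec_ne hne]

/-- The transposition (a, b) changes the labels at both a and b, so (i, j) has to move both points.
-/
lemma eq_transp_of_smul {n : ℕ} {f₀ : X} {a b i j : NZ} (ha : a ∈ box n) (hb : b ∈ box n)
    (hfa : f₀.1 a = 0) (hfb : f₀.1 b = 1)
    (h : ∀ k ∈ box n, (transp a b • f₀).1 k = (transp i j • f₀).1 k) :
    transp i j = transp a b := by
  have h1 := h a ha
  have h2 := h b hb
  simp only [smul_apply, transp_inv, transp_smul, Equiv.swap_apply_left, Equiv.swap_apply_right,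
    hfa, hfb] at h1 h2
  have key : (i = a ∧ j = b) ∨ (i = b ∧ j = a) := by
    by_cases hia : a = i
    · subst hia
      by_cases hjb : b = j
      · exact Or.inl ⟨rfl, hjb.symm⟩
      · rw [Equiv.swap_apply_of_ne_of_ne (by rintro rfl; simp [hfa] at hfb) hjb, hfb] at h2
        exact absurd h2 (by decide)
    · by_cases hja : a = j
      · subst hja
        by_cases hib : b = i
        · exact Or.inr ⟨hib.symm, rfl⟩
        · rw [Equiv.swap_apply_of_ne_of_ne hib (by rintro rfl; simp [hfa] at hfb), hfb] at h2
          exact absurd h2 (by decide)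
      · rw [Equiv.swap_apply_of_ne_of_ne hia hja, hfa] at h1
        exact absurd h1 (by decide)
  rcases key with ⟨rfl, rfl⟩ | ⟨rfl, rfl⟩
  · rfl
  · exact transp_comm _ _

include h₁ h₂ in
/-- The mixture is reducible if the supports meet. -/
theorem not_isIrredRoot_mixture (he₁ : IsYoungVector π₁ T₁ e₁) (he₂ : IsYoungVector π₂ T₂ e₂)
    {x : ℝ} (hx₁ : x ∈ (Λ₁.scale p.p₁ p.pos₁ p.le_one₁).supp)
    (hx₂ : x ∈ (Λ₂.scale p.p₂ p.pos₂ p.le_one₂).supp) :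
    ¬ IsIrredRoot (mixture p π₁ π₂) (depth π₁ + depth π₂) := by
  obtain ⟨f₀, hf₀⟩ := exists_mem_Yab (depth π₁) (depth π₂)
  have hab := mem_Yab_iff.1 hf₀
  have hcell : ∀ {Λ : YoungDiagram}, Λ ≠ ⊥ → ∃ c, c ∈ Λ.cells := by
    intro Λ h
    by_contra hcon
    push Not at hcon
    exact h (YoungDiagram.ext (Finset.eq_empty_iff_forall_notMem.2 hcon))
  obtain ⟨c₁, hc₁⟩ := hcell (show Λ₁.toFun (x / p.p₁) ≠ ⊥ from hx₁)
  obtain ⟨c₂, hc₂⟩ := hcell (show Λ₂.toFun (x / p.p₂) ≠ ⊥ from hx₂)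
  set i₁ : box (depth π₁) := T₁.symm ⟨_, c₁, hc₁⟩ with hi₁
  set i₂ : box (depth π₂) := T₂.symm ⟨_, c₂, hc₂⟩ with hi₂
  have hfin := finiteDimensional_root_mixture (p := p) h₁ h₂
  have hv₁ : mixedValue p T₁ T₂ (Sum.inl i₁) = x := by
    rw [mixedValue, Sum.elim_inl, hi₁, Equiv.apply_symm_apply, mul_div_cancel₀ _ p.pos₁.ne']
  have hv₂ : mixedValue p T₁ T₂ (Sum.inr i₂) = x := by
    rw [mixedValue, Sum.elim_inr, hi₂, Equiv.apply_symm_apply, mul_div_cancel₀ _ p.pos₂.ne']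
  set F : mixtureSpace p π₁ π₂ := ⟨_, cylVec_mem_mixtureSpace h₁ h₂ hf₀ he₁.mem he₂.mem⟩ with hF
  -- The eigenvalues are transported from the cells to the points of the box; the value 0 outside
  -- plays no role.
  set χ : NZ → ℝ := fun k => if h : k ∈ box (depth π₁ + depth π₂) then
    mixedValue p T₁ T₂ ((placeEquiv f₀ hf₀).symm ⟨k, h⟩) else 0 with hχ
  have hχp : ∀ i, χ (place f₀ hf₀ i) = mixedValue p T₁ T₂ i := by
    intro i
    rw [hχ]
    simp only [Subtype.coe_eta, Finset.coe_mem, dif_pos]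
    rw [← placeEquiv_apply, Equiv.symm_apply_apply]
  have ha := (place f₀ hf₀ (Sum.inl i₁)).2
  have hb := (place f₀ hf₀ (Sum.inr i₂)).2
  have hfa := color_place_inl hf₀ i₁
  have hfb := color_place_inr hf₀ i₂
  -- The points a, b have different labels but the same eigenvalue x. So (a, b) moves F to another
  -- cylinder, and every transposition except (a, b) moves F to a cylinder different from that one.
  refine not_isIrredRoot_of_eigenvector (isAdmissible_mixture h₁ h₂)
    (mem_root_of_eq h₁ h₂ hf₀ he₁.mem he₂.mem (F := F) rfl)
    (fun h0 => cylVec_pt_ne_zero hf₀ he₁.ne_zero he₂.ne_zero (congrArg Subtype.val h0))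
    (χ := χ) (fun k hk => ?_) (mem_box.1 ha) (mem_box.1 hb) (by rw [hχp, hχp, hv₁, hv₂]) ?_
    fun i j hi hj => ?_
  · obtain ⟨i, hi⟩ := (place_bijective hf₀).2 ⟨k, mem_box.2 hk⟩
    have hk' : k = place f₀ hf₀ i := by rw [hi]
    rw [hk', hχp]
    exact opA_place h₁ h₂ he₁ he₂ hf₀ rfl i
  · have := inner_transp_cylVec_eq_zero (p := p) (π₁ := π₁) (π₂ := π₂) hf₀.1 hab.2.1
      (inG_transp (mem_box.1 ha) (mem_box.1 hb)) (h := 1) (fun _ _ => one_smul _ _)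
      (fun h => by
        have h1 := h _ ha
        rw [one_smul, smul_apply, transp_inv, transp_smul, Equiv.swap_apply_left, hfa, hfb] at h1
        exact absurd h1 (by decide)) (pt e₁ e₂) (pt e₁ e₂)
    rw [rep_one] at this
    exact this
  · by_cases h : ∀ k ∈ box (depth π₁ + depth π₂), (transp (place f₀ hf₀ (Sum.inl i₁))
      (place f₀ hf₀ (Sum.inr i₂)) • f₀).1 k = (transp i j • f₀).1 k
    · exact Or.inl (eq_transp_of_smul ha hb hfa hfb h)
    · exact Or.inr (inner_transp_cylVec_eq_zero (p := p) (π₁ := π₁) (π₂ := π₂) hf₀.1 hab.2.1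
        (inG_transp (mem_box.1 ha) (mem_box.1 hb)) (inG_transp hi hj) h _ _)

end Reducible

/-! ### The Young distribution of an irreducible mixture -/

section Symmetrizer

variable {ι : Type*} [Fintype ι] [DecidableEq ι] {Λ : YoungDist} {T : Filling ι Λ}

lemma symmetrizer_mul {σ τ : Equiv.Perm ι} (hσ : IsRow T σ) (hτ : IsCol T τ) :
    symmetrizer T (σ * τ) = ((Equiv.Perm.sign τ : ℤ) : ℂ) := by
  have h := isYoungSymm_symmetrizer T
  rw [h.row σ hσ, ← one_mul τ, h.col τ hτ, symmetrizer_one, mul_one, one_mul]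

end Symmetrizer

/-! ### The symmetrizer of a union with disjoint supports -/

section Filling

variable {a b : ℕ} {f₀ : X} {p : Weights} {Λ₁ Λ₂ : YoungDist}

/-- The union of the scaled Young distributions. -/
abbrev mixedDist (p : Weights) (Λ₁ Λ₂ : YoungDist) : YoungDist :=
  (Λ₁.scale p.p₁ p.pos₁ p.le_one₁).union (Λ₂.scale p.p₂ p.pos₂ p.le_one₂)

/-- The cells of the two Young distributions as cells of their union. -/
def mixedCell (p : Weights) (Λ₁ Λ₂ : YoungDist) :
    (Σ x : ℝ, (Λ₁.toFun x).cells) ⊕ (Σ x : ℝ, (Λ₂.toFun x).cells) →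
      Σ x : ℝ, ((mixedDist p Λ₁ Λ₂).toFun x).cells :=
  Sum.elim
    (fun s => ⟨p.p₁ * s.1, s.2.1, by
      change _ ∈ ((Λ₁.scale p.p₁ p.pos₁ p.le_one₁).toFun _ ⊔ _).cells
      rw [scale_apply_mul, YoungDiagram.cells_sup]
      exact Finset.mem_union_left _ s.2.2⟩)
    (fun s => ⟨p.p₂ * s.1, s.2.1, by
      change _ ∈ (_ ⊔ (Λ₂.scale p.p₂ p.pos₂ p.le_one₂).toFun _).cells
      rw [scale_apply_mul, YoungDiagram.cells_sup]
      exact Finset.mem_union_right _ s.2.2⟩)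

variable (hdisj : (Λ₁.scale p.p₁ p.pos₁ p.le_one₁).supp ∩ (Λ₂.scale p.p₂ p.pos₂ p.le_one₂).supp = ∅)
include hdisj

/-- The existence of cells makes both diagrams nonempty, so a common scaled point would belong to
both supports. -/
lemma mul_ne_mul_of_disjoint (s : Σ x : ℝ, (Λ₁.toFun x).cells) (t : Σ x : ℝ, (Λ₂.toFun x).cells) :
    p.p₁ * s.1 ≠ p.p₂ * t.1 := by
  intro h
  have hne : ∀ {Λ : YoungDiagram} (c : Λ.cells), Λ ≠ ⊥ := by
    rintro _ c rfl
    exact Finset.notMem_empty _ c.2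
  have h1 : p.p₁ * s.1 ∈ (Λ₁.scale p.p₁ p.pos₁ p.le_one₁).supp := by
    change (Λ₁.scale p.p₁ p.pos₁ p.le_one₁).toFun _ ≠ ⊥
    rw [scale_apply_mul]
    exact hne s.2
  have h2 : p.p₂ * t.1 ∈ (Λ₂.scale p.p₂ p.pos₂ p.le_one₂).supp := by
    change (Λ₂.scale p.p₂ p.pos₂ p.le_one₂).toFun _ ≠ ⊥
    rw [scale_apply_mul]
    exact hne t.2
  have h3 := Set.mem_inter h1 (h ▸ h2)
  rw [hdisj] at h3
  exact h3

lemma mixedCell_bijective : Function.Bijective (mixedCell p Λ₁ Λ₂) := by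
  constructor
  · rintro (s | s) (t | t) h
    · have h1 : p.p₁ * s.1 = p.p₁ * t.1 := congrArg Sigma.fst h
      have h2 : s.2.1 = t.2.1 := congrArg (fun c => c.2.1) h
      rw [cell_ext (mul_left_cancel₀ p.pos₁.ne' h1) h2]
    · exact absurd (congrArg Sigma.fst h) (mul_ne_mul_of_disjoint hdisj s t)
    · exact absurd (congrArg Sigma.fst h).symm (mul_ne_mul_of_disjoint hdisj t s)
    · have h1 : p.p₂ * s.1 = p.p₂ * t.1 := congrArg Sigma.fst h
      have h2 : s.2.1 = t.2.1 := congrArg (fun c => c.2.1) h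
      rw [cell_ext (mul_left_cancel₀ p.pos₂.ne' h1) h2]
  · rintro ⟨x, c, hc⟩
    have hc' : c ∈ (Λ₁.toFun (x / p.p₁) ⊔ Λ₂.toFun (x / p.p₂)).cells := hc
    rw [YoungDiagram.cells_sup, Finset.mem_union] at hc'
    rcases hc' with h | h
    · exact ⟨Sum.inl ⟨x / p.p₁, c, h⟩, cell_ext (mul_div_cancel₀ x p.pos₁.ne') rfl⟩
    · exact ⟨Sum.inr ⟨x / p.p₂, c, h⟩, cell_ext (mul_div_cancel₀ x p.pos₂.ne') rfl⟩

omit hdisj in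
/-- The permutation of `-n, …, n` given by permutations of the two sets of indices. -/
def placePerm (f₀ : X) (hf₀ : f₀ ∈ Yab a b) (σ : Equiv.Perm (box a)) (τ : Equiv.Perm (box b)) :
    Equiv.Perm (box (a + b)) := (placeEquiv f₀ hf₀).permCongr (Equiv.Perm.sumCongr σ τ)

/-- The filling of the union of the Young distributions. -/
def mixedFilling (hf₀ : f₀ ∈ Yab a b) (T₁ : Filling (box a) Λ₁) (T₂ : Filling (box b) Λ₂) :
    Filling (box (a + b)) (mixedDist p Λ₁ Λ₂) :=
  (placeEquiv f₀ hf₀).symm.trans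
    ((Equiv.sumCongr T₁ T₂).trans (Equiv.ofBijective _ (mixedCell_bijective hdisj)))

lemma mixedFilling_place (hf₀ : f₀ ∈ Yab a b) (T₁ : Filling (box a) Λ₁) (T₂ : Filling (box b) Λ₂)
    (i : box a ⊕ box b) : mixedFilling hdisj hf₀ T₁ T₂ (place f₀ hf₀ i) =
      mixedCell p Λ₁ Λ₂ (Sum.map T₁ T₂ i) := by
  rw [mixedFilling, ← placeEquiv_apply, Equiv.trans_apply, Equiv.symm_apply_apply]
  rfl

omit hdisj

@[simp] lemma placePerm_place (hf₀ : f₀ ∈ Yab a b) (σ : Equiv.Perm (box a))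
    (τ : Equiv.Perm (box b)) (i : box a ⊕ box b) :
    placePerm f₀ hf₀ σ τ (place f₀ hf₀ i) = place f₀ hf₀ (Sum.map σ τ i) := by
  rw [placePerm, ← placeEquiv_apply, Equiv.permCongr_apply, Equiv.symm_apply_apply]
  rfl

lemma placePerm_mul (hf₀ : f₀ ∈ Yab a b) (σ σ' : Equiv.Perm (box a)) (τ τ' : Equiv.Perm (box b)) :
    placePerm f₀ hf₀ (σ * σ') (τ * τ') = placePerm f₀ hf₀ σ τ * placePerm f₀ hf₀ σ' τ' := by
  refine Equiv.ext fun k => ?_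
  obtain ⟨i, rfl⟩ := (place_bijective hf₀).2 k
  rw [Equiv.Perm.mul_apply, placePerm_place, placePerm_place, placePerm_place]
  rcases i with i | i <;> rfl

lemma placePerm_injective (hf₀ : f₀ ∈ Yab a b) {σ σ' : Equiv.Perm (box a)}
    {τ τ' : Equiv.Perm (box b)} (h : placePerm f₀ hf₀ σ τ = placePerm f₀ hf₀ σ' τ') :
    σ = σ' ∧ τ = τ' := by
  have key : ∀ i, Sum.map σ τ i = Sum.map σ' τ' i := fun i => (place_bijective hf₀).1 (by
    rw [← placePerm_place, ← placePerm_place, h])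
  exact ⟨Equiv.ext fun i => Sum.inl_injective (key (Sum.inl i)),
    Equiv.ext fun i => Sum.inr_injective (key (Sum.inr i))⟩

lemma sign_placePerm (hf₀ : f₀ ∈ Yab a b) (σ : Equiv.Perm (box a)) (τ : Equiv.Perm (box b)) :
    Equiv.Perm.sign (placePerm f₀ hf₀ σ τ) = Equiv.Perm.sign σ * Equiv.Perm.sign τ := by
  rw [placePerm, Equiv.Perm.sign_permCongr, Equiv.Perm.sign_sumCongr]

/-- The permutation acts on `f₀⁻¹(1)` and `f₀⁻¹(2)` separately. -/
lemma ofPerm_placePerm (hf₀ : f₀ ∈ Yab a b) (σ : Equiv.Perm (box a)) (τ : Equiv.Perm (box b)) :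
    ofPerm (placePerm f₀ hf₀ σ τ) = blend f₀ hf₀.1 ![ofPerm σ, ofPerm τ] := by
  have hab := mem_Yab_iff.1 hf₀
  refine GE.ext_smul fun k => ?_
  by_cases hk : k ∈ box (a + b)
  · obtain ⟨i, hi⟩ := (place_bijective hf₀).2 ⟨k, hk⟩
    have hk' : k = place f₀ hf₀ i := by rw [hi]
    rw [hk', ofPerm_smul, placePerm_place]
    rcases i with i | i
    · have h1 : eta f₀ hf₀.1 0 ⟨place f₀ hf₀ (Sum.inl i), color_place_inl hf₀ i⟩ = i.1 :=
        (eta f₀ hf₀.1 0).apply_symm_apply i.1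
      have h2 := blend_smul f₀ hf₀.1 ![ofPerm σ, ofPerm τ]
        ⟨place f₀ hf₀ (Sum.inl i), color_place_inl hf₀ i⟩
      rw [h1] at h2
      refine Eq.trans ?_ h2.symm
      change _ = ((eta f₀ hf₀.1 0).symm (ofPerm σ • i.1)).1
      rw [ofPerm_smul]
      rfl
    · have h1 : eta f₀ hf₀.1 1 ⟨place f₀ hf₀ (Sum.inr i), color_place_inr hf₀ i⟩ = i.1 :=
        (eta f₀ hf₀.1 1).apply_symm_apply i.1
      have h2 := blend_smul f₀ hf₀.1 ![ofPerm σ, ofPerm τ]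
        ⟨place f₀ hf₀ (Sum.inr i), color_place_inr hf₀ i⟩
      rw [h1] at h2
      refine Eq.trans ?_ h2.symm
      change _ = ((eta f₀ hf₀.1 1).symm (ofPerm τ • i.1)).1
      rw [ofPerm_smul]
      rfl
  · rw [mem_box, not_le] at hk
    rw [inG_ofPerm _ k hk, blend_inG hf₀.1 hab.2.1 (fun j => ?_) k hk]
    fin_cases j
    · intro i hi
      exact inG_ofPerm σ i (hab.2.2.1 ▸ hi)
    · intro i hi
      exact inG_ofPerm τ i (hab.2.2.2 ▸ hi)

include hdisj

/-- The permutations that preserve the diagrams, and a function of the cells. -/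
lemma exists_placePerm (hf₀ : f₀ ∈ Yab a b) {T₁ : Filling (box a) Λ₁} {T₂ : Filling (box b) Λ₂}
    (φ : ℕ × ℕ → ℕ) {σ : Equiv.Perm (box (a + b))}
    (h : ∀ k, (mixedFilling hdisj hf₀ T₁ T₂ (σ k)).1 = (mixedFilling hdisj hf₀ T₁ T₂ k).1 ∧
      φ (mixedFilling hdisj hf₀ T₁ T₂ (σ k)).2.1 = φ (mixedFilling hdisj hf₀ T₁ T₂ k).2.1) :
    ∃ σ₁ σ₂, (∀ i, (T₁ (σ₁ i)).1 = (T₁ i).1 ∧ φ (T₁ (σ₁ i)).2.1 = φ (T₁ i).2.1) ∧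
      (∀ i, (T₂ (σ₂ i)).1 = (T₂ i).1 ∧ φ (T₂ (σ₂ i)).2.1 = φ (T₂ i).2.1) ∧
      σ = placePerm f₀ hf₀ σ₁ σ₂ := by
  -- Points with different labels have different eigenvalues, so a permutation that preserves the
  -- eigenvalue preserves the labels. With φ the row or the column of a cell, this treats row and
  -- column permutations together.
  have hmem : (placeEquiv f₀ hf₀).symm.permCongr σ ∈ (Equiv.Perm.sumCongrHom (box a) (box b)).range := by
    refine Equiv.Perm.mem_sumCongrHom_range_of_perm_mapsTo_inl ?_
    rintro _ ⟨i, rfl⟩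
    obtain ⟨j | j, hj⟩ := (place_bijective hf₀).2 (σ (place f₀ hf₀ (Sum.inl i)))
    · refine ⟨j, ?_⟩
      rw [Equiv.permCongr_apply, Equiv.symm_symm, placeEquiv_apply, ← hj, ← placeEquiv_apply,
        Equiv.symm_apply_apply]
    · have h1 := (h (place f₀ hf₀ (Sum.inl i))).1
      rw [← hj, mixedFilling_place, mixedFilling_place] at h1
      exact absurd h1.symm (mul_ne_mul_of_disjoint hdisj (T₁ i) (T₂ j))
  obtain ⟨⟨σ₁, σ₂⟩, hσ⟩ := hmem
  have hσ' : σ = placePerm f₀ hf₀ σ₁ σ₂ := by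
    rw [placePerm]
    change _ = (placeEquiv f₀ hf₀).permCongr (Equiv.Perm.sumCongrHom _ _ (σ₁, σ₂))
    rw [hσ]
    ext k
    simp
  refine ⟨σ₁, σ₂, fun i => ?_, fun i => ?_, hσ'⟩
  · have h1 := h (place f₀ hf₀ (Sum.inl i))
    rw [hσ', placePerm_place, mixedFilling_place, mixedFilling_place] at h1
    exact ⟨mul_left_cancel₀ p.pos₁.ne' h1.1, h1.2⟩
  · have h1 := h (place f₀ hf₀ (Sum.inr i))
    rw [hσ', placePerm_place, mixedFilling_place, mixedFilling_place] at h1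
    exact ⟨mul_left_cancel₀ p.pos₂.ne' h1.1, h1.2⟩

lemma placePerm_preserves (hf₀ : f₀ ∈ Yab a b) {T₁ : Filling (box a) Λ₁}
    {T₂ : Filling (box b) Λ₂} (φ : ℕ × ℕ → ℕ) {σ₁ : Equiv.Perm (box a)} {σ₂ : Equiv.Perm (box b)}
    (h₁ : ∀ i, (T₁ (σ₁ i)).1 = (T₁ i).1 ∧ φ (T₁ (σ₁ i)).2.1 = φ (T₁ i).2.1)
    (h₂ : ∀ i, (T₂ (σ₂ i)).1 = (T₂ i).1 ∧ φ (T₂ (σ₂ i)).2.1 = φ (T₂ i).2.1) (k : box (a + b)) :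
    (mixedFilling hdisj hf₀ T₁ T₂ (placePerm f₀ hf₀ σ₁ σ₂ k)).1 =
        (mixedFilling hdisj hf₀ T₁ T₂ k).1 ∧
      φ (mixedFilling hdisj hf₀ T₁ T₂ (placePerm f₀ hf₀ σ₁ σ₂ k)).2.1 =
        φ (mixedFilling hdisj hf₀ T₁ T₂ k).2.1 := by
  obtain ⟨i, rfl⟩ := (place_bijective hf₀).2 k
  rw [placePerm_place, mixedFilling_place, mixedFilling_place]
  rcases i with i | i
  · exact ⟨congrArg (p.p₁ * ·) (h₁ i).1, (h₁ i).2⟩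
  · exact ⟨congrArg (p.p₂ * ·) (h₂ i).1, (h₂ i).2⟩

/-- The symmetrizer of the union is the product of the symmetrizers. -/
lemma symmetrizer_placePerm (hf₀ : f₀ ∈ Yab a b) (T₁ : Filling (box a) Λ₁)
    (T₂ : Filling (box b) Λ₂) (σ₁ : Equiv.Perm (box a)) (σ₂ : Equiv.Perm (box b)) :
    symmetrizer (mixedFilling hdisj hf₀ T₁ T₂) (placePerm f₀ hf₀ σ₁ σ₂) =
      symmetrizer T₁ σ₁ * symmetrizer T₂ σ₂ := by
  -- At products of row and column permutations both sides are signs of the column parts. Elsewhere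
  -- both sides vanish, because the row and column permutations of the union are pairs of such
  -- permutations.
  have key : ∀ {p₁ q₁ p₂ q₂}, IsRow T₁ p₁ → IsCol T₁ q₁ → IsRow T₂ p₂ → IsCol T₂ q₂ →
      symmetrizer (mixedFilling hdisj hf₀ T₁ T₂) (placePerm f₀ hf₀ (p₁ * q₁) (p₂ * q₂)) =
        symmetrizer T₁ (p₁ * q₁) * symmetrizer T₂ (p₂ * q₂) := by
    intro p₁ q₁ p₂ q₂ hp₁ hq₁ hp₂ hq₂
    rw [placePerm_mul, symmetrizer_mul (placePerm_preserves hdisj hf₀ Prod.fst hp₁ hp₂)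
      (placePerm_preserves hdisj hf₀ Prod.snd hq₁ hq₂), symmetrizer_mul hp₁ hq₁,
      symmetrizer_mul hp₂ hq₂, sign_placePerm]
    push_cast
    rfl
  by_cases h : symmetrizer (mixedFilling hdisj hf₀ T₁ T₂) (placePerm f₀ hf₀ σ₁ σ₂) = 0
  · by_contra hne
    rw [h] at hne
    obtain ⟨hn₁, hn₂⟩ := mul_ne_zero_iff.1 (Ne.symm hne)
    obtain ⟨p₁, q₁, hp₁, hq₁, rfl⟩ := symmetrizer_supp hn₁
    obtain ⟨p₂, q₂, hp₂, hq₂, rfl⟩ := symmetrizer_supp hn₂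
    exact hne (h.symm.trans (key hp₁ hq₁ hp₂ hq₂))
  · obtain ⟨P, Q, hP, hQ, hPQ⟩ := symmetrizer_supp h
    obtain ⟨p₁, p₂, hp₁, hp₂, rfl⟩ := exists_placePerm hdisj hf₀ Prod.fst hP
    obtain ⟨q₁, q₂, hq₁, hq₂, rfl⟩ := exists_placePerm hdisj hf₀ Prod.snd hQ
    rw [← placePerm_mul] at hPQ
    obtain ⟨rfl, rfl⟩ := placePerm_injective hf₀ hPQ
    exact key hp₁ hq₁ hp₂ hq₂

lemma exists_placePerm_of_symmetrizer (hf₀ : f₀ ∈ Yab a b) {T₁ : Filling (box a) Λ₁}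
    {T₂ : Filling (box b) Λ₂} {σ : Equiv.Perm (box (a + b))}
    (h : symmetrizer (mixedFilling hdisj hf₀ T₁ T₂) σ ≠ 0) :
    ∃ σ₁ σ₂, σ = placePerm f₀ hf₀ σ₁ σ₂ := by
  obtain ⟨P, Q, hP, hQ, rfl⟩ := symmetrizer_supp h
  obtain ⟨p₁, p₂, -, -, rfl⟩ := exists_placePerm hdisj hf₀ Prod.fst hP
  obtain ⟨q₁, q₂, -, -, rfl⟩ := exists_placePerm hdisj hf₀ Prod.snd hQ
  exact ⟨_, _, (placePerm_mul hf₀ _ _ _ _).symm⟩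

/-- The symmetrizer of the union is carried by the permutations that preserve the labels, where it
factors. -/
lemma sum_symmetrizer_smul {M : Type*} [AddCommGroup M] [Module ℂ M] (hf₀ : f₀ ∈ Yab a b)
    (T₁ : Filling (box a) Λ₁) (T₂ : Filling (box b) Λ₂) (ψ : Equiv.Perm (box (a + b)) → M) :
    ∑ σ, symmetrizer (mixedFilling hdisj hf₀ T₁ T₂) σ • ψ σ =
      ∑ σ₁, ∑ σ₂, (symmetrizer T₁ σ₁ * symmetrizer T₂ σ₂) • ψ (placePerm f₀ hf₀ σ₁ σ₂) := by
  rw [← Fintype.sum_prod_type' (f := fun σ₁ σ₂ =>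
    (symmetrizer T₁ σ₁ * symmetrizer T₂ σ₂) • ψ (placePerm f₀ hf₀ σ₁ σ₂))]
  symm
  refine Finset.sum_of_injOn (fun σ => placePerm f₀ hf₀ σ.1 σ.2) ?_ (fun _ _ => by simp) ?_ ?_
  · intro σ _ τ _ h
    exact Prod.ext_iff.2 (placePerm_injective hf₀ h)
  · intro σ _ hσ
    by_contra hne
    obtain ⟨σ₁, σ₂, rfl⟩ := exists_placePerm_of_symmetrizer hdisj hf₀
      (fun h => hne (by rw [h, zero_smul]))
    exact hσ ⟨(σ₁, σ₂), by simp, rfl⟩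
  · intro σ _
    rw [symmetrizer_placePerm]

end Filling

/-! ### The module generated by e₁ ⊗ e₂ -/

section Irreducible

lemma rep_mem_span_ofPerm {H : Type*} [NormedAddCommGroup H] [InnerProductSpace ℂ H] {π : URep H}
    {d : ℕ} {e v : H} {g : GE} (hg : InG d g)
    (hv : v ∈ Submodule.span ℂ (Set.range fun σ : Equiv.Perm (box d) => π (ofPerm σ) e)) :
    π g v ∈ Submodule.span ℂ (Set.range fun σ : Equiv.Perm (box d) => π (ofPerm σ) e) := by
  obtain ⟨τ, rfl⟩ := exists_ofPerm hg
  induction hv using Submodule.span_induction with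
  | mem v hv =>
    obtain ⟨σ, rfl⟩ := hv
    have h : π (ofPerm τ) (π (ofPerm σ) e) = π (ofPerm (τ * σ)) e := by rw [ofPerm_mul, rep_mul]
    refine Submodule.subset_span ⟨τ * σ, ?_⟩
    rw [h]
  | zero => rw [map_zero]; exact zero_mem _
  | add v w _ _ hv hw => rw [map_add]; exact add_mem hv hw
  | smul c v _ hv => rw [map_smul]; exact Submodule.smul_mem _ c hv

variable {H₁ H₂ : Type*} [NormedAddCommGroup H₁] [InnerProductSpace ℂ H₁]
  [NormedAddCommGroup H₂] [InnerProductSpace ℂ H₂] {p : Weights}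
  {π₁ : URep H₁} {π₂ : URep H₂} {Λ₁ Λ₂ : YoungDist}

/-- By `ofPerm_placePerm` the permutation fixes f₀, and its cocycle there is (σ, τ). -/
lemma fullRep_placePerm {a b : ℕ} {f₀ : X} (hf₀ : f₀ ∈ Yab a b) (σ : Equiv.Perm (box a))
    (τ : Equiv.Perm (box b)) (x : H₁) (y : H₂) :
    fullRep p π₁ π₂ (ofPerm (placePerm f₀ hf₀ σ τ)) (cylVec p (a + b) f₀.1 (pt x y)) =
      cylVec p (a + b) f₀.1 (pt (π₁ (ofPerm σ) x) (π₂ (ofPerm τ) y)) := by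
  rw [fullRep_cylVec (inG_ofPerm _) hf₀.1 (mem_Yab_iff.1 hf₀).2.1, ofPerm_placePerm, blend_fix,
    coc_blend, coc_blend, tensorOp_pt]
  rfl

variable [CompleteSpace H₁] [CompleteSpace H₂] (h₁ : HasIrredRoot π₁) (h₂ : HasIrredRoot π₂)
  {T₁ : Filling (box (depth π₁)) Λ₁} {T₂ : Filling (box (depth π₂)) Λ₂} {e₁ : H₁} {e₂ : H₂}
  (he₁ : IsYoungVector π₁ T₁ e₁) (he₂ : IsYoungVector π₂ T₂ e₂)
include h₁ h₂ he₁ he₂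

-- By bilinearity, because the translates of e₁ and e₂ span the two roots.
omit [CompleteSpace H₁] [CompleteSpace H₂] h₁ h₂ in
lemma cylVec_pt_mem {f₀ : X}
    {S : Submodule ℂ (L2Y p H₁ H₂)}
    (hS : ∀ σ τ, cylVec p (depth π₁ + depth π₂) f₀.1
      (pt (π₁ (ofPerm (n := depth π₁) σ) e₁) (π₂ (ofPerm (n := depth π₂) τ) e₂)) ∈ S)
    {x : H₁} (hx : x ∈ fixedSpace π₁ (depth π₁)) {y : H₂} (hy : y ∈ fixedSpace π₂ (depth π₂)) :
    cylVec p (depth π₁ + depth π₂) f₀.1 (pt x y) ∈ S := by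
  have hx' : fixedSpace π₁ (depth π₁) ≤ S.comap
      (cylVecₗ p (depth π₁ + depth π₂) f₀.1 ∘ₗ (ptₗ (H₁ := H₁) (H₂ := H₂)).flip y) := by
    refine he₁.span.trans (Submodule.span_le.2 ?_)
    rintro _ ⟨σ, rfl⟩
    have hy' : fixedSpace π₂ (depth π₂) ≤ S.comap
        (cylVecₗ p (depth π₁ + depth π₂) f₀.1 ∘ₗ ptₗ (π₁ (ofPerm σ) e₁)) := by
      refine he₂.span.trans (Submodule.span_le.2 ?_)
      rintro _ ⟨τ, rfl⟩
      exact hS σ τ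
    exact hy' hy
  exact hx' hx

/-- The translates of `e₁ ⊗ e₂` span the root of the mixture. -/
lemma root_mixture_le_span {f₀ : X} (hf₀ : f₀ ∈ Yab (depth π₁) (depth π₂))
    {F : mixtureSpace p π₁ π₂}
    (hF : (F : L2Y p H₁ H₂) = cylVec p (depth π₁ + depth π₂) f₀.1 (pt e₁ e₂)) :
    fixedSpace (mixture p π₁ π₂) (depth π₁ + depth π₂) ≤ Submodule.span ℂ
      (Set.range fun σ : Equiv.Perm (box (depth π₁ + depth π₂)) =>
        mixture p π₁ π₂ (ofPerm σ) F) := by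
  have hab := mem_Yab_iff.1 hf₀
  rw [span_fixedSpace_mixture h₁ h₂, Submodule.span_le]
  rintro G ⟨f, hf, x, hx, y, hy, hG⟩
  -- An element of G(d) moves the cylinder of f₀ to that of f, and its cocycle acts within the two
  -- roots, so the cylinder of f₀ suffices.
  obtain ⟨g, hg, hgf⟩ := exists_inG_smul_eq hf₀ hf
  have hr₁ : InG (depth π₁) (coc 0 g f₀) := by
    have := inG_coc hf₀.1 hab.2.1 hg 0
    rwa [hab.2.2.1] at this
  have hr₂ : InG (depth π₂) (coc 1 g f₀) := by
    have := inG_coc hf₀.1 hab.2.1 hg 1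
    rwa [hab.2.2.2] at this
  have hbase := cylVec_pt_mem he₁ he₂ (f₀ := f₀) (p := p)
    (S := (Submodule.span ℂ (Set.range fun σ : Equiv.Perm (box (depth π₁ + depth π₂)) =>
      mixture p π₁ π₂ (ofPerm σ) F)).map (mixtureSpace p π₁ π₂).subtype) (fun σ τ => by
        rw [← fullRep_placePerm hf₀, ← hF]
        exact ⟨mixture p π₁ π₂ (ofPerm (placePerm f₀ hf₀ σ τ)) F,
          Submodule.subset_span ⟨placePerm f₀ hf₀ σ τ, rfl⟩, rfl⟩)
    (rep_mem_fixedSpace hr₁.inv hx) (rep_mem_fixedSpace hr₂.inv hy)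
  obtain ⟨G', hG', hG'e⟩ := hbase
  have h3 : mixture p π₁ π₂ g G' = G := by
    apply Subtype.ext
    rw [Submodule.subtype_apply] at hG'e
    rw [coe_mixture, hG'e, fullRep_cylVec hg hf₀.1 hab.2.1, tensorOp_pt, rep_rep_inv,
      rep_rep_inv, cylVec_congr hgf, hG]
  rw [← h3]
  exact rep_mem_span_ofPerm hg hG'

/-- If the supports are disjoint, then `e₁ ⊗ e₂` generates the Young module of the union. -/
theorem isYoungVector_mixture (hdisj : (Λ₁.scale p.p₁ p.pos₁ p.le_one₁).supp ∩
      (Λ₂.scale p.p₂ p.pos₂ p.le_one₂).supp = ∅)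
    {f₀ : X} (hf₀ : f₀ ∈ Yab (depth π₁) (depth π₂)) {F : mixtureSpace p π₁ π₂}
    (hF : (F : L2Y p H₁ H₂) = cylVec p (depth π₁ + depth π₂) f₀.1 (pt e₁ e₂)) :
    IsYoungVector (mixture p π₁ π₂) (mixedFilling hdisj hf₀ T₁ T₂) F := by
  refine ⟨mem_root_of_eq h₁ h₂ hf₀ he₁.mem he₂.mem hF, fun h0 => ?_, fun k => ?_, ?_,
    root_mixture_le_span h₁ h₂ he₁ he₂ hf₀ hF⟩
  · exact cylVec_pt_ne_zero hf₀ he₁.ne_zero he₂.ne_zero (hF.symm.trans (congrArg Subtype.val h0))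
  · obtain ⟨i, rfl⟩ := (place_bijective hf₀).2 k
    rw [opA_place h₁ h₂ he₁ he₂ hf₀ hF i, mixedFilling_place]
    rcases i with i | i <;> rfl
  · obtain ⟨c₁, hc₁, hs₁⟩ := he₁.symm
    obtain ⟨c₂, hc₂, hs₂⟩ := he₂.symm
    refine ⟨c₁ * c₂, mul_ne_zero hc₁ hc₂, ?_⟩
    apply Subtype.ext
    rw [sum_symmetrizer_smul]
    simp only [AddSubmonoidClass.coe_finsetSum, Submodule.coe_smul, coe_mixture, hF,
      fullRep_placePerm]
    rw [mul_smul, ← cylVec_smul, ← pt_smul_right, ← cylVec_smul, ← pt_smul_left, ← hs₁, ← hs₂]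
    change _ = cylVecₗ p (depth π₁ + depth π₂) f₀.1 (ptₗ _ _)
    simp only [map_sum, LinearMap.sum_apply, map_smul, LinearMap.smul_apply, Finset.smul_sum,
      smul_smul, mul_comm]
    rw [Finset.sum_comm]
    rfl

end Irreducible

end Olshanski

end

theorem theorem6 {H₁ H₂ : Type*}
    [NormedAddCommGroup H₁] [InnerProductSpace ℂ H₁] [CompleteSpace H₁]
    [NormedAddCommGroup H₂] [InnerProductSpace ℂ H₂] [CompleteSpace H₂]
    (π₁ : URep H₁) (π₂ : URep H₂)
    (hadm₁ : IsAdmissible π₁) (hadm₂ : IsAdmissible π₂)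
    (hirr₁ : IsIrredRep π₁) (hirr₂ : IsIrredRep π₂)
    (μ₁ μ₂ : MeasureTheory.Measure ℝ)
    (hμ₁ : HasThomaMeasure π₁ μ₁) (hμ₂ : HasThomaMeasure π₂ μ₂)
    (Λ₁ Λ₂ : YoungDist) (hΛ₁ : HasYoungDist π₁ Λ₁) (hΛ₂ : HasYoungDist π₂ Λ₂)
    (p : Weights) :
    IsAdmissible (mixture p π₁ π₂) ∧
    (∃ (n : ℕ) (V : Fin n → Submodule ℂ (mixtureSpace p π₁ π₂))
      (hV : ∀ k, IsInvariantSubspace (mixture p π₁ π₂) (V k)),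
      (∀ k, IsClosed (V k : Set (mixtureSpace p π₁ π₂))) ∧
      (Pairwise fun k l => V k ⟂ V l) ∧
      (⨆ k, V k = ⊤) ∧
      ∀ k, IsAdmissible (subrep (mixture p π₁ π₂) (V k) (hV k)) ∧
        IsIrredRep (subrep (mixture p π₁ π₂) (V k) (hV k)) ∧
        HasThomaMeasure (subrep (mixture p π₁ π₂) (V k) (hV k)) (mixedMeasure p μ₁ μ₂)) ∧
    (IsIrredRep (mixture p π₁ π₂) ↔
      (Λ₁.scale p.p₁ p.pos₁ p.le_one₁).supp ∩ (Λ₂.scale p.p₂ p.pos₂ p.le_one₂).supp = ∅) ∧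
    (IsIrredRep (mixture p π₁ π₂) →
      HasYoungDist (mixture p π₁ π₂)
        ((Λ₁.scale p.p₁ p.pos₁ p.le_one₁).union (Λ₂.scale p.p₂ p.pos₂ p.le_one₂))) := by
  have h₁ := hΛ₁.hasIrredRoot hadm₁ hirr₁
  have h₂ := hΛ₂.hasIrredRoot hadm₂ hirr₂
  obtain ⟨T₁, e₁, he₁⟩ := hΛ₁.exists_isYoungVector
  obtain ⟨T₂, e₂, he₂⟩ := hΛ₂.exists_isYoungVector
  have hyoung : (Λ₁.scale p.p₁ p.pos₁ p.le_one₁).supp ∩ (Λ₂.scale p.p₂ p.pos₂ p.le_one₂).supp = ∅ →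
      HasYoungDist (mixture p π₁ π₂)
        ((Λ₁.scale p.p₁ p.pos₁ p.le_one₁).union (Λ₂.scale p.p₂ p.pos₂ p.le_one₂)) := by
    intro hdisj
    obtain ⟨f₀, hf₀⟩ := exists_mem_Yab (depth π₁) (depth π₂)
    exact (isYoungVector_mixture h₁ h₂ he₁ he₂ hdisj hf₀
      (F := ⟨_, cylVec_mem_mixtureSpace h₁ h₂ hf₀ he₁.mem he₂.mem⟩) rfl).hasYoungDist
      (isAdmissible_mixture h₁ h₂) (depth_mixture h₁ h₂)
  have hdisj : IsIrredRep (mixture p π₁ π₂) →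
      (Λ₁.scale p.p₁ p.pos₁ p.le_one₁).supp ∩ (Λ₂.scale p.p₂ p.pos₂ p.le_one₂).supp = ∅ := by
    intro hirr
    rw [Set.eq_empty_iff_forall_notMem]
    rintro x ⟨hx₁, hx₂⟩
    exact not_isIrredRoot_mixture h₁ h₂ he₁ he₂ hx₁ hx₂ ((isIrredRep_mixture_iff h₁ h₂).1 hirr)
  refine ⟨isAdmissible_mixture h₁ h₂, exists_decomposition_mixture h₁ h₂ hμ₁ hμ₂,
    ⟨hdisj, fun h => ?_⟩, fun h => hyoung (hdisj h)⟩
  -- Disjoint supports give the isomorphism of the root with V_Λ, and V_Λ is irreducible.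
  rw [isIrredRep_mixture_iff h₁ h₂, ← depth_mixture (p := p) h₁ h₂]
  exact (hyoung h).isIrredRoot
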